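/- **Setting.** Let $Y$ be a Noetherian separated scheme. Let $\mathcal A=\bigoplus_{i\in\mathbb Z}\mathcal A_i$ be a quasi-coherent sheaf of commutative $\mathbb Z$-graded $\mathcal O_Y$-algebras such that $\mathcal A(U)$ is a Noetherian ring for every affine open $U\subset Y$ and $\mathcal A_0$ is coherent over $\mathcal O_Y$. Write $\mathscr I^+\subset\mathcal A$ (resp. $\mathscr I^-$) for the ideal sheaf generated by all $\mathcal A_i$ with $i>0$ (resp. $i<0$). Let $\mathcal D(\mathrm{Gr}(\mathcal A))$ be the derived category of graded $\mathcal A$-modules, let $\mathcal M(m)$ be the weight shift, $\mathcal M(m)_i=\mathcal M_{i+m}$, and let $[1]$ be the homological shift. Let $\mathbf R\Gamma_{\mathscr I^\pm}$ be the right derived functor of the functor of $(\mathscr I^{\pm})^\infty$-torsion sections, and let $\check{\mathcal C}_{\mathscr I^\pm}(\mathcal A)$ be the cone of $\mathbf R\Gamma_{\mathscr I^\pm}(\mathcal A)\to\mathcal A$ (both computed on an injective resolution of $\mathcal A$), with its canonical map $\eta^\pm:\mathcal A\to\check{\mathcal C}_{\mathscr I^\pm}(\mathcal A)$. Let $\omega\in\mathcal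 D^b_{\rm coh}(\mathrm{QCoh}(Y))$ be a dualizing complex, and let $\mathbb D_Y$ be the weightwise dualizing functor on $\mathcal D(\mathrm{Gr}(\mathcal A))$, i.e. $\mathbb D_Y(\mathcal M)_i=\mathbf R\mathscr Hom_{\mathcal O_Y}(\mathcal M_{-i},\omega)$. Suppose that $(Y,\omega,\mathcal A,a,\Phi^-,\Phi^+)$ is a *homological flip* ($a>0$) or *homological flop* ($a=0$): $a\ge 0$ is an integer, and $$\Phi^{+}:\check{\mathcal C}_{\mathscr I^{+}}(\mathcal A)(a)\to\mathbb D_Y(\check{\mathcal C}_{\mathscr I^{+}}(\mathcal A)),\qquad \Phi^{-}:\check{\mathcal C}_{\mathscr I^{-}}(\mathcal A)(a)\to\mathbb D_Y(\check{\mathcal C}_{\mathscr I^{-}}(\mathcal A))$$ are isomorphisms in $\mathcal D(\mathrm{Gr}(\mathcal A))$ with $$\mathbb D_Y(\eta^+)\circ\Phi^+\circ\eta^+(a)=\mathbb D_Y(\eta^-)\circ\Phi^-\circ\eta^-(a):\ \mathcal A(a)\to\mathbb D_Y(\mathcal A).$$ Suppose that it has *canonical vanishing*: $\mathbf R\Gamma_{\mathscr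 I^+}(\mathcal A)_i\simeq 0$ for all $i\ge a$ and $\mathbf R\Gamma_{\mathscr I^-}(\mathcal A)_i\simeq0$ for all $i\le a$. **Theorem.** There is a map $$\Psi:\mathbf R\Gamma_{\mathscr I^+}(\mathcal A)(a)[1]\longrightarrow\mathbb D_Y(\mathbf R\Gamma_{\mathscr I^-}(\mathcal A))$$ in $\mathcal D(\mathrm{Gr}(\mathcal A))$ which is a quasi-isomorphism in every weight $i\in\mathbb Z$ except possibly those with $-a<i<0$. In particular, if $a=0$ or $a=1$, then $\Psi$ is an isomorphism; and in that case the ring $\mathcal A(U)$ is Gorenstein (Noetherian, with every local ring of finite injective dimension over itself) for every affine open $U\subset Y$. -/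

import Mathlib

open CategoryTheory Limits AlgebraicGeometry TopologicalSpace Opposite ZeroObject
universe u

set_option linter.unusedVariables false
namespace HomFlip

/-- Restriction of sections of an `𝒪_Y`-module. -/
noncomputable def res {Y : Scheme.{u}} (M : Y.Modules) {U V : Y.Opens} (h : V ≤ U) :
    Γ(M, U) →+ Γ(M, V) :=
  (M.presheaf.map (homOfLE h).op).hom

/-- Restriction of functions. -/
noncomputable def resO (Y : Scheme.{u}) {U V : Y.Opens} (h : V ≤ U) : Γ(Y, U) →+* Γ(Y, V) :=
  (Y.presheaf.map (homOfLE h).op).hom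

/-- The action of a morphism of `𝒪_Y`-modules on sections. -/
noncomputable def sec {Y : Scheme.{u}} {M N : Y.Modules} (f : M ⟶ N) (U : Y.Opens) :
    Γ(M, U) →ₗ[Γ(Y, U)] Γ(N, U) where
  toFun x := f.app U x
  map_add' x y := map_add _ x y
  map_smul' r x := f.app_smul r x

section
variable {Y : Scheme.{u}} {M N K : Y.Modules} {U V W : Y.Opens}

lemma res_smul (h : V ≤ U) (r : Γ(Y, U)) (x : Γ(M, U)) :
    res M h (r • x) = resO Y h r • res M h x :=
  M.map_smul (homOfLE h) r x

@[simp] lemma res_self (h : U ≤ U) (x : Γ(M, U)) : res M h x = x := by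
  simp [res]

@[simp] lemma res_res (h : V ≤ U) (h' : W ≤ V) (x : Γ(M, U)) :
    res M h' (res M h x) = res M (h'.trans h) x := by
  have : (homOfLE (h'.trans h)).op = (homOfLE h).op ≫ (homOfLE h').op := rfl
  simp [res, this]

@[simp] lemma resO_self (h : U ≤ U) (x : Γ(Y, U)) : resO Y h x = x := by
  simp [resO]

@[simp] lemma resO_resO (h : V ≤ U) (h' : W ≤ V) (x : Γ(Y, U)) :
    resO Y h' (resO Y h x) = resO Y (h'.trans h) x := by
  have : (homOfLE (h'.trans h)).op = (homOfLE h).op ≫ (homOfLE h').op := rfl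
  simp [resO, this]

lemma sec_res (f : M ⟶ N) (h : V ≤ U) (x : Γ(M, U)) :
    sec f V (res M h x) = res N h (sec f U x) :=
  ConcreteCategory.congr_hom (f.mapPresheaf.naturality (homOfLE h).op) x

@[simp] lemma sec_id (x : Γ(M, U)) : sec (𝟙 M) U x = x := rfl
@[simp] lemma sec_comp (f : M ⟶ N) (g : N ⟶ K) (x : Γ(M, U)) :
    sec (f ≫ g) U x = sec g U (sec f U x) := rfl
@[simp] lemma sec_add (f g : M ⟶ N) (x : Γ(M, U)) :
    sec (f + g) U x = sec f U x + sec g U x := rfl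
@[simp] lemma sec_sub (f g : M ⟶ N) (x : Γ(M, U)) :
    sec (f - g) U x = sec f U x - sec g U x := rfl
@[simp] lemma sec_neg (f : M ⟶ N) (x : Γ(M, U)) : sec (-f) U x = -sec f U x := rfl
@[simp] lemma sec_zero (x : Γ(M, U)) : sec (0 : M ⟶ N) U x = 0 := rfl

lemma hom_ext' {f g : M ⟶ N} (h : ∀ (U : Y.Opens) (x : Γ(M, U)), sec f U x = sec g U x) :
    f = g := by
  apply Scheme.Modules.hom_ext
  intro U
  ext x
  exact h U x

/-- Sections of an `𝒪_Y`-module glue uniquely. -/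
lemma exists_glue (M : Y.Modules) {ι : Type*} (U : ι → Y.Opens) (V : Y.Opens)
    (hU : ∀ i, U i ≤ V) (hV : V ≤ iSup U) (s : ∀ i, Γ(M, U i))
    (hs : ∀ i j, res M inf_le_left (s i) = res M (inf_le_right : U i ⊓ U j ≤ U j) (s j)) :
    ∃! t : Γ(M, V), ∀ i, res M (hU i) t = s i :=
  TopCat.Sheaf.existsUnique_gluing' (⟨M.presheaf, M.isSheaf⟩ : TopCat.Sheaf Ab Y) U V
    (fun i => homOfLE (hU i)) hV s hs

end

section
variable {Y : Scheme.{u}} (S : Y.Opens → Type u) [∀ U, AddCommGroup (S U)]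
  [∀ U, Module Γ(Y, U) (S U)] (r : ∀ {U V : Y.Opens}, V ≤ U → (S U →+ S V))
  (r_self : ∀ (U : Y.Opens) (x : S U), r le_rfl x = x)
  (r_comp : ∀ {U V W : Y.Opens} (h : V ≤ U) (h' : W ≤ V) (x : S U),
    r h' (r h x) = r (h'.trans h) x)
  (r_smul : ∀ {U V : Y.Opens} (h : V ≤ U) (c : Γ(Y, U)) (x : S U),
    r h (c • x) = resO Y h c • r h x)
  (glue : ∀ (ι : Type u) (U : ι → Y.Opens) (s : ∀ i, S (U i)),
    (∀ i j, r inf_le_left (s i) = r (inf_le_right : U i ⊓ U j ≤ U j) (s j)) →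
      ∃! t : S (iSup U), ∀ i, r (le_iSup U i) t = s i)

noncomputable def mkPresheaf : TopCat.Presheaf Ab.{u} Y where
  obj U := AddCommGrpCat.of (S U.unop)
  map f := AddCommGrpCat.ofHom (r f.unop.le)
  map_id U := by ext x; exact r_self _ x
  map_comp f g := by ext x; exact (r_comp _ _ x).symm

/-- The `𝒪_Y`-module with prescribed modules of sections and restriction maps. -/
noncomputable def mkModules : Y.Modules where
  val :=
    letI : ∀ U : (Opens Y)ᵒᵖ, Module (Y.ringCatSheaf.obj.obj U)
        ((mkPresheaf S r r_self r_comp).obj U) :=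
      fun U => inferInstanceAs (Module Γ(Y, U.unop) (S U.unop))
    PresheafOfModules.ofPresheaf (mkPresheaf S r r_self r_comp)
      (fun _ _ f c x => r_smul f.unop.le c x)
  isSheaf := by
    refine (TopCat.Presheaf.isSheaf_iff_isSheafUniqueGluing
      (mkPresheaf S r r_self r_comp)).2 ?_
    intro ι U s hs
    exact glue ι U s hs

end

/-- Constructor for morphisms of `𝒪_Y`-modules. -/
noncomputable def mkHom {Y : Scheme.{u}} {M N : Y.Modules}
    (f : ∀ U : Y.Opens, Γ(M, U) →ₗ[Γ(Y, U)] Γ(N, U))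
    (hf : ∀ {U V : Y.Opens} (h : V ≤ U) (x : Γ(M, U)), f V (res M h x) = res N h (f U x)) :
    M ⟶ N :=
  SheafOfModules.Hom.mk (PresheafOfModules.homMk
    { app := fun U => AddCommGrpCat.ofHom (f U.unop).toAddMonoidHom
      naturality := fun U V g => by
        ext x
        exact hf g.unop.le x }
    (fun U c x => (f U.unop).map_smul c x))

@[simp] lemma sec_mkHom {Y : Scheme.{u}} {M N : Y.Modules}
    (f : ∀ U : Y.Opens, Γ(M, U) →ₗ[Γ(Y, U)] Γ(N, U))
    (hf : ∀ {U V : Y.Opens} (h : V ≤ U) (x : Γ(M, U)), f V (res M h x) = res N h (f U x))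
    (U : Y.Opens) (x : Γ(M, U)) : sec (mkHom f hf) U x = f U x := rfl

/-! ## Sheaves of `ℤ`-graded rings and graded modules -/

/-- A sheaf `𝒜 = ⨁ 𝒜_i` of commutative `ℤ`-graded `𝒪_Y`-algebras on `Y`. -/
structure GradedRingSheaf (Y : Scheme.{u}) where
  /-- the weight `i` component `𝒜_i` -/
  gr : ℤ → Y.Modules
  mul {i j k : ℤ} (h : i + j = k) (U : Y.Opens) :
    Γ(gr i, U) →ₗ[Γ(Y, U)] Γ(gr j, U) →ₗ[Γ(Y, U)] Γ(gr k, U)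
  one (U : Y.Opens) : Γ(gr 0, U)
  mul_res {i j k : ℤ} (h : i + j = k) {U V : Y.Opens} (hV : V ≤ U)
    (a : Γ(gr i, U)) (b : Γ(gr j, U)) :
    res (gr k) hV (mul h U a b) = mul h V (res (gr i) hV a) (res (gr j) hV b)
  one_res {U V : Y.Opens} (hV : V ≤ U) : res (gr 0) hV (one U) = one V
  one_mul {i : ℤ} (U : Y.Opens) (a : Γ(gr i, U)) : mul (zero_add i) U (one U) a = a
  mul_comm {i j k : ℤ} (h : i + j = k) (h' : j + i = k) (U : Y.Opens)
    (a : Γ(gr i, U)) (b : Γ(gr j, U)) : mul h U a b = mul h' U b a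
  mul_assoc {i j l m n k : ℤ} (hm : i + j = m) (hk : m + l = k) (hn : j + l = n)
    (hk' : i + n = k) (U : Y.Opens) (a : Γ(gr i, U)) (b : Γ(gr j, U)) (c : Γ(gr l, U)) :
    mul hk U (mul hm U a b) c = mul hk' U a (mul hn U b c)

namespace GradedRingSheaf

variable {Y : Scheme.{u}} (A : GradedRingSheaf Y)

/-- The family of abelian groups `𝒜_i(U)`. -/
abbrev piece (U : Y.Opens) (i : ℤ) : Type u := Γ(A.gr i, U)

lemma mk_mul_eq (U : Y.Opens) {i j k k' : ℤ} (h : i + j = k) (h' : i + j = k')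
    (a : A.piece U i) (b : A.piece U j) :
    (GradedMonoid.mk k (A.mul h U a b) : GradedMonoid (A.piece U)) =
      GradedMonoid.mk k' (A.mul h' U a b) := by
  subst h h'; rfl

lemma mul_one' {i : ℤ} (U : Y.Opens) (a : Γ(A.gr i, U)) :
    A.mul (add_zero i) U a (A.one U) = a := by
  rw [A.mul_comm (add_zero i) (zero_add i), A.one_mul]

noncomputable instance gone (U : Y.Opens) : GradedMonoid.GOne (A.piece U) := ⟨A.one U⟩

noncomputable instance gmul (U : Y.Opens) : GradedMonoid.GMul (A.piece U) :=
  ⟨fun a b => A.mul rfl U a b⟩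

noncomputable instance gcommRing (U : Y.Opens) : DirectSum.GCommRing (A.piece U) where
  mul_zero a := map_zero _
  zero_mul {i j} b := LinearMap.map_zero₂ (A.mul rfl U) b
  mul_add a b c := map_add _ b c
  add_mul a b c := LinearMap.map_add₂ (A.mul rfl U) a b c
  one_mul a := (A.mk_mul_eq U rfl (zero_add _) (A.one U) a.2).trans
    (congrArg (GradedMonoid.mk a.1) (A.one_mul U a.2))
  mul_one a := (A.mk_mul_eq U rfl (add_zero _) a.2 (A.one U)).trans
    (congrArg (GradedMonoid.mk a.1) (A.mul_one' U a.2))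
  mul_assoc a b c := (A.mk_mul_eq U rfl (add_assoc _ _ _) _ c.2).trans
    (congrArg (GradedMonoid.mk _) (A.mul_assoc rfl (add_assoc _ _ _) rfl rfl U a.2 b.2 c.2))
  mul_comm a b := (A.mk_mul_eq U rfl (add_comm _ _) a.2 b.2).trans
    (congrArg (GradedMonoid.mk _) (A.mul_comm (add_comm _ _) rfl U a.2 b.2))
  natCast n := n • A.one U
  natCast_zero := zero_smul _ _
  natCast_succ n := succ_nsmul _ _
  intCast n := n • A.one U
  intCast_ofNat n := natCast_zsmul _ _
  intCast_negSucc_ofNat n := negSucc_zsmul _ _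

/-- The ring of sections `𝒜(U) = ⨁ 𝒜_i(U)`. On a Noetherian scheme every open set is
quasi-compact, so that these are the sections of the sheaf `⨁ 𝒜_i`. -/
def ring (U : Y.Opens) : Type u := DirectSum ℤ (A.piece U)

noncomputable instance (U : Y.Opens) : CommRing (A.ring U) :=
  inferInstanceAs (CommRing (DirectSum ℤ (A.piece U)))

/-- The inclusion `𝒜_i(U) → 𝒜(U)`. -/
noncomputable def incl (U : Y.Opens) (i : ℤ) : Γ(A.gr i, U) →+ A.ring U :=
  DirectSum.of (A.piece U) i

lemma incl_mul (U : Y.Opens) {i j k : ℤ} (h : i + j = k) (a : Γ(A.gr i, U)) (b : Γ(A.gr j, U)) :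
    A.incl U i a * A.incl U j b = A.incl U k (A.mul h U a b) := by
  subst h
  exact DirectSum.of_mul_of (A := A.piece U) a b

/-- The standing assumptions on the sheaf of graded rings: `𝒜` is quasi-coherent, its rings of
sections over affine opens are Noetherian, and `𝒜_0` is coherent over `𝒪_Y`. -/
structure IsNoetherianOver : Prop where
  quasicoherent (i : ℤ) : (A.gr i).IsQuasicoherent
  noetherian (U : Y.affineOpens) : IsNoetherianRing (A.ring U.1)
  coherent_zero (U : Y.affineOpens) : Module.Finite Γ(Y, U.1) Γ(A.gr 0, U.1)

/-- Over an open `U`, the ideal of `𝒜(U)` generated by the homogeneous elements whose weight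
satisfies `P`. -/
noncomputable def idealOf (P : ℤ → Prop) (U : Y.Opens) : Ideal (A.ring U) :=
  Ideal.span {x | ∃ i, P i ∧ ∃ a : Γ(A.gr i, U), x = A.incl U i a}

end GradedRingSheaf

/-- A sheaf of `ℤ`-graded `𝒜`-modules. -/
structure GrMod {Y : Scheme.{u}} (A : GradedRingSheaf Y) where
  /-- the weight `i` component -/
  obj : ℤ → Y.Modules
  act {i j k : ℤ} (h : i + j = k) (U : Y.Opens) :
    Γ(A.gr i, U) →ₗ[Γ(Y, U)] Γ(obj j, U) →ₗ[Γ(Y, U)] Γ(obj k, U)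
  act_res {i j k : ℤ} (h : i + j = k) {U V : Y.Opens} (hV : V ≤ U)
    (a : Γ(A.gr i, U)) (x : Γ(obj j, U)) :
    res (obj k) hV (act h U a x) = act h V (res (A.gr i) hV a) (res (obj j) hV x)
  one_act {i : ℤ} (U : Y.Opens) (x : Γ(obj i, U)) : act (zero_add i) U (A.one U) x = x
  mul_act {i j l m n k : ℤ} (hm : i + j = m) (hk : m + l = k) (hn : j + l = n)
    (hk' : i + n = k) (U : Y.Opens) (a : Γ(A.gr i, U)) (b : Γ(A.gr j, U)) (x : Γ(obj l, U)) :
    act hk U (A.mul hm U a b) x = act hk' U a (act hn U b x)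

namespace GrMod

variable {Y : Scheme.{u}} {A : GradedRingSheaf Y}

/-- Morphisms of graded modules: weight-preserving `𝒜`-linear maps. -/
@[ext]
structure Hom (M N : GrMod A) where
  app (i : ℤ) : M.obj i ⟶ N.obj i
  app_act {i j k : ℤ} (h : i + j = k) (U : Y.Opens) (a : Γ(A.gr i, U)) (x : Γ(M.obj j, U)) :
    sec (app k) U (M.act h U a x) = N.act h U a (sec (app j) U x)

instance : Category (GrMod A) where
  Hom := Hom
  id M := { app := fun i => 𝟙 _, app_act := fun _ _ _ _ => rfl }
  comp f g :=
    { app := fun i => f.app i ≫ g.app i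
      app_act := fun h U a x => by simp [f.app_act, g.app_act] }

lemma hom_ext {M N : GrMod A} {f g : M ⟶ N} (h : ∀ i, f.app i = g.app i) : f = g :=
  Hom.ext (funext h)

@[simp] lemma id_app (M : GrMod A) (i : ℤ) : Hom.app (𝟙 M) i = 𝟙 _ := rfl
@[simp] lemma comp_app {M N K : GrMod A} (f : M ⟶ N) (g : N ⟶ K) (i : ℤ) :
    (f ≫ g).app i = f.app i ≫ g.app i := rfl

section preadditive
variable {M N : GrMod A}

noncomputable instance : Zero (M ⟶ N) := ⟨{ app := fun _ => 0, app_act := fun h U a x => by simp }⟩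
noncomputable instance : Add (M ⟶ N) :=
  ⟨fun f g => { app := fun i => f.app i + g.app i
                app_act := fun h U a x => by simp [f.app_act, g.app_act] }⟩
noncomputable instance : Neg (M ⟶ N) :=
  ⟨fun f => { app := fun i => - f.app i
              app_act := fun h U a x => by simp [f.app_act] }⟩
noncomputable instance : Sub (M ⟶ N) :=
  ⟨fun f g => { app := fun i => f.app i - g.app i
                app_act := fun h U a x => by simp [f.app_act, g.app_act] }⟩

@[simp] lemma zero_app (i : ℤ) : (0 : M ⟶ N).app i = 0 := rfl
@[simp] lemma add_app (f g : M ⟶ N) (i : ℤ) : (f + g).app i = f.app i + g.app i := rfl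
@[simp] lemma neg_app (f : M ⟶ N) (i : ℤ) : (-f).app i = -f.app i := rfl
@[simp] lemma sub_app (f g : M ⟶ N) (i : ℤ) : (f - g).app i = f.app i - g.app i := rfl

noncomputable instance : AddCommGroup (M ⟶ N) :=
  { add_assoc := fun f g h => by apply hom_ext; intro i; simp [add_assoc]
    zero_add := fun f => by apply hom_ext; intro i; simp
    add_zero := fun f => by apply hom_ext; intro i; simp
    nsmul := nsmulRec
    zsmul := zsmulRec
    neg_add_cancel := fun f => by apply hom_ext; intro i; simp
    add_comm := fun f g => by apply hom_ext; intro i; simp [add_comm]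
    sub_eq_add_neg := fun f g => by apply hom_ext; intro i; simp [sub_eq_add_neg] }

end preadditive

noncomputable instance : Preadditive (GrMod A) where
  add_comp _ _ _ f g h := by apply hom_ext; intro i; simp
  comp_add _ _ _ f g h := by apply hom_ext; intro i; simp

/-- The zero graded module. -/
noncomputable def zero (A : GradedRingSheaf Y) : GrMod A where
  obj _ := 0
  act _ _ := 0
  act_res _ {U V} hV a x := by simp
  one_act {i} U x := by
    have h : x = 0 := by
      rw [← sec_id x, (isZero_zero Y.Modules).eq_of_src (𝟙 _) 0]; rfl
    rw [h]; simp
  mul_act _ _ _ _ U a b x := by simp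

instance : HasZeroObject (GrMod A) :=
  ⟨⟨zero A,
    fun M => ⟨⟨⟨0⟩, fun f => by
      apply hom_ext; intro i; exact (isZero_zero Y.Modules).eq_of_src _ _⟩⟩,
    fun M => ⟨⟨⟨0⟩, fun f => by
      apply hom_ext; intro i; exact (isZero_zero Y.Modules).eq_of_tgt _ _⟩⟩⟩⟩

end GrMod

namespace GrMod

variable {Y : Scheme.{u}} {A : GradedRingSheaf Y}

/-- The componentwise action on `M ⊕ N`. -/
noncomputable def biprodAct (M N : GrMod A) {i j k : ℤ} (h : i + j = k) (U : Y.Opens) :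
    Γ(A.gr i, U) →ₗ[Γ(Y, U)] Γ(M.obj j ⊞ N.obj j, U) →ₗ[Γ(Y, U)] Γ(M.obj k ⊞ N.obj k, U) :=
  ((M.act h U).compl₂ (sec biprod.fst U)).compr₂ (sec biprod.inl U) +
    ((N.act h U).compl₂ (sec biprod.snd U)).compr₂ (sec biprod.inr U)

lemma biprodAct_apply (M N : GrMod A) {i j k : ℤ} (h : i + j = k) (U : Y.Opens)
    (a : Γ(A.gr i, U)) (x : Γ(M.obj j ⊞ N.obj j, U)) :
    biprodAct M N h U a x =
      sec biprod.inl U (M.act h U a (sec biprod.fst U x)) +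
        sec biprod.inr U (N.act h U a (sec biprod.snd U x)) := rfl

lemma biprodAct_fst (M N : GrMod A) {i j k : ℤ} (h : i + j = k) (U : Y.Opens)
    (a : Γ(A.gr i, U)) (x : Γ(M.obj j ⊞ N.obj j, U)) :
    sec biprod.fst U (biprodAct M N h U a x) = M.act h U a (sec biprod.fst U x) := by
  rw [biprodAct_apply, map_add, ← sec_comp, ← sec_comp, biprod.inl_fst, biprod.inr_fst,
    sec_id, sec_zero, add_zero]

lemma biprodAct_snd (M N : GrMod A) {i j k : ℤ} (h : i + j = k) (U : Y.Opens)
    (a : Γ(A.gr i, U)) (x : Γ(M.obj j ⊞ N.obj j, U)) :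
    sec biprod.snd U (biprodAct M N h U a x) = N.act h U a (sec biprod.snd U x) := by
  rw [biprodAct_apply, map_add, ← sec_comp, ← sec_comp, biprod.inl_snd, biprod.inr_snd,
    sec_id, sec_zero, zero_add]

lemma biprodAct_inl (M N : GrMod A) {i j k : ℤ} (h : i + j = k) (U : Y.Opens)
    (a : Γ(A.gr i, U)) (x : Γ(M.obj j, U)) :
    sec (biprod.inl : _ ⟶ M.obj k ⊞ N.obj k) U (M.act h U a x) =
      biprodAct M N h U a (sec biprod.inl U x) := by
  rw [biprodAct_apply, ← sec_comp, ← sec_comp, biprod.inl_fst, biprod.inl_snd, sec_id, sec_zero,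
    map_zero, map_zero, add_zero]

lemma biprodAct_inr (M N : GrMod A) {i j k : ℤ} (h : i + j = k) (U : Y.Opens)
    (a : Γ(A.gr i, U)) (x : Γ(N.obj j, U)) :
    sec (biprod.inr : _ ⟶ M.obj k ⊞ N.obj k) U (N.act h U a x) =
      biprodAct M N h U a (sec biprod.inr U x) := by
  rw [biprodAct_apply, ← sec_comp, ← sec_comp, biprod.inr_fst, biprod.inr_snd, sec_id, sec_zero,
    map_zero, map_zero, zero_add]

/-- The direct sum of two graded modules. -/
noncomputable def biprodObj (M N : GrMod A) : GrMod A where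
  obj i := M.obj i ⊞ N.obj i
  act h U := biprodAct M N h U
  act_res h _ _ hV a x := by
    simp only [biprodAct_apply, map_add, ← sec_res, act_res]
  one_act {i} U x := by
    rw [biprodAct_apply, one_act, one_act, ← sec_comp, ← sec_comp, ← sec_add, biprod.total,
      sec_id]
  mul_act hm hk hn hk' U a b x := by
    rw [biprodAct_apply, biprodAct_apply M N hk', biprodAct_fst, biprodAct_snd,
      M.mul_act hm hk hn hk', N.mul_act hm hk hn hk']

/-- The biproduct bicone. -/
noncomputable def bicone (M N : GrMod A) : BinaryBicone M N where
  pt := biprodObj M N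
  fst := { app := fun i => (biprod.fst : M.obj i ⊞ N.obj i ⟶ _)
           app_act := fun h U a x => biprodAct_fst M N h U a x }
  snd := { app := fun i => (biprod.snd : M.obj i ⊞ N.obj i ⟶ _)
           app_act := fun h U a x => biprodAct_snd M N h U a x }
  inl := { app := fun i => (biprod.inl : _ ⟶ M.obj i ⊞ N.obj i)
           app_act := fun h U a x => biprodAct_inl M N h U a x }
  inr := { app := fun i => (biprod.inr : _ ⟶ M.obj i ⊞ N.obj i)
           app_act := fun h U a x => biprodAct_inr M N h U a x }
  inl_fst := hom_ext fun _ => biprod.inl_fst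
  inl_snd := hom_ext fun _ => biprod.inl_snd
  inr_fst := hom_ext fun _ => biprod.inr_fst
  inr_snd := hom_ext fun _ => biprod.inr_snd

instance : HasBinaryBiproducts (GrMod A) :=
  ⟨fun M N => hasBinaryBiproduct_of_total (bicone M N) (hom_ext fun _ => biprod.total)⟩

/-- The weight `i` component `M ↦ M_i`. -/
def weight (A : GradedRingSheaf Y) (i : ℤ) : GrMod A ⥤ Y.Modules where
  obj M := M.obj i
  map f := f.app i

instance (i : ℤ) : (weight A i).Additive where

/-- The weight shift `M ↦ M(m)`, with `M(m)_i = M_{i + m}`. -/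
def twist (A : GradedRingSheaf Y) (m : ℤ) : GrMod A ⥤ GrMod A where
  obj M :=
    { obj := fun i => M.obj (i + m)
      act := fun h U => M.act (by omega) U
      act_res := fun h _ _ hV a x => M.act_res (by omega) hV a x
      one_act := fun {i} U x => by
        have := M.one_act U x
        convert this
      mul_act := fun hm hk hn hk' U a b x =>
        M.mul_act hm (by omega) (by omega) (by omega) U a b x }
  map f :=
    { app := fun i => f.app (i + m)
      app_act := fun h U a x => f.app_act (by omega) U a x }

instance (m : ℤ) : (twist A m).Additive where

/-- A graded module is quasi-coherent if all its weight components are. -/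
def isQuasicoherent (A : GradedRingSheaf Y) : ObjectProperty (GrMod A) :=
  fun M => ∀ i, (M.obj i).IsQuasicoherent

end GrMod

/-- `𝒜` as a graded module over itself. -/
def GradedRingSheaf.self {Y : Scheme.{u}} (A : GradedRingSheaf Y) : GrMod A where
  obj := A.gr
  act := A.mul
  act_res := A.mul_res
  one_act := A.one_mul
  mul_act := A.mul_assoc

/-! ## Torsion -/

namespace GrMod

variable {Y : Scheme.{u}} {A : GradedRingSheaf Y}

/-- Let `I ⊆ 𝒜` be the ideal generated by the components of weights satisfying `P`. A section of
`M_i` is `I^∞`-torsion if locally it is annihilated by some power of `I`. -/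
def torsion (P : ℤ → Prop) (M : GrMod A) (i : ℤ) (U : Y.Opens) :
    Submodule Γ(Y, U) Γ(M.obj i, U) where
  carrier := {s | ∀ y ∈ U, ∃ (W : Y.Opens) (_ : y ∈ W) (hW : W ≤ U) (n : ℕ),
    ∀ (V : Y.Opens) (hV : V ≤ W) (d k : ℤ) (h : d + i = k) (b : Γ(A.gr d, V)),
      A.incl V d b ∈ A.idealOf P V ^ n → M.act h V b (res (M.obj i) (hV.trans hW) s) = 0}
  zero_mem' y hy := ⟨U, hy, le_rfl, 0, fun V hV d k h b _ => by simp⟩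
  add_mem' {s t} hs ht y hy := by
    obtain ⟨W, hyW, hW, n, h1⟩ := hs y hy
    obtain ⟨W', hyW', hW', n', h2⟩ := ht y hy
    refine ⟨W ⊓ W', ⟨hyW, hyW'⟩, inf_le_left.trans hW, max n n', fun V hV d k h b hb => ?_⟩
    rw [map_add, map_add, h1 V (hV.trans inf_le_left) d k h b (Ideal.pow_le_pow_right
      (le_max_left _ _) hb), h2 V (hV.trans inf_le_right) d k h b (Ideal.pow_le_pow_right
      (le_max_right _ _) hb), add_zero]
  smul_mem' c s hs y hy := by
    obtain ⟨W, hyW, hW, n, h1⟩ := hs y hy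
    refine ⟨W, hyW, hW, n, fun V hV d k h b hb => ?_⟩
    rw [res_smul, map_smul, h1 V hV d k h b hb, smul_zero]

lemma torsion_res {P : ℤ → Prop} {M : GrMod A} {i : ℤ} {U V : Y.Opens} (h : V ≤ U)
    {s : Γ(M.obj i, U)} (hs : s ∈ torsion P M i U) :
    res (M.obj i) h s ∈ torsion P M i V := by
  intro y hy
  obtain ⟨W, hyW, hW, n, h1⟩ := hs y (h hy)
  refine ⟨W ⊓ V, ⟨hyW, hy⟩, inf_le_right, n, fun V' hV' d k hk b hb => ?_⟩
  rw [res_res]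
  exact h1 V' (hV'.trans inf_le_left) d k hk b hb

lemma torsion_of_local {P : ℤ → Prop} {M : GrMod A} {i : ℤ} {U : Y.Opens} {s : Γ(M.obj i, U)}
    (hs : ∀ y ∈ U, ∃ (V : Y.Opens) (h : V ≤ U), y ∈ V ∧ res (M.obj i) h s ∈ torsion P M i V) :
    s ∈ torsion P M i U := by
  intro y hy
  obtain ⟨V, h, hyV, hV⟩ := hs y hy
  obtain ⟨W, hyW, hW, n, h1⟩ := hV y hyV
  refine ⟨W, hyW, hW.trans h, n, fun V' hV' d k hk b hb => ?_⟩
  have := h1 V' hV' d k hk b hb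
  rwa [res_res] at this

lemma act_comm (M : GrMod A) {d m i e k l : ℤ} (h1 : m + i = e) (h2 : d + e = k)
    (h3 : d + i = l) (h4 : m + l = k) (U : Y.Opens) (a : Γ(A.gr m, U)) (b : Γ(A.gr d, U))
    (x : Γ(M.obj i, U)) :
    M.act h2 U b (M.act h1 U a x) = M.act h4 U a (M.act h3 U b x) := by
  rw [← M.mul_act (m := d + m) rfl (by omega) h1 h2, ← M.mul_act (m := d + m) (by omega)
    (by omega) h3 h4, A.mul_comm]

lemma act_torsion {P : ℤ → Prop} {M : GrMod A} {m i j : ℤ} (h : m + i = j) {U : Y.Opens}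
    (a : Γ(A.gr m, U)) {s : Γ(M.obj i, U)} (hs : s ∈ torsion P M i U) :
    M.act h U a s ∈ torsion P M j U := by
  intro y hy
  obtain ⟨W, hyW, hW, n, h1⟩ := hs y hy
  refine ⟨W, hyW, hW, n, fun V hV d k hk b hb => ?_⟩
  rw [M.act_res, M.act_comm h hk rfl (by omega), h1 V hV d _ rfl b hb, map_zero]

lemma map_torsion {P : ℤ → Prop} {M N : GrMod A} (f : M ⟶ N) {i : ℤ} {U : Y.Opens}
    {s : Γ(M.obj i, U)} (hs : s ∈ torsion P M i U) :
    sec (f.app i) U s ∈ torsion P N i U := by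
  intro y hy
  obtain ⟨W, hyW, hW, n, h1⟩ := hs y hy
  refine ⟨W, hyW, hW, n, fun V hV d k hk b hb => ?_⟩
  rw [← sec_res, ← f.app_act, h1 V hV d k hk b hb, map_zero]

/-- The weight `i` component of `Γ_I(M)`. -/
noncomputable def torsionObj (P : ℤ → Prop) (M : GrMod A) (i : ℤ) : Y.Modules :=
  mkModules (fun U => torsion P M i U)
    (fun {U V} h => ((res (M.obj i) h).comp (torsion P M i U).subtype.toAddMonoidHom).codRestrict
      (torsion P M i V).toAddSubgroup (fun s => torsion_res h s.2))
    (fun U x => Subtype.ext (res_self le_rfl x.1))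
    (fun h h' x => Subtype.ext (res_res h h' x.1))
    (fun h c x => Subtype.ext (res_smul h c x.1))
    (by
      intro ι U s hs
      obtain ⟨t, ht, htu⟩ := exists_glue (M.obj i) U (iSup U) (le_iSup U) le_rfl (fun j => (s j).1)
        (fun j k => congrArg Subtype.val (hs j k))
      refine ⟨⟨t, ?_⟩, fun j => Subtype.ext (ht j), fun t' ht' => Subtype.ext
        (htu t'.1 fun j => congrArg Subtype.val (ht' j))⟩
      apply torsion_of_local
      intro y hy
      obtain ⟨j, hj⟩ := Opens.mem_iSup.1 hy
      refine ⟨U j, le_iSup U j, hj, ?_⟩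
      rw [ht j]
      exact (s j).2)

/-- The functor `Γ_I` of `I^∞`-torsion sections, where `I ⊆ 𝒜` is the ideal generated by the
components of weights satisfying `P`. -/
noncomputable def Gam (A : GradedRingSheaf Y) (P : ℤ → Prop) : GrMod A ⥤ GrMod A where
  obj M :=
    { obj := torsionObj P M
      act := fun {i j k} h U => LinearMap.mk₂ Γ(Y, U)
        (fun a (s : torsion P M j U) => (⟨M.act h U a s.1, act_torsion h a s.2⟩ : torsion P M k U))
        (fun a b s => Subtype.ext (LinearMap.map_add₂ (M.act h U) a b s.1))
        (fun c a s => Subtype.ext (LinearMap.map_smul₂ (M.act h U) c a s.1))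
        (fun a s t => Subtype.ext (map_add (M.act h U a) s.1 t.1))
        (fun c a s => Subtype.ext (map_smul (M.act h U a) c s.1))
      act_res := fun h _ _ hV a x => Subtype.ext (M.act_res h hV a x.1)
      one_act := fun U x => Subtype.ext (M.one_act U x.1)
      mul_act := fun hm hk hn hk' U a b x => Subtype.ext (M.mul_act hm hk hn hk' U a b x.1) }
  map {M N} f :=
    { app := fun i => mkHom
        (fun U => ((sec (f.app i) U).restrict (fun s hs => map_torsion f hs) :
          torsion P M i U →ₗ[Γ(Y, U)] torsion P N i U))
        (fun h x => Subtype.ext (sec_res (f.app i) h x.1))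
      app_act := fun h U a x => Subtype.ext (f.app_act h U a x.1) }
  map_id M := hom_ext fun i => hom_ext' fun U x => rfl
  map_comp f g := hom_ext fun i => hom_ext' fun U x => rfl

instance (P : ℤ → Prop) : (Gam A P).Additive where
  map_add := hom_ext fun i => hom_ext' fun U x => rfl

/-- The inclusion `Γ_I(M) → M`. -/
noncomputable def gamIncl (A : GradedRingSheaf Y) (P : ℤ → Prop) : Gam A P ⟶ 𝟭 (GrMod A) where
  app M :=
    { app := fun i => mkHom (M := torsionObj P M i) (N := M.obj i)
        (fun U => (torsion P M i U).subtype) (fun h x => rfl)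
      app_act := fun h U a x => rfl }
  naturality M N f := hom_ext fun i => hom_ext' fun U x => rfl

end GrMod

/-! ## Weightwise dualizing functor -/

section sheafHom

variable {Y : Scheme.{u}} {T : Type} (F G : T → Y.Modules)

/-- Sections over `U` of the sheaf `∏_t ℋom_{𝒪_Y}(F_t, G_t)`: families of `𝒪`-linear maps
`F_t|_U → G_t|_U`. -/
@[ext]
structure HomSec (U : Y.Opens) : Type u where
  app (t : T) (V : Y.Opens) (hV : V ≤ U) : Γ(F t, V) →ₗ[Γ(Y, V)] Γ(G t, V)
  app_res (t : T) {V W : Y.Opens} (hV : V ≤ U) (hW : W ≤ V) (x : Γ(F t, V)) :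
    app t W (hW.trans hV) (res (F t) hW x) = res (G t) hW (app t V hV x)

namespace HomSec

variable {F G} {U : Y.Opens}

lemma ext' {φ ψ : HomSec F G U}
    (h : ∀ t V hV x, φ.app t V hV x = ψ.app t V hV x) : φ = ψ :=
  HomSec.ext (by funext t V hV; exact LinearMap.ext (h t V hV))

noncomputable instance : Zero (HomSec F G U) :=
  ⟨{ app := fun _ _ _ => 0, app_res := fun t _ _ hV hW x => by simp }⟩
noncomputable instance : Add (HomSec F G U) :=
  ⟨fun φ ψ => { app := fun t V hV => φ.app t V hV + ψ.app t V hV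
                app_res := fun t _ _ hV hW x => by simp [φ.app_res t hV, ψ.app_res t hV] }⟩
noncomputable instance : Neg (HomSec F G U) :=
  ⟨fun φ => { app := fun t V hV => -φ.app t V hV
              app_res := fun t _ _ hV hW x => by simp [φ.app_res t hV] }⟩
noncomputable instance : SMul Γ(Y, U) (HomSec F G U) :=
  ⟨fun c φ => { app := fun t V hV => resO Y hV c • φ.app t V hV
                app_res := fun t _ _ hV hW x => by
                  simp [φ.app_res t hV, res_smul] }⟩

@[simp] lemma zero_app (t : T) (V : Y.Opens) (hV : V ≤ U) :
    (0 : HomSec F G U).app t V hV = 0 := rfl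
@[simp] lemma add_app (φ ψ : HomSec F G U) (t : T) (V : Y.Opens) (hV : V ≤ U) :
    (φ + ψ).app t V hV = φ.app t V hV + ψ.app t V hV := rfl
@[simp] lemma neg_app (φ : HomSec F G U) (t : T) (V : Y.Opens) (hV : V ≤ U) :
    (-φ).app t V hV = -φ.app t V hV := rfl
@[simp] lemma smul_app (c : Γ(Y, U)) (φ : HomSec F G U) (t : T) (V : Y.Opens) (hV : V ≤ U) :
    (c • φ).app t V hV = resO Y hV c • φ.app t V hV := rfl

noncomputable instance : AddCommGroup (HomSec F G U) :=
  { add_assoc := fun a b c => ext' fun _ _ _ _ => by simp [add_assoc]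
    zero_add := fun a => ext' fun _ _ _ _ => by simp
    add_zero := fun a => ext' fun _ _ _ _ => by simp
    nsmul := nsmulRec
    zsmul := zsmulRec
    neg_add_cancel := fun a => ext' fun _ _ _ _ => by simp
    add_comm := fun a b => ext' fun _ _ _ _ => by simp [add_comm] }

noncomputable instance : Module Γ(Y, U) (HomSec F G U) :=
  { one_smul := fun a => ext' fun _ _ _ _ => by simp
    mul_smul := fun c d a => ext' fun _ _ _ _ => by simp [mul_smul]
    smul_zero := fun c => ext' fun _ _ _ _ => by simp
    smul_add := fun c a b => ext' fun _ _ _ _ => by simp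
    add_smul := fun c d a => ext' fun _ _ _ _ => by simp [add_smul]
    zero_smul := fun a => ext' fun _ _ _ _ => by simp }

/-- Restriction of a family of `𝒪`-linear maps to a smaller open. -/
def restr {U V : Y.Opens} (h : V ≤ U) : HomSec F G U →+ HomSec F G V where
  toFun φ := { app := fun t W hW => φ.app t W (hW.trans h)
               app_res := fun t _ _ hV hW x => φ.app_res t (hV.trans h) hW x }
  map_zero' := rfl
  map_add' _ _ := rfl

@[simp] lemma restr_app {U V : Y.Opens} (h : V ≤ U) (φ : HomSec F G U) (t : T) (W : Y.Opens)
    (hW : W ≤ V) : (restr h φ).app t W hW = φ.app t W (hW.trans h) := rfl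

lemma app_congr (φ : HomSec F G U) (t : T) {V : Y.Opens} (h h' : V ≤ U) (x : Γ(F t, V)) :
    φ.app t V h x = φ.app t V h' x := rfl

lemma glue {ι : Type u} (U : ι → Y.Opens) (s : ∀ i, HomSec F G (U i))
    (hs : ∀ i j, restr inf_le_left (s i) = restr (inf_le_right : U i ⊓ U j ≤ U j) (s j)) :
    ∃! t : HomSec F G (iSup U), ∀ i, restr (le_iSup U i) t = s i := by
  have hcov : ∀ V : Y.Opens, V ≤ iSup U → V ≤ ⨆ i, V ⊓ U i := fun V hV => by
    rw [← inf_iSup_eq]; exact le_inf le_rfl hV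
  have hij : ∀ (t : T) (i j : ι) (W : Y.Opens) (hi : W ≤ U i) (hj : W ≤ U j) (x : Γ(F t, W)),
      (s i).app t W hi x = (s j).app t W hj x := fun t i j W hi hj x => by
    have := congrArg (fun φ : HomSec F G (U i ⊓ U j) => φ.app t W (le_inf hi hj) x) (hs i j)
    exact this
  have key : ∀ (t : T) (V : Y.Opens) (hV : V ≤ iSup U) (x : Γ(F t, V)),
      ∃! z : Γ(G t, V), ∀ i, res (G t) (inf_le_left : V ⊓ U i ≤ V) z =
        (s i).app t (V ⊓ U i) inf_le_right (res (F t) inf_le_left x) := fun t V hV x => by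
    refine exists_glue (G t) (fun i => V ⊓ U i) V (fun i => inf_le_left) (hcov V hV) _ ?_
    intro i j
    rw [← (s i).app_res t _ _ _, ← (s j).app_res t _ _ _, res_res, res_res]
    exact hij t i j _ _ _ _
  choose z hz hzu using key
  have hW : ∀ (t : T) (V : Y.Opens) (hV : V ≤ iSup U) (x : Γ(F t, V)) (i : ι) (W : Y.Opens)
      (h1 : W ≤ V) (h2 : W ≤ U i), res (G t) h1 (z t V hV x) =
        (s i).app t W h2 (res (F t) h1 x) := fun t V hV x i W h1 h2 => by
    have := congrArg (res (G t) (le_inf h1 h2)) (hz t V hV x i)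
    rwa [res_res, ← (s i).app_res t _ _ _, res_res] at this
  refine ⟨⟨fun t V hV => ⟨⟨z t V hV, fun x y => ?_⟩, fun c x => ?_⟩, fun t V W hV hWV x => ?_⟩,
    fun i => ext' fun t V hV x => ?_, fun φ hφ => ext' fun t V hV x => ?_⟩
  · refine (hzu t V hV _ _ fun i => ?_).symm
    rw [map_add, hz, hz, map_add, map_add]
  · refine (hzu t V hV _ _ fun i => ?_).symm
    simp only [RingHom.id_apply]
    rw [res_smul, hz, res_smul, map_smul]
  · refine (hzu t W _ _ _ fun i => ?_).symm
    refine (res_res _ _ _).trans ?_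
    refine (hW t V hV x i _ (inf_le_left.trans hWV) inf_le_right).trans ?_
    rw [res_res]
  · have := hW t V (hV.trans (le_iSup U i)) x i V le_rfl hV
    rwa [res_self, res_self] at this
  · refine hzu t V hV x _ fun i => ?_
    rw [← φ.app_res t _ _ _, ← hφ i]
    rfl

end HomSec

/-- The sheaf `∏_t ℋom_{𝒪_Y}(F_t, G_t)`. -/
noncomputable def sheafHom : Y.Modules :=
  mkModules (HomSec F G) HomSec.restr (fun U x => rfl) (fun h h' x => rfl)
    (fun h c x => HomSec.ext' fun t W hW y => by simp) (fun ι U s hs => HomSec.glue U s hs)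

end sheafHom

section dual

open CochainComplex.HomComplex (Triplet)

variable {Y : Scheme.{u}} {A : GradedRingSheaf Y} (ω : CochainComplex Y.Modules ℤ)

/-- Sections over `U` of the weight `j` component of the degree `n` term of `𝔻_Y(K)`: families of
maps `(K^p)_{-j}|_U → ω^q|_U` with `p + n = q`. -/
abbrev DualSec (K : CochainComplex (GrMod A) ℤ) (n j : ℤ) (U : Y.Opens) : Type u :=
  HomSec (fun t : Triplet n => (K.X t.p).obj (-j)) (fun t => ω.X t.q) U

/-- Multiplication by `a ∈ 𝒜_m(U)` on the graded dual: `(a φ)(x) = φ(a x)`. -/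
noncomputable def dualSmul (K : CochainComplex (GrMod A) ℤ) (n : ℤ) {m j k : ℤ} (h : m + j = k)
    (U : Y.Opens) (a : Γ(A.gr m, U)) (φ : DualSec ω K n j U) : DualSec ω K n k U where
  app t V hV := φ.app t V hV ∘ₗ (K.X t.p).act (by omega) V (res (A.gr m) hV a)
  app_res t V W hV hW x := by
    simp only [LinearMap.comp_apply]
    rw [← φ.app_res t hV hW, (K.X t.p).act_res, res_res]

lemma dualSmul_app (K : CochainComplex (GrMod A) ℤ) (n : ℤ) {m j k : ℤ} (h : m + j = k)
    (U : Y.Opens) (a : Γ(A.gr m, U)) (φ : DualSec ω K n j U) (t : Triplet n) (V : Y.Opens)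
    (hV : V ≤ U) (x : Γ((K.X t.p).obj (-k), V)) :
    (dualSmul ω K n h U a φ).app t V hV x =
      φ.app t V hV ((K.X t.p).act (by omega) V (res (A.gr m) hV a) x) := rfl

/-- The action of `𝒜_m(U)` as a bilinear map. -/
noncomputable def dualAct (K : CochainComplex (GrMod A) ℤ) (n : ℤ) {m j k : ℤ} (h : m + j = k)
    (U : Y.Opens) : Γ(A.gr m, U) →ₗ[Γ(Y, U)] DualSec ω K n j U →ₗ[Γ(Y, U)] DualSec ω K n k U :=
  LinearMap.mk₂ Γ(Y, U) (dualSmul ω K n h U)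
    (fun a b φ => HomSec.ext' fun t V hV x => by simp [dualSmul])
    (fun c a φ => HomSec.ext' fun t V hV x => by simp [dualSmul, res_smul])
    (fun a φ ψ => HomSec.ext' fun t V hV x => rfl)
    (fun c a φ => HomSec.ext' fun t V hV x => rfl)

/-- The degree `n` term of `𝔻_Y(K)`: its weight `j` component is
`∏_{p + n = q} ℋom_{𝒪_Y}((K^p)_{-j}, ω^q)`. -/
noncomputable def dualX (K : CochainComplex (GrMod A) ℤ) (n : ℤ) : GrMod A where
  obj j := sheafHom (fun t : Triplet n => (K.X t.p).obj (-j)) (fun t => ω.X t.q)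
  act h U := dualAct ω K n h U
  act_res {m j k} h {U V} hV a φ := HomSec.ext' fun t W hW x => by
    change HomSec.app φ t W _ ((K.X t.p).act _ W (res (A.gr m) _ a) x) =
      HomSec.app φ t W _ ((K.X t.p).act _ W (res (A.gr m) _ (res (A.gr m) _ a)) x)
    rw [res_res]
  one_act {j} U φ := HomSec.ext' fun t V hV x => by
    change HomSec.app φ t V _ ((K.X t.p).act _ V (res (A.gr 0) hV (A.one U)) x) = _
    rw [A.one_res, (K.X t.p).one_act]
  mul_act {i j l m n' k} hm hk hn hk' U a b φ := HomSec.ext' fun t V hV x => by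
    change HomSec.app φ t V _ ((K.X t.p).act _ V (res (A.gr m) hV (A.mul hm U a b)) x) =
      HomSec.app φ t V _ ((K.X t.p).act _ V (res (A.gr j) hV b)
        ((K.X t.p).act _ V (res (A.gr i) hV a) x))
    rw [A.mul_res, A.mul_comm hm ((add_comm j i).trans hm), (K.X t.p).mul_act]

/-- The differential of `𝔻_Y(K)` on sections: `d φ = d_ω ∘ φ - (-1)^{|φ|} φ ∘ d_K`. -/
noncomputable def dualDSec (K : CochainComplex (GrMod A) ℤ) (n m : ℤ) (h : n + 1 = m) (j : ℤ)
    (U : Y.Opens) : DualSec ω K n j U →ₗ[Γ(Y, U)] DualSec ω K m j U where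
  toFun φ :=
    { app := fun t V hV =>
        sec (ω.d (t.q - 1) t.q) V ∘ₗ φ.app ⟨t.p, t.q - 1, by have := t.hpq; omega⟩ V hV +
          (m.negOnePow : ℤ) • (φ.app ⟨t.p + 1, t.q, by have := t.hpq; omega⟩ V hV ∘ₗ
            sec ((K.d t.p (t.p + 1)).app (-j)) V)
      app_res := fun t V W hV hW x => by
        simp only [LinearMap.add_apply, LinearMap.comp_apply, LinearMap.smul_apply]
        rw [map_add, map_zsmul, ← sec_res, sec_res,
          φ.app_res ⟨t.p, t.q - 1, by have := t.hpq; omega⟩ hV hW,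
          φ.app_res ⟨t.p + 1, t.q, by have := t.hpq; omega⟩ hV hW] }
  map_add' φ ψ := HomSec.ext' fun t V hV x => by
    simp only [LinearMap.add_apply, LinearMap.comp_apply, LinearMap.smul_apply,
      HomSec.add_app, map_add, smul_add]
    abel
  map_smul' c φ := HomSec.ext' fun t V hV x => by
    simp only [LinearMap.add_apply, LinearMap.comp_apply, LinearMap.smul_apply,
      HomSec.smul_app, map_smul, RingHom.id_apply, smul_add]
    rw [smul_comm]

lemma dualDSec_apply (K : CochainComplex (GrMod A) ℤ) (n m : ℤ) (h : n + 1 = m) (j : ℤ)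
    (U : Y.Opens) (φ : DualSec ω K n j U) (t : Triplet m) (V : Y.Opens) (hV : V ≤ U)
    (x : Γ((K.X t.p).obj (-j), V)) :
    (dualDSec ω K n m h j U φ).app t V hV x =
      sec (ω.d (t.q - 1) t.q) V (φ.app ⟨t.p, t.q - 1, by have := t.hpq; omega⟩ V hV x) +
        (m.negOnePow : ℤ) • φ.app ⟨t.p + 1, t.q, by have := t.hpq; omega⟩ V hV
          (sec ((K.d t.p (t.p + 1)).app (-j)) V x) := rfl

lemma dualDSec_dualSmul (K : CochainComplex (GrMod A) ℤ) (n m : ℤ) (h : n + 1 = m) {i j k : ℤ}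
    (hk : i + j = k) (U : Y.Opens) (a : Γ(A.gr i, U)) (φ : DualSec ω K n j U) :
    dualDSec ω K n m h k U (dualSmul ω K n hk U a φ) =
      dualSmul ω K m hk U a (dualDSec ω K n m h j U φ) := by
  refine HomSec.ext' fun t V hV x => ?_
  rw [dualDSec_apply, dualSmul_app, dualSmul_app, dualSmul_app, dualDSec_apply,
    (K.d t.p (t.p + 1)).app_act]

/-- The differential of `𝔻_Y(K)`. -/
noncomputable def dualD (K : CochainComplex (GrMod A) ℤ) (n m : ℤ) (h : n + 1 = m) :
    dualX ω K n ⟶ dualX ω K m where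
  app j := mkHom (M := sheafHom (fun t : Triplet n => (K.X t.p).obj (-j)) (fun t => ω.X t.q))
    (N := sheafHom (fun t : Triplet m => (K.X t.p).obj (-j)) (fun t => ω.X t.q))
    (fun U => dualDSec ω K n m h j U)
    (fun h φ => HomSec.ext' fun t V hV x => rfl)
  app_act hk U a φ := dualDSec_dualSmul ω K n m h hk U a φ

lemma sec_d_d (K : CochainComplex Y.Modules ℤ) (p q r : ℤ) (V : Y.Opens) (x : Γ(K.X p, V)) :
    sec (K.d q r) V (sec (K.d p q) V x) = 0 := by
  rw [← sec_comp, K.d_comp_d, sec_zero]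

lemma sec_d_d' (K : CochainComplex (GrMod A) ℤ) (p q r j : ℤ) (V : Y.Opens)
    (x : Γ((K.X p).obj j, V)) :
    sec ((K.d q r).app j) V (sec ((K.d p q).app j) V x) = 0 := by
  rw [← sec_comp, ← GrMod.comp_app, K.d_comp_d, GrMod.zero_app, sec_zero]

lemma dualDSec_dualDSec (K : CochainComplex (GrMod A) ℤ) (n m l : ℤ) (h : n + 1 = m)
    (h' : m + 1 = l) (j : ℤ) (U : Y.Opens) (φ : DualSec ω K n j U) :
    dualDSec ω K m l h' j U (dualDSec ω K n m h j U φ) = 0 := by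
  refine HomSec.ext' fun t V hV x => ?_
  have e1 := dualDSec_apply ω K n m h j U φ ⟨t.p, t.q - 1, by have := t.hpq; omega⟩ V hV x
  have e2 := dualDSec_apply ω K n m h j U φ ⟨t.p + 1, t.q, by have := t.hpq; omega⟩ V hV
    (sec ((K.d t.p (t.p + 1)).app (-j)) V x)
  dsimp only at e1 e2
  rw [dualDSec_apply, e1, e2, sec_d_d', map_add, map_zsmul, sec_d_d, map_zero, smul_zero,
    add_zero, zero_add]
  have e3 : (l.negOnePow : ℤ) = -(m.negOnePow : ℤ) := by
    rw [← h', Int.negOnePow_succ, Units.val_neg]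
  rw [e3, neg_smul, add_neg_cancel]
  rfl

/-- The weightwise dual `𝔻_Y(K) = ℋom_{𝒪_Y}(K, ω)` of a complex of graded `𝒜`-modules, a complex
of graded `𝒜`-modules with `𝔻_Y(K)_i = ℋom_{𝒪_Y}(K_{-i}, ω)`. -/
noncomputable def dual (K : CochainComplex (GrMod A) ℤ) : CochainComplex (GrMod A) ℤ where
  X := dualX ω K
  d n m := if h : n + 1 = m then dualD ω K n m h else 0
  shape n m h := dif_neg h
  d_comp_d' n m l h h' := by
    have h1 : n + 1 = m := h
    have h2 : m + 1 = l := h'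
    rw [dif_pos h1, dif_pos h2]
    exact GrMod.hom_ext fun j => hom_ext' fun U φ => dualDSec_dualDSec ω K n m l h1 h2 j U φ

/-- Precomposition with a morphism of complexes. -/
noncomputable def dualMapSec {K L : CochainComplex (GrMod A) ℤ} (f : K ⟶ L) (n j : ℤ)
    (U : Y.Opens) : DualSec ω L n j U →ₗ[Γ(Y, U)] DualSec ω K n j U where
  toFun φ :=
    { app := fun t V hV => φ.app t V hV ∘ₗ sec ((f.f t.p).app (-j)) V
      app_res := fun t V W hV hW x => by
        simp only [LinearMap.comp_apply]
        rw [← φ.app_res t hV hW, sec_res] }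
  map_add' φ ψ := rfl
  map_smul' c φ := rfl

lemma dualMapSec_app {K L : CochainComplex (GrMod A) ℤ} (f : K ⟶ L) (n j : ℤ)
    (U : Y.Opens) (φ : DualSec ω L n j U) (t : Triplet n) (V : Y.Opens) (hV : V ≤ U)
    (x : Γ((K.X t.p).obj (-j), V)) :
    (dualMapSec ω f n j U φ).app t V hV x = φ.app t V hV (sec ((f.f t.p).app (-j)) V x) := rfl

lemma dualMapSec_dualSmul {K L : CochainComplex (GrMod A) ℤ} (f : K ⟶ L) (n : ℤ) {i j k : ℤ}
    (hk : i + j = k) (U : Y.Opens) (a : Γ(A.gr i, U)) (φ : DualSec ω L n j U) :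
    dualMapSec ω f n k U (dualSmul ω L n hk U a φ) =
      dualSmul ω K n hk U a (dualMapSec ω f n j U φ) := by
  refine HomSec.ext' fun t V hV x => ?_
  rw [dualMapSec_app, dualSmul_app, dualSmul_app, dualMapSec_app, (f.f t.p).app_act]

lemma dualDSec_dualMapSec {K L : CochainComplex (GrMod A) ℤ} (f : K ⟶ L) (n m : ℤ)
    (h : n + 1 = m) (j : ℤ) (U : Y.Opens) (φ : DualSec ω L n j U) :
    dualDSec ω K n m h j U (dualMapSec ω f n j U φ) =
      dualMapSec ω f m j U (dualDSec ω L n m h j U φ) := by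
  refine HomSec.ext' fun t V hV x => ?_
  rw [dualDSec_apply, dualMapSec_app, dualMapSec_app, dualMapSec_app, dualDSec_apply,
    ← sec_comp, ← sec_comp, ← GrMod.comp_app, ← GrMod.comp_app, f.comm]

/-- `𝔻_Y(f)` is precomposition with `f`. -/
noncomputable def dualMap {K L : CochainComplex (GrMod A) ℤ} (f : K ⟶ L) :
    dual ω L ⟶ dual ω K where
  f n :=
    { app := fun j => mkHom
        (M := sheafHom (fun t : Triplet n => (L.X t.p).obj (-j)) (fun t => ω.X t.q))
        (N := sheafHom (fun t : Triplet n => (K.X t.p).obj (-j)) (fun t => ω.X t.q))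
        (fun U => dualMapSec ω f n j U) (fun h φ => rfl)
      app_act := fun hk U a φ => dualMapSec_dualSmul ω f n hk U a φ }
  comm' n m h := by
    have h1 : n + 1 = m := h
    simp only [dual, dif_pos h1]
    exact GrMod.hom_ext fun j => hom_ext' fun U φ => dualDSec_dualMapSec ω f n m h1 j U φ

/-- The functor `𝔻_Y` on complexes of graded `𝒜`-modules. -/
noncomputable def DY (A : GradedRingSheaf Y) :
    (CochainComplex (GrMod A) ℤ)ᵒᵖ ⥤ CochainComplex (GrMod A) ℤ where
  obj K := dual ω K.unop
  map f := dualMap ω f.unop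
  map_id K := rfl
  map_comp f g := rfl

end dual

/-! ## The derived category of graded modules -/

section derived

variable {Y : Scheme.{u}} (A : GradedRingSheaf Y)

/-- The complex `K_i` of weight `i` components of a complex `K` of graded modules. -/
noncomputable abbrev weightComplex (i : ℤ) :
    CochainComplex (GrMod A) ℤ ⥤ CochainComplex Y.Modules ℤ :=
  (GrMod.weight A i).mapHomologicalComplex _

/-- The weight shift `K(m)` of a complex of graded modules. -/
noncomputable abbrev twistComplex (m : ℤ) :
    CochainComplex (GrMod A) ℤ ⥤ CochainComplex (GrMod A) ℤ :=
  (GrMod.twist A m).mapHomologicalComplex _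

/-- Quasi-isomorphisms of complexes of graded modules: a morphism is a quasi-isomorphism if it is
one in each weight. -/
def grQuasiIso : MorphismProperty (CochainComplex (GrMod A) ℤ) :=
  fun _ _ f => ∀ i, QuasiIso ((weightComplex A i).map f)

/-- The derived category `𝒟(Gr(𝒜))` of graded `𝒜`-modules: the localization of the category of
complexes at the quasi-isomorphisms. -/
abbrev DGr : Type _ := (grQuasiIso A).Localization

/-- The localization functor to the derived category. -/
noncomputable abbrev DGr.Q : CochainComplex (GrMod A) ℤ ⥤ DGr A := (grQuasiIso A).Q

lemma grQuasiIso_isInvertedBy (i n : ℤ) :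
    (grQuasiIso A).IsInvertedBy
      (weightComplex A i ⋙ HomologicalComplex.homologyFunctor Y.Modules _ n) := fun K L f hf => by
  have := hf i
  exact inferInstanceAs (IsIso (HomologicalComplex.homologyMap ((weightComplex A i).map f) n))

/-- The functor `M ↦ H^n(M)_i` on the derived category. -/
noncomputable def DGr.homologyWeight (i n : ℤ) : DGr A ⥤ Y.Modules :=
  Localization.Construction.lift _ (grQuasiIso_isInvertedBy A i n)

variable {A} in
/-- A morphism in the derived category is a quasi-isomorphism in weight `i` if it induces
isomorphisms on the weight `i` components of all cohomology sheaves. -/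
def IsQuasiIsoInWeight {M N : DGr A} (f : M ⟶ N) (i : ℤ) : Prop :=
  ∀ n, IsIso ((DGr.homologyWeight A i n).map f)

end derived

/-! ## Dualizing complexes -/

section dualizing

/-- The functor of sections over an open subset. -/
noncomputable def sectionsFunctor {Y : Scheme.{u}} (U : Y.Opens) :
    Y.Modules ⥤ ModuleCat.{u} Γ(Y, U) where
  obj M := ModuleCat.of Γ(Y, U) Γ(M, U)
  map f := ModuleCat.ofHom (sec f U)

instance {Y : Scheme.{u}} (U : Y.Opens) : (sectionsFunctor U).Additive where

/-- The complex of sections over an open subset. -/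
noncomputable abbrev sectionsComplex {Y : Scheme.{u}} (U : Y.Opens)
    (K : CochainComplex Y.Modules ℤ) : CochainComplex (ModuleCat.{u} Γ(Y, U)) ℤ :=
  ((sectionsFunctor U).mapHomologicalComplex _).obj K

/-- A dualizing complex on `Y`, represented by a bounded complex of injective quasi-coherent
sheaves. As the terms are injective, morphisms `ω(U) → ω(U)[n]` in the derived category of
`Γ(Y, U)` are homotopy classes of morphisms of complexes, so the last two conditions say that
`Γ(Y, U) → RHom(ω(U), ω(U))` is an isomorphism. -/
structure IsDualizingComplex {Y : Scheme.{u}} (ω : CochainComplex Y.Modules ℤ) : Prop where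
  quasicoherent (p : ℤ) : (ω.X p).IsQuasicoherent
  bounded : ∃ l m : ℤ, ∀ p, p < l ∨ m < p → IsZero (ω.X p)
  injective (U : Y.affineOpens) (p : ℤ) : Module.Injective Γ(Y, U.1) Γ(ω.X p, U.1)
  finite (U : Y.affineOpens) (p : ℤ) :
    Module.Finite Γ(Y, U.1) ((sectionsComplex U.1 ω).homology p)
  homothety (U : Y.affineOpens) (f : sectionsComplex U.1 ω ⟶ sectionsComplex U.1 ω) :
    ∃! r : Γ(Y, U.1), Nonempty (Homotopy f (r • 𝟙 _))
  ext_eq_zero (U : Y.affineOpens) (n : ℤ) (hn : n ≠ 0)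
    (f : sectionsComplex U.1 ω ⟶ (sectionsComplex U.1 ω)⟦n⟧) : Nonempty (Homotopy f 0)

end dualizing

/-! ## Local cohomology and Čech complexes -/

section localCohomology

variable {Y : Scheme.{u}} (A : GradedRingSheaf Y)

/-- An injective resolution `𝒜 → J` in the category of quasi-coherent graded `𝒜`-modules. -/
structure InjRes where
  J : CochainComplex (GrMod A) ℤ
  quasicoherent (n : ℤ) : GrMod.isQuasicoherent A (J.X n)
  injective (n : ℤ) :
    Injective (⟨J.X n, quasicoherent n⟩ : (GrMod.isQuasicoherent A).FullSubcategory)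
  isZero (n : ℤ) (hn : n < 0) : IsZero (J.X n)
  ι : (CochainComplex.singleFunctor (GrMod A) 0).obj A.self ⟶ J
  quasiIso : grQuasiIso A ι

variable {A} (J : InjRes A) (P : ℤ → Prop)

namespace InjRes

/-- `RΓ_I(𝒜) = Γ_I(J)`, where `I` is the ideal generated by the components of `𝒜` of weights
satisfying `P`. -/
noncomputable def RΓ : CochainComplex (GrMod A) ℤ :=
  ((GrMod.Gam A P).mapHomologicalComplex _).obj J.J

/-- The map `RΓ_I(𝒜) → J ≃ 𝒜`. -/
noncomputable def ε : J.RΓ P ⟶ J.J where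
  f n := (GrMod.gamIncl A P).app (J.J.X n)
  comm' n m _ := ((GrMod.gamIncl A P).naturality (J.J.d n m)).symm

/-- The Čech complex `Č_I(𝒜)`: the cone of `RΓ_I(𝒜) → 𝒜`. -/
noncomputable def Cech : CochainComplex (GrMod A) ℤ :=
  CochainComplex.mappingCone (J.ε P)

/-- The map `η : 𝒜 → Č_I(𝒜)`. -/
noncomputable def η : (CochainComplex.singleFunctor (GrMod A) 0).obj A.self ⟶ J.Cech P :=
  J.ι ≫ CochainComplex.mappingCone.inr (J.ε P)

/-- `RΓ_{I⁺}(𝒜)`, where `I⁺` is generated by the positive weight components. -/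
noncomputable abbrev RΓplus : CochainComplex (GrMod A) ℤ := J.RΓ (0 < ·)
/-- `RΓ_{I⁻}(𝒜)`, where `I⁻` is generated by the negative weight components. -/
noncomputable abbrev RΓminus : CochainComplex (GrMod A) ℤ := J.RΓ (· < 0)
/-- `Č_{I⁺}(𝒜)` -/
noncomputable abbrev CechPlus : CochainComplex (GrMod A) ℤ := J.Cech (0 < ·)
/-- `Č_{I⁻}(𝒜)` -/
noncomputable abbrev CechMinus : CochainComplex (GrMod A) ℤ := J.Cech (· < 0)
/-- `η⁺ : 𝒜 → Č_{I⁺}(𝒜)` -/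
noncomputable abbrev ηplus := J.η (0 < ·)
/-- `η⁻ : 𝒜 → Č_{I⁻}(𝒜)` -/
noncomputable abbrev ηminus := J.η (· < 0)

end InjRes

end localCohomology

/-! ## Homological flips and flops -/

section flip

variable {Y : Scheme.{u}} (ω : CochainComplex Y.Modules ℤ) {A : GradedRingSheaf Y}

/-- The structure of a homological flip (`a > 0`) or flop (`a = 0`) on a pair consisting of a
dualizing complex `ω` and a sheaf `𝒜` of Noetherian `ℤ`-graded rings. -/
structure HomologicalFlipFlop (J : InjRes A) where
  a : ℤ
  a_nonneg : 0 ≤ a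
  Φplus : (DGr.Q A).obj ((twistComplex A a).obj J.CechPlus) ⟶ (DGr.Q A).obj (dual ω J.CechPlus)
  Φminus :
    (DGr.Q A).obj ((twistComplex A a).obj J.CechMinus) ⟶ (DGr.Q A).obj (dual ω J.CechMinus)
  isIso_Φplus : IsIso Φplus
  isIso_Φminus : IsIso Φminus
  compatible :
    (DGr.Q A).map ((twistComplex A a).map J.ηplus) ≫ Φplus ≫ (DGr.Q A).map (dualMap ω J.ηplus) =
    (DGr.Q A).map ((twistComplex A a).map J.ηminus) ≫ Φminus ≫
      (DGr.Q A).map (dualMap ω J.ηminus)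

/-- Canonical vanishing: `RΓ_{I⁺}(𝒜)_i ≃ 0` for `i ≥ a` and `RΓ_{I⁻}(𝒜)_i ≃ 0` for `i ≤ a`. -/
structure HomologicalFlipFlop.CanonicalVanishing {ω : CochainComplex Y.Modules ℤ} {J : InjRes A}
    (H : HomologicalFlipFlop ω J) : Prop where
  plus (i : ℤ) (hi : H.a ≤ i) : ((weightComplex A i).obj J.RΓplus).Acyclic
  minus (i : ℤ) (hi : i ≤ H.a) : ((weightComplex A i).obj J.RΓminus).Acyclic

end flip

/-- A commutative ring is Gorenstein if it is Noetherian and each of its local rings has finite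
injective dimension over itself. -/
def IsGorensteinRing (R : Type u) [CommRing R] : Prop :=
  IsNoetherianRing R ∧ ∀ (p : Ideal R) [p.IsPrime], ∃ n : ℕ,
    HasInjectiveDimensionLT
      (ModuleCat.of (Localization.AtPrime p) (Localization.AtPrime p)) n

end HomFlip

/-! The comparison map. Write `RΓ⁺`, `Č⁺` for the local cohomology and the Čech complex of `𝒜` along
the positive ideal, and similarly with a minus sign. The cone triangles give `𝒜(a) → Č⁺(a) →
RΓ⁺(a)[1]` and, after dualizing, `𝔻(Č⁻) → 𝔻(𝒜) → 𝔻(RΓ⁻)`. The maps `u : 𝒜(a) → Č⁻(a) ≅ 𝔻(Č⁻)` and `v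
: Č⁺(a) ≅ 𝔻(Č⁺) → 𝔻(𝒜)` make a square with the first arrows of these triangles, which commutes
precisely because `Φ⁺` and `Φ⁻` are compatible. `Ψ` is a third map completing `(u, v)` to a morphism
of triangles (`exists_comparison`). In weights `i ≤ -a` canonical vanishing kills the cones of `u`
and of `v`, so `Ψ` is invertible there; in weights `i ≥ 0` it kills both the source and the target
of `Ψ`. What has to be known is that `𝔻` respects cone triangles (`exists_dual_distinguished`), that
it preserves acyclicity weight by weight for complexes with quasi-coherent terms (`dual_acyclic`;
over an affine open `ω` is a bounded complex of injectives, hence K-injective), and that torsion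
sections of quasi-coherent modules are quasi-coherent (`qcoh_torsionObj`).

The Gorenstein property. If `Ψ` is invertible, the triangle `RΓ⁺(a) → 𝒜(a) → Č⁺(a)` presents `𝒜(a)`
as an extension of `𝔻(Č⁺)` by `𝔻(RΓ⁻[1])`. Over an affine `U` the complexes `RΓ` and `Č` have finite
flat dimension over `𝒜(U)`, being built from `𝒜` by localizing at finitely many homogeneous
elements, and homomorphisms from a complex of finite flat dimension to a bounded complex of
injectives have finite injective dimension. So `𝒜(U)` should have finite injective dimension over
itself. Three points need care.

First, flatness requires the sequences `0 → Γ_{(x,s)}(J) → Γ_s(J) → Γ_s(J)_x → 0` to be exact for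
the given resolution `J`, that is, torsion elements must be divisible by `x` up to `x`-torsion. This
follows for injective modules over a Noetherian ring from an ascending chain argument
(`hasTorsionLift_of_injective`), and for the terms of `J` because they are retracts of finite sums
of modules coinduced from such injectives (`InjRes.torsionLift`).

Second, the weightwise dual is a direct sum of weights, smaller than the full complex of
homomorphisms, and sections are only controlled locally. Therefore finite injective dimension is
tested only against finite complexes of graded free modules, and only up to shrinking the open set
(`IsLocallyFinInj`). This condition is invariant under isomorphism in the derived category and
stable in triangles. For a dual it is deduced from the full complex of homomorphisms by projecting
null-homotopies onto weights (`isLocallyFinInj_dual`). As `𝒜` is quasi-coherent, its local extension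
problems can be solved over all of `U`.

Third, this yields `Ext^n(𝒜(U)/q, 𝒜(U)) = 0` for large `n` only for homogeneous `q`. A prime of a
graded ring is either homogeneous or, up to denominators outside it, generated by its homogeneous
core and one further element (`exists_mul_mem_core`), and Noetherian induction then reaches all
ideals (`extVanish_quotient`). Baer's criterion gives finite injective dimension, which localizes.
-/

namespace HomFlip

/-! ### Subsheaves, and exactness tested on local sections -/

section subsheaf

variable {Y : Scheme.{u}}

/-- A family of submodules of the sections of `M` that is stable under restriction and local. -/
structure Subsheaf (M : Y.Modules) where
  carrier (U : Y.Opens) : Submodule Γ(Y, U) Γ(M, U)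
  res_mem {U V : Y.Opens} (h : V ≤ U) {s : Γ(M, U)} : s ∈ carrier U → res M h s ∈ carrier V
  of_local {U : Y.Opens} {s : Γ(M, U)} :
    (∀ y ∈ U, ∃ (V : Y.Opens) (h : V ≤ U), y ∈ V ∧ res M h s ∈ carrier V) → s ∈ carrier U

namespace Subsheaf

variable {M : Y.Modules} (p : Subsheaf M)

/-- The `𝒪_Y`-module of sections of a subsheaf. -/
noncomputable def toModules : Y.Modules :=
  mkModules (fun U => p.carrier U)
    (fun {U V} h => ((res M h).comp (p.carrier U).subtype.toAddMonoidHom).codRestrict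
      (p.carrier V).toAddSubgroup (fun s => p.res_mem h s.2))
    (fun U x => Subtype.ext (res_self le_rfl x.1))
    (fun h h' x => Subtype.ext (res_res h h' x.1))
    (fun h c x => Subtype.ext (res_smul h c x.1))
    (by
      intro ι U s hs
      obtain ⟨t, ht, htu⟩ := exists_glue M U (iSup U) (le_iSup U) le_rfl (fun j => (s j).1)
        (fun j k => congrArg Subtype.val (hs j k))
      refine ⟨⟨t, ?_⟩, fun j => Subtype.ext (ht j), fun t' ht' => Subtype.ext
        (htu t'.1 fun j => congrArg Subtype.val (ht' j))⟩
      apply p.of_local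
      intro y hy
      obtain ⟨j, hj⟩ := Opens.mem_iSup.1 hy
      refine ⟨U j, le_iSup U j, hj, ?_⟩
      rw [ht j]
      exact (s j).2)

/-- The inclusion of a subsheaf. -/
noncomputable def ι : p.toModules ⟶ M :=
  mkHom (M := p.toModules) (N := M) (fun U => (p.carrier U).subtype) (fun h x => rfl)

lemma sec_ι_mem {U : Y.Opens} (x : Γ(p.toModules, U)) : sec p.ι U x ∈ p.carrier U :=
  (show p.carrier U from x).2

lemma exists_sec_ι {U : Y.Opens} {s : Γ(M, U)} (hs : s ∈ p.carrier U) :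
    ∃ x : Γ(p.toModules, U), sec p.ι U x = s := ⟨(⟨s, hs⟩ : p.carrier U), rfl⟩

lemma sec_ι_injective (U : Y.Opens) : Function.Injective (sec p.ι U) :=
  fun x y h => Subtype.ext (a1 := (show p.carrier U from x)) (a2 := (show p.carrier U from y)) h

/-- Lifting a morphism to a subsheaf. -/
noncomputable def lift {T : Y.Modules} (f : T ⟶ M) (hf : ∀ U x, sec f U x ∈ p.carrier U) :
    T ⟶ p.toModules :=
  mkHom (M := T) (N := p.toModules)
    (fun U => ((sec f U).codRestrict (p.carrier U) (hf U) : Γ(T, U) →ₗ[Γ(Y, U)] p.carrier U))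
    (fun h x => Subtype.ext (sec_res f h x))

lemma lift_ι {T : Y.Modules} (f : T ⟶ M) (hf : ∀ U x, sec f U x ∈ p.carrier U) :
    p.lift f hf ≫ p.ι = f := hom_ext' fun U x => rfl

instance : Mono p.ι where
  right_cancellation f g h := hom_ext' fun U x => p.sec_ι_injective U
    (by rw [← sec_comp, ← sec_comp, h])

end Subsheaf

lemma eq_of_locally {M : Y.Modules} {U : Y.Opens} {s t : Γ(M, U)}
    (h : ∀ y ∈ U, ∃ (V : Y.Opens) (hV : V ≤ U), y ∈ V ∧ res M hV s = res M hV t) : s = t := by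
  choose V hV hy hst using h
  have := exists_glue M (fun y : U => V y.1 y.2) U (fun y => hV _ _)
    (fun y hyU => Opens.mem_iSup.2 ⟨⟨y, hyU⟩, hy _ _⟩)
    (fun y => res M (hV _ _) s) (fun i j => by simp)
  exact this.unique (fun _ => rfl) (fun i => (hst _ _).symm)

/-- The sections locally in the image of a morphism. -/
noncomputable def imageSubsheaf {M N : Y.Modules} (f : M ⟶ N) : Subsheaf N where
  carrier U :=
    { carrier := {s | ∀ y ∈ U, ∃ (V : Y.Opens) (h : V ≤ U), y ∈ V ∧
        ∃ t : Γ(M, V), sec f V t = res N h s}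
      zero_mem' := fun y hy => ⟨U, le_rfl, hy, 0, by simp⟩
      add_mem' := by
        intro s t hs ht y hy
        obtain ⟨V, h, hyV, a, ha⟩ := hs y hy
        obtain ⟨W, h', hyW, b, hb⟩ := ht y hy
        refine ⟨V ⊓ W, inf_le_left.trans h, ⟨hyV, hyW⟩,
          res M inf_le_left a + res M inf_le_right b, ?_⟩
        rw [map_add, map_add, sec_res, sec_res, ha, hb, res_res, res_res]
      smul_mem' := by
        intro c s hs y hy
        obtain ⟨V, h, hyV, a, ha⟩ := hs y hy
        exact ⟨V, h, hyV, resO Y h c • a, by rw [map_smul, ha, res_smul]⟩ }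
  res_mem {U V} h s hs y hy := by
    obtain ⟨W, h', hyW, a, ha⟩ := hs y (h hy)
    refine ⟨V ⊓ W, inf_le_left, ⟨hy, hyW⟩, res M inf_le_right a, ?_⟩
    rw [sec_res, ha, res_res, res_res]
  of_local {U s} hs y hy := by
    obtain ⟨V, h, hyV, h1⟩ := hs y hy
    obtain ⟨W, h', hyW, a, ha⟩ := h1 y hyV
    exact ⟨W, h'.trans h, hyW, a, by rw [ha, res_res]⟩

/-- The sections killed by a morphism. -/
noncomputable def kerSubsheaf {M N : Y.Modules} (f : M ⟶ N) : Subsheaf M where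
  carrier U := LinearMap.ker (sec f U)
  res_mem h s hs := by
    rw [LinearMap.mem_ker] at hs ⊢
    rw [sec_res, hs, map_zero]
  of_local {U s} hs := by
    rw [LinearMap.mem_ker]
    apply eq_of_locally
    intro y hy
    obtain ⟨V, h, hyV, h1⟩ := hs y hy
    refine ⟨V, h, hyV, ?_⟩
    rw [LinearMap.mem_ker, sec_res] at h1
    rw [h1, map_zero]

/-- Exactness of a short complex of `𝒪_Y`-modules can be tested on local sections. -/
lemma exact_iff_locally (S : ShortComplex Y.Modules) :
    S.Exact ↔ ∀ (U : Y.Opens) (x : Γ(S.X₂, U)), sec S.g U x = 0 →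
      ∀ y ∈ U, ∃ (V : Y.Opens) (h : V ≤ U), y ∈ V ∧ ∃ t : Γ(S.X₁, V), sec S.f V t = res S.X₂ h x := by
  -- `S.f` is an epimorphism onto the subsheaf `p` followed by the monomorphism `p.ι`. Replacing
  -- `S.f` by `p.ι` does not affect exactness, and exactness then means that `p.ι` is a kernel of
  -- `S.g`: every section killed by `S.g` lies in `p`.
  let p := imageSubsheaf S.f
  have hp : ∀ U x, sec S.f U x ∈ p.carrier U := fun U x y hy => ⟨U, le_rfl, hy, x, by simp⟩
  have hg : p.ι ≫ S.g = 0 := by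
    refine hom_ext' fun U x => eq_of_locally fun y hy => ?_
    obtain ⟨V, h, hyV, t, ht⟩ := p.sec_ι_mem x y hy
    refine ⟨V, h, hyV, ?_⟩
    rw [sec_comp, ← sec_res, ← ht, ← sec_comp, S.zero]
    simp
  have hepi : Epi (p.lift S.f hp) := ⟨fun {Z} a b hab => by
    refine hom_ext' fun U x => eq_of_locally fun y hy => ?_
    obtain ⟨V, h, hyV, t, ht⟩ := p.sec_ι_mem x y hy
    refine ⟨V, h, hyV, ?_⟩
    have : sec (p.lift S.f hp) V t = res _ h x := by
      apply p.sec_ι_injective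
      rw [← sec_comp, p.lift_ι, ht, sec_res]
    rw [← sec_res, ← sec_res, ← this, ← sec_comp, hab, sec_comp]⟩
  let S' : ShortComplex Y.Modules := ShortComplex.mk p.ι S.g hg
  let φ : S ⟶ S' := { τ₁ := p.lift S.f hp, τ₂ := 𝟙 _, τ₃ := 𝟙 _,
                      comm₁₂ := by simp [S', p.lift_ι], comm₂₃ := by simp [S'] }
  have : Epi φ.τ₁ := hepi
  have : IsIso φ.τ₂ := inferInstanceAs (IsIso (𝟙 _))
  have : Mono φ.τ₃ := inferInstanceAs (Mono (𝟙 _))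
  rw [ShortComplex.exact_iff_of_epi_of_isIso_of_mono φ]
  have : Mono S'.f := inferInstanceAs (Mono p.ι)
  constructor
  · intro h U x hx
    let k := kerSubsheaf S.g
    have hk : k.ι ≫ S'.g = 0 := hom_ext' fun U x => k.sec_ι_mem x
    obtain ⟨x', hx'⟩ := k.exists_sec_ι (s := x) hx
    have := congrArg (fun f => sec f U x') (h.lift_f k.ι hk)
    simp only [sec_comp, hx'] at this
    rw [← this]
    exact p.sec_ι_mem (sec (h.lift k.ι hk) U x')
  · intro h
    apply ShortComplex.exact_of_f_is_kernel
    refine KernelFork.IsLimit.ofι' _ _ fun {T} k hk => ⟨p.lift k fun U x => h U _ ?_, p.lift_ι _ _⟩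
    rw [← sec_comp, hk]
    rfl

lemma acyclic_iff_locally (K : CochainComplex Y.Modules ℤ) :
    K.Acyclic ↔ ∀ (n : ℤ) (U : Y.Opens) (x : Γ(K.X n, U)), sec (K.d n (n + 1)) U x = 0 →
      ∀ y ∈ U, ∃ (V : Y.Opens) (h : V ≤ U), y ∈ V ∧
        ∃ t : Γ(K.X (n - 1), V), sec (K.d (n - 1) n) V t = res (K.X n) h x := by
  refine forall_congr' fun n => ?_
  rw [K.exactAt_iff' (n - 1) n (n + 1) (by simp) (by simp), exact_iff_locally]
  rfl

end subsheaf

end HomFlip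

namespace HomFlip

/-! ### The elementary form of quasi-coherence -/

section qcoh

variable {Y : Scheme.{u}}

/-- Over the affine open `U`, restriction of sections to basic opens is localization. -/
def LocalizesAt (M : Y.Modules) (U : Y.Opens) : Prop :=
  ∀ f : Γ(Y, U),
    (∀ s : Γ(M, U), res M (Y.basicOpen_le f) s = 0 → ∃ n : ℕ, f ^ n • s = 0) ∧
    (∀ t : Γ(M, Y.basicOpen f), ∃ (n : ℕ) (s : Γ(M, U)),
      res M (Y.basicOpen_le f) s = resO Y (Y.basicOpen_le f) (f ^ n) • t)

/-- The elementary form of quasi-coherence. -/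
def QCoh (M : Y.Modules) : Prop := ∀ U : Y.Opens, IsAffineOpen U → LocalizesAt M U

lemma image_fromSpec_le {U : Y.Opens} (hU : IsAffineOpen U) (W : (Spec Γ(Y, U)).Opens) :
    hU.fromSpec ''ᵁ W ≤ U := by
  have := hU.fromSpec.image_le_opensRange (U := W)
  rwa [hU.opensRange_fromSpec] at this

lemma image_fromSpec_top {U : Y.Opens} (hU : IsAffineOpen U) :
    hU.fromSpec ''ᵁ (⊤ : (Spec Γ(Y, U)).Opens) = U := by
  rw [Scheme.Hom.image_top_eq_opensRange, hU.opensRange_fromSpec]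

lemma appIso_inv_fromSpec {U : Y.Opens} (hU : IsAffineOpen U) (W : (Spec Γ(Y, U)).Opens)
    (r : Γ(Y, U)) :
    (hU.fromSpec.appIso W).inv ((Spec Γ(Y, U)).presheaf.map W.leTop.op
      ((Scheme.ΓSpecIso Γ(Y, U)).inv r)) = resO Y (image_fromSpec_le hU W) r := by
  have e : W ≤ hU.fromSpec ⁻¹ᵁ U := by rw [hU.fromSpec_preimage_self]; exact le_top
  have h1 := hU.fromSpec.appLE_appIso_inv e
  have h2 : hU.fromSpec.appLE U W e = (Scheme.ΓSpecIso Γ(Y, U)).inv ≫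
      (Spec Γ(Y, U)).presheaf.map W.leTop.op := by
    rw [Scheme.Hom.appLE, hU.fromSpec_app_self, Category.assoc, ← Functor.map_comp]
    rfl
  rw [h2] at h1
  exact congr($(h1) r)

/-- Sections over an open of `Spec Γ(Y, U)` are a module over the global ring `Γ(Y, U)`. Identifying
this action with restriction of functions on `Y` lets localization statements on the spectrum be
read on `Y`. -/
lemma smul_restrict_fromSpec (M : Y.Modules) {U : Y.Opens} (hU : IsAffineOpen U)
    (W : (Spec Γ(Y, U)).Opens) (r : Γ(Y, U)) (x : Γ(M.restrict hU.fromSpec, W)) :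
    r • x = (show Γ(M.restrict hU.fromSpec, W) from
      (resO Y (image_fromSpec_le hU W) r • (show Γ(M, hU.fromSpec ''ᵁ W) from x))) := by
  rw [Scheme.Modules.smul_Spec_def, ← appIso_inv_fromSpec hU W r]
  rfl

lemma isLocalizedModule_powers_iff {R : Type*} [CommRing R] {X Z : Type*} [AddCommGroup X]
    [AddCommGroup Z] [Module R X] [Module R Z] (φ : X →ₗ[R] Z) (f : R)
    (hu : IsUnit (algebraMap R (Module.End R Z) f)) :
    IsLocalizedModule (.powers f) φ ↔ (∀ s, φ s = 0 → ∃ n : ℕ, f ^ n • s = 0) ∧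
      (∀ t, ∃ (n : ℕ) (s : X), φ s = f ^ n • t) := by
  constructor
  · intro h
    refine ⟨fun s hs => ?_, fun t => ?_⟩
    · obtain ⟨⟨_, n, rfl⟩, hn⟩ := (IsLocalizedModule.eq_zero_iff (.powers f) φ).1 hs
      exact ⟨n, hn⟩
    · obtain ⟨⟨s, ⟨_, n, rfl⟩⟩, hs⟩ := IsLocalizedModule.surj (.powers f) φ t
      exact ⟨n, s, hs.symm⟩
  · rintro ⟨h1, h2⟩
    refine IsLocalizedModule.Away.mk_of_addCommGroup hu ?_ ?_
    · intro x
      obtain ⟨n, s, hs⟩ := h2 x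
      exact ⟨n, s, hs.symm⟩
    · exact h1

/-- The images in `Y` of the whole spectrum and of a basic open equal `U` and `Y.basicOpen f` only
propositionally. With all opens as variables these equalities can be substituted. -/
lemma localizes_transport (M : Y.Modules) {U D T W : Y.Opens} (f : Γ(Y, U)) (hT : T = U)
    (hW : W = D) (hD : D ≤ U) (hTW : W ≤ T) (hTU : T ≤ U) (hWU : W ≤ U) :
    ((∀ s : Γ(M, T), res M hTW s = 0 → ∃ n : ℕ, resO Y hTU (f ^ n) • s = 0) ∧
      (∀ t : Γ(M, W), ∃ (n : ℕ) (s : Γ(M, T)), res M hTW s = resO Y hWU (f ^ n) • t)) ↔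
    ((∀ s : Γ(M, U), res M hD s = 0 → ∃ n : ℕ, f ^ n • s = 0) ∧
      (∀ t : Γ(M, D), ∃ (n : ℕ) (s : Γ(M, U)), res M hD s = resO Y hD (f ^ n) • t)) := by
  subst hT hW
  simp only [resO_self]

/-- A function always acts invertibly over its own basic open, so being a localization reduces to
the two conditions on vanishing and on clearing denominators. -/
lemma isLocalizing_restrict_iff (M : Y.Modules) {U : Y.Opens} (hU : IsAffineOpen U) :
    IsLocalizing (modulesSpecToSheaf.obj (M.restrict hU.fromSpec)) ↔ LocalizesAt M U := by
  refine forall_congr' fun f => ?_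
  have hT := image_fromSpec_top hU
  have hW : hU.fromSpec ''ᵁ (PrimeSpectrum.basicOpen f) = Y.basicOpen f :=
    hU.fromSpec_image_basicOpen f
  have hTW : hU.fromSpec ''ᵁ (PrimeSpectrum.basicOpen f) ≤ hU.fromSpec ''ᵁ ⊤ := by
    rw [hT, hW]; exact Y.basicOpen_le f
  let φ := ((modulesSpecToSheaf.obj (M.restrict hU.fromSpec)).obj.map
    (PrimeSpectrum.basicOpen f).leTop.op).hom
  change IsLocalizedModule (.powers f) φ ↔ _
  refine (isLocalizedModule_powers_iff φ f
    (Scheme.Modules.isUnit_algebraMap_end_of_le_basicOpen f le_rfl)).trans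
    (Iff.trans ?_ (localizes_transport M f hT hW (Y.basicOpen_le f) hTW
      (image_fromSpec_le hU _) (image_fromSpec_le hU _)))
  refine and_congr (forall_congr' fun s => forall_congr' fun _ => exists_congr fun n => ?_)
    (forall_congr' fun t => exists_congr fun n => exists_congr fun s => ?_)
  · exact Eq.congr (smul_restrict_fromSpec M hU ⊤ (f ^ n) s) rfl
  · exact Eq.congr rfl (smul_restrict_fromSpec M hU (PrimeSpectrum.basicOpen f) (f ^ n) t)

lemma qcoh_of_isQuasicoherent (M : Y.Modules) (h : M.IsQuasicoherent) : QCoh M := fun U hU => by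
  rw [← isLocalizing_restrict_iff M hU, ← isIso_fromTildeΓ_iff_isLocalizing]
  infer_instance

/-- Transport of presentations along isomorphisms of `𝒪`-modules. -/
noncomputable def presentationOfIso {X : Scheme.{u}} {M N : X.Modules} (e : M ≅ N)
    (p : SheafOfModules.Presentation.{u} (R := X.ringCatSheaf) M) :
    SheafOfModules.Presentation.{u} (R := X.ringCatSheaf) N :=
  have h : @IsIso (SheafOfModules X.ringCatSheaf) _ M N e.hom :=
    ⟨e.inv, e.hom_inv_id, e.inv_hom_id⟩
  @SheafOfModules.Presentation.ofIsIso.{u, u, u} _ _ _ _ _ _ M N e.hom h p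

/-- A module that localizes over an affine open has a presentation there. -/
noncomputable def presentationOver (M : Y.Modules) {U : Y.Opens} (hU : IsAffineOpen U)
    (h : LocalizesAt M U) :
    (SheafOfModules.over (R := Y.ringCatSheaf) M U).Presentation :=
  have h' := (isIso_fromTildeΓ_iff_isLocalizing _).2 ((isLocalizing_restrict_iff M hU).2 h)
  let N := (modulesSpecToSheaf.obj (M.restrict hU.fromSpec)).presheaf.obj (.op ⊤)
  let e : tilde N ≅ M.restrict hU.fromSpec := @asIso _ _ _ _ (M.restrict hU.fromSpec).fromTildeΓ h'
  -- A sheaf associated to a module is presented by all elements of the module and all relations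
  -- between them. The presentation is moved first to the scheme `U` and then to the site of opens
  -- inside `U`.
  let p1 := presentationOfIso e (presentationTilde.{u} N .univ (by simp) _ (Submodule.span_eq _))
  let iso : Scheme.Modules.restrictFunctor hU.fromSpec ⋙
      Scheme.Modules.restrictFunctor hU.isoSpec.hom ≅ Scheme.Modules.restrictFunctor U.ι :=
    (Scheme.Modules.restrictFunctorComp _ _).symm ≪≫
      Scheme.Modules.restrictFunctorCongr hU.isoSpec_hom_fromSpec
  let p2 := presentationOfIso (iso.app M)
    (Scheme.Modules.presentationRestrict hU.isoSpec.hom p1)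
  let E : SheafOfModules (Y.ringCatSheaf.over U) ≌ SheafOfModules (U : Scheme.{u}).ringCatSheaf :=
    Scheme.Modules.overEquiv U
  let F := E.inverse
  let e0 := (Scheme.Modules.overFunctorEquiv U).symm.app M
  let e1 : @Iso (SheafOfModules (U : Scheme.{u}).ringCatSheaf) _ (M.restrict U.ι)
    (E.functor.obj (SheafOfModules.over (R := Y.ringCatSheaf) M U)) :=
    ⟨e0.hom, e0.inv, e0.hom_inv_id, e0.inv_hom_id⟩
  let iso2 : F.obj (M.restrict U.ι) ≅ SheafOfModules.over (R := Y.ringCatSheaf) M U :=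
    F.mapIso e1 ≪≫ E.unitIso.symm.app _
  let iso0 : SheafOfModules.unit _ ≅ F.obj (SheafOfModules.unit (U : Scheme.{u}).ringCatSheaf) :=
    E.unitIso.app (SheafOfModules.unit _)
  SheafOfModules.Presentation.ofIsIso.{u, u, u} iso2.hom
    (SheafOfModules.Presentation.map.{u, u, u} p2 F iso0)

/-- Injectivity of the terms of `InjRes` is a property in the category of quasi-coherent graded
modules; this admits modules known only through their localization behaviour to that category. All
affine opens together serve as the cover. -/
lemma isQuasicoherent_of_qcoh (M : Y.Modules) (h : QCoh M) : M.IsQuasicoherent := by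
  let q : SheafOfModules.QuasicoherentData.{u} (R := Y.ringCatSheaf) M :=
    { I := Y.affineOpens
      X := fun U => U.1
      coversTop := by
        refine (Opens.coversTop_iff (T := Y) _).2 ?_
        exact iSup_affineOpens_eq_top Y
      presentation := fun U => presentationOver M U.2 (h U.1 U.2) }
  exact q.isQuasicoherent

end qcoh

end HomFlip

namespace HomFlip

open Pretriangulated

/-! ### The derived category of graded modules as a triangulated category -/

section triangulated

variable {Y : Scheme.{u}} (A : GradedRingSheaf Y)

/-- The homotopy category of complexes of graded modules. -/
abbrev KGr := HomotopyCategory (GrMod A) (ComplexShape.up ℤ)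

/-- The quotient functor from complexes to the homotopy category. -/
noncomputable abbrev KGr.q : CochainComplex (GrMod A) ℤ ⥤ KGr A :=
  HomotopyCategory.quotient (GrMod A) (ComplexShape.up ℤ)

/-- Complexes that are acyclic in weight `i`. -/
noncomputable def acyclicIn (i : ℤ) : ObjectProperty (KGr A) :=
  (HomotopyCategory.subcategoryAcyclic Y.Modules).inverseImage
    ((GrMod.weight A i).mapHomotopyCategory (ComplexShape.up ℤ))

noncomputable instance (i : ℤ) : (acyclicIn A i).IsTriangulated :=
  inferInstanceAs (((HomotopyCategory.subcategoryAcyclic Y.Modules).inverseImage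
    ((GrMod.weight A i).mapHomotopyCategory (ComplexShape.up ℤ))).IsTriangulated)

noncomputable instance (i : ℤ) : (acyclicIn A i).IsClosedUnderIsomorphisms :=
  inferInstanceAs (((HomotopyCategory.subcategoryAcyclic Y.Modules).inverseImage
    ((GrMod.weight A i).mapHomotopyCategory (ComplexShape.up ℤ))).IsClosedUnderIsomorphisms)

/-- Complexes that are acyclic in every weight. -/
noncomputable def acyclicGr : ObjectProperty (KGr A) := fun K => ∀ i, acyclicIn A i K

noncomputable instance : (acyclicGr A).IsClosedUnderIsomorphisms where
  of_iso e h i := (acyclicIn A i).prop_of_iso e (h i)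

noncomputable instance : (acyclicGr A).IsTriangulated where
  exists_zero := ⟨0, isZero_zero _, fun i => (acyclicIn A i).prop_zero⟩
  isStableUnderShiftBy n := ⟨fun K h i => (acyclicIn A i).le_shift n _ (h i)⟩
  toIsTriangulatedClosed₂ := .mk' fun T hT h1 h3 i =>
    (acyclicIn A i).ext_of_isTriangulatedClosed₂ T hT (h1 i) (h3 i)

lemma acyclicIn_q_iff (i : ℤ) (K : CochainComplex (GrMod A) ℤ) :
    acyclicIn A i ((KGr.q A).obj K) ↔ ((weightComplex A i).obj K).Acyclic :=
  HomotopyCategory.quotient_obj_mem_subcategoryAcyclic_iff_acyclic _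

lemma acyclicIn_trW_q_iff (i : ℤ) {K L : CochainComplex (GrMod A) ℤ} (f : K ⟶ L) :
    (acyclicIn A i).trW ((KGr.q A).map f) ↔ QuasiIso ((weightComplex A i).map f) := by
  rw [acyclicIn, ObjectProperty.inverseImage_trW_iff,
    ← HomotopyCategory.quasiIso_eq_trW_subcategoryAcyclic]
  exact HomotopyCategory.quotient_map_mem_quasiIso_iff ((weightComplex A i).map f)

/-- Membership is decided by the cone in any one distinguished triangle on `f`, and the same cone
serves for all weights at once. -/
lemma trW_acyclicGr_iff {K L : KGr A} (f : K ⟶ L) :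
    (acyclicGr A).trW f ↔ ∀ i, (acyclicIn A i).trW f := by
  obtain ⟨Z, g, h, hT⟩ := distinguished_cocone_triangle f
  have h1 : ∀ (P : ObjectProperty (KGr A)) [P.IsClosedUnderIsomorphisms], P.trW f ↔ P Z :=
    fun P _ => P.trW_iff_of_distinguished _ hT
  rw [h1]
  simp only [h1]
  rfl

lemma trW_acyclicGr_q_iff {K L : CochainComplex (GrMod A) ℤ} (f : K ⟶ L) :
    (acyclicGr A).trW ((KGr.q A).map f) ↔ grQuasiIso A f := by
  rw [trW_acyclicGr_iff]
  exact forall_congr' fun i => acyclicIn_trW_q_iff A i f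

lemma homotopyEquivalences_le_grQuasiIso :
    HomologicalComplex.homotopyEquivalences (GrMod A) (ComplexShape.up ℤ) ≤ grQuasiIso A := by
  intro K L f hf
  rw [← trW_acyclicGr_q_iff]
  have : IsIso ((KGr.q A).map f) := by
    have := HomotopyCategory.quotient_inverts_homotopyEquivalences (GrMod A)
      (ComplexShape.up ℤ) f hf
    exact this
  exact (acyclicGr A).trW_of_isIso _

/-- The localization functor from the homotopy category. -/
noncomputable def Qh : KGr A ⥤ DGr A :=
  Localization.lift (DGr.Q A) (fun _ _ f hf => Localization.inverts (DGr.Q A) (grQuasiIso A) f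
    (homotopyEquivalences_le_grQuasiIso A f hf) :
    (HomologicalComplex.homotopyEquivalences (GrMod A) (ComplexShape.up ℤ)).IsInvertedBy
      (DGr.Q A)) (KGr.q A)

/-- The localization functor factors through the homotopy category. -/
noncomputable def qCompQhIso : KGr.q A ⋙ Qh A ≅ DGr.Q A := Localization.fac _ _ _

/-- Since the quotient functor is full, the morphisms with acyclic cone are exactly those coming
from quasi-isomorphisms of complexes. Hence inverting homotopy equivalences first and acyclic cones
afterwards yields `DGr`, which thereby becomes triangulated. -/
lemma trW_acyclicGr_eq_map : (acyclicGr A).trW = (grQuasiIso A).map (KGr.q A) := by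
  ext ⟨K⟩ ⟨L⟩ f
  obtain ⟨f, rfl⟩ := (KGr.q A).map_surjective f
  constructor
  · intro h
    exact MorphismProperty.map_mem_map _ _ _ ((trW_acyclicGr_q_iff A f).1 h)
  · rintro ⟨K', L', f', h, ⟨e⟩⟩
    rw [← (acyclicGr A).trW.arrow_mk_iso_iff e]
    exact (trW_acyclicGr_q_iff A f').2 h

instance : (KGr.q A ⋙ Qh A).IsLocalization (grQuasiIso A) :=
  Functor.IsLocalization.of_iso _ (qCompQhIso A).symm

instance : (Qh A).IsLocalization (acyclicGr A).trW :=
  Functor.IsLocalization.of_comp (KGr.q A) (Qh A)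
    (HomologicalComplex.homotopyEquivalences (GrMod A) (ComplexShape.up ℤ))
    (acyclicGr A).trW (grQuasiIso A) (homotopyEquivalences_le_grQuasiIso A)
    (trW_acyclicGr_eq_map A)

noncomputable instance : Preadditive (DGr A) := Localization.preadditive (Qh A) (acyclicGr A).trW

instance : (Qh A).Additive := Localization.functor_additive (Qh A) (acyclicGr A).trW

instance : (DGr.Q A).Additive := Functor.additive_of_iso (qCompQhIso A)

instance : HasZeroObject (DGr A) := (DGr.Q A).hasZeroObject_of_additive

noncomputable instance : HasShift (DGr A) ℤ := HasShift.localized (Qh A) (acyclicGr A).trW ℤ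

noncomputable instance : (Qh A).CommShift ℤ :=
  Functor.CommShift.localized (Qh A) (acyclicGr A).trW ℤ

noncomputable instance : (DGr.Q A).CommShift ℤ := Functor.CommShift.ofIso (qCompQhIso A) ℤ

instance : NatTrans.CommShift (qCompQhIso A).hom ℤ :=
  Functor.CommShift.ofIso_compatibility (qCompQhIso A) ℤ

instance (n : ℤ) : (shiftFunctor (DGr A) n).Additive := by
  rw [Localization.functor_additive_iff (Qh A) (acyclicGr A).trW]
  exact Functor.additive_of_iso ((Qh A).commShiftIso n)

noncomputable instance : Pretriangulated (DGr A) :=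
  Triangulated.Localization.pretriangulated (Qh A) (acyclicGr A).trW

instance : (Qh A).IsTriangulated :=
  Triangulated.Localization.isTriangulated_functor (Qh A) (acyclicGr A).trW

lemma Q_mappingCone_triangle_distinguished {K L : CochainComplex (GrMod A) ℤ} (φ : K ⟶ L) :
    (DGr.Q A).mapTriangle.obj (CochainComplex.mappingCone.triangle φ) ∈ distTriang (DGr A) := by
  refine isomorphic_distinguished _ ((Qh A).map_distinguished
    ((KGr.q A).mapTriangle.obj (CochainComplex.mappingCone.triangle φ)) ?_) _
    ((Functor.mapTriangleIso (qCompQhIso A)).symm.app _ ≪≫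
      (Functor.mapTriangleCompIso (KGr.q A) (Qh A)).app _)
  exact ⟨_, _, _, ⟨Iso.refl _⟩⟩

/-- Triangles of duals arise in this form: the dual of a mapping cone sequence is degreewise split,
but it is not itself given as a mapping cone sequence. -/
lemma Q_degreewiseSplit_distinguished (S : ShortComplex (CochainComplex (GrMod A) ℤ))
    (σ : ∀ n, (S.map (HomologicalComplex.eval (GrMod A) (ComplexShape.up ℤ) n)).Splitting) :
    (DGr.Q A).mapTriangle.obj (CochainComplex.triangleOfDegreewiseSplit S σ) ∈
      distTriang (DGr A) := by
  refine isomorphic_distinguished _ ((Qh A).map_distinguished _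
    ((HomotopyCategory.distinguished_iff_iso_trianglehOfDegreewiseSplit _).2
      ⟨S, σ, ⟨Iso.refl _⟩⟩)) _
    ((Functor.mapTriangleIso (qCompQhIso A)).symm.app _ ≪≫
      (Functor.mapTriangleCompIso (KGr.q A) (Qh A)).app _)

end triangulated

/-! ### Weight components on the derived category -/

section weights

variable {Y : Scheme.{u}} (A : GradedRingSheaf Y)

attribute [local instance] HasDerivedCategory.standard

/-- The weight `i` part on the homotopy category, with values in the derived category. -/
noncomputable def KWeight (i : ℤ) : KGr A ⥤ DerivedCategory Y.Modules :=
  (GrMod.weight A i).mapHomotopyCategory (ComplexShape.up ℤ) ⋙ DerivedCategory.Qh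

noncomputable instance (i : ℤ) : (KWeight A i).CommShift ℤ :=
  inferInstanceAs (((GrMod.weight A i).mapHomotopyCategory (ComplexShape.up ℤ) ⋙
    DerivedCategory.Qh).CommShift ℤ)

instance (i : ℤ) : (KWeight A i).IsTriangulated :=
  inferInstanceAs (((GrMod.weight A i).mapHomotopyCategory (ComplexShape.up ℤ) ⋙
    DerivedCategory.Qh).IsTriangulated)

lemma KWeight_isInvertedBy (i : ℤ) : (acyclicGr A).trW.IsInvertedBy (KWeight A i) := by
  intro K L f hf
  have h := (trW_acyclicGr_iff A f).1 hf i
  rw [acyclicIn, ObjectProperty.inverseImage_trW_iff] at h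
  exact Localization.inverts DerivedCategory.Qh
    (HomotopyCategory.subcategoryAcyclic Y.Modules).trW _ h

/-- The weight `i` part on the derived category of graded modules. -/
noncomputable def DWeight (i : ℤ) : DGr A ⥤ DerivedCategory Y.Modules :=
  Localization.lift (KWeight A i) (KWeight_isInvertedBy A i) (Qh A)

noncomputable instance (i : ℤ) : Localization.Lifting (Qh A) (acyclicGr A).trW (KWeight A i)
    (DWeight A i) :=
  Localization.liftingLift _ _ _

/-- The factorization of the weight functor. -/
noncomputable def QhCompDWeightIso (i : ℤ) : Qh A ⋙ DWeight A i ≅ KWeight A i :=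
  Localization.fac _ _ _

noncomputable instance (i : ℤ) : (DWeight A i).CommShift ℤ :=
  Functor.commShiftOfLocalization (Qh A) (acyclicGr A).trW ℤ (KWeight A i) (DWeight A i)

instance (i : ℤ) : NatTrans.CommShift (Localization.Lifting.iso (Qh A) (acyclicGr A).trW
    (KWeight A i) (DWeight A i)).hom ℤ := by
  infer_instance

instance : (Qh A).mapArrow.EssSurj :=
  Localization.essSurj_mapArrow _ (acyclicGr A).trW

instance (i : ℤ) : (DWeight A i).IsTriangulated :=
  Functor.isTriangulated_of_precomp_iso (Localization.Lifting.iso (Qh A) (acyclicGr A).trW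
    (KWeight A i) (DWeight A i))

/-- The weight functor on complexes. -/
noncomputable def QCompDWeightIso (i : ℤ) :
    DGr.Q A ⋙ DWeight A i ≅ weightComplex A i ⋙ DerivedCategory.Q :=
  Functor.isoWhiskerRight (qCompQhIso A).symm _ ≪≫ Functor.associator _ _ _ ≪≫
    Functor.isoWhiskerLeft (KGr.q A) (QhCompDWeightIso A i) ≪≫
    Functor.isoWhiskerLeft (weightComplex A i) (DerivedCategory.quotientCompQhIso Y.Modules)

lemma isIso_DWeight_Q_map_iff (i : ℤ) {K L : CochainComplex (GrMod A) ℤ} (f : K ⟶ L) :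
    IsIso ((DWeight A i).map ((DGr.Q A).map f)) ↔ QuasiIso ((weightComplex A i).map f) := by
  rw [← DerivedCategory.isIso_Q_map_iff_quasiIso]
  exact NatIso.isIso_map_iff (QCompDWeightIso A i) f

/-- Cohomology in weight `i` factors through the weight functor. -/
noncomputable def DWeightHomologyIso (i n : ℤ) :
    DWeight A i ⋙ DerivedCategory.homologyFunctor Y.Modules n ≅ DGr.homologyWeight A i n :=
  Localization.liftNatIso (DGr.Q A) (grQuasiIso A)
    (DGr.Q A ⋙ DWeight A i ⋙ DerivedCategory.homologyFunctor Y.Modules n)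
    (DGr.Q A ⋙ DGr.homologyWeight A i n) _ _
    (Functor.isoWhiskerRight (QCompDWeightIso A i) (DerivedCategory.homologyFunctor Y.Modules n) ≪≫
      Functor.isoWhiskerLeft (weightComplex A i)
        (DerivedCategory.homologyFunctorFactors Y.Modules n) ≪≫
      eqToIso (Localization.Construction.fac _ (grQuasiIso_isInvertedBy A i n)).symm)

lemma isQuasiIsoInWeight_of_isIso {M N : DGr A} (f : M ⟶ N) (i : ℤ)
    (h : IsIso ((DWeight A i).map f)) : IsQuasiIsoInWeight f i := fun n => by
  rw [← NatIso.isIso_map_iff (DWeightHomologyIso A i n) f]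
  exact inferInstanceAs (IsIso ((DerivedCategory.homologyFunctor Y.Modules n).map _))

/-- Apply to the cone `Z` of `f` the fact that an object with vanishing weights is zero: if `Z` is
represented by a complex `K`, then `K ⟶ 0` is a quasi-isomorphism in each weight and so is inverted.
-/
lemma isIso_of_isIso_DWeight {M N : DGr A} (f : M ⟶ N) (h : ∀ i, IsIso ((DWeight A i).map f)) :
    IsIso f := by
  obtain ⟨Z, g, k, hT⟩ := distinguished_cocone_triangle f
  suffices IsZero Z from (Triangle.isZero₃_iff_isIso₁ _ hT).1 this
  have h1 : ∀ i, IsZero ((DWeight A i).obj Z) := fun i =>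
    (Triangle.isZero₃_iff_isIso₁ _ ((DWeight A i).map_distinguished _ hT)).2 (h i)
  obtain ⟨K, ⟨e⟩⟩ : ∃ K, Nonempty ((DGr.Q A).obj K ≅ Z) :=
    have := Localization.essSurj (DGr.Q A) (grQuasiIso A)
    ⟨_, ⟨(DGr.Q A).objObjPreimageIso Z⟩⟩
  refine IsZero.of_iso ?_ e.symm
  have h2 : grQuasiIso A (0 : K ⟶ 0) := fun i => by
    rw [← isIso_DWeight_Q_map_iff]
    have h3 : IsZero ((DWeight A i).obj ((DGr.Q A).obj K)) :=
      (h1 i).of_iso ((DWeight A i).mapIso e)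
    have h4 : IsZero ((DWeight A i).obj ((DGr.Q A).obj (0 : CochainComplex (GrMod A) ℤ))) :=
      Functor.map_isZero _ (Functor.map_isZero _ (isZero_zero _))
    exact ⟨0, h3.eq_of_src _ _, h4.eq_of_src _ _⟩
  have := Localization.inverts (DGr.Q A) (grQuasiIso A) _ h2
  exact (Functor.map_isZero (DGr.Q A) (isZero_zero _)).of_iso (asIso ((DGr.Q A).map (0 : K ⟶ 0)))

end weights

end HomFlip

namespace HomFlip

/-! ### Quasi-coherent complexes over affine opens -/

section affine

variable {Y : Scheme.{u}} {W : Y.Opens}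

lemma isUnit_resO (f : Γ(Y, W)) {V : Y.Opens} (hV : V ≤ Y.basicOpen f) :
    IsUnit (resO Y (hV.trans (Y.basicOpen_le f)) f) := by
  have h : IsUnit (resO Y (Y.basicOpen_le f) f) :=
    RingedSpace.isUnit_res_basicOpen Y.toLocallyRingedSpace.toRingedSpace f
  have := h.map (resO Y hV)
  rwa [resO_resO] at this

lemma pow_smul_cancel {M : Y.Modules} (f : Γ(Y, W)) {V : Y.Opens} (hV : V ≤ Y.basicOpen f)
    (n : ℕ) {x y : Γ(M, V)}
    (h : resO Y (hV.trans (Y.basicOpen_le f)) (f ^ n) • x =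
      resO Y (hV.trans (Y.basicOpen_le f)) (f ^ n) • y) : x = y := by
  have hu := (isUnit_resO f hV).pow n
  rw [← map_pow] at hu
  exact (IsUnit.smul_left_cancel hu).1 h

lemma res_eq_zero_of_pow_smul {M : Y.Modules} (f : Γ(Y, W)) {V : Y.Opens}
    (hV : V ≤ Y.basicOpen f) (n : ℕ) {x : Γ(M, W)} (h : f ^ n • x = 0) :
    res M (hV.trans (Y.basicOpen_le f)) x = 0 := by
  apply pow_smul_cancel f hV n
  rw [← res_smul, h, map_zero, smul_zero]

/-- The device for passing from local solutions to solutions over an affine open. The functions `r`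
for which `r` times the problem is solvable form an ideal, and clearing the denominators of a
solution over a basic open `D(f)` puts a power of `f` into it. -/
lemma ideal_eq_top_of_locally (hW : IsAffineOpen W) (I : Ideal Γ(Y, W))
    (h : ∀ y ∈ W, ∃ f ∈ I, y ∈ Y.basicOpen f) : I = ⊤ := by
  rw [← Ideal.span_eq I, ← hW.self_le_iSup_basicOpen_iff]
  intro y hy
  obtain ⟨f, hf, hyf⟩ := h y hy
  exact Opens.mem_iSup.2 ⟨⟨f, hf⟩, hyf⟩

lemma exists_basicOpen (hW : IsAffineOpen W) {V : Y.Opens} {y : Y} (hy : y ∈ V) (hyW : y ∈ W) :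
    ∃ f : Γ(Y, W), Y.basicOpen f ≤ V ∧ y ∈ Y.basicOpen f :=
  hW.exists_basicOpen_le ⟨y, hy⟩ hyW

lemma exists_affine {U : Y.Opens} {y : Y} (hy : y ∈ U) :
    ∃ W : Y.Opens, IsAffineOpen W ∧ y ∈ W ∧ W ≤ U :=
  let ⟨W, h1, h2, h3⟩ := exists_isAffineOpen_mem_and_subset hy
  ⟨W, h1, h2, h3⟩

/-- Cohomology of quasi-coherent acyclic complexes vanishes on affine sections. -/
lemma exists_sec_of_acyclic (K : CochainComplex Y.Modules ℤ) (hK : K.Acyclic)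
    (hW : IsAffineOpen W) (n : ℤ) (h0 : LocalizesAt (K.X (n - 1)) W) (h1 : LocalizesAt (K.X n) W)
    (x : Γ(K.X n, W)) (hx : sec (K.d n (n + 1)) W x = 0) :
    ∃ t : Γ(K.X (n - 1), W), sec (K.d (n - 1) n) W t = x := by
  -- The functions `r` such that `r • x` is a boundary. Acyclicity gives primitives of `x` near each
  -- point; clearing denominators over `D(f)` shows that a power of `f` lies in `I`. No cohomology
  -- of quasi-coherent sheaves is needed.
  let I : Ideal Γ(Y, W) := (LinearMap.range (sec (K.d (n - 1) n) W)).colon {x}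
  have hI : ∀ r, r ∈ I ↔ ∃ t, sec (K.d (n - 1) n) W t = r • x := fun r => by
    simp [I, Submodule.mem_colon_singleton]
  suffices I = ⊤ by
    obtain ⟨t, ht⟩ := (hI 1).1 (by rw [this]; trivial)
    exact ⟨t, by rw [ht, one_smul]⟩
  refine ideal_eq_top_of_locally hW I fun y hy => ?_
  obtain ⟨V, hV, hyV, t, ht⟩ := (acyclic_iff_locally K).1 hK n W x hx y hy
  obtain ⟨f, hf, hyf⟩ := exists_basicOpen hW hyV hy
  obtain ⟨N, s, hs⟩ := (h0 f).2 (res _ hf t)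
  obtain ⟨m, hm⟩ := (h1 f).1 (sec (K.d (n - 1) n) W s - f ^ N • x) (by
    rw [map_sub, ← sec_res, hs, map_smul, sec_res, ht, res_res, res_smul, sub_self])
  -- The additional factor `f` keeps the exponent positive, so that the power has the same basic
  -- open as `f`.
  refine ⟨f ^ (m + N + 1), (hI _).2 ⟨(f ^ (m + 1)) • s, ?_⟩, ?_⟩
  · rw [smul_sub, sub_eq_zero] at hm
    rw [map_smul, pow_succ', mul_smul, hm, ← mul_smul, ← mul_smul]
    congr 1
    ring
  · rw [Scheme.basicOpen_pow _ _ (by omega)]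
    exact hyf

end affine

/-! ### Extending linear maps of affine sections to maps of sheaves -/

section extend

variable {Y : Scheme.{u}} {W : Y.Opens} {T : Type}

lemma homSec_ext_affine {F G : T → Y.Modules} (hW : IsAffineOpen W)
    (hF : ∀ t, LocalizesAt (F t) W) {φ ψ : HomSec F G W}
    (h : ∀ t x, φ.app t W le_rfl x = ψ.app t W le_rfl x) : φ = ψ := by
  refine HomSec.ext' fun t V hV x => eq_of_locally fun y hy => ?_
  obtain ⟨f, hf, hyf⟩ := exists_basicOpen hW hy (hV hy)
  refine ⟨Y.basicOpen f, hf, hyf, ?_⟩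
  rw [← φ.app_res t hV hf, ← ψ.app_res t hV hf]
  obtain ⟨n, s, hs⟩ := (hF t f).2 (res _ hf x)
  refine pow_smul_cancel f le_rfl n ?_
  rw [← (φ.app t _ _).map_smul, ← (ψ.app t _ _).map_smul, ← hs, φ.app_res t le_rfl,
    ψ.app_res t le_rfl, h]

/-- `z` is a value at `x` of the map of sheaves extending `g`. -/
def ExtRel {F G : Y.Modules} (g : Γ(F, W) →ₗ[Γ(Y, W)] Γ(G, W)) {V : Y.Opens}
    (x : Γ(F, V)) (z : Γ(G, V)) : Prop :=
  ∀ (f : Γ(Y, W)) (hf : Y.basicOpen f ≤ V) (n : ℕ) (s : Γ(F, W)),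
    res F (Y.basicOpen_le f) s = resO Y (Y.basicOpen_le f) (f ^ n) • res F hf x →
    res G (Y.basicOpen_le f) (g s) = resO Y (Y.basicOpen_le f) (f ^ n) • res G hf z

lemma res_map_eq_zero {F G : Y.Modules} (hF : LocalizesAt F W)
    (g : Γ(F, W) →ₗ[Γ(Y, W)] Γ(G, W)) (f : Γ(Y, W)) {s : Γ(F, W)}
    (hs : res F (Y.basicOpen_le f) s = 0) : res G (Y.basicOpen_le f) (g s) = 0 := by
  obtain ⟨n, hn⟩ := (hF f).1 s hs
  exact res_eq_zero_of_pow_smul f le_rfl n (by rw [← map_smul, hn, map_zero])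

/-- Thanks to uniqueness, additivity, linearity and compatibility with restriction of the extended
map are just closure properties of the relation `ExtRel`. -/
lemma extRel_unique {F G : Y.Modules} (hW : IsAffineOpen W) (hF : LocalizesAt F W)
    (g : Γ(F, W) →ₗ[Γ(Y, W)] Γ(G, W)) {V : Y.Opens} (hV : V ≤ W) {x : Γ(F, V)} {z z' : Γ(G, V)}
    (h : ExtRel g x z) (h' : ExtRel g x z') : z = z' := by
  refine eq_of_locally fun y hy => ?_
  obtain ⟨f, hf, hyf⟩ := exists_basicOpen hW hy (hV hy)
  obtain ⟨n, s, hs⟩ := (hF f).2 (res _ hf x)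
  exact ⟨_, hf, hyf, pow_smul_cancel f le_rfl n ((h f hf n s hs).symm.trans (h' f hf n s hs))⟩

/-- Over `D(f)` the value must be `g s / f ^ n`, where `s` is a section over `W` that restricts to
`f ^ n • x`. Two such choices agree on `D(f f')`, because a section of `F` vanishing there is killed
by a power of `f f'`, and hence so is its image. The values therefore glue. Nothing is required of
`G` beyond being a sheaf. -/
lemma extRel_exists {F G : Y.Modules} (hW : IsAffineOpen W) (hF : LocalizesAt F W)
    (g : Γ(F, W) →ₗ[Γ(Y, W)] Γ(G, W)) {V : Y.Opens} (hV : V ≤ W) (x : Γ(F, V)) :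
    ∃ z : Γ(G, V), ExtRel g x z := by
  have key : ∀ (f f' : Γ(Y, W)) (hf : Y.basicOpen f ≤ V) (hf' : Y.basicOpen f' ≤ V) (n n' : ℕ)
      (s s' : Γ(F, W)),
      res F (Y.basicOpen_le f) s = resO Y (Y.basicOpen_le f) (f ^ n) • res F hf x →
      res F (Y.basicOpen_le f') s' = resO Y (Y.basicOpen_le f') (f' ^ n') • res F hf' x →
      res G (Y.basicOpen_le (f * f')) (g (f' ^ n' • s)) =
        res G (Y.basicOpen_le (f * f')) (g (f ^ n • s')) := by
    intro f f' hf hf' n n' s s' hs hs'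
    rw [← sub_eq_zero, ← map_sub, ← map_sub]
    apply res_map_eq_zero hF
    have h1 : Y.basicOpen (f * f') ≤ Y.basicOpen f := by
      rw [Scheme.basicOpen_mul]; exact inf_le_left
    have h2 : Y.basicOpen (f * f') ≤ Y.basicOpen f' := by
      rw [Scheme.basicOpen_mul]; exact inf_le_right
    have e1 := congrArg (res F h1) hs
    have e2 := congrArg (res F h2) hs'
    rw [res_smul, res_res, resO_resO, res_res] at e1 e2
    rw [map_sub, res_smul, res_smul, e1, e2, ← mul_smul, ← mul_smul,
      mul_comm (resO Y _ (f' ^ n')), sub_self]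
  let ι := {f : Γ(Y, W) // Y.basicOpen f ≤ V}
  choose n s hs using fun f : ι => (hF f.1).2 (res _ f.2 x)
  have hunit : ∀ f : ι, IsUnit (resO Y (Y.basicOpen_le f.1) (f.1 ^ n f)) := fun f => by
    rw [map_pow]; exact (isUnit_resO f.1 le_rfl).pow _
  have hz : ∀ f : ι, ∃ z : Γ(G, Y.basicOpen f.1),
      res G (Y.basicOpen_le f.1) (g (s f)) = resO Y (Y.basicOpen_le f.1) (f.1 ^ n f) • z :=
    fun f => by
      obtain ⟨v, hv⟩ := (hunit f).exists_right_inv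
      exact ⟨v • res G (Y.basicOpen_le f.1) (g (s f)), by rw [← mul_smul, hv, one_smul]⟩
  choose z hz using hz
  have compat : ∀ (f f' : ι) (n' : ℕ) (s' : Γ(F, W)),
      res F (Y.basicOpen_le f'.1) s' = resO Y (Y.basicOpen_le f'.1) (f'.1 ^ n') • res F f'.2 x →
      ∀ (z' : Γ(G, Y.basicOpen f'.1)),
      res G (Y.basicOpen_le f'.1) (g s') = resO Y (Y.basicOpen_le f'.1) (f'.1 ^ n') • z' →
      ∀ (V' : Y.Opens) (h1 : V' ≤ Y.basicOpen f.1) (h2 : V' ≤ Y.basicOpen f'.1),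
        res G h1 (z f) = res G h2 z' := by
    intro f f' n' s' hs' z' hz' V' h1 h2
    have h3 : V' ≤ Y.basicOpen (f.1 * f'.1) := by
      rw [Scheme.basicOpen_mul]; exact le_inf h1 h2
    have e := congrArg (res G h3) (key f.1 f'.1 f.2 f'.2 (n f) n' (s f) s' (hs f) hs')
    rw [res_res, res_res, g.map_smul, g.map_smul, res_smul, res_smul] at e
    have e1 := congrArg (res G h1) (hz f)
    have e2 := congrArg (res G h2) hz'
    rw [res_smul, res_res, resO_resO] at e1 e2
    rw [e1, e2, smul_comm] at e
    exact pow_smul_cancel f'.1 h2 n' (pow_smul_cancel f.1 h1 (n f) e)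
  obtain ⟨t, ht, -⟩ := exists_glue G (fun f : ι => Y.basicOpen f.1) V (fun f => f.2) (by
      intro y hy
      obtain ⟨f, hf, hyf⟩ := exists_basicOpen hW hy (hV hy)
      exact Opens.mem_iSup.2 ⟨⟨f, hf⟩, hyf⟩) z
    (fun f f' => compat f f' (n f') (s f') (hs f') (z f') (hz f') _ _ _)
  refine ⟨t, fun f hf n' s' hs' => ?_⟩
  obtain ⟨v, hv⟩ : ∃ v, resO Y (Y.basicOpen_le f) (f ^ n') * v = 1 := by
    have : IsUnit (resO Y (Y.basicOpen_le f) (f ^ n')) := by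
      rw [map_pow]; exact (isUnit_resO f le_rfl).pow _
    exact this.exists_right_inv
  have e := compat ⟨f, hf⟩ ⟨f, hf⟩ n' s' hs' (v • res G (Y.basicOpen_le f) (g s'))
    (by rw [← mul_smul, hv, one_smul]) (Y.basicOpen f) le_rfl le_rfl
  rw [res_self, res_self] at e
  have e2 : res G hf t = z ⟨f, hf⟩ := ht ⟨f, hf⟩
  rw [e2, e, ← mul_smul, hv, one_smul]

lemma ExtRel.res {F G : Y.Modules} {g : Γ(F, W) →ₗ[Γ(Y, W)] Γ(G, W)} {V V' : Y.Opens}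
    {x : Γ(F, V)} {z : Γ(G, V)} (h : ExtRel g x z) (hV : V' ≤ V) :
    ExtRel g (res F hV x) (HomFlip.res G hV z) := fun f hf n s hs => by
  rw [res_res] at hs ⊢
  exact h f _ n s hs

lemma ExtRel.add {F G : Y.Modules} (hF : LocalizesAt F W)
    {g : Γ(F, W) →ₗ[Γ(Y, W)] Γ(G, W)} {V : Y.Opens}
    {x x' : Γ(F, V)} {z z' : Γ(G, V)} (h : ExtRel g x z) (h' : ExtRel g x' z') :
    ExtRel g (x + x') (z + z') := fun f hf n s hs => by
  obtain ⟨m, t, ht⟩ := (hF f).2 (HomFlip.res F hf x)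
  have e1 := h f hf m t ht
  have e2 := h' f hf (m + n) (f ^ m • s - f ^ n • t) (by
    rw [map_sub, res_smul, res_smul, hs, ht, ← mul_smul, ← mul_smul, ← map_mul, ← map_mul,
      ← pow_add, ← pow_add, add_comm n m, ← smul_sub, map_add, add_sub_cancel_left])
  apply pow_smul_cancel f le_rfl m
  rw [map_sub, map_smul, map_smul, map_sub, res_smul, res_smul, e1, sub_eq_iff_eq_add] at e2
  rw [e2, map_add, smul_add, smul_add, ← mul_smul, ← mul_smul, ← mul_smul, ← map_mul, ← map_mul,
    ← pow_add, ← pow_add, add_comm n m, add_comm]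

lemma ExtRel.smul {F G : Y.Modules} (hF : LocalizesAt F W) (hO : ∀ f : Γ(Y, W),
      ∀ t : Γ(Y, Y.basicOpen f), ∃ (n : ℕ) (s : Γ(Y, W)),
        resO Y (Y.basicOpen_le f) s = resO Y (Y.basicOpen_le f) (f ^ n) * t)
    {g : Γ(F, W) →ₗ[Γ(Y, W)] Γ(G, W)} {V : Y.Opens}
    {x : Γ(F, V)} {z : Γ(G, V)} (h : ExtRel g x z) (c : Γ(Y, V)) :
    ExtRel g (c • x) (c • z) := fun f hf n s hs => by
  obtain ⟨m, t, ht⟩ := (hF f).2 (HomFlip.res F hf x)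
  obtain ⟨k, r, hr⟩ := hO f (resO Y hf c)
  have e1 := h f hf m t ht
  have e3 : HomFlip.res F (Y.basicOpen_le f) (f ^ (m + k) • s - (f ^ n * r) • t) = 0 := by
    rw [map_sub, res_smul, res_smul, hs, ht, res_smul, map_mul, hr, sub_eq_zero, ← mul_smul,
      ← mul_smul, ← mul_smul]
    congr 1
    rw [pow_add, map_mul]
    ring
  have e4 := res_map_eq_zero hF g f e3
  rw [map_sub, map_smul, map_smul, map_sub, res_smul, res_smul, e1, sub_eq_zero, map_mul, hr] at e4
  apply pow_smul_cancel f le_rfl (m + k)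
  rw [e4, res_smul, ← mul_smul, ← mul_smul, ← mul_smul]
  congr 1
  rw [pow_add, map_mul]
  ring

lemma exists_resO_eq (hW : IsAffineOpen W) (f : Γ(Y, W)) (t : Γ(Y, Y.basicOpen f)) :
    ∃ (n : ℕ) (s : Γ(Y, W)),
      resO Y (Y.basicOpen_le f) s = resO Y (Y.basicOpen_le f) (f ^ n) * t := by
  have := hW.isLocalization_basicOpen f
  obtain ⟨⟨s, ⟨_, n, rfl⟩⟩, h⟩ := IsLocalization.surj (Submonoid.powers f) t
  exact ⟨n, s, by rw [mul_comm]; exact h.symm⟩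

/-- Over an affine open, a linear map out of the sections of a quasi-coherent sheaf extends to a
map of sheaves. -/
noncomputable def homSecExtend {F G : T → Y.Modules} (hW : IsAffineOpen W)
    (hF : ∀ t, LocalizesAt (F t) W) (g : ∀ t, Γ(F t, W) →ₗ[Γ(Y, W)] Γ(G t, W)) :
    HomSec F G W where
  app t V hV :=
    { toFun := fun x => (extRel_exists hW (hF t) (g t) hV x).choose
      map_add' := fun x y => extRel_unique hW (hF t) (g t) hV
        (extRel_exists hW (hF t) (g t) hV _).choose_spec
        ((extRel_exists hW (hF t) (g t) hV x).choose_spec.add (hF t)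
          (extRel_exists hW (hF t) (g t) hV y).choose_spec)
      map_smul' := fun c x => extRel_unique hW (hF t) (g t) hV
        (extRel_exists hW (hF t) (g t) hV _).choose_spec
        ((extRel_exists hW (hF t) (g t) hV x).choose_spec.smul (hF t) (exists_resO_eq hW) c) }
  app_res t V V' hV hW' x := extRel_unique hW (hF t) (g t) (hW'.trans hV)
    (extRel_exists hW (hF t) (g t) (hW'.trans hV) _).choose_spec
    ((extRel_exists hW (hF t) (g t) hV x).choose_spec.res hW')

lemma homSecExtend_app {F G : T → Y.Modules} (hW : IsAffineOpen W)
    (hF : ∀ t, LocalizesAt (F t) W) (g : ∀ t, Γ(F t, W) →ₗ[Γ(Y, W)] Γ(G t, W)) (t : T)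
    (x : Γ(F t, W)) : (homSecExtend hW hF g).app t W le_rfl x = g t x := by
  have h : ExtRel (g t) x ((homSecExtend hW hF g).app t W le_rfl x) :=
    (extRel_exists hW (hF t) (g t) le_rfl x).choose_spec
  refine extRel_unique hW (hF t) (g t) le_rfl h fun f hf n s hs => ?_
  rw [← res_smul, ← sub_eq_zero, ← map_sub] at hs
  rw [← res_smul, ← sub_eq_zero, ← map_sub, ← map_smul, ← map_sub]
  exact res_map_eq_zero (hF t) (g t) f hs

end extend

end HomFlip

namespace HomFlip

/-! ### Complexes of sections over an affine open -/

section sectionsComplex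

variable {Y : Scheme.{u}} {W : Y.Opens}

lemma moduleCat_acyclic_iff {R : Type u} [Ring R] (K : CochainComplex (ModuleCat.{u} R) ℤ) :
    K.Acyclic ↔ ∀ (n : ℤ) (x : K.X n), K.d n (n + 1) x = 0 →
      ∃ t : K.X (n - 1), K.d (n - 1) n t = x := by
  refine forall_congr' fun n => ?_
  rw [K.exactAt_iff' (n - 1) n (n + 1) (by simp) (by simp), ShortComplex.moduleCat_exact_iff]
  rfl

lemma sectionsComplex_acyclic (hW : IsAffineOpen W) (K : CochainComplex Y.Modules ℤ)
    (hK : K.Acyclic) (hq : ∀ p, QCoh (K.X p)) : (sectionsComplex W K).Acyclic :=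
  (moduleCat_acyclic_iff _).2 fun n x hx =>
    exists_sec_of_acyclic K hK hW n (hq _ W hW) (hq _ W hW) x hx

/-- Bounded below complexes of injective modules are K-injective, and both boundedness and
injectivity over affine opens are part of being a dualizing complex. -/
lemma isKInjective_sections {ω : CochainComplex Y.Modules ℤ} (hω : IsDualizingComplex ω)
    (hW : IsAffineOpen W) : (sectionsComplex W ω).IsKInjective := by
  obtain ⟨l, m, h⟩ := hω.bounded
  have : (sectionsComplex W ω).IsStrictlyGE l :=
    (CochainComplex.isStrictlyGE_iff _ _).2 fun i hi =>
      (sectionsFunctor W).map_isZero (h i (Or.inl hi))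
  have : ∀ n, Injective ((sectionsComplex W ω).X n) := fun n => by
    have := hω.injective ⟨W, hW⟩ n
    exact Module.injective_object_of_injective_module _ Γ(ω.X n, W)
  exact CochainComplex.isKInjective_of_injective _ l

end sectionsComplex

/-! ### The dual of acyclic complexes and of cone triangles -/

section dual

open CochainComplex HomComplex Pretriangulated

variable {Y : Scheme.{u}} {A : GradedRingSheaf Y} (ω : CochainComplex Y.Modules ℤ)

lemma dual_d_sec (K : CochainComplex (GrMod A) ℤ) (n m : ℤ) (h : n + 1 = m) (j : ℤ)
    (U : Y.Opens) (φ : DualSec ω K n j U) :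
    sec (((dual ω K).d n m).app j) U φ = dualDSec ω K n m h j U φ := by
  simp only [dual, dif_pos h]
  rfl

/-- The dual of an acyclic complex with quasi-coherent terms is acyclic. -/
lemma dual_acyclic (hω : IsDualizingComplex ω) (K : CochainComplex (GrMod A) ℤ) (j : ℤ)
    (hq : ∀ p, QCoh ((K.X p).obj (-j))) (hK : ((weightComplex A (-j)).obj K).Acyclic) :
    ((weightComplex A j).obj (dual ω K)).Acyclic := by
  rw [acyclic_iff_locally]
  intro n U φ hφ y hy
  obtain ⟨W, hW, hyW, hWU⟩ := exists_affine hy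
  refine ⟨W, hWU, hyW, ?_⟩
  change DualSec ω K n j U at φ
  have hφ : dualDSec ω K n (n + 1) rfl j U φ = 0 := (dual_d_sec ω K n (n + 1) rfl j U φ).symm.trans hφ
  -- Taking sections over the affine `W` turns a local section of the dual into a cochain from
  -- `K_{-j}(W)` to `ω(W)`, and the sign conventions of `dualDSec` are those of `δ`, so cocycles go
  -- to cocycles.
  let z : Cochain (sectionsComplex W ((weightComplex A (-j)).obj K)) (sectionsComplex W ω) n :=
    Cochain.mk fun p q hpq => ModuleCat.ofHom (φ.app ⟨p, q, hpq⟩ W hWU)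
  have hz : δ n (n + 1) z = 0 := by
    ext p q hpq x
    rw [δ_v n (n + 1) rfl z p q hpq (q - 1) (p + 1) rfl rfl]
    exact (dualDSec_apply ω K n (n + 1) rfl j U φ ⟨p, q, hpq⟩ W hWU x).symm.trans
      (congrArg (fun ψ : DualSec ω K (n + 1) j U => ψ.app ⟨p, q, hpq⟩ W hWU x) hφ)
  have := isKInjective_sections hω hW
  obtain ⟨α, hα⟩ := IsKInjective.eq_δ_of_cocycle (Cocycle.mk z (n + 1) rfl hz)
    (sectionsComplex_acyclic hW _ hK hq) (n - 1) (by omega)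
  have hF : ∀ t : Triplet (n - 1), LocalizesAt ((K.X t.p).obj (-j)) W := fun t => hq _ W hW
  -- `K_{-j}(W)` is acyclic and `ω(W)` is K-injective, so the cocycle is a coboundary `δ α`. The
  -- components of `α` are maps of sections over `W` only; quasi-coherence of `K` extends them to
  -- maps of sheaves.
  let ψ : DualSec ω K (n - 1) j W := homSecExtend hW hF fun t => (α.v t.p t.q t.hpq).hom
  refine ⟨ψ, (dual_d_sec ω K (n - 1) n (by omega) j W ψ).trans ?_⟩
  refine homSec_ext_affine hW (fun t => hq _ W hW) fun t x => ?_
  rw [dualDSec_apply]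
  have e1 := homSecExtend_app (G := fun t : Triplet (n - 1) => ω.X t.q) hW hF
    (fun t => (α.v t.p t.q t.hpq).hom) ⟨t.p, t.q - 1, by have := t.hpq; omega⟩ x
  have e2 := homSecExtend_app (G := fun t : Triplet (n - 1) => ω.X t.q) hW hF
    (fun t => (α.v t.p t.q t.hpq).hom)
    ⟨t.p + 1, t.q, by have := t.hpq; omega⟩ (sec ((K.d t.p (t.p + 1)).app (-j)) W x)
  have e3 := ConcreteCategory.congr_hom (Cochain.congr_v hα t.p t.q t.hpq) x
  rw [δ_v (n - 1) n (by omega) α t.p t.q t.hpq (t.q - 1) (t.p + 1) rfl rfl] at e3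
  refine Eq.trans ?_ e3
  exact congrArg₂ (· + ·) (congrArg (sec (ω.d (t.q - 1) t.q) W) e1) (congrArg _ e2)

/-- Precomposition with morphisms of the terms of complexes. -/
noncomputable def dualXMap {K L : CochainComplex (GrMod A) ℤ} (g : ∀ p, K.X p ⟶ L.X p) (n : ℤ) :
    dualX ω L n ⟶ dualX ω K n where
  app j := mkHom
    (M := sheafHom (fun t : Triplet n => (L.X t.p).obj (-j)) (fun t => ω.X t.q))
    (N := sheafHom (fun t : Triplet n => (K.X t.p).obj (-j)) (fun t => ω.X t.q))
    (fun U =>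
      { toFun := fun φ =>
          { app := fun t V hV => φ.app t V hV ∘ₗ sec ((g t.p).app (-j)) V
            app_res := fun t V W hV hW x => by
              simp only [LinearMap.comp_apply]
              rw [← φ.app_res t hV hW, sec_res] }
        map_add' := fun φ ψ => rfl
        map_smul' := fun c φ => rfl }) (fun h φ => rfl)
  app_act hk U a φ := HomSec.ext' fun t V hV x =>
    congrArg (HomSec.app φ t V hV) ((g t.p).app_act _ V _ x).symm

lemma dualXMap_id {K : CochainComplex (GrMod A) ℤ} (n : ℤ) :
    dualXMap ω (fun p => 𝟙 (K.X p)) n = 𝟙 _ := rfl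

lemma dualXMap_add {K L : CochainComplex (GrMod A) ℤ} (g h : ∀ p, K.X p ⟶ L.X p) (n : ℤ) :
    dualXMap ω (fun p => g p + h p) n = dualXMap ω g n + dualXMap ω h n :=
  GrMod.hom_ext fun j => hom_ext' fun U φ => HomSec.ext' fun t V hV x =>
    map_add (HomSec.app φ t V hV) _ _

lemma GrMod.isIso_of_bijective {M N : GrMod A} (f : M ⟶ N)
    (h : ∀ i U, Function.Bijective (sec (f.app i) U)) : IsIso f := by
  let e : ∀ i U, Γ(M.obj i, U) ≃ₗ[Γ(Y, U)] Γ(N.obj i, U) := fun i U =>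
    LinearEquiv.ofBijective _ (h i U)
  have he : ∀ i U x, sec (f.app i) U ((e i U).symm x) = x := fun i U x =>
    (e i U).apply_symm_apply x
  let g : N ⟶ M :=
    { app := fun i => mkHom (fun U => (e i U).symm.toLinearMap) (fun {U V} hV x => by
        apply (h i V).1
        refine (he i V _).trans ?_
        rw [sec_res]
        exact congrArg _ (he i U x).symm)
      app_act := fun {i j k} hk U a x => by
        apply (h k U).1
        refine (he k U _).trans ?_
        rw [f.app_act]
        exact congrArg _ (he j U x).symm }
  exact ⟨g, GrMod.hom_ext fun i => hom_ext' fun U x => (e i U).symm_apply_apply x,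
    GrMod.hom_ext fun i => hom_ext' fun U x => he i U x⟩

/-- The comparison map from the dual to the shifted dual of the shift, on sections. -/
noncomputable def dualShiftSec (K : CochainComplex (GrMod A) ℤ) (n j : ℤ) (U : Y.Opens) :
    DualSec ω K n j U →ₗ[Γ(Y, U)]
      HomSec (fun t : Triplet (n + 1) => (K.X (t.p + 1)).obj (-j)) (fun t => ω.X t.q) U where
  toFun φ :=
    -- The sign `(-1)^n` compensates for the signs of the differentials of `K[1]` and of the outer
    -- shift.
    { app := fun t V hV => (n.negOnePow : ℤ) •
        φ.app ⟨t.p + 1, t.q, by have := t.hpq; omega⟩ V hV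
      app_res := fun t V W hV hW x => by
        simp only [LinearMap.smul_apply]
        rw [map_zsmul, φ.app_res ⟨t.p + 1, t.q, by have := t.hpq; omega⟩ hV hW] }
  map_add' φ ψ := HomSec.ext' fun t V hV x => by
    simp only [LinearMap.smul_apply, HomSec.add_app, LinearMap.add_apply, smul_add]
  map_smul' c φ := HomSec.ext' fun t V hV x => by
    simp only [LinearMap.smul_apply, HomSec.smul_app, RingHom.id_apply]
    rw [smul_comm]

/-- The comparison map from the dual to the shifted dual of the shift, in degree `n`. -/
noncomputable def dualShiftX (K : CochainComplex (GrMod A) ℤ) (n : ℤ) :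
    dualX ω K n ⟶ dualX ω (K⟦(1 : ℤ)⟧) (n + 1) where
  app j := mkHom
    (M := sheafHom (fun t : Triplet n => (K.X t.p).obj (-j)) (fun t => ω.X t.q))
    (N := sheafHom (fun t : Triplet (n + 1) => ((K⟦(1 : ℤ)⟧).X t.p).obj (-j)) (fun t => ω.X t.q))
    (fun U => dualShiftSec ω K n j U) (fun h φ => rfl)
  app_act hk U a φ := HomSec.ext' fun t V hV x => rfl

lemma dualShiftX_app (K : CochainComplex (GrMod A) ℤ) (n j : ℤ) {U : Y.Opens}
    (φ : DualSec ω K n j U) (t : Triplet (n + 1)) (V : Y.Opens) (hV : V ≤ U)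
    (x : Γ((K.X (t.p + 1)).obj (-j), V)) :
    HomSec.app (sec ((dualShiftX ω K n).app j) U φ : DualSec ω (K⟦(1 : ℤ)⟧) (n + 1) j U) t V hV x =
      (n.negOnePow : ℤ) • φ.app ⟨t.p + 1, t.q, by have := t.hpq; omega⟩ V hV x := rfl

lemma negOnePow_smul_smul {M : Type*} [AddCommGroup M] (n : ℤ) (x : M) :
    (n.negOnePow : ℤ) • (n.negOnePow : ℤ) • x = x := by
  rw [← mul_smul, ← Units.val_mul, Int.units_mul_self, Units.val_one, one_smul]

/-- Triplets of consecutive degrees. -/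
def tripletShift (n : ℤ) : Triplet (n + 1) ≃ Triplet n where
  toFun t := ⟨t.p + 1, t.q, by have := t.hpq; omega⟩
  invFun t := ⟨t.p - 1, t.q, by have := t.hpq; omega⟩
  left_inv t := by cases t; simp
  right_inv t := by cases t; simp

lemma isIso_dualShiftX (K : CochainComplex (GrMod A) ℤ) (n : ℤ) : IsIso (dualShiftX ω K n) := by
  refine GrMod.isIso_of_bijective _ fun j U => ⟨?_, fun ψ => ?_⟩
  · rw [injective_iff_map_eq_zero]
    intro φ hφ
    refine HomSec.ext' (F := fun t : Triplet n => (K.X t.p).obj (-j)) fun t V hV x => ?_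
    obtain ⟨p, q, h⟩ := t
    obtain ⟨p, rfl⟩ : ∃ p', p = p' + 1 := ⟨p - 1, by omega⟩
    have := congrArg (fun ψ : DualSec ω (K⟦(1 : ℤ)⟧) (n + 1) j U =>
      (n.negOnePow : ℤ) • ψ.app ⟨p, q, by omega⟩ V hV x) hφ
    dsimp only at this
    rw [dualShiftX_app ω K n j φ ⟨p, q, by omega⟩ V hV x, negOnePow_smul_smul] at this
    exact this.trans (smul_zero _)
  · change DualSec ω (K⟦(1 : ℤ)⟧) (n + 1) j U at ψ
    -- The preimage is `ψ` reindexed along `tripletShift`. The types of its components depend on the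
    -- triplet, so the reindexing is left to `Equiv.piCongrLeft`.
    let P : Triplet n → Type _ := fun t =>
      HomSec (fun _ : Unit => (K.X t.p).obj (-j)) (fun _ : Unit => ω.X t.q) U
    let g : ∀ t : Triplet (n + 1), P (tripletShift n t) := fun t =>
      { app := fun _ V hV => (n.negOnePow : ℤ) • ψ.app t V hV
        app_res := fun _ V W hV hW x =>
          (congrArg (fun z => (n.negOnePow : ℤ) • z) (ψ.app_res t hV hW x)).trans
            (map_zsmul (res (ω.X t.q) hW) _ _).symm }
    let G := Equiv.piCongrLeft P (tripletShift n) g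
    have hG : ∀ t, G (tripletShift n t) = g t := Equiv.piCongrLeft_apply_apply P (tripletShift n) g
    let φ : DualSec ω K n j U :=
      { app := fun t V hV => (G t).app () V hV
        app_res := fun t V W hV hW x => (G t).app_res () hV hW x }
    refine ⟨φ, HomSec.ext' fun t V hV x => ?_⟩
    refine (dualShiftX_app ω K n j φ t V hV x).trans ?_
    have := congrArg (fun φ : P (tripletShift n t) => (n.negOnePow : ℤ) • φ.app () V hV x) (hG t)
    refine Eq.trans this ?_
    exact negOnePow_smul_smul n _

/-- The sign computation behind `dualShift`: the outer minus comes from shifting the dual, and the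
argument `-x` from the differential of `K[1]`. -/
lemma dualShift_sign {X M N : Type*} [AddCommGroup X] [AddCommGroup M] [AddCommGroup N] (n : ℤ)
    (d : M →+ N) (a : M) (φ : X →+ N) (x : X) :
    -(d ((n.negOnePow : ℤ) • a) + ((n + 1 + 1).negOnePow : ℤ) • ((n.negOnePow : ℤ) • φ (-x))) =
      ((n + 1).negOnePow : ℤ) • (d a + ((n + 1).negOnePow : ℤ) • φ x) := by
  rw [Int.negOnePow_succ (n + 1), Int.negOnePow_succ n, neg_neg, map_neg, smul_neg, smul_neg,
    negOnePow_smul_smul, Units.val_neg, map_zsmul, smul_add, neg_smul, neg_smul, neg_smul,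
    smul_neg, neg_neg, negOnePow_smul_smul, neg_add, neg_neg]

/-- The dual of a complex agrees with the shifted dual of its shift. -/
noncomputable def dualShift (K : CochainComplex (GrMod A) ℤ) :
    dual ω K ⟶ (dual ω (K⟦(1 : ℤ)⟧))⟦(1 : ℤ)⟧ where
  f n := dualShiftX ω K n
  comm' n m h := by
    have h1 : n + 1 = m := h
    subst h1
    refine GrMod.hom_ext fun j => hom_ext' fun U φ => HomSec.ext' fun t V hV x => ?_
    change DualSec ω K n j U at φ
    have e1 : sec (((dual ω K).d n (n + 1)).app j) U φ = dualDSec ω K n (n + 1) rfl j U φ :=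
      dual_d_sec ω K n (n + 1) rfl j U φ
    have e2 := dual_d_sec ω (K⟦(1 : ℤ)⟧) (n + 1) (n + 1 + 1) rfl j U (dualShiftSec ω K n j U φ)
    have e3 : ((dual ω (K⟦(1 : ℤ)⟧))⟦(1 : ℤ)⟧).d n (n + 1) =
        -(dual ω (K⟦(1 : ℤ)⟧)).d (n + 1) (n + 1 + 1) := by
      rw [CochainComplex.shiftFunctor_obj_d']
      simp
    have e4 : ((K⟦(1 : ℤ)⟧)).d t.p (t.p + 1) = -K.d (t.p + 1) (t.p + 1 + 1) := by
      rw [CochainComplex.shiftFunctor_obj_d']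
      simp
    have e5 := dualDSec_apply ω (K⟦(1 : ℤ)⟧) (n + 1) (n + 1 + 1) rfl j U
      (dualShiftSec ω K n j U φ) t V hV x
    have e6 := dualDSec_apply ω K n (n + 1) rfl j U φ
      ⟨t.p + 1, t.q, by have := t.hpq; change _ + (n + 1 + 1) = _ at this; omega⟩ V hV x
    rw [e4] at e5
    refine Eq.trans (congrArg (fun g : dualX ω (K⟦(1 : ℤ)⟧) (n + 1) ⟶
      dualX ω (K⟦(1 : ℤ)⟧) (n + 1 + 1) => HomSec.app (sec (g.app j) U (dualShiftSec ω K n j U φ) :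
        DualSec ω (K⟦(1 : ℤ)⟧) (n + 1 + 1) j U) t V hV x) e3) ?_
    refine Eq.trans (congrArg (fun ψ : DualSec ω (K⟦(1 : ℤ)⟧) (n + 1 + 1) j U =>
      -ψ.app t V hV x) e2) ?_
    refine Eq.trans (congrArg Neg.neg e5) ?_
    refine Eq.trans ?_ (congrArg (fun ψ : DualSec ω K (n + 1) j U =>
      HomSec.app (dualShiftSec ω K (n + 1) j U ψ) t V hV x) e1).symm
    refine Eq.trans ?_ (congrArg (fun z => ((n + 1).negOnePow : ℤ) • z) e6.symm)
    exact dualShift_sign n (sec (ω.d (t.q - 1) t.q) V).toAddMonoidHom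
      (φ.app ⟨t.p + 1, t.q - 1, _⟩ V hV x)
      (φ.app ⟨t.p + 1 + 1, t.q, _⟩ V hV).toAddMonoidHom
      (sec ((K.d (t.p + 1) (t.p + 1 + 1)).app (-j)) V x)

instance (K : CochainComplex (GrMod A) ℤ) : IsIso (dualShift ω K) := by
  have : ∀ n, IsIso ((dualShift ω K).f n) := fun n => isIso_dualShiftX ω K n
  exact HomologicalComplex.Hom.isIso_of_components _

variable {K L : CochainComplex (GrMod A) ℤ} (f : K ⟶ L)

/-- The dual of the degreewise split sequence attached to a mapping cone. -/
noncomputable def dualConeShortComplex : ShortComplex (CochainComplex (GrMod A) ℤ) :=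
  ShortComplex.mk (dualMap ω (mappingCone.triangleRotateShortComplex f).g)
    (dualMap ω (mappingCone.triangleRotateShortComplex f).f) (by
      have h := (mappingCone.triangleRotateShortComplex f).zero
      have : dualMap ω ((mappingCone.triangleRotateShortComplex f).f ≫
        (mappingCone.triangleRotateShortComplex f).g) = 0 := by
        rw [h]
        ext n
        refine GrMod.hom_ext fun j => hom_ext' fun U φ => HomSec.ext' fun t V hV x => ?_
        exact map_zero (HomSec.app φ t V hV)
      exact this)

/-- The degreewise splittings of the dual of the sequence attached to a mapping cone. -/
noncomputable def dualConeSplitting (n : ℤ) : ((dualConeShortComplex ω f).map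
    (HomologicalComplex.eval (GrMod A) (ComplexShape.up ℤ) n)).Splitting where
  -- Dualizing interchanges sections and retractions. These are not chain maps, which is why
  -- `dualXMap` accepts arbitrary families of maps between the terms.
  r := dualXMap ω (fun p => (mappingCone.triangleRotateShortComplexSplitting f p).s) n
  s := dualXMap ω (fun p => (mappingCone.triangleRotateShortComplexSplitting f p).r) n
  f_r := by
    refine Eq.trans (congrArg (fun g => dualXMap ω (K := K⟦(1 : ℤ)⟧) (L := K⟦(1 : ℤ)⟧) g n)
      (funext fun p => (mappingCone.triangleRotateShortComplexSplitting f p).s_g)) ?_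
    exact dualXMap_id ω n
  s_g := by
    refine Eq.trans (congrArg (fun g => dualXMap ω (K := L) (L := L) g n)
      (funext fun p => (mappingCone.triangleRotateShortComplexSplitting f p).f_r)) ?_
    exact dualXMap_id ω n
  id := by
    have := (dualXMap_add ω (K := mappingCone f) (L := mappingCone f)
      (fun p => (mappingCone.triangleRotateShortComplex f).g.f p ≫
        (mappingCone.triangleRotateShortComplexSplitting f p).s)
      (fun p => (mappingCone.triangleRotateShortComplexSplitting f p).r ≫
        (mappingCone.triangleRotateShortComplex f).f.f p) n).symm
    refine Eq.trans this ?_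
    refine Eq.trans (congrArg (fun g => dualXMap ω (K := mappingCone f) (L := mappingCone f) g n)
      (funext fun p => (add_comm _ _).trans
        (mappingCone.triangleRotateShortComplexSplitting f p).id)) ?_
    exact dualXMap_id ω n

lemma mappingCone_inl_d_snd (p : ℤ) : (-(mappingCone.inl f).v (p + 1) p (by omega)) ≫
    (mappingCone f).d p (p + 1) ≫ (mappingCone.snd f).v (p + 1) (p + 1) (add_zero _) =
      -f.f (p + 1) := by
  rw [mappingCone.d_snd_v f p (p + 1) rfl]
  simp

lemma mappingCone_inl_snd (p : ℤ) : (-(mappingCone.inl f).v (p + 1) p (by omega)) ≫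
    (mappingCone.snd f).v p p (add_zero _) = 0 := by
  simp

lemma dualCone_sign {X X' M N : Type*} [AddCommGroup X] [AddCommGroup X'] [AddCommGroup M]
    [AddCommGroup N] (n : ℤ) (d : M →+ N) (ψ : X' →+ M) (φ : X →+ N) (x : X') (y z : X)
    (hx : x = 0) (hy : y = -z) :
    d (ψ x) + ((n + 1).negOnePow : ℤ) • φ y = (n.negOnePow : ℤ) • φ z := by
  rw [hx, hy, map_zero, map_zero, zero_add, Int.negOnePow_succ, Units.val_neg, map_neg, neg_smul,
    smul_neg, neg_neg]

/-- The connecting map is section, then differential, then retraction. The section extends a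
functional on `L` to the cone along `snd`, the retraction restricts along `-inl`, and the only part
of the differential of the cone going from `K[1]` to `L` is `f`. What remains is precomposition with
`f`, with the sign built into `dualShift`. -/
lemma homOfDegreewiseSplit_dualCone :
    homOfDegreewiseSplit (dualConeShortComplex ω f) (dualConeSplitting ω f) =
      dualMap ω f ≫ dualShift ω K := by
  ext n
  rw [homOfDegreewiseSplit_f]
  refine GrMod.hom_ext fun j => hom_ext' fun U φ => HomSec.ext' fun t V hV x => ?_
  change DualSec ω L n j U at φ
  let ψ : DualSec ω (mappingCone f) n j U :=
    sec ((dualXMap ω (K := mappingCone f) (L := L)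
        (fun p => (mappingCone.snd f).v p p (add_zero p)) n).app j) U φ
  have e2 := dual_d_sec ω (mappingCone f) n (n + 1) rfl j U ψ
  obtain ⟨p, q, hpq⟩ := t
  change Γ((K.X (p + 1)).obj (-j), V) at x
  let x' : Γ(((mappingCone f).X p).obj (-j), V) :=
    sec (GrMod.Hom.app (-(mappingCone.inl f).v (p + 1) p (by omega)) (-j)) V x
  refine Eq.trans (congrArg (fun χ : DualSec ω (mappingCone f) (n + 1) j U =>
    χ.app ⟨p, q, hpq⟩ V hV x') e2) ?_
  refine Eq.trans (dualDSec_apply ω (mappingCone f) n (n + 1) rfl j U ψ ⟨p, q, hpq⟩ V hV x') ?_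
  have h1 := congrArg (fun g : K.X (p + 1) ⟶ L.X p => sec (g.app (-j)) V x)
    (mappingCone_inl_snd f p)
  have h2 := congrArg (fun g : K.X (p + 1) ⟶ L.X (p + 1) => sec (g.app (-j)) V x)
    (mappingCone_inl_d_snd f p)
  exact dualCone_sign (X := Γ((L.X (p + 1)).obj (-j), V)) (X' := Γ((L.X p).obj (-j), V))
    n (sec (ω.d (q - 1) q) V).toAddMonoidHom
    (φ.app ⟨p, q - 1, by omega⟩ V hV).toAddMonoidHom
    (φ.app ⟨p + 1, q, by omega⟩ V hV).toAddMonoidHom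
    (sec (GrMod.Hom.app ((mappingCone.snd f).v p p (add_zero p)) (-j)) V x')
    (sec (GrMod.Hom.app ((mappingCone.snd f).v (p + 1) (p + 1) (add_zero _)) (-j)) V
      (sec (((mappingCone f).d p (p + 1)).app (-j)) V x'))
    (sec ((f.f (p + 1)).app (-j)) V x) h1 h2

/-- The triangle dual to the triangle of a mapping cone. -/
lemma exists_dual_distinguished :
    ∃ h, Pretriangulated.Triangle.mk ((DGr.Q A).map (dualMap ω (mappingCone.inr f)))
      ((DGr.Q A).map (dualMap ω f)) h ∈ distTriang (DGr A) := by
  -- The degreewise split sequence is `𝔻(K[1]) → 𝔻(cone f) → 𝔻(L)`, with connecting map to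
  -- `𝔻(K[1])[1]`. Rotating it and replacing `𝔻(K[1])[1]` by `𝔻(K)` gives the triangle `𝔻(cone f) →
  -- 𝔻(L) → 𝔻(K)`.
  have h1 := Pretriangulated.rot_of_distTriang _
    (Q_degreewiseSplit_distinguished A (dualConeShortComplex ω f) (dualConeSplitting ω f))
  let e : (DGr.Q A).obj (dual ω K) ≅ ((DGr.Q A).obj (dual ω (K⟦(1 : ℤ)⟧)))⟦(1 : ℤ)⟧ :=
    (DGr.Q A).mapIso (asIso (dualShift ω K)) ≪≫ ((DGr.Q A).commShiftIso (1 : ℤ)).app _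
  let h := e.hom ≫ (((DGr.Q A).mapTriangle.obj (triangleOfDegreewiseSplit
      (dualConeShortComplex ω f) (dualConeSplitting ω f))).rotate).mor₃
  refine ⟨h, Pretriangulated.isomorphic_distinguished _ h1 _
    (Pretriangulated.Triangle.isoMk _ _ (Iso.refl _) (Iso.refl _) e ?_ ?_ ?_)⟩
  · refine (Category.comp_id _).trans ((Category.id_comp _).trans ?_).symm
    rfl
  · refine Eq.trans ?_ (Category.id_comp _).symm
    change (DGr.Q A).map (dualMap ω f) ≫ (DGr.Q A).map (dualShift ω K) ≫ _ =
      (DGr.Q A).map (homOfDegreewiseSplit (dualConeShortComplex ω f) (dualConeSplitting ω f)) ≫ _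
    rw [homOfDegreewiseSplit_dualCone]
    refine Eq.trans ?_ (congrArg (· ≫ _) ((DGr.Q A).map_comp _ _).symm)
    exact (Category.assoc _ _ _).symm
  · exact (congrArg _ (CategoryTheory.Functor.map_id _ _)).trans (Category.comp_id _)

end dual

end HomFlip

namespace HomFlip

/-! ### Sections of graded modules as modules over the ring of sections -/

section tot

variable {Y : Scheme.{u}} {A : GradedRingSheaf Y} {U V V' V'' : Y.Opens}

lemma GrMod.mk_act_eq (M : GrMod A) {i j k k' : ℤ} (h : i + j = k) (h' : i + j = k') (V : Y.Opens)
    (a : Γ(A.gr i, V)) (x : Γ(M.obj j, V)) :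
    (GradedMonoid.mk k (M.act h V a x) : GradedMonoid fun k => (Γ(M.obj k, V) : Type u)) =
      GradedMonoid.mk k' (M.act h' V a x) := by
  subst h h'; rfl

/-- The graded module structure on sections. -/
@[reducible] noncomputable def totGmodule (M : GrMod A) (hV : V ≤ U) :
    DirectSum.Gmodule (A.piece U) (fun k => (Γ(M.obj k, V) : Type u)) where
  smul {i j} a x := M.act rfl V (res (A.gr i) hV a) x
  one_smul b := (M.mk_act_eq rfl (zero_add _) V _ b.2).trans
    (congrArg (GradedMonoid.mk b.1) ((congrArg (fun z => M.act (zero_add b.1) V z b.2)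
      (A.one_res hV)).trans (M.one_act V b.2)))
  mul_smul a a' b := (M.mk_act_eq rfl (add_assoc _ _ _) V _ b.2).trans
    (congrArg (GradedMonoid.mk _) ((congrArg (fun z => M.act (add_assoc _ _ _) V z b.2)
      (A.mul_res rfl hV a.2 a'.2)).trans
        (M.mul_act rfl (add_assoc _ _ _) rfl rfl V _ _ b.2)))
  smul_add a b c := map_add _ _ _
  smul_zero a := map_zero _
  add_smul {i j} a a' b := by
    change M.act rfl V (res (A.gr i) hV (a + a')) b = _
    rw [map_add, LinearMap.map_add₂]
  zero_smul {i j} b := by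
    change M.act rfl V (res (A.gr i) hV 0) b = _
    rw [map_zero, LinearMap.map_zero₂]

/-- The sections `⨁ M_k(V)` over `V ≤ U` of a graded module, as a module over `𝒜(U)`. -/
def Tot (M : GrMod A) (hV : V ≤ U) : Type u := DirectSum ℤ fun k => (Γ(M.obj k, V) : Type u)

namespace Tot

noncomputable instance (M : GrMod A) (hV : V ≤ U) : AddCommGroup (Tot M hV) :=
  inferInstanceAs (AddCommGroup (DirectSum ℤ fun k => (Γ(M.obj k, V) : Type u)))

noncomputable instance (M : GrMod A) (hV : V ≤ U) : Module (A.ring U) (Tot M hV) :=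
  letI := totGmodule M hV
  (DirectSum.Gmodule.module (A.piece U) fun k => (Γ(M.obj k, V) : Type u) :
    Module (DirectSum ℤ (A.piece U)) (DirectSum ℤ fun k => (Γ(M.obj k, V) : Type u)))

variable (M : GrMod A) (hV : V ≤ U)

/-- The inclusion of the weight `k` sections. -/
noncomputable def of (k : ℤ) : Γ(M.obj k, V) →+ Tot M hV :=
  DirectSum.of (fun k => (Γ(M.obj k, V) : Type u)) k

/-- The weight `k` component. -/
noncomputable def comp (k : ℤ) : Tot M hV →+ Γ(M.obj k, V) where
  toFun x := (show DirectSum ℤ fun k => (Γ(M.obj k, V) : Type u) from x) k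
  map_zero' := rfl
  map_add' x y := rfl

@[simp] lemma comp_of_same (k : ℤ) (x : Γ(M.obj k, V)) : comp M hV k (of M hV k x) = x :=
  DirectSum.of_eq_same _ _

lemma comp_of_ne {k l : ℤ} (h : k ≠ l) (x : Γ(M.obj k, V)) : comp M hV l (of M hV k x) = 0 :=
  DirectSum.of_eq_of_ne _ _ _ h.symm

variable {M hV} in
lemma ext {x y : Tot M hV} (h : ∀ k, comp M hV k x = comp M hV k y) : x = y := DFinsupp.ext h

variable {M hV} in
lemma induction {p : Tot M hV → Prop} (x : Tot M hV) (h0 : p 0) (hof : ∀ k x, p (of M hV k x))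
    (hadd : ∀ x y, p x → p y → p (x + y)) : p x :=
  DirectSum.induction_on x h0 hof hadd

lemma of_injective (k : ℤ) : Function.Injective (of M hV k) := DirectSum.of_injective k

lemma incl_smul_of {d k l : ℤ} (h : d + k = l) (a : Γ(A.gr d, U)) (x : Γ(M.obj k, V)) :
    A.incl U d a • of M hV k x = of M hV l (M.act h V (res (A.gr d) hV a) x) := by
  subst h
  let := totGmodule M hV
  exact DirectSum.Gmodule.of_smul_of (A.piece U) (fun k => (Γ(M.obj k, V) : Type u)) a x

lemma comp_incl_smul {d k l : ℤ} (h : d + k = l) (a : Γ(A.gr d, U)) (x : Tot M hV) :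
    comp M hV l (A.incl U d a • x) = M.act h V (res (A.gr d) hV a) (comp M hV k x) := by
  induction x using induction with
  | h0 => simp
  | hof k' x =>
    rw [incl_smul_of M hV (l := d + k') rfl]
    by_cases hk : k' = k
    · subst hk; subst h; simp
    · rw [comp_of_ne _ _ hk, comp_of_ne _ _ (by omega), map_zero]
  | hadd x y hx hy => rw [smul_add, map_add, hx, hy, map_add, map_add]

lemma _root_.HomFlip.GradedRingSheaf.ring_induction {p : A.ring U → Prop} (x : A.ring U) (h0 : p 0)
    (hof : ∀ k x, p (A.incl U k x)) (hadd : ∀ x y, p x → p y → p (x + y)) : p x :=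
  DirectSum.induction_on x h0 hof hadd

variable {M} in
/-- An additive map commuting with the homogeneous elements is linear. -/
def mkLinear {X X' : Type*} [AddCommGroup X] [AddCommGroup X'] [Module (A.ring U) X]
    [Module (A.ring U) X'] (f : X →+ X')
    (h : ∀ d (a : Γ(A.gr d, U)) x, f (A.incl U d a • x) = A.incl U d a • f x) :
    X →ₗ[A.ring U] X' where
  toFun := f
  map_add' := map_add f
  map_smul' b x := by
    induction b using GradedRingSheaf.ring_induction with
    | h0 => simp
    | hof k a => exact h k a x
    | hadd b b' hb hb' => rw [add_smul, map_add, hb, hb', RingHom.id_apply, RingHom.id_apply,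
        RingHom.id_apply, add_smul]

/-- Componentwise additive maps. -/
noncomputable def mapAdd {M N : GrMod A} {T : Y.Opens} {hV : V ≤ U} {hV' : V' ≤ T}
    (f : ∀ k, Γ(M.obj k, V) →+ Γ(N.obj k, V')) : Tot M hV →+ Tot N hV' :=
  DirectSum.toAddMonoid fun k => (of N hV' k).comp (f k)

lemma mapAdd_of {M N : GrMod A} {T : Y.Opens} {hV : V ≤ U} {hV' : V' ≤ T}
    (f : ∀ k, Γ(M.obj k, V) →+ Γ(N.obj k, V')) (k : ℤ) (x : Γ(M.obj k, V)) :
    mapAdd f (of M hV k x) = of N hV' k (f k x) := DirectSum.toAddMonoid_of _ _ _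

lemma comp_mapAdd {M N : GrMod A} {T : Y.Opens} {hV : V ≤ U} {hV' : V' ≤ T}
    (f : ∀ k, Γ(M.obj k, V) →+ Γ(N.obj k, V')) (k : ℤ) (x : Tot M hV) :
    comp N hV' k (mapAdd f x) = f k (comp M hV k x) := by
  induction x using induction with
  | h0 => simp
  | hof k' x =>
    rw [mapAdd_of]
    by_cases hk : k' = k
    · subst hk; simp
    · rw [comp_of_ne _ _ hk, comp_of_ne _ _ hk, map_zero]
  | hadd x y hx hy => rw [map_add, map_add, hx, hy, map_add, map_add]

/-- The map of sections induced by a morphism. -/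
noncomputable def map {M N : GrMod A} (f : M ⟶ N) (hV : V ≤ U) : Tot M hV →ₗ[A.ring U] Tot N hV :=
  mkLinear (mapAdd fun k => (sec (f.app k) V).toAddMonoidHom) fun d a x => ext fun k => by
    have h : d + (k - d) = k := by omega
    rw [comp_mapAdd, comp_incl_smul M hV h, comp_incl_smul N hV h, comp_mapAdd]
    exact f.app_act _ _ _ _

lemma comp_map {M N : GrMod A} (f : M ⟶ N) (hV : V ≤ U) (k : ℤ) (x : Tot M hV) :
    comp N hV k (map f hV x) = sec (f.app k) V (comp M hV k x) := comp_mapAdd _ k x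

lemma map_of {M N : GrMod A} (f : M ⟶ N) (hV : V ≤ U) (k : ℤ) (x : Γ(M.obj k, V)) :
    map f hV (of M hV k x) = of N hV k (sec (f.app k) V x) :=
  mapAdd_of (fun k => (sec (f.app k) V).toAddMonoidHom) k x

/-- Restriction of sections. -/
noncomputable def resTo (hV : V ≤ U) (h : V' ≤ V) (hV' : V' ≤ U := h.trans hV) :
    Tot M hV →ₗ[A.ring U] Tot M hV' :=
  mkLinear (mapAdd fun k => res (M.obj k) h) fun d a x => ext fun k => by
    have h : d + (k - d) = k := by omega
    rw [comp_mapAdd, comp_incl_smul M hV h, comp_incl_smul M hV' h, comp_mapAdd, M.act_res,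
      res_res]

lemma comp_resTo (hV : V ≤ U) (h : V' ≤ V) (hV' : V' ≤ U) (k : ℤ) (x : Tot M hV) :
    comp M hV' k (resTo M hV h hV' x) = res (M.obj k) h (comp M hV k x) := comp_mapAdd _ k x

lemma resTo_of (hV : V ≤ U) (h : V' ≤ V) (hV' : V' ≤ U) (k : ℤ) (x : Γ(M.obj k, V)) :
    resTo M hV h hV' (of M hV k x) = of M hV' k (res (M.obj k) h x) :=
  mapAdd_of (fun k => res (M.obj k) h) k x

lemma resTo_resTo (hV : V ≤ U) (h : V' ≤ V) (hV' : V' ≤ U) (h' : V'' ≤ V') (hV'' : V'' ≤ U)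
    (x : Tot M hV) : resTo M hV' h' hV'' (resTo M hV h hV' x) =
      resTo M hV (h'.trans h) hV'' x := ext fun k => by
  rw [comp_resTo, comp_resTo, comp_resTo, res_res]

lemma resTo_map {M N : GrMod A} (f : M ⟶ N) (hV : V ≤ U) (h : V' ≤ V) (hV' : V' ≤ U)
    (x : Tot M hV) : resTo N hV h hV' (map f hV x) = map f hV' (resTo M hV h hV' x) :=
  ext fun k => by rw [comp_resTo, comp_map, comp_map, comp_resTo, sec_res]

/-- The functor of sections. -/
noncomputable def functor (A : GradedRingSheaf Y) (hV : V ≤ U) :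
    GrMod A ⥤ ModuleCat.{u} (A.ring U) where
  obj M := ModuleCat.of _ (Tot M hV)
  map f := ModuleCat.ofHom (map f hV)
  map_id M := by
    ext x
    exact Tot.ext (hV := hV) fun k => comp_map (𝟙 M) hV k x
  map_comp {M N K} f g := by
    ext x
    refine Tot.ext (hV := hV) fun k => (comp_map (f ≫ g) hV k x).trans ?_
    exact ((comp_map g hV k (map f hV x)).trans (congrArg _ (comp_map f hV k x))).symm

instance (hV : V ≤ U) : (functor A hV).Additive where
  map_add {M N f g} := by
    ext x
    refine Tot.ext (hV := hV) fun k => (comp_map (f + g) hV k x).trans ?_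
    exact ((map_add (comp N hV k) (map f hV x) (map g hV x)).trans
      (congrArg₂ (· + ·) (comp_map f hV k x) (comp_map g hV k x))).symm

/-- Restriction as a natural transformation. -/
noncomputable def resTrans (A : GradedRingSheaf Y) (hV : V ≤ U) (h : V' ≤ V) (hV' : V' ≤ U) :
    functor A hV ⟶ functor A hV' where
  app M := ModuleCat.ofHom (resTo M hV h hV')
  naturality M N f := by
    ext x
    exact resTo_map f hV h hV' x

end Tot

end tot

/-! ### Restriction, homogeneous ideals and localization -/

section restriction

namespace GradedRingSheaf

variable {Y : Scheme.{u}} (A : GradedRingSheaf Y) {U V : Y.Opens}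

/-- Functions as homogeneous elements of weight zero. -/
noncomputable def scal (U : Y.Opens) : Γ(Y, U) →+* A.ring U where
  toFun r := A.incl U 0 (r • A.one U)
  map_one' := by rw [one_smul]; rfl
  map_mul' r r' := by
    rw [A.incl_mul U (zero_add 0), LinearMap.map_smul (A.mul _ U _), LinearMap.map_smul₂, A.one_mul,
      smul_smul, _root_.mul_comm r r']
  map_zero' := by rw [zero_smul, map_zero]
  map_add' r r' := by rw [add_smul, map_add]

/-- Restriction of sections as a homomorphism of rings. -/
noncomputable def resRing (h : V ≤ U) : A.ring U →+* A.ring V :=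
  DirectSum.toSemiring (fun i => (A.incl V i).comp (res (A.gr i) h))
    (congrArg (A.incl V 0) (A.one_res h))
    (fun {i j} a b => (congrArg (A.incl V (i + j)) (A.mul_res rfl h a b)).trans
      (A.incl_mul V rfl _ _).symm)

lemma resRing_incl (h : V ≤ U) (i : ℤ) (a : Γ(A.gr i, U)) :
    A.resRing h (A.incl U i a) = A.incl V i (res (A.gr i) h a) :=
  DirectSum.toAddMonoid_of (β := A.piece U) (fun i => (A.incl V i).comp (res (A.gr i) h)) i a

lemma exists_incl_pow (U : Y.Opens) {d : ℤ} (a : Γ(A.gr d, U)) (n : ℕ) :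
    ∃ b : Γ(A.gr (n * d), U), A.incl U d a ^ n = A.incl U _ b := by
  induction n with
  | zero =>
    have h : (0 : ℤ) = ((0 : ℕ) : ℤ) * d := by simp
    rw [pow_zero, ← h]
    exact ⟨A.one U, rfl⟩
  | succ n ih =>
    obtain ⟨b, hb⟩ := ih
    exact ⟨A.mul (by push_cast; ring) U b a, by rw [pow_succ, hb, A.incl_mul]⟩

lemma map_idealOf_le (P : ℤ → Prop) (h : V ≤ U) :
    (A.idealOf P U).map (A.resRing h) ≤ A.idealOf P V := by
  rw [idealOf, Ideal.map_span, Ideal.span_le]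
  rintro _ ⟨_, ⟨i, hi, a, rfl⟩, rfl⟩
  exact Ideal.subset_span ⟨i, hi, _, A.resRing_incl h i a⟩

lemma scal_mul_incl (U : Y.Opens) (r : Γ(Y, U)) {i : ℤ} (a : Γ(A.gr i, U)) :
    A.scal U r * A.incl U i a = A.incl U i (r • a) := by
  change A.incl U 0 _ * _ = _
  rw [A.incl_mul U (zero_add i), LinearMap.map_smul₂, A.one_mul]

/-- A homogeneous section over `D(f)` extends to `U` after multiplication by a power of `f`, and
this power is a unit of weight zero over `D(f)`. -/
lemma idealOf_le_map (P : ℤ → Prop) (hA : ∀ i, QCoh (A.gr i)) (hU : IsAffineOpen U)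
    (f : Γ(Y, U)) :
    A.idealOf P (Y.basicOpen f) ≤ (A.idealOf P U).map (A.resRing (Y.basicOpen_le f)) := by
  rw [idealOf, Ideal.span_le]
  rintro _ ⟨i, hi, a, rfl⟩
  obtain ⟨n, b, hb⟩ := (hA i U hU f).2 a
  have hu : IsUnit (A.scal (Y.basicOpen f) (resO Y (Y.basicOpen_le f) (f ^ n))) := by
    rw [map_pow]
    exact ((isUnit_resO f le_rfl).pow n).map _
  refine (Ideal.unit_mul_mem_iff_mem _ hu).1 ?_
  rw [scal_mul_incl, ← hb, ← A.resRing_incl]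
  exact Ideal.mem_map_of_mem _ (Ideal.subset_span ⟨i, hi, b, rfl⟩)

/-- A finite family of homogeneous generators of an ideal. -/
structure Gens (P : ℤ → Prop) (U : Y.Opens) where
  N : ℕ
  deg : Fin N → ℤ
  elt (j : Fin N) : Γ(A.gr (deg j), U)
  span : A.idealOf P U = Ideal.span (Set.range fun j => A.incl U (deg j) (elt j))

lemma exists_gens (P : ℤ → Prop) (U : Y.Opens) [IsNoetherianRing (A.ring U)] :
    Nonempty (A.Gens P U) := by
  obtain ⟨S, hS, h⟩ := (Submodule.fg_span_iff_fg_span_finset_subset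
    {x | ∃ i, P i ∧ ∃ a : Γ(A.gr i, U), x = A.incl U i a}).1 (IsNoetherian.noetherian (R := A.ring U) (M := A.ring U) _)
  have h2 : ∀ x : S, ∃ i, ∃ a : Γ(A.gr i, U), x.1 = A.incl U i a := fun x =>
    let ⟨i, _, h⟩ := hS x.2
    ⟨i, h⟩
  choose deg elt helt using h2
  let e := S.equivFin
  refine ⟨⟨S.card, fun j => deg (e.symm j), fun j => elt (e.symm j), ?_⟩⟩
  have : (Set.range fun j => A.incl U (deg (e.symm j)) (elt (e.symm j))) = S := by
    ext x
    constructor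
    · rintro ⟨j, rfl⟩
      change A.incl U _ _ ∈ S
      rw [← helt]
      exact (e.symm j).2
    · intro hx
      exact ⟨e ⟨x, hx⟩, (helt _).symm.trans (congrArg Subtype.val (e.symm_apply_apply ⟨x, hx⟩))⟩
  rw [this]
  exact h

namespace Gens
variable {A} {P : ℤ → Prop} (G : A.Gens P U)

/-- The generators as elements of the ring. -/
noncomputable def x (j : Fin G.N) : A.ring U := A.incl U (G.deg j) (G.elt j)

lemma x_mem (j : Fin G.N) : G.x j ∈ A.idealOf P U := by
  rw [G.span]
  exact Ideal.subset_span ⟨j, rfl⟩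

lemma exists_pow_le {I : Ideal (A.ring U)} (h : ∀ j, ∃ n : ℕ, G.x j ^ n ∈ I) :
    ∃ n : ℕ, A.idealOf P U ^ n ≤ I := by
  refine Ideal.exists_pow_le_of_le_radical_of_fg ?_ ?_
  · rw [G.span, Ideal.span_le]
    rintro _ ⟨j, rfl⟩
    exact h j
  · rw [G.span]
    exact ⟨(Set.finite_range fun j => A.incl U (G.deg j) (G.elt j)).toFinset, by simp⟩

end Gens

end GradedRingSheaf

namespace Tot

variable {Y : Scheme.{u}} {A : GradedRingSheaf Y} {U V V' : Y.Opens} (M : GrMod A)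

lemma comp_scal_smul (hV : V ≤ U) (r : Γ(Y, U)) (k : ℤ) (x : Tot M hV) :
    comp M hV k (A.scal U r • x) = resO Y hV r • comp M hV k x := by
  refine (comp_incl_smul M hV (zero_add k) _ x).trans ?_
  rw [res_smul, A.one_res, LinearMap.map_smul₂, M.one_act]

lemma scal_smul_of (hV : V ≤ U) (r : Γ(Y, U)) (k : ℤ) (x : Γ(M.obj k, V)) :
    A.scal U r • of M hV k x = of M hV k (resO Y hV r • x) := by
  refine (incl_smul_of M hV (zero_add k) _ x).trans ?_
  rw [res_smul, A.one_res, LinearMap.map_smul₂, M.one_act]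

/-- Restriction of sections, with change of rings. -/
noncomputable def resSemi {T T' : Y.Opens} (hV : V ≤ T) (hV' : V' ≤ T') (h : V' ≤ V) :
    Tot M hV →+ Tot M hV' := mapAdd fun k => res (M.obj k) h

lemma resSemi_smul {T T' : Y.Opens} (hV : V ≤ T) (hV' : V' ≤ T') (h : V' ≤ V) (hT : T' ≤ T)
    (b : A.ring T) (x : Tot M hV) :
    resSemi M hV hV' h (b • x) = A.resRing hT b • resSemi M hV hV' h x := by
  induction b using GradedRingSheaf.ring_induction with
  | h0 => simp
  | hof d a =>
    refine Tot.ext fun k => ?_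
    have h : d + (k - d) = k := by omega
    rw [A.resRing_incl, resSemi, comp_mapAdd, comp_incl_smul M hV h, comp_incl_smul M hV' h,
      comp_mapAdd, M.act_res, res_res, res_res]
  | hadd b b' hb hb' => rw [add_smul, map_add, map_add, hb, hb', add_smul]

lemma resSemi_of {T T' : Y.Opens} (hV : V ≤ T) (hV' : V' ≤ T') (h : V' ≤ V) (k : ℤ)
    (x : Γ(M.obj k, V)) : resSemi M hV hV' h (of M hV k x) = of M hV' k (res (M.obj k) h x) :=
  mapAdd_of (fun k => res (M.obj k) h) k x

open Classical in
lemma exists_pow_of_comp (hV : V ≤ U) (f : Γ(Y, U)) (x : Tot M hV)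
    (h : ∀ k, ∃ n : ℕ, resO Y hV f ^ n • comp M hV k x = 0) :
    ∃ n : ℕ, A.scal U f ^ n • x = 0 := by
  choose n hn using h
  let s : Finset ℤ := DFinsupp.support (show DirectSum ℤ fun k => (Γ(M.obj k, V) : Type u) from x)
  refine ⟨s.sup n, ext fun k => ?_⟩
  rw [← map_pow, comp_scal_smul, map_pow, map_zero]
  by_cases hk : k ∈ s
  · obtain ⟨c, hc⟩ := Nat.exists_eq_add_of_le (Finset.le_sup (f := n) hk)
    rw [hc, pow_add, mul_comm, mul_smul, hn, smul_zero]
  · have : comp M hV k x = 0 := by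
      have := DFinsupp.notMem_support_iff.1 hk
      exact this
    rw [this, smul_zero]

variable {M} in
-- Quasi-coherence gives the statement in each weight with its own exponent. An element of the
-- direct sum has only finitely many components, so one exponent suffices.
lemma isLocalizedModule_resTo (hU : IsAffineOpen U) (hM : ∀ k, QCoh (M.obj k)) (f : Γ(Y, U)) :
    IsLocalizedModule (.powers (A.scal U f))
      (resTo M (le_refl U) (Y.basicOpen_le f) (Y.basicOpen_le f)) := by
  have hu : IsUnit (algebraMap (A.ring U) (Module.End (A.ring U) (Tot M (Y.basicOpen_le f)))
      (A.scal U f)) := by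
    rw [Module.End.isUnit_iff]
    have h := isUnit_resO f (le_refl (Y.basicOpen f))
    constructor
    · rw [injective_iff_map_eq_zero]
      intro x hx
      refine ext fun k => ?_
      have := congrArg (comp M _ k) hx
      rw [Module.algebraMap_end_apply, comp_scal_smul, map_zero] at this
      rw [map_zero]
      exact h.smul_eq_zero.1 this
    · intro x
      obtain ⟨v, hv⟩ := h
      refine ⟨mapAdd (fun k => DistribSMul.toAddMonoidHom _ (↑v⁻¹ : Γ(Y, Y.basicOpen f))) x,
        ext fun k => ?_⟩
      rw [Module.algebraMap_end_apply, comp_scal_smul, comp_mapAdd]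
      change resO Y _ f • (↑v⁻¹ : Γ(Y, Y.basicOpen f)) • comp M _ k x = _
      rw [← hv, smul_smul, v.mul_inv, one_smul]
  rw [isLocalizedModule_powers_iff _ _ hu]
  constructor
  · intro x hx
    refine exists_pow_of_comp M _ f x fun k => ?_
    obtain ⟨n, hn⟩ := (hM k U hU f).1 (comp M _ k x) (by
      rw [← comp_resTo M (le_refl U) (Y.basicOpen_le f) (Y.basicOpen_le f), hx, map_zero])
    exact ⟨n, by rwa [resO_self]⟩
  · intro t
    induction t using induction with
    | h0 => exact ⟨0, 0, by simp⟩
    | hof k t =>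
      obtain ⟨n, s, hs⟩ := (hM k U hU f).2 t
      exact ⟨n, of M _ k s, by rw [resTo_of, hs, ← map_pow, scal_smul_of]⟩
    | hadd t t' ht ht' =>
      obtain ⟨n, s, hs⟩ := ht
      obtain ⟨n', s', hs'⟩ := ht'
      refine ⟨n + n', A.scal U f ^ n' • s + A.scal U f ^ n • s', ?_⟩
      rw [map_add, map_smul, map_smul, hs, hs', smul_smul, smul_smul, smul_add, ← pow_add,
        ← pow_add, add_comm n' n]

end Tot

end restriction

end HomFlip

namespace HomFlip

/-! ### Torsion sections over affine opens -/

section torsion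

variable {Y : Scheme.{u}} {A : GradedRingSheaf Y} {U V V' : Y.Opens} {P : ℤ → Prop} (M : GrMod A)

/-- Sections annihilated by a power of the ideal over an affine open are torsion. -/
lemma mem_torsion_of_pow (hA : ∀ i, QCoh (A.gr i)) (hU : IsAffineOpen U) (hV : V ≤ U) (i : ℤ)
    (s : Γ(M.obj i, V)) (n : ℕ)
    (h : ∀ b ∈ A.idealOf P U ^ n, b • Tot.of M hV i s = 0) : s ∈ GrMod.torsion P M i V := by
  intro y hy
  refine ⟨V, hy, le_rfl, n, fun V' hV' d k hk b hb => eq_of_locally fun z hz => ?_⟩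
  obtain ⟨f, hf, hzf⟩ := exists_basicOpen hU hz (hV (hV' hz))
  refine ⟨_, hf, hzf, ?_⟩
  have hfU := Y.basicOpen_le f
  -- The ideal over an arbitrary open `V'` is not controlled by the one over `U`. Over a basic open
  -- of `U` it is generated by restrictions, so the annihilation hypothesis carries over.
  have h1 : ∀ c ∈ A.idealOf P (Y.basicOpen f) ^ n,
      c • Tot.of M (le_refl (Y.basicOpen f)) i (res (M.obj i) (hf.trans hV') s) = 0 := by
    intro c hc
    have h2 := Ideal.pow_right_mono (A.idealOf_le_map P hA hU f) n hc
    rw [← Ideal.map_pow] at h2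
    refine Submodule.span_induction (p := fun c _ => c • Tot.of M (le_refl (Y.basicOpen f)) i
      (res (M.obj i) (hf.trans hV') s) = 0) ?_ (zero_smul _ _)
      (fun a b _ _ ha hb => by rw [add_smul, ha, hb, add_zero])
      (fun a b _ hb => by rw [smul_assoc, hb, smul_zero]) h2
    rintro _ ⟨b, hb, rfl⟩
    rw [← Tot.resSemi_of M hV le_rfl, ← Tot.resSemi_smul, h b hb, map_zero]
  have h3 := h1 (A.resRing hf (A.incl V' d b))
    (Ideal.pow_right_mono (A.map_idealOf_le P hf) n (by
      rw [← Ideal.map_pow]; exact Ideal.mem_map_of_mem _ hb))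
  rw [A.resRing_incl, Tot.incl_smul_of M _ hk] at h3
  have h4 := Tot.of_injective M _ k (h3.trans (map_zero _).symm)
  rw [res_self] at h4
  rw [M.act_res, res_res, h4, map_zero]

/-- On affine opens, torsion is detected by powers of generators. -/
lemma mem_torsion_iff (hA : ∀ i, QCoh (A.gr i)) (hU : IsAffineOpen U) (G : A.Gens P U) (hV : V ≤ U)
    (hVa : IsAffineOpen V) (i : ℤ) (s : Γ(M.obj i, V)) :
    s ∈ GrMod.torsion P M i V ↔ ∀ j, ∃ n : ℕ, G.x j ^ n • Tot.of M hV i s = 0 := by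
  constructor
  · intro hs j
    suffices h : ∃ n : ℕ, ∀ y ∈ (V : Set Y), ∃ (W : Y.Opens) (hW : W ≤ V), y ∈ W ∧
        Tot.resTo M hV hW (hW.trans hV) (G.x j ^ n • Tot.of M hV i s) = 0 by
      obtain ⟨n, hn⟩ := h
      refine ⟨n, Tot.ext fun k => eq_of_locally fun y hy => ?_⟩
      obtain ⟨W, hW, hyW, h⟩ := hn y hy
      refine ⟨W, hW, hyW, ?_⟩
      rw [← Tot.comp_resTo M hV hW (hW.trans hV), h, map_zero, map_zero, map_zero]
    have mono : ∀ {n m : ℕ} (hnm : n ≤ m) {W : Y.Opens} (hW : W ≤ V),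
        Tot.resTo M hV hW (hW.trans hV) (G.x j ^ n • Tot.of M hV i s) = 0 →
        Tot.resTo M hV hW (hW.trans hV) (G.x j ^ m • Tot.of M hV i s) = 0 := by
      intro n m hnm W hW h
      obtain ⟨c, rfl⟩ := Nat.exists_eq_add_of_le hnm
      rw [pow_add, mul_comm, mul_smul, map_smul, h, smul_zero]
    -- In the definition of torsion the exponent varies from point to point; quasi-compactness of
    -- the affine open `V` makes it uniform.
    refine hVa.isCompact.induction_on (p := fun S => ∃ n : ℕ, ∀ y ∈ S, ∃ (W : Y.Opens) (hW : W ≤ V),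
      y ∈ W ∧ Tot.resTo M hV hW (hW.trans hV) (G.x j ^ n • Tot.of M hV i s) = 0)
      ⟨0, by simp⟩ ?_ ?_ ?_
    · rintro S T hST ⟨n, hn⟩
      exact ⟨n, fun y hy => hn y (hST hy)⟩
    · rintro S T ⟨n, hn⟩ ⟨m, hm⟩
      refine ⟨max n m, fun y hy => ?_⟩
      rcases hy with hy | hy
      · obtain ⟨W, hW, hyW, h⟩ := hn y hy
        exact ⟨W, hW, hyW, mono (le_max_left _ _) hW h⟩
      · obtain ⟨W, hW, hyW, h⟩ := hm y hy
        exact ⟨W, hW, hyW, mono (le_max_right _ _) hW h⟩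
    · intro y hy
      obtain ⟨W, hyW, hW, n, h⟩ := hs y hy
      refine ⟨W, mem_nhdsWithin_of_mem_nhds (W.isOpen.mem_nhds hyW), n, fun z hz =>
        ⟨W, hW, hz, ?_⟩⟩
      obtain ⟨b, hb⟩ := A.exists_incl_pow U (G.elt j) n
      have hb' : G.x j ^ n = A.incl U _ b := hb
      rw [hb', Tot.incl_smul_of M hV rfl, Tot.resTo_of, M.act_res, res_res]
      have := h W le_rfl _ _ rfl (res _ (hW.trans hV) b) (by
        rw [← A.resRing_incl, ← hb']
        refine Ideal.pow_right_mono (A.map_idealOf_le P (hW.trans hV)) n ?_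
        rw [← Ideal.map_pow]
        exact Ideal.mem_map_of_mem _ (Ideal.pow_mem_pow (G.x_mem j) n))
      rw [this, map_zero]
  · intro h
    obtain ⟨n, hn⟩ := G.exists_pow_le (I := LinearMap.ker
      (LinearMap.toSpanSingleton (A.ring U) _ (Tot.of M hV i s))) h
    exact mem_torsion_of_pow M hA hU hV i s n fun b hb => hn hb

/-- The functor of torsion sections preserves quasi-coherence. -/
lemma qcoh_torsionObj (hA : ∀ i, QCoh (A.gr i)) (hN : ∀ U : Y.Opens, IsAffineOpen U →
    IsNoetherianRing (A.ring U)) (hM : ∀ i, QCoh (M.obj i)) (P : ℤ → Prop) (i : ℤ) :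
    QCoh (GrMod.torsionObj P M i) := by
  intro U hU f
  have := hN U hU
  obtain ⟨G⟩ := A.exists_gens P U
  constructor
  · intro s hs
    change GrMod.torsion P M i U at s
    obtain ⟨n, hn⟩ := (hM i U hU f).1 s.1 (congrArg Subtype.val hs)
    exact ⟨n, Subtype.ext hn⟩
  · intro t
    change GrMod.torsion P M i (Y.basicOpen f) at t
    obtain ⟨n, s, hs⟩ := (hM i U hU f).2 t.1
    have ht := (mem_torsion_iff M hA hU G (Y.basicOpen_le f) (hU.basicOpen f) i t.1).1 t.2
    -- A relation `x_j ^ m • t = 0` over `D(f)` becomes `f ^ c • x_j ^ m • s = 0` over `U`. A common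
    -- exponent for `f` and `x_j` leaves only one maximum over the finitely many generators, after
    -- which `f ^ c • s` is torsion over all of `U`.
    have h1 : ∀ j, ∃ m : ℕ, A.scal U f ^ m • G.x j ^ m • Tot.of M (le_refl U) i s = 0 := by
      intro j
      obtain ⟨m, hm⟩ := ht j
      have h2 := Tot.isLocalizedModule_resTo (M := M) hU hM f
      obtain ⟨⟨_, c, rfl⟩, hc⟩ := (IsLocalizedModule.eq_zero_iff (.powers (A.scal U f))
        (Tot.resTo M (le_refl U) (Y.basicOpen_le f) (Y.basicOpen_le f))
          (m := G.x j ^ m • Tot.of M (le_refl U) i s)).1 (by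
        rw [map_smul, Tot.resTo_of, hs, ← Tot.scal_smul_of, smul_comm, hm, smul_zero])
      change A.scal U f ^ c • G.x j ^ m • Tot.of M (le_refl U) i s = 0 at hc
      refine ⟨c + m, ?_⟩
      have : A.scal U f ^ (c + m) • G.x j ^ (c + m) • Tot.of M (le_refl U) i s =
          (A.scal U f ^ m * G.x j ^ c) • A.scal U f ^ c • G.x j ^ m • Tot.of M (le_refl U) i s := by
        simp only [smul_smul]
        congr 1
        ring
      rw [this, hc, smul_zero]
    choose m hm using h1
    let c := Finset.univ.sup m
    refine ⟨c + n, (⟨f ^ c • s, (mem_torsion_iff M hA hU G le_rfl hU i _).2 fun j => ⟨m j, ?_⟩⟩ :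
      GrMod.torsion P M i U), Subtype.ext ?_⟩
    · obtain ⟨e, he⟩ := Nat.exists_eq_add_of_le (Finset.le_sup (f := m) (Finset.mem_univ j))
      have : f ^ c • s = resO Y le_rfl (f ^ c) • s := by rw [resO_self]
      rw [this, ← Tot.scal_smul_of, map_pow, smul_comm]
      change A.scal U f ^ (Finset.univ.sup m) • _ = 0
      rw [he, pow_add, mul_comm, mul_smul, hm, smul_zero]
    · change res (M.obj i) _ (f ^ c • s) = _ • t.1
      rw [res_smul, hs, smul_smul, ← map_mul, ← pow_add]

end torsion

end HomFlip

namespace HomFlip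

/-! ### The comparison map -/

section psi

open Pretriangulated CochainComplex

variable {Y : Scheme.{u}} {ω : CochainComplex Y.Modules ℤ} {A : GradedRingSheaf Y}

/-- Only the decomposition of the identity of `Z` is used. It therefore applies to the terms of a
mapping cone through their structure maps. -/
lemma qcoh_of_total {M N Z : Y.Modules} (hM : QCoh M) (hN : QCoh N) (fst : Z ⟶ M) (snd : Z ⟶ N)
    (inl : M ⟶ Z) (inr : N ⟶ Z) (h : fst ≫ inl + snd ≫ inr = 𝟙 Z) : QCoh Z := by
  intro U hU g
  have htot : ∀ (V : Y.Opens) x, sec inl V (sec fst V x) + sec inr V (sec snd V x) = x :=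
    fun V x => congrArg (fun g : Z ⟶ Z => sec g V x) h
  constructor
  · intro s hs
    obtain ⟨n1, h1⟩ := (hM U hU g).1 (sec fst U s) (by rw [← sec_res, hs, map_zero])
    obtain ⟨n2, h2⟩ := (hN U hU g).1 (sec snd U s) (by rw [← sec_res, hs, map_zero])
    refine ⟨n1 + n2, ?_⟩
    rw [← htot U (g ^ (n1 + n2) • s), map_smul (sec fst U), map_smul (sec snd U), pow_add,
      mul_smul, mul_smul, h2, smul_comm, h1, smul_zero, smul_zero, map_zero, map_zero, add_zero]
  · intro t
    obtain ⟨n1, s1, h1⟩ := (hM U hU g).2 (sec fst _ t)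
    obtain ⟨n2, s2, h2⟩ := (hN U hU g).2 (sec snd _ t)
    refine ⟨n1 + n2, sec inl U (g ^ n2 • s1) + sec inr U (g ^ n1 • s2), ?_⟩
    rw [map_add, ← sec_res, ← sec_res, res_smul, res_smul, h1, h2, smul_smul, smul_smul,
      ← map_mul, ← map_mul, ← pow_add, ← pow_add, add_comm n2 n1, map_smul, map_smul, ← smul_add,
      htot]

lemma qcoh_mappingCone {K L : CochainComplex (GrMod A) ℤ} (f : K ⟶ L) (n i : ℤ)
    (hK : ∀ n i, QCoh ((K.X n).obj i)) (hL : ∀ n i, QCoh ((L.X n).obj i)) :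
    QCoh (((mappingCone f).X n).obj i) :=
  qcoh_of_total (hK (n + 1) i) (hL n i)
    (GrMod.Hom.app ((mappingCone.fst f).1.v n (n + 1) rfl) i)
    (GrMod.Hom.app ((mappingCone.snd f).v n n (add_zero n)) i)
    (GrMod.Hom.app ((mappingCone.inl f).v (n + 1) n (by omega)) i)
    (GrMod.Hom.app ((mappingCone.inr f).f n) i)
    (congrArg (fun g : (mappingCone f).X n ⟶ (mappingCone f).X n => g.app i)
      (mappingCone.id_X f n (n + 1) rfl))

attribute [local instance] HasDerivedCategory.standard

lemma isZero_DWeight_iff (i : ℤ) (K : CochainComplex (GrMod A) ℤ) :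
    IsZero ((DWeight A i).obj ((DGr.Q A).obj K)) ↔ ((weightComplex A i).obj K).Acyclic := by
  have e := (QCompDWeightIso A i).app K
  refine e.isZero_iff.trans ?_
  have h0 : IsZero (DerivedCategory.Q.obj (0 : CochainComplex Y.Modules ℤ)) :=
    DerivedCategory.Q.map_isZero (isZero_zero _)
  have h1 : IsIso (DerivedCategory.Q.map (0 : (weightComplex A i).obj K ⟶ 0)) ↔
      IsZero (DerivedCategory.Q.obj ((weightComplex A i).obj K)) :=
    ⟨fun h => h0.of_iso (asIso (DerivedCategory.Q.map (0 : (weightComplex A i).obj K ⟶ 0))),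
      fun h => ⟨0, h.eq_of_src _ _, h0.eq_of_src _ _⟩⟩
  refine h1.symm.trans ((DerivedCategory.isIso_Q_map_iff_quasiIso Y.Modules _).trans ?_)
  rw [quasiIso_iff]
  exact forall_congr' fun n => quasiIsoAt_iff_exactAt' _ n
    (HomologicalComplex.ExactAt.of_isZero ((HomologicalComplex.eval _ _ n).map_isZero (isZero_zero _)))

lemma isZero_of_isZero_DWeight (Z : DGr A) (h : ∀ i, IsZero ((DWeight A i).obj Z)) : IsZero Z := by
  have : IsIso (0 : Z ⟶ 0) := isIso_of_isIso_DWeight A _ fun i =>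
    ⟨0, (h i).eq_of_src _ _, (Functor.map_isZero (DWeight A i) (isZero_zero _)).eq_of_src _ _⟩
  exact (isZero_zero _).of_iso (asIso (0 : Z ⟶ 0))

/-- The dual of a quasi-isomorphism of complexes with quasi-coherent terms is an isomorphism in
the derived category. -/
lemma isIso_Q_dualMap (hω : IsDualizingComplex ω) {K L : CochainComplex (GrMod A) ℤ} (f : K ⟶ L)
    (hf : grQuasiIso A f)
    (hK : ∀ n i, QCoh ((K.X n).obj i)) (hL : ∀ n i, QCoh ((L.X n).obj i)) :
    IsIso ((DGr.Q A).map (dualMap ω f)) := by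
  obtain ⟨h, hT⟩ := exists_dual_distinguished ω f
  refine (Triangle.isZero₁_iff_isIso₂ _ hT).1 (isZero_of_isZero_DWeight _ fun i => ?_)
  refine (isZero_DWeight_iff i _).2 (dual_acyclic ω hω _ i
    (fun p => qcoh_mappingCone f p _ hK hL) ((isZero_DWeight_iff (-i) _).1 ?_))
  exact (Triangle.isZero₃_iff_isIso₁ _
    ((DWeight A (-i)).map_distinguished _ (Q_mappingCone_triangle_distinguished A f))).2
    ((isIso_DWeight_Q_map_iff A (-i) f).2 (hf (-i)))

lemma Q_twist_distinguished (a : ℤ) {K L : CochainComplex (GrMod A) ℤ} (f : K ⟶ L) :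
    ∃ h, Triangle.mk ((DGr.Q A).map ((twistComplex A a).map f))
      ((DGr.Q A).map ((twistComplex A a).map (mappingCone.inr f))) h ∈ distTriang (DGr A) := by
  have h1 := Q_mappingCone_triangle_distinguished A ((twistComplex A a).map f)
  exact ⟨_, isomorphic_distinguished _ h1 _
    ((DGr.Q A).mapTriangle.mapIso (mappingCone.mapTriangleIso f (GrMod.twist A a)))⟩

lemma qcoh_single (hA : ∀ i, QCoh (A.gr i)) (n i : ℤ) :
    QCoh ((((CochainComplex.singleFunctor (GrMod A) 0).obj A.self).X n).obj i) := by
  by_cases hn : n = 0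
  · subst hn
    exact hA i
  · have h : IsZero ((((CochainComplex.singleFunctor (GrMod A) 0).obj A.self).X n).obj i) :=
      (GrMod.weight A i).map_isZero (HomologicalComplex.isZero_single_obj_X _ _ _ _ hn)
    have h0 : ∀ V (x : Γ((((CochainComplex.singleFunctor (GrMod A) 0).obj A.self).X n).obj i, V)),
        x = 0 := fun V x => by
      rw [← sec_id x, h.eq_of_src (𝟙 _) 0]; rfl
    exact fun U hU f => ⟨fun s _ => ⟨0, (h0 _ _)⟩, fun t => ⟨0, 0, (h0 _ _).trans (h0 _ _).symm⟩⟩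

variable {J : InjRes A}

lemma InjRes.qcoh (n i : ℤ) : QCoh ((J.J.X n).obj i) :=
  qcoh_of_isQuasicoherent _ (J.quasicoherent n i)

lemma GradedRingSheaf.IsNoetherianOver.qcoh (hA : A.IsNoetherianOver) (i : ℤ) : QCoh (A.gr i) :=
  qcoh_of_isQuasicoherent _ (hA.quasicoherent i)

lemma InjRes.qcoh_RΓ (hA : A.IsNoetherianOver) (P : ℤ → Prop) (n i : ℤ) :
    QCoh (((J.RΓ P).X n).obj i) :=
  qcoh_torsionObj (J.J.X n) hA.qcoh (fun U hU => hA.noetherian ⟨U, hU⟩) (fun i => J.qcoh n i) P i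

/-- The inclusion of the resolution in the Čech complex. -/
noncomputable def InjRes.inr (J : InjRes A) (P : ℤ → Prop) : J.J ⟶ J.Cech P :=
  mappingCone.inr (J.ε P)

/-- The compatibility of `Φ⁺` and `Φ⁻` is stated on `𝒜`, whereas the triangles involve its
resolution `J`. The isomorphism induced by `𝒜 → J` and its dual have to be cancelled at the two
ends. -/
lemma cancel_square {C : Type*} [Category C] {X X' Z Z' S S' T T' : C} {e : X ⟶ X'} {f : T ⟶ T'}
    [IsIso e] [IsIso f] (p : X' ⟶ S) (φ : S ⟶ Z) (d : Z ⟶ T) (p' : X' ⟶ S') (φ' : S' ⟶ Z')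
    (d' : Z' ⟶ T) (h : (e ≫ p) ≫ φ ≫ d ≫ f = (e ≫ p') ≫ φ' ≫ d' ≫ f) :
    p ≫ φ ≫ d = p' ≫ φ' ≫ d' := by
  rw [← cancel_epi e, ← cancel_mono f]
  simpa only [Category.assoc] using h

/-- The comparison map, on the shifted object of the derived category. -/
lemma exists_comparison (hω : IsDualizingComplex ω) (hA : A.IsNoetherianOver)
    (H : HomologicalFlipFlop ω J) (hv : H.CanonicalVanishing) :
    ∃ Ψ : ((DGr.Q A).obj ((twistComplex A H.a).obj J.RΓplus))⟦(1 : ℤ)⟧ ⟶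
        (DGr.Q A).obj (dual ω J.RΓminus),
      ∀ i : ℤ, ¬ (-H.a < i ∧ i < 0) → IsIso ((DWeight A i).map Ψ) := by
  have hΦp := H.isIso_Φplus
  have hΦm := H.isIso_Φminus
  obtain ⟨hp, hTp⟩ : ∃ h, Triangle.mk ((DGr.Q A).map ((twistComplex A H.a).map (J.ε (0 < ·))))
      ((DGr.Q A).map ((twistComplex A H.a).map (J.inr (0 < ·)))) h ∈ distTriang (DGr A) :=
    Q_twist_distinguished H.a (J.ε (0 < ·))
  obtain ⟨hm, hTm⟩ : ∃ h, Triangle.mk ((DGr.Q A).map ((twistComplex A H.a).map (J.ε (· < 0))))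
      ((DGr.Q A).map ((twistComplex A H.a).map (J.inr (· < 0)))) h ∈ distTriang (DGr A) :=
    Q_twist_distinguished H.a (J.ε (· < 0))
  obtain ⟨hp', hTp'⟩ : ∃ h, Triangle.mk ((DGr.Q A).map (dualMap ω (J.inr (0 < ·))))
      ((DGr.Q A).map (dualMap ω (J.ε (0 < ·)))) h ∈ distTriang (DGr A) :=
    exists_dual_distinguished ω (J.ε (0 < ·))
  obtain ⟨hm', hTm'⟩ : ∃ h, Triangle.mk ((DGr.Q A).map (dualMap ω (J.inr (· < 0))))
      ((DGr.Q A).map (dualMap ω (J.ε (· < 0)))) h ∈ distTriang (DGr A) :=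
    exists_dual_distinguished ω (J.ε (· < 0))
  have hι : IsIso ((DGr.Q A).map (dualMap ω J.ι)) := isIso_Q_dualMap hω J.ι J.quasiIso
    (qcoh_single hA.qcoh) (fun n i => J.qcoh n i)
  have hι' : IsIso ((DGr.Q A).map ((twistComplex A H.a).map J.ι)) :=
    Localization.inverts (DGr.Q A) (grQuasiIso A) _ fun i => J.quasiIso (i + H.a)
  -- `u : J(a) → Č⁻(a) ≅ 𝔻(Č⁻)` and `v : Č⁺(a) ≅ 𝔻(Č⁺) → 𝔻(J)`. The square `hsq` which they form is
  -- the compatibility condition of the flip.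
  let u := (DGr.Q A).map ((twistComplex A H.a).map (J.inr (· < 0))) ≫ H.Φminus
  let v := H.Φplus ≫ (DGr.Q A).map (dualMap ω (J.inr (0 < ·)))
  have hsq : (DGr.Q A).map ((twistComplex A H.a).map (J.inr (0 < ·))) ≫ v =
      u ≫ (DGr.Q A).map (dualMap ω (J.inr (· < 0))) := by
    change _ ≫ H.Φplus ≫ (DGr.Q A).map (dualMap ω (J.inr (0 < ·))) =
      ((DGr.Q A).map ((twistComplex A H.a).map (J.inr (· < 0))) ≫ H.Φminus) ≫ _
    rw [Category.assoc]
    refine cancel_square (e := (DGr.Q A).map ((twistComplex A H.a).map J.ι))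
      (f := (DGr.Q A).map (dualMap ω J.ι)) _ _ _ _ _ _ ?_
    have e1 : ∀ P : ℤ → Prop, (DGr.Q A).map ((twistComplex A H.a).map (J.η P)) =
        (DGr.Q A).map ((twistComplex A H.a).map J.ι) ≫
          (DGr.Q A).map ((twistComplex A H.a).map (J.inr P)) := fun P =>
      (twistComplex A H.a ⋙ DGr.Q A).map_comp J.ι (J.inr P)
    have e2 : ∀ P : ℤ → Prop, (DGr.Q A).map (dualMap ω (J.η P)) =
        (DGr.Q A).map (dualMap ω (J.inr P)) ≫ (DGr.Q A).map (dualMap ω J.ι) :=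
      fun P => (DGr.Q A).map_comp (dualMap ω (J.inr P)) (dualMap ω J.ι)
    exact (congrArg₂ (fun x y => x ≫ H.Φplus ≫ y) (e1 _) (e2 _)).symm.trans (H.compatible.trans
      (congrArg₂ (fun x y => x ≫ H.Φminus ≫ y) (e1 _) (e2 _)))
  let T1 := (Triangle.mk ((DGr.Q A).map ((twistComplex A H.a).map (J.ε (0 < ·))))
      ((DGr.Q A).map ((twistComplex A H.a).map (J.inr (0 < ·)))) hp).rotate
  let T2 := Triangle.mk ((DGr.Q A).map (dualMap ω (J.inr (· < 0))))
      ((DGr.Q A).map (dualMap ω (J.ε (· < 0)))) hm'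
  have hT1 : T1 ∈ distTriang (DGr A) := rot_of_distTriang _ hTp
  -- The triangles are `T1 : J(a) → Č⁺(a) → RΓ⁺(a)[1]` and `T2 : 𝔻(Č⁻) → 𝔻(J) → 𝔻(RΓ⁻)`.
  obtain ⟨Ψ, hΨ1, hΨ2⟩ := complete_distinguished_triangle_morphism T1 T2 hT1 hTm' u v hsq
  refine ⟨Ψ, fun i hi => ?_⟩
  have ha := H.a_nonneg
  rw [not_and_or, not_lt, not_lt] at hi
  rcases hi with hi | hi
  -- Weights `i ≤ -a`. The obstruction to `u` being invertible is `RΓ⁻` in weight `i + a ≤ 0 ≤ a`,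
  -- and the obstruction for `v` is the dual of `RΓ⁺` in weight `-i ≥ a`. Both vanish.
  · let F : T1 ⟶ T2 := ⟨u, v, Ψ, hsq, hΨ1, hΨ2⟩
    have h1 : IsIso ((DWeight A i).map u) := by
      have h2 : IsIso ((DWeight A i).map ((DGr.Q A).map ((twistComplex A H.a).map
          (J.inr (· < 0))))) := by
        refine (Triangle.isZero₁_iff_isIso₂ _ ((DWeight A i).map_distinguished _ hTm)).1 ?_
        exact (isZero_DWeight_iff i _).2 (hv.minus (i + H.a) (by omega))
      have h3 : IsIso ((DWeight A i).map H.Φminus) := inferInstance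
      rw [Functor.map_comp]
      infer_instance
    have h2 : IsIso ((DWeight A i).map v) := by
      have h2 : IsIso ((DWeight A i).map ((DGr.Q A).map (dualMap ω
          (J.inr (0 < ·))))) := by
        refine (Triangle.isZero₃_iff_isIso₁ _ ((DWeight A i).map_distinguished _ hTp')).1 ?_
        exact (isZero_DWeight_iff i _).2 (dual_acyclic ω hω _ i
          (fun p => J.qcoh_RΓ hA _ p _) (hv.plus (-i) (by omega)))
      have h3 : IsIso ((DWeight A i).map H.Φplus) := inferInstance
      rw [Functor.map_comp]
      infer_instance
    exact isIso₃_of_isIso₁₂ ((DWeight A i).mapTriangle.map F)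
      ((DWeight A i).map_distinguished _ hT1) ((DWeight A i).map_distinguished _ hTm') h1 h2
  -- Weights `i ≥ 0`. The source is `RΓ⁺[1]` in weight `i + a ≥ a`, the target is the dual of `RΓ⁻`
  -- in weight `-i ≤ 0 ≤ a`; both are zero.
  · have h1 : IsZero ((DWeight A i).obj T1.obj₃) := by
      have h0 : IsZero ((DWeight A i).obj ((DGr.Q A).obj ((twistComplex A H.a).obj J.RΓplus))) :=
        (isZero_DWeight_iff i _).2 (hv.plus (i + H.a) (by omega))
      exact ((CategoryTheory.shiftFunctor _ (1 : ℤ)).map_isZero h0).of_iso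
        (((DWeight A i).commShiftIso (1 : ℤ)).app _)
    have h2 : IsZero ((DWeight A i).obj T2.obj₃) :=
      (isZero_DWeight_iff i _).2 (dual_acyclic ω hω _ i
          (fun p => J.qcoh_RΓ hA _ p _) (hv.minus (-i) (by omega)))
    exact ⟨0, h1.eq_of_src _ _, h2.eq_of_src _ _⟩

end psi

end HomFlip

namespace HomFlip

/-! ### Division inside the torsion of injective modules -/

section torsionLift

/-- Torsion elements with respect to a finite family can, up to a power of `y`, be divided by `y`
within the torsion elements. -/
def HasTorsionLift (C N : Type*) [CommRing C] [AddCommGroup N] [Module C N] : Prop :=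
  ∀ (k : ℕ) (x : Fin k → C) (y : C) (e : N), (∀ j, ∃ n : ℕ, x j ^ n • e = 0) →
    ∃ (e' : N) (m : ℕ), (∀ j, ∃ n : ℕ, x j ^ n • e' = 0) ∧ y ^ (m + 1) • e' = y ^ m • e

lemma pow_smul_of_le {C N : Type*} [CommRing C] [AddCommGroup N] [Module C N] {x : C} {e : N}
    {n m : ℕ} (h : x ^ n • e = 0) (hnm : n ≤ m) : x ^ m • e = 0 := by
  obtain ⟨c, rfl⟩ := Nat.exists_eq_add_of_le hnm
  rw [pow_add, mul_comm, mul_smul, h, smul_zero]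

lemma exists_uniform_pow {C N : Type*} [CommRing C] [AddCommGroup N] [Module C N] {k : ℕ}
    {x : Fin k → C} {e : N} (h : ∀ j, ∃ n : ℕ, x j ^ n • e = 0) : ∃ n : ℕ, ∀ j, x j ^ n • e = 0 := by
  choose n hn using h
  exact ⟨Finset.univ.sup n, fun j => pow_smul_of_le (hn j) (Finset.le_sup (Finset.mem_univ j))⟩

/-- Let `c` be the ideal generated by powers of the `x_j` that kill `e`. The chain of ideals `(c : y
^ m)` stabilizes, so for large `m` everything in `C ⧸ c` killed by `y ^ (m + 1)` is also killed by
the map `1 ↦ y ^ m • e`. By injectivity this map factors through multiplication by `y ^ (m + 1)` on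
`C ⧸ c`; the value of the factorization at `1` is the required `e'`, which is killed by `c`. -/
lemma hasTorsionLift_of_injective (C N : Type u) [CommRing C] [IsNoetherianRing C]
    [AddCommGroup N] [Module C N] [Module.Injective C N] : HasTorsionLift C N := by
  intro k x y e he
  obtain ⟨n, hn⟩ := exists_uniform_pow he
  let c : Ideal C := Ideal.span (Set.range fun j => x j ^ n)
  have hc : ∀ b ∈ c, b • e = 0 := fun b hb => by
    refine Submodule.span_induction (p := fun b _ => b • e = 0) ?_ (zero_smul _ _)
      (fun a b _ _ ha hb => by rw [add_smul, ha, hb, add_zero])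
      (fun a b _ hb => by rw [smul_assoc, hb, smul_zero]) hb
    rintro _ ⟨j, rfl⟩
    exact hn j
  let F : ℕ →o Ideal C :=
    { toFun := fun m => Submodule.comap (LinearMap.mulLeft C (y ^ m)) c
      monotone' := monotone_nat_of_le_succ fun m b hb => by
        change y ^ (m + 1) * b ∈ c
        rw [pow_succ', mul_assoc]
        exact c.mul_mem_left _ hb }
  obtain ⟨m, hm⟩ := monotone_stabilizes_iff_noetherian.2 ‹IsNoetherianRing C› F
  let ψ : C ⧸ c →ₗ[C] N := c.liftQ (LinearMap.toSpanSingleton C N (y ^ m • e)) fun b hb => by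
    rw [LinearMap.mem_ker, LinearMap.toSpanSingleton_apply, smul_comm, hc b hb, smul_zero]
  let f : C ⧸ c →ₗ[C] C ⧸ c := LinearMap.lsmul C (C ⧸ c) (y ^ (m + 1))
  have hf : LinearMap.ker f ≤ LinearMap.ker ψ := by
    intro b hb
    obtain ⟨b, rfl⟩ := Submodule.Quotient.mk_surjective c b
    have h1 : y ^ (m + 1) * b ∈ c := (Submodule.Quotient.mk_eq_zero c).1 hb
    have h2 : b ∈ F m := by
      rw [hm (m + 1) (Nat.le_succ m)]
      exact h1
    have h3 : (y ^ m * b) • e = 0 := hc _ h2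
    rw [LinearMap.mem_ker]
    change b • y ^ m • e = 0
    rw [smul_smul, mul_comm, h3]
  obtain ⟨h, hh⟩ := Module.Injective.out (R := C) (Q := N) ((LinearMap.ker f).liftQ f le_rfl)
    (LinearMap.ker_eq_bot.1 (Submodule.ker_liftQ_eq_bot _ _ _ le_rfl))
    ((LinearMap.ker f).liftQ ψ hf)
  have hh' : ∀ b, h (f b) = ψ b := fun b => hh (Submodule.Quotient.mk b)
  refine ⟨h (Submodule.Quotient.mk 1), m, fun j => ⟨n, ?_⟩, ?_⟩
  · rw [← map_smul, ← Submodule.Quotient.mk_smul, (Submodule.Quotient.mk_eq_zero c).2, map_zero]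
    rw [smul_eq_mul, mul_one]
    exact Ideal.subset_span ⟨j, rfl⟩
  · rw [← map_smul]
    refine (hh' _).trans ?_
    change (1 : C) • y ^ m • e = _
    rw [one_smul]

variable {X : Scheme.{u}} {M : X.Modules}

lemma exists_common_resO {W : X.Opens} (hW : IsAffineOpen W) (f : Γ(X, W)) {k : ℕ}
    (x : Fin k → Γ(X, X.basicOpen f)) : ∃ (n : ℕ) (s : Fin k → Γ(X, W)), ∀ j,
      resO X (X.basicOpen_le f) (s j) = resO X (X.basicOpen_le f) (f ^ n) * x j := by
  choose n s hs using fun j => exists_resO_eq hW f (x j)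
  refine ⟨Finset.univ.sup n, fun j => f ^ (Finset.univ.sup n - n j) * s j, fun j => ?_⟩
  rw [map_mul, hs, ← mul_assoc, ← map_mul, ← pow_add,
    Nat.sub_add_cancel (Finset.le_sup (Finset.mem_univ j))]

/-- The division property passes to affine open subsets. -/
lemma hasTorsionLift_affine (hM : QCoh M) {W V : X.Opens} (hW : IsAffineOpen W)
    (h : HasTorsionLift Γ(X, W) Γ(M, W)) (hV : IsAffineOpen V) (hVW : V ≤ W) :
    HasTorsionLift Γ(X, V) Γ(M, V) := by
  intro k x y e he
  -- The functions `r` for which `r • e` can be divided in the required sense.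
  let I : Ideal Γ(X, V) :=
    { carrier := {r | ∃ (e' : Γ(M, V)) (m : ℕ), (∀ j, ∃ n : ℕ, x j ^ n • e' = 0) ∧
        y ^ (m + 1) • e' = y ^ m • r • e}
      zero_mem' := ⟨0, 0, fun j => ⟨0, smul_zero _⟩, by simp⟩
      add_mem' := by
        rintro r r' ⟨e1, m1, h1, h1'⟩ ⟨e2, m2, h2, h2'⟩
        refine ⟨e1 + e2, m1 + m2, fun j => ?_, ?_⟩
        · obtain ⟨n1, hn1⟩ := h1 j
          obtain ⟨n2, hn2⟩ := h2 j
          exact ⟨n1 + n2, by rw [smul_add, pow_smul_of_le hn1 (Nat.le_add_right _ _),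
            pow_smul_of_le hn2 (Nat.le_add_left _ _), add_zero]⟩
        · have e1' : y ^ (m1 + m2 + 1) • e1 = y ^ (m1 + m2) • r • e := by
            rw [show m1 + m2 + 1 = m2 + (m1 + 1) by omega, pow_add, mul_smul, h1', ← mul_smul,
              ← pow_add, add_comm m2]
          have e2' : y ^ (m1 + m2 + 1) • e2 = y ^ (m1 + m2) • r' • e := by
            rw [show m1 + m2 + 1 = m1 + (m2 + 1) by omega, pow_add, mul_smul, h2', ← mul_smul,
              ← pow_add]
          rw [smul_add, e1', e2', add_smul, smul_add]
      smul_mem' := by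
        rintro c r ⟨e1, m1, h1, h1'⟩
        refine ⟨c • e1, m1, fun j => ?_, ?_⟩
        · obtain ⟨n1, hn1⟩ := h1 j
          exact ⟨n1, by rw [smul_comm, hn1, smul_zero]⟩
        · rw [smul_comm, h1', smul_comm, smul_assoc] }
  suffices hI : I = ⊤ by
    obtain ⟨e', m, h1, h2⟩ := (Ideal.eq_top_iff_one I).1 hI
    exact ⟨e', m, h1, by rw [h2, one_smul]⟩
  refine ideal_eq_top_of_locally hV I fun z hz => ?_
  -- Over a basic open `D(c)` of `W` contained in `V`, the elements `x_j`, `y` and `e` come from `W`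
  -- after multiplication by powers of `c`. The division is made over `W`, restricted to `D(c)`, and
  -- extended to `V` after multiplying by a power of the restriction `c'` of `c`.
  obtain ⟨c, hcV, hzc⟩ := exists_basicOpen hW hz (hVW hz)
  have hcW := X.basicOpen_le c
  obtain ⟨n, hn⟩ := exists_uniform_pow he
  obtain ⟨a, xs, hxs⟩ := exists_common_resO hW c (fun j : Fin k => resO X hcV (x j))
  obtain ⟨a', ys, hys⟩ := exists_resO_eq hW c (resO X hcV y)
  obtain ⟨a'', es, hes⟩ := (hM W hW c).2 (res M hcV e)
  have hb : ∀ j, ∃ b : ℕ, c ^ b • xs j ^ n • es = 0 := fun j => by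
    refine (hM W hW c).1 _ ?_
    rw [res_smul, map_pow, hxs, hes, mul_pow, smul_smul, ← map_pow, ← map_pow, mul_comm, ← mul_assoc,
      mul_smul, ← res_smul, hn, map_zero, smul_zero]
  choose b hb using hb
  let b' := Finset.univ.sup b
  obtain ⟨e1, m, h1, h2⟩ := h k xs ys (c ^ b' • es) fun j => ⟨n, by
    rw [smul_comm]; exact pow_smul_of_le (e := xs j ^ n • es)
      (hb j) (Finset.le_sup (Finset.mem_univ j))⟩
  obtain ⟨n1, hn1⟩ := exists_uniform_pow h1
  let c' := resO X hVW c
  have hD : X.basicOpen c' ≤ X.basicOpen c := by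
    refine (X.basicOpen_res c (homOfLE hVW).op).le.trans inf_le_right
  have hDV := X.basicOpen_le c'
  have hDc : resO X hDV c' = resO X (hD.trans hcW) c := resO_resO _ _ _
  have hu : IsUnit (resO X (hD.trans hcW) c) := hDc ▸ isUnit_resO c' le_rfl
  let u : Γ(X, X.basicOpen c') := resO X (hD.trans hcW) c
  have hx' : ∀ j, resO X (hD.trans hcW) (xs j) = u ^ a * resO X hDV (x j) := fun j => by
    have := congrArg (resO X hD) (hxs j)
    rwa [map_mul, resO_resO, resO_resO, resO_resO, map_pow] at this
  have hy' : resO X (hD.trans hcW) ys = u ^ a' * resO X hDV y := by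
    have := congrArg (resO X hD) hys
    rwa [map_mul, resO_resO, resO_resO, resO_resO, map_pow] at this
  have he' : res M (hD.trans hcW) es = u ^ a'' • res M hDV e := by
    have := congrArg (res M hD) hes
    rwa [res_smul, res_res, res_res, resO_resO, map_pow] at this
  let e1' := res M (hD.trans hcW) e1
  have hcancel : ∀ (l : ℕ) (s : Γ(M, X.basicOpen c')), u ^ l • s = 0 → s = 0 := fun l s hs =>
    (hu.pow l).smul_eq_zero.1 hs
  have h1' : ∀ j, resO X hDV (x j) ^ n1 • e1' = 0 := fun j => by
    have := congrArg (res M (hD.trans hcW)) (hn1 j)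
    rw [res_smul, map_pow, hx', map_zero, mul_pow, mul_smul, ← pow_mul] at this
    exact hcancel _ _ this
  have h2' : u ^ a' • resO X hDV y ^ (m + 1) • e1' =
      u ^ (b' + a'') • resO X hDV y ^ m • res M hDV e := by
    have := congrArg (res M (hD.trans hcW)) h2
    simp only [res_smul, map_pow, hy', he'] at this
    rw [← sub_eq_zero] at this ⊢
    refine hcancel (a' * m) _ ?_
    rw [← this]
    simp only [smul_sub, smul_smul, e1', u]
    congr 2 <;> ring
  obtain ⟨N, e3, he3⟩ := (hM V hV c').2 (u ^ a' • e1')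
  have he3' : res M hDV e3 = u ^ (N + a') • e1' := by
    rw [he3, map_pow, hDc, smul_smul, pow_add]
  have hk1 : ∀ j, ∃ l : ℕ, c' ^ l • x j ^ n1 • e3 = 0 := fun j => (hM V hV c').1 _ (by
    rw [res_smul, map_pow, he3', smul_comm, h1', smul_zero])
  have hk2 : ∃ l : ℕ, c' ^ l • (y ^ (m + 1) • e3 - y ^ m • c' ^ (N + b' + a'') • e) = 0 :=
    (hM V hV c').1 _ (by
      rw [map_sub, sub_eq_zero]
      simp only [res_smul, map_pow, he3', hDc]
      have := congrArg (fun s => u ^ N • s) h2'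
      simp only [smul_smul] at this ⊢
      convert this using 2 <;> ring)
  choose l1 hl1 using hk1
  obtain ⟨l2, hl2⟩ := hk2
  let l := l2 + Finset.univ.sup l1
  have hr : c' ^ (l + (N + b' + a'')) ∈ I := by
    refine ⟨c' ^ l • e3, m, fun j => ⟨n1, ?_⟩, ?_⟩
    · rw [smul_comm]
      exact pow_smul_of_le (hl1 j)
        ((Finset.le_sup (Finset.mem_univ j)).trans (Nat.le_add_left _ _))
    · have := pow_smul_of_le hl2 (Nat.le_add_right l2 (Finset.univ.sup l1))
      rw [smul_sub, sub_eq_zero] at this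
      rw [smul_comm, this]
      simp only [smul_smul]
      congr 1
      ring
  refine ⟨_, I.mul_mem_left c' hr, ?_⟩
  rw [← pow_succ', X.basicOpen_pow _ (Nat.succ_pos _)]
  exact (X.basicOpen_res c (homOfLE hVW).op).ge ⟨hz, hzc⟩

end torsionLift

end HomFlip

namespace HomFlip

/-! ### Maps into direct images from an affine open -/

section extendHom

variable {Y : Scheme.{u}} {W : Y.Opens}

/-- `Z` is the direct image of its restriction to `W`. -/
def IsDirectImageFrom (Z : Y.Modules) (W : Y.Opens) : Prop :=
  ∀ V : Y.Opens, Function.Bijective (res Z (inf_le_left : V ⊓ W ≤ V))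

/-- Sections of `Z` over `V` are the same as sections over `V ⊓ W`, so it is enough to define the
map below `W`, where `homSecExtend` provides it. -/
lemma exists_extendHom {F Z : Y.Modules} (hW : IsAffineOpen W) (hF : LocalizesAt F W)
    (hZ : IsDirectImageFrom Z W) (g : Γ(F, W) →ₗ[Γ(Y, W)] Γ(Z, W)) :
    ∃ φ : F ⟶ Z, ∀ x, sec φ W x = g x := by
  let ψ : HomSec (fun _ : Unit => F) (fun _ => Z) W := homSecExtend hW (fun _ => hF) fun _ => g
  have hψ : ∀ V x, ∃ z : Γ(Z, V), res Z (inf_le_left : V ⊓ W ≤ V) z =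
      ψ.app () (V ⊓ W) inf_le_right (res F inf_le_left x) := fun V x => (hZ V).2 _
  choose G hG using hψ
  let φ : F ⟶ Z := mkHom
    (fun V =>
      { toFun := G V
        map_add' := fun x y => (hZ V).1 (by
          rw [map_add, hG, hG, hG, map_add, map_add])
        map_smul' := fun c x => (hZ V).1 (by
          rw [RingHom.id_apply, res_smul, hG, hG, res_smul, map_smul]) })
    (fun {V V'} h x => (hZ V').1 (by
      change res Z _ (G V' (res F h x)) = res Z _ (res Z h (G V x))
      rw [hG, res_res, res_res]
      have h1 : V' ⊓ W ≤ V ⊓ W := inf_le_inf_right W h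
      have := congrArg (res Z h1) (hG V x)
      rw [res_res] at this
      rw [this]
      exact (congrArg _ (res_res _ h1 x).symm).trans (ψ.app_res () inf_le_right h1 _)))
  refine ⟨φ, fun x => (hZ W).1 ?_⟩
  refine (hG W x).trans ?_
  refine (ψ.app_res () le_rfl inf_le_left x).trans ?_
  exact congrArg _ (homSecExtend_app hW (fun _ => hF) (fun _ => g) () x)

/-- Because `Z₃` is a direct image from `W`, the identity may be checked on basic opens of `W`.
There both arguments come from `W` up to invertible factors, which are cancelled by bilinearity. -/
lemma bilin_ext {F₁ F₂ F₃ Z₁ Z₂ Z₃ : Y.Modules} (α : F₁ ⟶ Z₁) (β : F₂ ⟶ Z₂) (γ : F₃ ⟶ Z₃)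
    (m : ∀ V : Y.Opens, Γ(F₁, V) →ₗ[Γ(Y, V)] Γ(F₂, V) →ₗ[Γ(Y, V)] Γ(F₃, V))
    (m' : ∀ V : Y.Opens, Γ(Z₁, V) →ₗ[Γ(Y, V)] Γ(Z₂, V) →ₗ[Γ(Y, V)] Γ(Z₃, V))
    (hm : ∀ {V V' : Y.Opens} (h : V' ≤ V) a b, res F₃ h (m V a b) = m V' (res F₁ h a) (res F₂ h b))
    (hm' : ∀ {V V' : Y.Opens} (h : V' ≤ V) a b,
      res Z₃ h (m' V a b) = m' V' (res Z₁ h a) (res Z₂ h b))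
    (hW : IsAffineOpen W) (h₁ : LocalizesAt F₁ W) (h₂ : LocalizesAt F₂ W)
    (hZ : IsDirectImageFrom Z₃ W)
    (h : ∀ a b, sec γ W (m W a b) = m' W (sec α W a) (sec β W b)) (V : Y.Opens)
    (a : Γ(F₁, V)) (b : Γ(F₂, V)) : sec γ V (m V a b) = m' V (sec α V a) (sec β V b) := by
  refine (hZ V).1 (eq_of_locally fun y hy => ?_)
  obtain ⟨g, hg, hyg⟩ := exists_basicOpen hW hy hy.2
  refine ⟨Y.basicOpen g, hg, hyg, ?_⟩
  have hV : Y.basicOpen g ≤ V := hg.trans inf_le_left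
  rw [res_res, res_res, ← sec_res, hm, hm', ← sec_res, ← sec_res]
  obtain ⟨n, a', ha⟩ := (h₁ g).2 (res F₁ hV a)
  obtain ⟨k, b', hb⟩ := (h₂ g).2 (res F₂ hV b)
  apply pow_smul_cancel g le_rfl n
  apply pow_smul_cancel g le_rfl k
  have e := congrArg (res Z₃ (Y.basicOpen_le g)) (h a' b')
  rw [← sec_res, hm, hm', ← sec_res, ← sec_res, ha, hb] at e
  simp only [map_smul, LinearMap.smul_apply] at e
  exact e

end extendHom

/-! ### Direct images along affine morphisms -/

section pushforward

lemma res_bijective_of_eq {X : Scheme.{u}} (M : X.Modules) {V V' : X.Opens} (h : V' ≤ V)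
    (e : V = V') : Function.Bijective (res M h) := by
  subst e
  exact ⟨fun x y hxy => by rwa [res_self, res_self] at hxy, fun x => ⟨x, res_self _ x⟩⟩

/-- The direct image. -/
noncomputable abbrev push {X Y : Scheme.{u}} (f : X ⟶ Y) (M : X.Modules) : Y.Modules :=
  (Scheme.Modules.pushforward f).obj M

lemma res_push {X Y : Scheme.{u}} (f : X ⟶ Y) (M : X.Modules) {V V' : Y.Opens} (h : V' ≤ V)
    (x : Γ(M, f ⁻¹ᵁ V)) :
    res (push f M) h x = res M (show f ⁻¹ᵁ V' ≤ f ⁻¹ᵁ V from fun _ hx => h hx) x := rfl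

lemma isDirectImageFrom_push {X Y : Scheme.{u}} (f : X ⟶ Y) (M : X.Modules) (W : Y.Opens)
    (h : f ⁻¹ᵁ W = ⊤) : IsDirectImageFrom (push f M) W := fun V =>
  res_bijective_of_eq M _ (by
    change f ⁻¹ᵁ V = f ⁻¹ᵁ V ⊓ f ⁻¹ᵁ W
    rw [h, inf_top_eq])

lemma app_resO {X Y : Scheme.{u}} (f : X ⟶ Y) {V V' : Y.Opens} (h : V' ≤ V) (r : Γ(Y, V)) :
    f.app V' (resO Y h r) =
      resO X (show f ⁻¹ᵁ V' ≤ f ⁻¹ᵁ V from fun _ hx => h hx) (f.app V r) :=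
  ConcreteCategory.congr_hom (f.naturality (homOfLE h).op) r

lemma qcoh_push {X Y : Scheme.{u}} (f : X ⟶ Y) [IsAffineHom f] {M : X.Modules} (hM : QCoh M) :
    QCoh (push f M) := fun U hU g => by
  have key := hM _ (hU.preimage f) (f.app U g)
  have e : f ⁻¹ᵁ Y.basicOpen g = X.basicOpen (f.app U g) := Scheme.preimage_basicOpen f g
  have h1 : X.basicOpen (f.app U g) ≤ f ⁻¹ᵁ Y.basicOpen g := e.ge
  have hb := res_bijective_of_eq M h1 e
  constructor
  · intro s hs
    obtain ⟨n, hn⟩ := key.1 s (by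
      exact (res_res _ h1 _).symm.trans ((congrArg (res M h1) hs).trans (map_zero _)))
    refine ⟨n, ?_⟩
    refine Eq.trans ?_ hn
    rw [← map_pow]
    rfl
  · intro t
    obtain ⟨n, s, hs⟩ := key.2 (res M h1 t)
    refine ⟨n, s, hb.1 ?_⟩
    rw [res_push, res_res]
    refine hs.trans ?_
    have : res M h1 (resO Y (Y.basicOpen_le g) (g ^ n) • t : Γ(push f M, Y.basicOpen g)) =
      resO X h1 (f.app _ (resO Y (Y.basicOpen_le g) (g ^ n))) • res M h1 t := res_smul h1 _ _
    refine Eq.trans ?_ this.symm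
    rw [app_resO, resO_resO, map_pow (f.app U).hom g n]

end pushforward

/-! ### Spectra of algebras over an affine open -/

section affineMap

variable {Y : Scheme.{u}} {W : Y.Opens} (hW : IsAffineOpen W) {C : CommRingCat.{u}}
  (φ : Γ(Y, W) ⟶ C)

/-- The morphism `Spec C → Y` defined by a homomorphism `Γ(Y, W) → C`. -/
noncomputable abbrev specTo : Spec C ⟶ Y := Spec.map φ ≫ hW.fromSpec

lemma specTo_preimage : specTo hW φ ⁻¹ᵁ W = ⊤ := by
  rw [Scheme.Hom.comp_preimage, hW.fromSpec_preimage_self]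
  rfl

/-- Separatedness of `Y` enters here: a morphism from an affine scheme to a separated scheme is
affine, so preimages of affine opens are affine and direct images stay quasi-coherent. -/
instance [Y.IsSeparated] : IsAffineHom (specTo hW φ) := by
  have : IsAffineHom (specTo hW φ ≫ terminal.from Y) := inferInstance
  exact IsAffineHom.of_comp (specTo hW φ) (terminal.from Y)

lemma specTo_app (V : Y.Opens) (hV : V ≤ W) (r : Γ(Y, W)) :
    (specTo hW φ).app V (resO Y hV r) = algebraMap C Γ(Spec C, specTo hW φ ⁻¹ᵁ V) (φ r) := by
  rw [app_resO]
  have h : (specTo hW φ).app W r = algebraMap C Γ(Spec C, specTo hW φ ⁻¹ᵁ W) (φ r) := by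
    have h1 : hW.fromSpec.app W r =
        resO _ le_top ((Scheme.ΓSpecIso Γ(Y, W)).inv r) :=
      ConcreteCategory.congr_hom hW.fromSpec_app_self r
    have h2 : (specTo hW φ).app W r =
        (Spec.map φ).app (hW.fromSpec ⁻¹ᵁ W) (hW.fromSpec.app W r) := by
      rw [Scheme.Hom.comp_app]; rfl
    rw [h2, h1, app_resO]
    exact congrArg _ (ConcreteCategory.congr_hom (Scheme.ΓSpecIso_inv_naturality φ) r).symm
  rw [h]
  rfl

end affineMap

/-- Elements of a ring as functions on its spectrum. -/
noncomputable def specFun {C : CommRingCat.{u}} (U : (Spec C).Opens) : C →+* Γ(Spec C, U) :=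
  algebraMap C Γ(Spec C, U)

/-- The multiplication of functions and sections over `X`. -/
noncomputable def pushSmul {X Y : Scheme.{u}} (f : X ⟶ Y) (M : X.Modules) (V : Y.Opens) :
    Γ(push f (SheafOfModules.unit.{u} _), V) →ₗ[Γ(Y, V)]
      Γ(push f M, V) →ₗ[Γ(Y, V)] Γ(push f M, V) :=
  LinearMap.mk₂ Γ(Y, V)
    (fun r x => (show Γ(M, f ⁻¹ᵁ V) from
      (show Γ(X, f ⁻¹ᵁ V) from r) • (show Γ(M, f ⁻¹ᵁ V) from x) : Γ(push f M, V)))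
    (fun r r' x => add_smul (R := Γ(X, f ⁻¹ᵁ V)) (M := Γ(M, f ⁻¹ᵁ V)) r r' x)
    (fun c r x => mul_smul (α := Γ(X, f ⁻¹ᵁ V)) (β := Γ(M, f ⁻¹ᵁ V)) (f.app V c) r x)
    (fun r x x' => smul_add (M := Γ(X, f ⁻¹ᵁ V)) (A := Γ(M, f ⁻¹ᵁ V)) r x x')
    (fun c r x => smul_comm (M := Γ(X, f ⁻¹ᵁ V)) (N := Γ(X, f ⁻¹ᵁ V)) (α := Γ(M, f ⁻¹ᵁ V))
      r (f.app V c) x)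

lemma res_pushSmul {X Y : Scheme.{u}} (f : X ⟶ Y) (M : X.Modules) {V V' : Y.Opens} (h : V' ≤ V)
    (r : Γ(push f (SheafOfModules.unit.{u} _), V)) (x : Γ(push f M, V)) :
    res (push f M) h (pushSmul f M V r x) =
      pushSmul f M V' (res (push f (SheafOfModules.unit.{u} _)) h r) (res (push f M) h x) :=
  res_smul (M := M) (show f ⁻¹ᵁ V' ≤ f ⁻¹ᵁ V from fun _ hx => h hx) r x

/-! ### Coinduced graded modules -/

section coinduced

variable {Y : Scheme.{u}} {A : GradedRingSheaf Y} {W : Y.Opens} (hW : IsAffineOpen W)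
  {C : CommRingCat.{u}} (ρ : A.ring W →+* C)

/-- The structure morphism of an algebra over `𝒜(W)`, as a morphism of schemes. -/
noncomputable abbrev specRing : Spec C ⟶ Y := specTo hW (CommRingCat.ofHom (ρ.comp (A.scal W)))

lemma specRing_app (V : Y.Opens) (hV : V ≤ W) (r : Γ(Y, W)) :
    (specRing hW ρ).app V (resO Y hV r) = specFun _ (ρ (A.scal W r)) := specTo_app hW _ V hV r

/-- The direct image of the structure sheaf. -/
noncomputable abbrev pushO : Y.Modules := push (specRing hW ρ) (SheafOfModules.unit.{u} _)

/-- Homogeneous elements as functions on the spectrum. -/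
noncomputable def thetaW (d : ℤ) : Γ(A.gr d, W) →ₗ[Γ(Y, W)] Γ(pushO hW ρ, W) where
  toFun a := specFun (specRing hW ρ ⁻¹ᵁ W) (ρ (A.incl W d a))
  map_add' a b := by rw [map_add, map_add, map_add]; rfl
  map_smul' r a := by
    rw [← A.scal_mul_incl, map_mul, map_mul]
    have := specRing_app hW ρ W le_rfl r
    rw [resO_self] at this
    exact congrArg (· * specFun (specRing hW ρ ⁻¹ᵁ W) (ρ (A.incl W d a))) this.symm

/-- The grading is forgotten at this point: every `𝒜_d` maps to the same sheaf, the direct image of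
the structure sheaf of `Spec C`. Through these maps a module on `Spec C` gives a graded module whose
weight components are all equal. -/
lemma exists_theta (hA : ∀ i, QCoh (A.gr i)) (d : ℤ) : ∃ θ : A.gr d ⟶ pushO hW ρ,
    ∀ a : Γ(A.gr d, W), sec θ W a = thetaW hW ρ d a :=
  exists_extendHom hW (hA d W hW) (isDirectImageFrom_push _ _ W (specTo_preimage hW _)) _

noncomputable def theta (hA : ∀ i, QCoh (A.gr i)) (d : ℤ) : A.gr d ⟶ pushO hW ρ :=
  (exists_theta hW ρ hA d).choose

lemma sec_theta (hA : ∀ i, QCoh (A.gr i)) (d : ℤ) (a : Γ(A.gr d, W)) :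
    sec (theta hW ρ hA d) W a = specFun (specRing hW ρ ⁻¹ᵁ W) (ρ (A.incl W d a)) :=
  (exists_theta hW ρ hA d).choose_spec a

lemma theta_mul (hA : ∀ i, QCoh (A.gr i)) {i j k : ℤ} (h : i + j = k) (V : Y.Opens)
    (a : Γ(A.gr i, V)) (b : Γ(A.gr j, V)) : sec (theta hW ρ hA k) V (A.mul h V a b) =
      pushSmul (specRing hW ρ) (SheafOfModules.unit.{u} _) V (sec (theta hW ρ hA i) V a)
        (sec (theta hW ρ hA j) V b) := by
  refine bilin_ext (theta hW ρ hA i) (theta hW ρ hA j) (theta hW ρ hA k) (A.mul h)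
    (pushSmul (specRing hW ρ) (SheafOfModules.unit.{u} _)) (fun h' a b => A.mul_res h h' a b)
    (fun h a b => res_pushSmul _ _ h a b) hW (hA i W hW) (hA j W hW)
    (isDirectImageFrom_push _ _ W (specTo_preimage hW _)) (fun a b => ?_) V a b
  rw [sec_theta, sec_theta, sec_theta, ← A.incl_mul, map_mul, map_mul]
  rfl

lemma theta_one (hA : ∀ i, QCoh (A.gr i)) (V : Y.Opens) :
    sec (theta hW ρ hA 0) V (A.one V) = (1 : Γ(Spec C, specRing hW ρ ⁻¹ᵁ V)) := by
  refine (isDirectImageFrom_push _ _ W (specTo_preimage hW _) V).1 ?_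
  rw [← sec_res, A.one_res, ← A.one_res (inf_le_right : V ⊓ W ≤ W), sec_res, sec_theta]
  have h1 : A.incl W 0 (A.one W) = 1 := rfl
  rw [h1, map_one, map_one]
  exact (map_one (resO (Spec C) _)).trans (map_one (resO (Spec C) _)).symm

/-- The graded module all of whose weight components are the direct image of the sheaf associated
to a module over an `𝒜(W)`-algebra. -/
noncomputable def coind (hA : ∀ i, QCoh (A.gr i)) (N : (Spec C).Modules) : GrMod A where
  obj _ := push (specRing hW ρ) N
  act {i j k} h V := (pushSmul (specRing hW ρ) N V).comp (sec (theta hW ρ hA i) V)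
  act_res h V V' hV a x := by
    rw [LinearMap.comp_apply, LinearMap.comp_apply, sec_res, res_pushSmul]
  one_act V x := by
    rw [LinearMap.comp_apply, theta_one]
    exact one_smul Γ(Spec C, specRing hW ρ ⁻¹ᵁ V) (show Γ(N, specRing hW ρ ⁻¹ᵁ V) from x)
  mul_act hm hk hn hk' V a b x := by
    rw [LinearMap.comp_apply, LinearMap.comp_apply, LinearMap.comp_apply, theta_mul]
    exact mul_smul (α := Γ(Spec C, specRing hW ρ ⁻¹ᵁ V)) (β := Γ(N, specRing hW ρ ⁻¹ᵁ V))
      (sec (theta hW ρ hA _) V a) (sec (theta hW ρ hA _) V b) x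

end coinduced

end HomFlip

namespace HomFlip

/-! ### Modules and their associated sheaves -/

section tilde

variable {C : CommRingCat.{u}} (N : ModuleCat.{u} C)

/-- Elements of a module as sections of the associated sheaf. -/
noncomputable def toTilde (U : (Spec C).Opens) : N →ₗ[C] Γ(tilde N, U) := (tilde.toOpen N U).hom

lemma res_toTilde {U V : (Spec C).Opens} (h : V ≤ U) (x : N) :
    res (tilde N) h (toTilde N U x) = toTilde N V x :=
  LinearMap.congr_fun (congrArg ModuleCat.Hom.hom (tilde.toOpen_res N U V (homOfLE h))) x

lemma toTilde_smul (U : (Spec C).Opens) (c : C) (x : N) :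
    toTilde N U (c • x) = specFun U c • toTilde N U x := by
  rw [map_smul]
  exact (algebraMap_smul Γ(Spec C, U) c (toTilde N U x)).symm

lemma toTilde_top_bijective : Function.Bijective (toTilde N ⊤) :=
  (ConcreteCategory.bijective_of_isIso (tilde.toOpen N ⊤))

lemma specFun_top_bijective : Function.Bijective (specFun (⊤ : (Spec C).Opens)) := by
  have h : ∀ c : C, specFun (⊤ : (Spec C).Opens) c = (Scheme.ΓSpecIso C).inv c := fun c =>
    resO_self (Y := Spec C) (U := ⊤) le_top ((Scheme.ΓSpecIso C).inv c)
  have := ConcreteCategory.bijective_of_isIso (Scheme.ΓSpecIso C).inv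
  exact (funext h : (specFun (⊤ : (Spec C).Opens) : C → _) = _) ▸ this

lemma qcoh_tilde : QCoh (tilde N) := qcoh_of_isQuasicoherent _ inferInstance

lemma toTilde_basicOpen_eq_zero {V : (Spec C).Opens} (c : C)
    (hV : V = (Spec C).basicOpen (specFun ⊤ c)) {x : N} (h : toTilde N V x = 0) :
    ∃ n : ℕ, c ^ n • x = 0 := by
  subst hV
  rw [← res_toTilde N ((Spec C).basicOpen_le (specFun ⊤ c))] at h
  obtain ⟨n, hn⟩ := (qcoh_tilde N ⊤ (isAffineOpen_top _) (specFun ⊤ c)).1 _ h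
  refine ⟨n, (toTilde_top_bijective N).1 ?_⟩
  rw [toTilde_smul, map_pow, hn, map_zero]

/-- The global sections are `N` itself over `C`; from there the property passes to every affine
open. -/
lemma hasTorsionLift_tilde (h : HasTorsionLift C N) {V : (Spec C).Opens} (hV : IsAffineOpen V) :
    HasTorsionLift Γ(Spec C, V) Γ(tilde N, V) := by
  refine hasTorsionLift_affine (qcoh_tilde N) (isAffineOpen_top _) ?_ hV le_top
  intro k x y e he
  obtain ⟨y, rfl⟩ := specFun_top_bijective.2 y
  obtain ⟨e, rfl⟩ := (toTilde_top_bijective N).2 e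
  choose x' hx using fun j => specFun_top_bijective.2 (x j)
  obtain ⟨e', m, h1, h2⟩ := h k x' y e fun j => by
    obtain ⟨n, hn⟩ := he j
    refine ⟨n, (toTilde_top_bijective N).1 ?_⟩
    rw [toTilde_smul, map_pow, hx, hn, map_zero]
  refine ⟨toTilde N ⊤ e', m, fun j => ?_, ?_⟩
  · obtain ⟨n, hn⟩ := h1 j
    exact ⟨n, by rw [← hx, ← map_pow, ← toTilde_smul, hn, map_zero]⟩
  · rw [← map_pow, ← map_pow, ← toTilde_smul, ← toTilde_smul, h2]

end tilde

/-! ### Maps into coinduced modules -/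

section coindMap

variable {Y : Scheme.{u}} {A : GradedRingSheaf Y} {W : Y.Opens} (hW : IsAffineOpen W)
  {C : CommRingCat.{u}} (ρ : A.ring W →+* C) (hA : ∀ i, QCoh (A.gr i)) {M : GrMod A}
  (N : ModuleCat.{u} C)

/-- An additive map to a module as a map to sections of the associated sheaf. -/
noncomputable def coindMapW (j : Tot M (le_refl W) →+ N) (hj : ∀ b x, j (b • x) = ρ b • j x) (k : ℤ) :
    Γ(M.obj k, W) →ₗ[Γ(Y, W)] Γ(push (specRing hW ρ) (tilde N), W) where
  toFun x := toTilde N (specRing hW ρ ⁻¹ᵁ W) (j (Tot.of M (le_refl W) k x))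
  map_add' x y := by rw [map_add, map_add, map_add]; rfl
  map_smul' r x := by
    have h1 := Tot.scal_smul_of M (le_refl W) r k x
    rw [resO_self] at h1
    rw [← h1, hj, toTilde_smul]
    have := specRing_app hW ρ W le_rfl r
    rw [resO_self] at this
    exact congrArg (· • toTilde N (specRing hW ρ ⁻¹ᵁ W) _) this.symm

/-- Coinduction is right adjoint to taking the total module of sections over `W`; this is the
existence half of the adjunction. -/
lemma exists_coindMap (hM : ∀ k, QCoh (M.obj k)) (j : Tot M (le_refl W) →+ N) (hj : ∀ b x, j (b • x) = ρ b • j x) :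
    ∃ Φ : M ⟶ coind hW ρ hA (tilde N), ∀ k x, sec (Φ.app k) W x =
      toTilde N (specRing hW ρ ⁻¹ᵁ W) (j (Tot.of M (le_refl W) k x)) := by
  have h : ∀ k, ∃ φ : M.obj k ⟶ push (specRing hW ρ) (tilde N), ∀ x, sec φ W x =
      toTilde N (specRing hW ρ ⁻¹ᵁ W) (j (Tot.of M (le_refl W) k x)) := fun k =>
    exists_extendHom hW (hM k W hW) (isDirectImageFrom_push _ _ W (specTo_preimage hW _))
      (coindMapW hW ρ N j hj k)
  choose φ hφ using h
  refine ⟨{ app := φ, app_act := fun {i j k} h V a x => ?_ }, hφ⟩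
  refine bilin_ext (theta hW ρ hA i) (φ j) (φ k) (M.act h)
    (pushSmul (specRing hW ρ) (tilde N)) (fun h' a b => M.act_res h h' a b)
    (fun h a b => res_pushSmul _ _ h a b) hW (hA i W hW) (hM j W hW)
    (isDirectImageFrom_push _ _ W (specTo_preimage hW _)) (fun a b => ?_) V a x
  have h1 := Tot.incl_smul_of M (le_refl W) h a b
  rw [res_self] at h1
  rw [hφ, hφ, sec_theta, ← h1, hj, toTilde_smul]
  rfl

/-- A section in the kernel may be taken over `D(g)` and, after clearing denominators, to be the
restriction of some `x'` over `W`. The image of `x'` in the associated sheaf vanishes over `D(g)`,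
so a power of `g` kills it in `N`, hence kills `x'` by injectivity of `j`. -/
lemma coindMap_injective (hM : ∀ k, QCoh (M.obj k)) {j : Tot M (le_refl W) →+ N} (hj : ∀ b x, j (b • x) = ρ b • j x)
    (hinj : Function.Injective j) {Φ : M ⟶ coind hW ρ hA (tilde N)}
    (hΦ : ∀ k x, sec (Φ.app k) W x =
      toTilde N (specRing hW ρ ⁻¹ᵁ W) (j (Tot.of M (le_refl W) k x)))
    {V : Y.Opens} (hV : V ≤ W) (k : ℤ) : Function.Injective (sec (Φ.app k) V) := by
  rw [injective_iff_map_eq_zero]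
  intro x hx
  refine eq_of_locally fun y hy => ?_
  obtain ⟨g, hg, hyg⟩ := exists_basicOpen hW hy (hV hy)
  refine ⟨Y.basicOpen g, hg, hyg, ?_⟩
  obtain ⟨n, x', hx'⟩ := (hM k W hW g).2 (res _ hg x)
  have h1 : sec (Φ.app k) (Y.basicOpen g) (res _ (Y.basicOpen_le g) x') = 0 := by
    rw [hx', map_smul, sec_res, hx, map_zero, smul_zero]
  rw [sec_res, hΦ] at h1
  have h2 : toTilde N (specRing hW ρ ⁻¹ᵁ Y.basicOpen g) (j (Tot.of M (le_refl W) k x')) = 0 :=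
    (res_toTilde N _ _).symm.trans h1
  obtain ⟨m, hm⟩ := toTilde_basicOpen_eq_zero N (ρ (A.scal W g)) (by
    refine (Scheme.preimage_basicOpen _ g).trans ?_
    have := specRing_app hW ρ W le_rfl g
    rw [resO_self] at this
    rw [this]
    have h3 : specFun (specRing hW ρ ⁻¹ᵁ W) (ρ (A.scal W g)) =
      resO (Spec C) le_top (specFun ⊤ (ρ (A.scal W g))) := rfl
    rw [h3]
    refine ((Spec C).basicOpen_res _ (homOfLE le_top).op).trans ?_
    rw [specTo_preimage, top_inf_eq]) h2
  rw [← map_pow, ← hj, ← map_pow, Tot.scal_smul_of, resO_self] at hm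
  have h4 : g ^ m • x' = 0 := Tot.of_injective M (le_refl W) k (hinj (hm.trans (by simp)))
  have h5 := res_eq_zero_of_pow_smul g le_rfl m h4
  rw [hx'] at h5
  rw [map_zero]
  apply pow_smul_cancel g le_rfl n
  rw [h5, smul_zero]

end coindMap

/-! ### The division property for graded modules -/

section gradedTorsionLift

variable {Y : Scheme.{u}} {A : GradedRingSheaf Y}

/-- The division property for homogeneous elements over affine opens. -/
def TorsionLift (M : GrMod A) : Prop :=
  ∀ (U : Y.Opens), IsAffineOpen U → ∀ (n : ℕ) (d : Fin n → ℤ) (x : ∀ j, Γ(A.gr (d j), U)) (c k l : ℤ)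
    (h : c + l = k) (y : Γ(A.gr c, U)) (e : Γ(M.obj k, U)),
    (∀ j, ∃ n : ℕ, A.incl U _ (x j) ^ n • Tot.of M (le_refl U) k e = 0) →
    ∃ (e' : Γ(M.obj l, U)) (m : ℕ),
      (∀ j, ∃ n : ℕ, A.incl U _ (x j) ^ n • Tot.of M (le_refl U) l e' = 0) ∧
      A.incl U _ y ^ (m + 1) • Tot.of M (le_refl U) l e' =
        A.incl U _ y ^ m • Tot.of M (le_refl U) k e

lemma TorsionLift.of_retract {M G : GrMod A} (hG : TorsionLift G) (i : M ⟶ G) (r : G ⟶ M)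
    (hir : i ≫ r = 𝟙 M) : TorsionLift M := by
  intro U hU n d x c k l h y e he
  obtain ⟨e', m, h1, h2⟩ := hG U hU n d x c k l h y (sec (i.app k) U e) fun j => by
    obtain ⟨n, hn⟩ := he j
    exact ⟨n, by rw [← Tot.map_of, ← map_smul, hn, map_zero]⟩
  refine ⟨sec (r.app l) U e', m, fun j => ?_, ?_⟩
  · obtain ⟨n, hn⟩ := h1 j
    exact ⟨n, by rw [← Tot.map_of, ← map_smul, hn, map_zero]⟩
  · rw [← Tot.map_of, ← map_smul, h2, map_smul, Tot.map_of, ← sec_comp, ← GrMod.comp_app, hir]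
    rfl

lemma TorsionLift.biprod {M M' G : GrMod A} (hM : TorsionLift M) (hM' : TorsionLift M')
    (i : M ⟶ G) (i' : M' ⟶ G) (p : G ⟶ M) (p' : G ⟶ M') (h : p ≫ i + p' ≫ i' = 𝟙 G) :
    TorsionLift G := by
  intro U hU n d x c k l hl y e he
  obtain ⟨e1, m1, h1, h1'⟩ := hM U hU n d x c k l hl y (sec (p.app k) U e) fun j => by
    obtain ⟨n, hn⟩ := he j
    exact ⟨n, by rw [← Tot.map_of, ← map_smul, hn, map_zero]⟩
  obtain ⟨e2, m2, h2, h2'⟩ := hM' U hU n d x c k l hl y (sec (p'.app k) U e) fun j => by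
    obtain ⟨n, hn⟩ := he j
    exact ⟨n, by rw [← Tot.map_of, ← map_smul, hn, map_zero]⟩
  refine ⟨sec (i.app l) U e1 + sec (i'.app l) U e2, m1 + m2, fun j => ?_, ?_⟩
  · obtain ⟨n1, hn1⟩ := h1 j
    obtain ⟨n2, hn2⟩ := h2 j
    refine ⟨n1 + n2, ?_⟩
    rw [map_add, smul_add, ← Tot.map_of, ← Tot.map_of, ← map_smul (Tot.map i _),
      ← map_smul (Tot.map i' _), pow_smul_of_le hn1 (Nat.le_add_right _ _), pow_smul_of_le hn2 (Nat.le_add_left _ _),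
      map_zero, map_zero, add_zero]
  · have e1' := congrArg (fun t => Tot.map i (le_refl U) (A.incl U _ y ^ m2 • t)) h1'
    have e2' := congrArg (fun t => Tot.map i' (le_refl U) (A.incl U _ y ^ m1 • t)) h2'
    simp only [smul_smul, ← pow_add, map_smul, Tot.map_of, ← sec_comp, ← GrMod.comp_app] at e1' e2'
    have e3 : e = sec ((p ≫ i).app k) U e + sec ((p' ≫ i').app k) U e := by
      rw [← sec_add, ← GrMod.add_app, h]
      rfl
    rw [map_add, smul_add, show m1 + m2 + 1 = m2 + (m1 + 1) by omega, e1',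
      show m2 + (m1 + 1) = m1 + (m2 + 1) by omega, e2', add_comm m2 m1, ← smul_add, ← map_add, ← e3]

/-- In every weight the sections over `U` are those of `tilde N` over the affine preimage of `U`,
and homogeneous elements act through functions there. The ungraded division property applies, and
since all weights coincide the quotient `e'` may be placed in the prescribed weight `l`. -/
lemma torsionLift_coind [Y.IsSeparated] {W : Y.Opens} (hW : IsAffineOpen W) {C : CommRingCat.{u}}
    (ρ : A.ring W →+* C) (hA : ∀ i, QCoh (A.gr i)) {N : ModuleCat.{u} C}
    (hN : HasTorsionLift C N) : TorsionLift (coind hW ρ hA (tilde N)) := by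
  intro U hU n d x c k l h y e he
  let V := specRing hW ρ ⁻¹ᵁ U
  have hV : IsAffineOpen V := hU.preimage _
  let T : ∀ {i : ℤ}, Γ(A.gr i, U) → Γ(Spec C, V) := fun {i} a => sec (theta hW ρ hA i) U a
  let G := coind hW ρ hA (tilde N)
  have act : ∀ {i j k : ℤ} (h : i + j = k) (a : Γ(A.gr i, U)) (z : Γ(tilde N, V)),
    G.act h U a z = T a • z := fun h a z => rfl
  have key : ∀ {i : ℤ} (a : Γ(A.gr i, U)) (m : ℕ) (j k : ℤ) (hk : m * i + j = k)
      (z : Γ(tilde N, V)),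
      A.incl U i a ^ m • Tot.of G (le_refl U) j z = Tot.of G (le_refl U) k (T a ^ m • z) := by
    intro i a m
    induction m with
    | zero =>
      intro j k hk z
      obtain rfl : j = k := by simpa using hk
      rw [pow_zero, pow_zero, one_smul, one_smul]
    | succ m ih =>
      intro j k hk z
      have hk' : m * i + (i + j) = k := by rw [← hk]; push_cast; ring
      rw [pow_succ, pow_succ, mul_smul, mul_smul]
      refine (congrArg (A.incl U i a ^ m • ·) ((Tot.incl_smul_of G (le_refl U) (l := i + j) rfl a
        z).trans (congrArg _ (congrArg (fun b => G.act rfl U b z) (res_self _ a))))).trans ?_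
      exact ih _ k hk' (T a • z)
  have key0 : ∀ {i : ℤ} (a : Γ(A.gr i, U)) (m : ℕ) (j : ℤ) (z : Γ(tilde N, V)),
      A.incl U i a ^ m • Tot.of G (le_refl U) j z = 0 ↔ T a ^ m • z = 0 := by
    intro i a m j z
    rw [key a m j _ rfl z]
    exact map_eq_zero_iff (Tot.of G (le_refl U) _) (Tot.of_injective G (le_refl U) _)
  obtain ⟨e', m, h1, h2⟩ := hasTorsionLift_tilde N hN hV n (fun j => T (x j)) (T y) e fun j => by
    obtain ⟨n, hn⟩ := he j
    exact ⟨n, (key0 _ _ _ _).1 hn⟩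
  refine ⟨e', m, fun j => ?_, ?_⟩
  · obtain ⟨n, hn⟩ := h1 j
    exact ⟨n, (key0 _ _ _ _).2 hn⟩
  · refine (key y (m + 1) l (m * c + k) (by rw [← h]; push_cast; ring) e').trans ?_
    rw [h2]
    exact (key y m k (m * c + k) rfl e).symm

end gradedTorsionLift

end HomFlip

namespace HomFlip

/-! ### Embedding quasi-coherent graded modules -/

section embedding

variable {Y : Scheme.{u}} {A : GradedRingSheaf Y}

lemma qcoh_coind [Y.IsSeparated] {W : Y.Opens} (hW : IsAffineOpen W) {C : CommRingCat.{u}}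
    (ρ : A.ring W →+* C) {N : (Spec C).Modules} (hN : QCoh N) : QCoh (push (specRing hW ρ) N) :=
  qcoh_push _ hN


/-- Induction over a finite union of affine opens. A new affine `U` contributes a summand coinduced
from an injective `𝒜(U)`-module that contains the sections of `M` over `U`; the map to this summand
is injective below `U`, and injectivity over the union is a local question. -/
lemma exists_torsionLift_embedding [Y.IsSeparated] (hA : A.IsNoetherianOver) (M : GrMod A)
    (hM : ∀ k, QCoh (M.obj k)) (V : Y.Opens) (hV : IsCompact (V : Set Y)) :
    ∃ (G : GrMod A) (i : M ⟶ G), (∀ k, QCoh (G.obj k)) ∧ TorsionLift G ∧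
      ∀ V' ≤ V, ∀ k, Function.Injective (sec (i.app k) V') := by
  refine compact_open_induction_on (P := fun V => ∃ (G : GrMod A) (i : M ⟶ G),
    (∀ k, QCoh (G.obj k)) ∧ TorsionLift G ∧ ∀ V' ≤ V, ∀ k, Function.Injective (sec (i.app k) V'))
    V hV ?_ ?_
  · have h0 : ∀ (U : Y.Opens) (x : Γ((0 : Y.Modules), U)), x = 0 := fun U x => by
      rw [← sec_id x, (isZero_zero Y.Modules).eq_of_src (𝟙 _) 0]; rfl
    refine ⟨GrMod.zero A, 0, fun k U hU f => ⟨fun s _ => ⟨0, h0 U _⟩,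
      fun t => ⟨0, 0, (h0 _ _).trans (h0 _ _).symm⟩⟩, ?_, ?_⟩
    · intro U hU n d x c k l h y e he
      refine ⟨0, 0, fun j => ⟨0, by rw [map_zero, smul_zero]⟩, ?_⟩
      rw [show e = 0 from h0 U e, map_zero, map_zero, smul_zero, smul_zero]
    · intro V' hV' k x y hxy
      exact eq_of_locally fun z hz => (hV' hz).elim
  · rintro S hS ⟨U, hU⟩ ⟨G, i, hG, hGT, hi⟩
    have := hA.noetherian ⟨U, hU⟩
    let T : ModuleCat.{u} (A.ring U) := ModuleCat.of _ (Tot M (le_refl U))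
    let N : ModuleCat.{u} (A.ring U) := Injective.under T
    have hN : HasTorsionLift (A.ring U) N := by
      have : Injective (ModuleCat.of (A.ring U) N) := inferInstanceAs (Injective (Injective.under T))
      have : Module.Injective (A.ring U) N := Module.injective_module_of_injective_object _ N
      exact hasTorsionLift_of_injective _ _
    let j : Tot M (le_refl U) →ₗ[A.ring U] N := (Injective.ι T).hom
    have hj : Function.Injective j := (ModuleCat.mono_iff_injective _).1 (inferInstanceAs (Mono (Injective.ι T)))
    let C : CommRingCat.{u} := .of (A.ring U)
    let N' : ModuleCat.{u} C := N
    let ρ : A.ring U →+* C := RingHom.id _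
    obtain ⟨Φ, hΦ⟩ := exists_coindMap hU ρ hA.qcoh N' hM j.toAddMonoidHom (fun b x => map_smul j b x)
    have hΦi := fun V hV k => coindMap_injective hU ρ hA.qcoh N' hM (j := j.toAddMonoidHom)
      (fun b x => map_smul j b x) hj hΦ (V := V) hV k
    let Z := coind hU ρ hA.qcoh (tilde N')
    have hZ : TorsionLift Z := torsionLift_coind hU ρ hA.qcoh hN
    let b := GrMod.bicone G Z
    have htot : b.fst ≫ b.inl + b.snd ≫ b.inr = 𝟙 b.pt := GrMod.hom_ext fun k => biprod.total
    refine ⟨b.pt, i ≫ b.inl + Φ ≫ b.inr, fun k => ?_, ?_, ?_⟩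
    · exact qcoh_of_total (hG k) (qcoh_coind hU ρ (qcoh_tilde N')) (b.fst.app k) (b.snd.app k)
        (b.inl.app k) (b.inr.app k) (congrArg (fun g : b.pt ⟶ b.pt => g.app k) htot)
    · exact hGT.biprod hZ b.inl b.inr b.fst b.snd htot
    · have h1 : (i ≫ b.inl + Φ ≫ b.inr) ≫ b.fst = i := by simp
      have h2 : (i ≫ b.inl + Φ ≫ b.inr) ≫ b.snd = Φ := by simp
      generalize i ≫ b.inl + Φ ≫ b.inr = t at h1 h2
      intro V' hV' k
      rw [injective_iff_map_eq_zero]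
      intro x hx
      refine eq_of_locally fun y hy => ?_
      have hx1 : sec (i.app k) V' x = 0 := by
        rw [← h1, GrMod.comp_app, sec_comp, hx, map_zero]
      have hx2 : sec (Φ.app k) V' x = 0 := by
        rw [← h2, GrMod.comp_app, sec_comp, hx, map_zero]
      rcases hV' hy with hyS | hyU
      · refine ⟨V' ⊓ S, inf_le_left, ⟨hy, hyS⟩, hi _ inf_le_right k ?_⟩
        rw [sec_res, hx1, map_zero, map_zero, map_zero]
      · refine ⟨V' ⊓ U, inf_le_left, ⟨hy, hyU⟩, hΦi _ inf_le_right k ?_⟩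
        rw [sec_res, hx2, map_zero, map_zero, map_zero]

/-- The terms of an injective resolution have the division property. -/
lemma InjRes.torsionLift [IsNoetherian Y] [Y.IsSeparated] (hA : A.IsNoetherianOver) (J : InjRes A)
    (n : ℤ) : TorsionLift (J.J.X n) := by
  obtain ⟨G, i, hG, hGT, hi⟩ := exists_torsionLift_embedding hA (J.J.X n) (fun k => J.qcoh n k) ⊤
    (by simpa using CompactSpace.isCompact_univ)
  let Gq : (GrMod.isQuasicoherent A).FullSubcategory :=
    ⟨G, fun k => isQuasicoherent_of_qcoh _ (hG k)⟩
  let Jq : (GrMod.isQuasicoherent A).FullSubcategory := ⟨J.J.X n, J.quasicoherent n⟩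
  let iq : Jq ⟶ Gq := ObjectProperty.homMk i
  -- Sectionwise injectivity makes the embedding a monomorphism among quasi-coherent graded modules,
  -- so the injective object `J.J.X n` is a retract of `G`.
  have : Mono iq := ⟨fun {Z} g h hgh => by
    ext : 1
    refine GrMod.hom_ext fun k => hom_ext' fun U x => hi U le_top k ?_
    have := congrArg (fun t : Z ⟶ Gq => sec (t.hom.app k) U x) hgh
    exact this⟩
  have := J.injective n
  have h : iq ≫ Injective.factorThru (𝟙 Jq) iq = 𝟙 Jq := Injective.comp_factorThru _ _
  exact hGT.of_retract i (Injective.factorThru (𝟙 Jq) iq).hom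
    (congrArg (fun t : Jq ⟶ Jq => t.hom) h)

end embedding

end HomFlip

namespace HomFlip

open Pretriangulated CochainComplex HomComplex

attribute [local instance] HasDerivedCategory.standard

/-! ### Finite injective dimension in the derived category of a ring -/

section finInj

variable {B : Type u} [CommRing B]

/-- An object of the derived category of modules has injective dimension less than `n₀` and is
bounded below by `-n₀`. -/
def FinInj (n₀ : ℤ) (X : DerivedCategory (ModuleCat.{u} B)) : Prop :=
  (∀ n, n₀ ≤ n → ∀ (Z : ModuleCat.{u} B)
    (f : (CategoryTheory.shiftFunctor _ (-n)).obj ((DerivedCategory.singleFunctor _ 0).obj Z) ⟶ X), f = 0) ∧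
  (∀ C : DerivedCategory (ModuleCat.{u} B), C.IsLE (-n₀) → ∀ f : C ⟶ X, f = 0)

lemma FinInj.mono {n m : ℤ} (hnm : n ≤ m) {X : DerivedCategory (ModuleCat.{u} B)}
    (h : FinInj n X) : FinInj m X :=
  ⟨fun k hk => h.1 k (hnm.trans hk), fun C hC =>
    h.2 C (DerivedCategory.TStructure.t.isLE_of_le C (-m) (-n) (by omega))⟩

lemma FinInj.triangle {n : ℤ} (T : Triangle (DerivedCategory (ModuleCat.{u} B)))
    (hT : T ∈ distTriang _) (h₁ : FinInj n T.obj₁) (h₃ : FinInj n T.obj₃) : FinInj n T.obj₂ := by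
  refine ⟨fun k hk Z f => ?_, fun C hC f => ?_⟩
  · obtain ⟨g, rfl⟩ := Triangle.coyoneda_exact₂ _ hT f (h₃.1 k hk Z _)
    rw [h₁.1 k hk Z g, zero_comp]
  · obtain ⟨g, rfl⟩ := Triangle.coyoneda_exact₂ _ hT f (h₃.2 C hC _)
    rw [h₁.2 C hC g, zero_comp]

lemma eq_zero_of_shift {C : Type*} [Category C] [Preadditive C] [HasShift C ℤ]
    [∀ n : ℤ, (CategoryTheory.shiftFunctor C n).Additive] {X X' : C} (k : ℤ)
    (h : ∀ g : X⟦-k⟧ ⟶ X', g = 0) (f : X ⟶ X'⟦k⟧) : f = 0 := by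
  have h1 := h (f⟦-k⟧' ≫ (shiftFunctorCompIsoId C k (-k) (by omega)).hom.app X')
  have h2 : f⟦-k⟧' = 0 := by
    rw [← cancel_mono ((shiftFunctorCompIsoId C k (-k) (by omega)).hom.app X'), h1, zero_comp]
  exact (CategoryTheory.shiftFunctor C (-k)).map_injective (h2.trans (Functor.map_zero _ _ _).symm)

lemma FinInj.shift {n : ℤ} {X : DerivedCategory (ModuleCat.{u} B)} (h : FinInj n X) :
    FinInj (n + 1) (X⟦(1 : ℤ)⟧) := by
  refine ⟨fun m hm Z f => eq_zero_of_shift 1 (fun g => ?_) f,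
    fun C hC f => eq_zero_of_shift 1 (fun g => ?_) f⟩
  · let e := (CategoryTheory.shiftFunctorAdd' _ (-m) (-1) (-(m + 1)) (by omega)).app
      ((DerivedCategory.singleFunctor (ModuleCat.{u} B) 0).obj Z)
    rw [← cancel_epi e.hom, h.1 (m + 1) (by omega) Z (e.hom ≫ g), comp_zero]
  · have : C.IsLE (-n - 1) := DerivedCategory.TStructure.t.isLE_of_le _ (-(n + 1)) (-n - 1) (by omega)
    exact h.2 _ (DerivedCategory.TStructure.t.isLE_shift C (-n - 1) (-1) (-n) (by omega)) g

lemma FinInj.of_isZero {n : ℤ} {X : DerivedCategory (ModuleCat.{u} B)} (h : IsZero X) :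
    FinInj n X :=
  ⟨fun _ _ _ _ => h.eq_of_tgt _ _, fun _ _ _ => h.eq_of_tgt _ _⟩

lemma isZero_Q_of_acyclic {C : Type*} [Category C] [Abelian C] (K : CochainComplex C ℤ)
    (h : K.Acyclic) : IsZero (DerivedCategory.Q.obj K) := by
  have h0 : IsZero (DerivedCategory.Q.obj (0 : CochainComplex C ℤ)) :=
    DerivedCategory.Q.map_isZero (isZero_zero _)
  have : IsIso (DerivedCategory.Q.map (0 : K ⟶ 0)) := by
    rw [DerivedCategory.isIso_Q_map_iff_quasiIso, quasiIso_iff]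
    exact fun n => (quasiIsoAt_iff_exactAt' _ n (HomologicalComplex.ExactAt.of_isZero
      ((HomologicalComplex.eval _ _ n).map_isZero (isZero_zero _)))).2 (h n)
  exact h0.of_iso (asIso (DerivedCategory.Q.map (0 : K ⟶ 0)))

/-- The complex is K-injective, so a morphism from `Z[-n]` is represented by a chain map, and this
is zero because the complex has no term in degree `n > m`. Maps from objects with cohomology in
degrees at most `-n₀ < l` vanish by the t-structure. -/
lemma finInj_of_bounded_injective (I : CochainComplex (ModuleCat.{u} B) ℤ)
    (hI : ∀ n, Injective (I.X n)) (l m : ℤ) (hb : ∀ p, p < l ∨ m < p → IsZero (I.X p))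
    (n₀ : ℤ) (hm : m < n₀) (hl : -l < n₀) : FinInj n₀ (DerivedCategory.Q.obj I) := by
  have : I.IsStrictlyGE l := (isStrictlyGE_iff _ _).2 fun p hp => hb p (Or.inl hp)
  have := isKInjective_of_injective I l
  refine ⟨fun n hn Z f => ?_, fun C hC f => ?_⟩
  · let K : CochainComplex (ModuleCat.{u} B) ℤ := (CochainComplex.singleFunctor _ 0).obj Z
    let e : DerivedCategory.Q.obj (K⟦-n⟧) ≅
        (CategoryTheory.shiftFunctor _ (-n)).obj ((DerivedCategory.singleFunctor _ 0).obj Z) :=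
      (DerivedCategory.Q.commShiftIso (-n)).app K ≪≫
        (CategoryTheory.shiftFunctor _ (-n)).mapIso ((DerivedCategory.singleFunctorIsoCompQ _ 0).app Z).symm
    rw [← cancel_epi e.hom, comp_zero]
    obtain ⟨g, hg⟩ := (IsKInjective.Qh_map_bijective ((HomotopyCategory.quotient _ _).obj (K⟦-n⟧))
      I).2 (e.hom ≫ f)
    obtain ⟨g, rfl⟩ := (HomotopyCategory.quotient _ _).map_surjective g
    have hg0 : g = 0 := by
      ext p : 1
      by_cases hp : p = n
      · exact (hb p (Or.inr (by omega))).eq_of_tgt _ _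
      · have h0 : IsZero (K.X (p + -n)) :=
          HomologicalComplex.isZero_single_obj_X (ComplexShape.up ℤ) 0 Z _ (by omega)
        exact h0.eq_of_src (Y := I.X p) _ _
    refine hg.symm.trans ?_
    rw [hg0, Functor.map_zero, Functor.map_zero]
    rfl
  · exact DerivedCategory.TStructure.t.zero f (-n₀) l (by omega)

end finInj

/-! ### Homomorphisms out of complexes of finite flat dimension -/

section innerHom

variable {B : Type u} [CommRing B]

/-- The complex of homomorphisms between complexes of modules. -/
noncomputable def innerHom (L E : CochainComplex (ModuleCat.{u} B) ℤ) :
    CochainComplex (ModuleCat.{u} B) ℤ where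
  X n := ModuleCat.of B (Cochain L E n)
  d n m := ModuleCat.ofHom (δ_hom B L E n m)
  shape n m h := ModuleCat.hom_ext (LinearMap.ext fun z => δ_shape n m h z)
  d_comp_d' n m k _ _ := ModuleCat.hom_ext (LinearMap.ext fun z => δ_δ n m k z)

/-- Precomposition with a morphism of complexes. -/
noncomputable def innerHomMap {L L' : CochainComplex (ModuleCat.{u} B) ℤ} (f : L' ⟶ L)
    (E : CochainComplex (ModuleCat.{u} B) ℤ) : innerHom L E ⟶ innerHom L' E where
  f n := ModuleCat.ofHom
    { toFun := fun z => ((Cochain.ofHom f).comp z (zero_add n) : Cochain L' E n)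
      map_add' := fun z z' => Cochain.comp_add _ _ _ _
      map_smul' := fun c z => Cochain.comp_smul _ _ _ _ }
  comm' n m _ := ModuleCat.hom_ext (LinearMap.ext fun z => δ_ofHom_comp f z m)

lemma innerHomMap_v {L L' : CochainComplex (ModuleCat.{u} B) ℤ} (f : L' ⟶ L)
    (E : CochainComplex (ModuleCat.{u} B) ℤ) {n : ℤ} (z : Cochain L E n) (p q : ℤ)
    (hpq : p + n = q) : Cochain.v ((innerHomMap f E).f n z : Cochain L' E n) p q hpq =
      f.f p ≫ z.v p q hpq := Cochain.zero_cochain_comp_v _ _ _ _ _ |>.trans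
  (congrArg (· ≫ z.v p q hpq) (Cochain.ofHom_v f p))

lemma innerHom_acyclic {L : CochainComplex (ModuleCat.{u} B) ℤ} (hL : L.Acyclic)
    (E : CochainComplex (ModuleCat.{u} B) ℤ) [E.IsKInjective] : (innerHom L E).Acyclic := by
  rw [moduleCat_acyclic_iff]
  intro n z hz
  exact IsKInjective.eq_δ_of_cocycle (Cocycle.mk z (n + 1) rfl hz) hL (n - 1) (by omega)

lemma innerHom_shortExact (S : ShortComplex (CochainComplex (ModuleCat.{u} B) ℤ))
    (hS : S.ShortExact) (E : CochainComplex (ModuleCat.{u} B) ℤ) (hE : ∀ n, Injective (E.X n)) :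
    ∃ w, (ShortComplex.mk (innerHomMap S.g E) (innerHomMap S.f E) w).ShortExact := by
  have hp : ∀ p, (S.map (HomologicalComplex.eval _ _ p)).ShortExact := fun p =>
    hS.map_of_exact (HomologicalComplex.eval _ _ p)
  have w : innerHomMap S.g E ≫ innerHomMap S.f E = 0 := by
    refine HomologicalComplex.hom_ext _ _ fun n =>
      ModuleCat.hom_ext (LinearMap.ext fun z => Cochain.ext _ _ fun p q hpq => ?_)
    refine (innerHomMap_v S.f E _ p q hpq).trans ?_
    refine (congrArg (S.f.f p ≫ ·) (innerHomMap_v S.g E z p q hpq)).trans ?_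
    rw [← Category.assoc, ← HomologicalComplex.comp_f, S.zero, HomologicalComplex.zero_f, zero_comp]
    rfl
  refine ⟨w, HomologicalComplex.shortExact_of_degreewise_shortExact _ fun n => ?_⟩
  have hm : ∀ p, Mono (S.f.f p) := fun p => (hp p).mono_f
  have he : ∀ p, Epi (S.g.f p) := fun p => (hp p).epi_g
  have he' : ∀ p, Epi (S.map (HomologicalComplex.eval _ _ p)).g := fun p => (hp p).epi_g
  refine ShortComplex.ShortExact.mk' ?_ ?_ ?_
  · rw [ShortComplex.ShortExact.moduleCat_exact_iff_function_exact]
    intro (z : Cochain S.X₂ E n)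
    constructor
    · intro hz
      have hz' : ∀ p q hpq, S.f.f p ≫ z.v p q hpq = 0 := fun p q hpq =>
        (innerHomMap_v S.f E z p q hpq).symm.trans
          (congrArg (fun z : Cochain S.X₁ E n => z.v p q hpq) hz)
      refine ⟨(Cochain.mk fun p q hpq => (hp p).exact.desc (z.v p q hpq) (hz' p q hpq) :
        Cochain S.X₃ E n), Cochain.ext _ _ fun p q hpq => ?_⟩
      refine (innerHomMap_v S.g E _ p q hpq).trans ?_
      exact (hp p).exact.g_desc _ _
    · rintro ⟨z, rfl⟩
      exact ConcreteCategory.congr_hom (HomologicalComplex.congr_hom w n) z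
  · refine (ModuleCat.mono_iff_injective _).2 ((injective_iff_map_eq_zero _).2 fun z hz => ?_)
    refine Cochain.ext _ _ fun p q hpq => ?_
    have := (innerHomMap_v S.g E z p q hpq).symm.trans
      (congrArg (fun z : Cochain S.X₂ E n => z.v p q hpq) hz)
    rw [← cancel_epi (S.g.f p)]
    exact this.trans (comp_zero (f := S.g.f p) (Z := E.X q)).symm
  · refine (ModuleCat.epi_iff_surjective _).2 fun (z : Cochain S.X₁ E n) => ?_
    refine ⟨(Cochain.mk fun p q hpq => Injective.factorThru (z.v p q hpq) (S.f.f p) :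
      Cochain S.X₂ E n), Cochain.ext _ _ fun p q hpq => ?_⟩
    refine (innerHomMap_v S.f E _ p q hpq).trans ?_
    exact Injective.comp_factorThru _ _

/-- A map from `X` to `F →ₗ[B] E` is a map from `X ⊗ F` to `E`, and tensoring with the flat module
`F` preserves injections. -/
lemma injective_hom_of_flat {F E : Type u} [AddCommGroup F] [Module B F] [AddCommGroup E]
    [Module B E] [Module.Flat B F] [Module.Injective B E] : Module.Injective B (F →ₗ[B] E) := by
  refine ⟨fun X Z _ _ _ _ f hf g => ?_⟩
  obtain ⟨h, hh⟩ := Module.Injective.out (f.rTensor F)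
    (Module.Flat.rTensor_preserves_injective_linearMap f hf) (TensorProduct.lift g)
  refine ⟨TensorProduct.curry h, fun x => LinearMap.ext fun y => ?_⟩
  exact hh (x ⊗ₜ y)

lemma innerHom_bounded_injective (L E : CochainComplex (ModuleCat.{u} B) ℤ)
    (hE : ∀ n, Injective (E.X n)) (l m n : ℤ) (hb : ∀ p, p < l ∨ m < p → IsZero (E.X p))
    (hL : ∀ p, p ≠ n → IsZero (L.X p)) [Module.Flat B (L.X n)] :
    (∀ k, Injective ((innerHom L E).X k)) ∧
      ∀ k, k < l - n ∨ m - n < k → IsZero ((innerHom L E).X k) := by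
  constructor
  · intro k
    have (t : Triplet k) : Module.Injective B (L.X t.p ⟶ E.X t.q) := by
      by_cases hp : t.p = n
      · have : Module.Flat B (L.X t.p) := hp ▸ inferInstance
        have : Injective (ModuleCat.of B (E.X t.q)) := hE t.q
        have : Module.Injective B (E.X t.q) := Module.injective_module_of_injective_object _ _
        have h := injective_hom_of_flat (B := B) (F := L.X t.p) (E := E.X t.q)
        exact (Module.Baer.of_equiv (ModuleCat.homLinearEquiv (S := B)).symm
          (Module.Baer.iff_injective.2 h)).injective
      · have : Subsingleton (L.X t.p ⟶ E.X t.q) := ⟨fun f g => (hL t.p hp).eq_of_src _ _⟩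
        exact ⟨fun X Z _ _ _ _ f hf g => ⟨0, fun x => Subsingleton.elim _ _⟩⟩
    have : Module.Injective B (Cochain L E k) :=
      Module.Injective.pi B (fun t : Triplet k => (L.X t.p ⟶ E.X t.q))
    exact Module.injective_object_of_injective_module _ _
  · intro k hk
    rw [ModuleCat.isZero_iff_subsingleton]
    refine ⟨fun (z z' : Cochain L E k) => Cochain.ext _ _ fun p q hpq => ?_⟩
    by_cases hp : p = n
    · exact (hb q (by omega)).eq_of_tgt _ _
    · exact (hL p hp).eq_of_src _ _

/-- Complexes of modules that are built in finitely many steps from flat modules and acyclic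
complexes. The index bounds the degrees and the number of steps. -/
inductive FlatBuilt : ℕ → CochainComplex (ModuleCat.{u} B) ℤ → Prop
  | acyclic (c : ℕ) (L : CochainComplex (ModuleCat.{u} B) ℤ) (h : L.Acyclic) : FlatBuilt c L
  | flat (c : ℕ) (L : CochainComplex (ModuleCat.{u} B) ℤ) (n : ℤ) (hn : |n| ≤ c)
      (h : ∀ p, p ≠ n → IsZero (L.X p)) (h' : Module.Flat B (L.X n)) : FlatBuilt c L
  | ker (c : ℕ) (S : ShortComplex (CochainComplex (ModuleCat.{u} B) ℤ)) (h : S.ShortExact)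
      (h₂ : FlatBuilt (c + 1) S.X₂) (h₃ : FlatBuilt c S.X₃) : FlatBuilt (c + 1) S.X₁
  | ext (c : ℕ) (S : ShortComplex (CochainComplex (ModuleCat.{u} B) ℤ)) (h : S.ShortExact)
      (h₁ : FlatBuilt c S.X₁) (h₃ : FlatBuilt c S.X₃) : FlatBuilt c S.X₂

lemma FlatBuilt.succ {c : ℕ} {L : CochainComplex (ModuleCat.{u} B) ℤ} (h : FlatBuilt c L) :
    FlatBuilt (c + 1) L := by
  induction h with
  | acyclic c L h => exact .acyclic _ L h
  | flat c L n hn h h' => exact .flat _ L n (by push_cast; omega) h h'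
  | ker c S h _ _ h₂ h₃ => exact .ker _ S h h₂ h₃
  | ext c S h _ _ h₁ h₃ => exact .ext _ S h h₁ h₃

lemma FlatBuilt.mono {c c' : ℕ} (hc : c ≤ c') {L : CochainComplex (ModuleCat.{u} B) ℤ}
    (h : FlatBuilt c L) : FlatBuilt c' L := by
  induction hc with
  | refl => exact h
  | step _ ih => exact ih.succ

lemma FlatBuilt.of_iso {c : ℕ} {L L' : CochainComplex (ModuleCat.{u} B) ℤ} (h : FlatBuilt c L)
    (e : L' ≅ L) : FlatBuilt c L' := by
  have h0 : FlatBuilt c (0 : CochainComplex (ModuleCat.{u} B) ℤ) := .acyclic _ _ fun n =>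
    HomologicalComplex.ExactAt.of_isZero
      ((HomologicalComplex.eval _ _ n).map_isZero (isZero_zero _))
  refine .ext _ (ShortComplex.mk e.inv (0 : L' ⟶ 0) comp_zero) ?_ h h0
  have : Epi (0 : L' ⟶ (0 : CochainComplex (ModuleCat.{u} B) ℤ)) := ⟨fun _ _ _ => (isZero_zero _).eq_of_src _ _⟩
  exact ShortComplex.ShortExact.mk' ((ShortComplex.exact_iff_epi _ rfl).2
    (inferInstanceAs (Epi e.inv))) (inferInstanceAs (Mono e.inv)) this

/-- Homomorphisms into `E` turn a flat module into a bounded complex of injectives, an acyclic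
complex into an acyclic one, and short exact sequences into triangles. In a `ker` step the complex
obtained from `S.X₃` appears shifted by one, which accounts for the growth of the index. -/
lemma FlatBuilt.finInj {c : ℕ} {L : CochainComplex (ModuleCat.{u} B) ℤ} (h : FlatBuilt c L)
    (E : CochainComplex (ModuleCat.{u} B) ℤ) (hE : ∀ n, Injective (E.X n)) (l m : ℤ)
    (hb : ∀ p, p < l ∨ m < p → IsZero (E.X p)) :
    FinInj (|l| + |m| + 1 + c) (DerivedCategory.Q.obj (innerHom L E)) := by
  have : E.IsStrictlyGE l := (isStrictlyGE_iff _ _).2 fun p hp => hb p (Or.inl hp)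
  have := isKInjective_of_injective E l
  induction h with
  | acyclic c L h => exact FinInj.of_isZero (isZero_Q_of_acyclic _ (innerHom_acyclic h E))
  | flat c L n hn h h' =>
    obtain ⟨h1, h2⟩ := innerHom_bounded_injective L E hE l m n hb h
    have := neg_abs_le l
    have := le_abs_self m
    have := neg_abs_le n
    have := le_abs_self n
    have := abs_nonneg l
    have := abs_nonneg m
    exact finInj_of_bounded_injective _ h1 _ _ h2 _ (by omega) (by omega)
  | ker c S h _ _ h₂ h₃ =>
    obtain ⟨w, hw⟩ := innerHom_shortExact S h E hE
    have hT := rot_of_distTriang _ (DerivedCategory.triangleOfSES_distinguished hw)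
    exact FinInj.triangle _ hT h₂ (h₃.shift.mono (by push_cast; omega))
  | ext c S h _ _ h₁ h₃ =>
    obtain ⟨w, hw⟩ := innerHom_shortExact S h E hE
    exact FinInj.triangle _ (DerivedCategory.triangleOfSES_distinguished hw) h₃ h₁

lemma FlatBuilt.map {c : ℕ} {L : CochainComplex (ModuleCat.{u} B) ℤ} (h : FlatBuilt c L)
    (F : ModuleCat.{u} B ⥤ ModuleCat.{u} B) [F.Additive] [PreservesFiniteLimits F]
    [PreservesFiniteColimits F] (hF : ∀ M : ModuleCat.{u} B, Module.Flat B M → Module.Flat B (F.obj M)) :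
    FlatBuilt c ((F.mapHomologicalComplex _).obj L) := by
  induction h with
  | acyclic c L h =>
    refine .acyclic _ _ fun n => ?_
    exact ShortComplex.Exact.map (h n) F
  | flat c L n hn h h' => exact .flat _ _ n hn (fun p hp => F.map_isZero (h p hp)) (hF _ h')
  | ker c S h _ _ h₂ h₃ =>
    refine .ker _ (S.map (F.mapHomologicalComplex _)) ?_ h₂ h₃
    refine HomologicalComplex.shortExact_of_degreewise_shortExact _ fun n => ?_
    exact (h.map_of_exact (HomologicalComplex.eval _ _ n)).map_of_exact F
  | ext c S h _ _ h₁ h₃ =>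
    refine .ext _ (S.map (F.mapHomologicalComplex _)) ?_ h₁ h₃
    refine HomologicalComplex.shortExact_of_degreewise_shortExact _ fun n => ?_
    exact (h.map_of_exact (HomologicalComplex.eval _ _ n)).map_of_exact F

lemma FlatBuilt.shift {c : ℕ} {L : CochainComplex (ModuleCat.{u} B) ℤ} (h : FlatBuilt c L) :
    FlatBuilt (c + 1) (L⟦(1 : ℤ)⟧) := by
  have hS : ∀ S : ShortComplex (CochainComplex (ModuleCat.{u} B) ℤ), S.ShortExact →
      (S.map (CategoryTheory.shiftFunctor _ (1 : ℤ))).ShortExact := fun S h =>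
    HomologicalComplex.shortExact_of_degreewise_shortExact _ fun n =>
      h.map_of_exact (HomologicalComplex.eval _ _ (n + 1))
  induction h with
  | acyclic c L h =>
    refine .acyclic _ _ ((HomotopyCategory.quotient_obj_mem_subcategoryAcyclic_iff_acyclic _).1 ?_)
    exact (HomotopyCategory.subcategoryAcyclic _).prop_of_iso
      (((HomotopyCategory.quotient _ _).commShiftIso (1 : ℤ)).app L).symm
      ((HomotopyCategory.subcategoryAcyclic _).le_shift (1 : ℤ) _
        ((HomotopyCategory.quotient_obj_mem_subcategoryAcyclic_iff_acyclic _).2 h))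
  | flat c L n hn h h' =>
    refine .flat _ _ (n - 1) ((abs_sub n 1).trans (by push_cast; simpa using hn)) (fun p hp => h _ (fun e : p + 1 = n => hp (by omega))) ?_
    have e : n = n - 1 + 1 := by omega
    exact (congrArg (fun k => Module.Flat B (L.X k)) e).mp h'
  | ker c S h _ _ h₂ h₃ => exact .ker _ _ (hS S h) h₂ h₃
  | ext c S h _ _ h₁ h₃ => exact .ext _ _ (hS S h) h₁ h₃

end innerHom

/-! ### Localization and torsion of modules -/

section localization

variable {B : Type u} [CommRing B]

/-- Localization of modules at the powers of an element. -/
noncomputable def locFunctor (x : B) : ModuleCat.{u} B ⥤ ModuleCat.{u} B where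
  obj M := ModuleCat.of B (LocalizedModule (.powers x) M)
  map {M N} f := ModuleCat.ofHom (IsLocalizedModule.map (.powers x)
    (LocalizedModule.mkLinearMap (.powers x) M) (LocalizedModule.mkLinearMap (.powers x) N) f.hom)
  map_id M := ModuleCat.hom_ext (IsLocalizedModule.map_id _ _)
  map_comp f g := ModuleCat.hom_ext (IsLocalizedModule.map_comp' _ _ _ _ _ _)

instance (x : B) : (locFunctor x).Additive where
  map_add {M N f g} := ModuleCat.hom_ext (map_add (IsLocalizedModule.map (.powers x)
    (LocalizedModule.mkLinearMap (.powers x) M) (LocalizedModule.mkLinearMap (.powers x) N)) f.hom g.hom)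

lemma locFunctor_map_exact (x : B) (T : ShortComplex (ModuleCat.{u} B)) (h : T.Exact) :
    (T.map (locFunctor x)).Exact := by
  rw [ShortComplex.ShortExact.moduleCat_exact_iff_function_exact] at h ⊢
  exact IsLocalizedModule.map_exact (.powers x) (LocalizedModule.mkLinearMap (.powers x) T.X₁)
    (LocalizedModule.mkLinearMap (.powers x) T.X₂) (LocalizedModule.mkLinearMap (.powers x) T.X₃)
    T.f.hom T.g.hom h

lemma locFunctor_exact (x : B) :
    PreservesFiniteLimits (locFunctor x) ∧ PreservesFiniteColimits (locFunctor x) :=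
  ((Functor.exact_tfae (locFunctor x)).out 1 3).mp (locFunctor_map_exact x)

instance (x : B) : PreservesFiniteLimits (locFunctor x) := (locFunctor_exact x).1
instance (x : B) : PreservesFiniteColimits (locFunctor x) := (locFunctor_exact x).2

lemma flat_of_isLocalizedModule (S : Submonoid B) {M N : Type u} [AddCommGroup M] [Module B M]
    [AddCommGroup N] [Module B N] (f : M →ₗ[B] N) [IsLocalizedModule S f] [Module.Flat B M] :
    Module.Flat B N := by
  have h : Module.Flat B (LocalizedModule S M) :=
    Module.Flat.trans B (Localization S) (LocalizedModule S M)
  exact Module.Flat.of_linearEquiv (IsLocalizedModule.iso S f).symm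

/-- The localization map. -/
noncomputable def toLoc (x : B) : 𝟭 (ModuleCat.{u} B) ⟶ locFunctor x where
  app M := ModuleCat.ofHom (LocalizedModule.mkLinearMap (.powers x) M)
  naturality M N f := ModuleCat.hom_ext (LinearMap.ext fun m =>
    (IsLocalizedModule.map_apply (.powers x) (LocalizedModule.mkLinearMap (.powers x) M)
      (LocalizedModule.mkLinearMap (.powers x) N) f.hom m).symm)

lemma FlatBuilt.loc {c : ℕ} {L : CochainComplex (ModuleCat.{u} B) ℤ} (h : FlatBuilt c L) (x : B) :
    FlatBuilt c (((locFunctor x).mapHomologicalComplex _).obj L) :=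
  h.map (locFunctor x) fun M hM => flat_of_isLocalizedModule (N := LocalizedModule (.powers x) M)
    (.powers x) (LocalizedModule.mkLinearMap (.powers x) M)

/-- The submodule of elements that are torsion with respect to each element of a list. -/
def torsSub (s : List B) (M : Type*) [AddCommGroup M] [Module B M] : Submodule B M where
  carrier := {e | ∀ x ∈ s, ∃ n : ℕ, x ^ n • e = 0}
  zero_mem' x _ := ⟨0, smul_zero _⟩
  add_mem' {e e'} he he' x hx := by
    obtain ⟨n, hn⟩ := he x hx
    obtain ⟨m, hm⟩ := he' x hx
    exact ⟨n + m, by rw [smul_add, pow_smul_of_le hn (Nat.le_add_right _ _),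
      pow_smul_of_le hm (Nat.le_add_left _ _), add_zero]⟩
  smul_mem' b e he x hx := by
    obtain ⟨n, hn⟩ := he x hx
    exact ⟨n, by rw [smul_comm, hn, smul_zero]⟩

/-- The functor of torsion elements. -/
def torsFunctor (s : List B) : ModuleCat.{u} B ⥤ ModuleCat.{u} B where
  obj M := ModuleCat.of B (torsSub s M)
  map f := ModuleCat.ofHom (f.hom.restrict fun e he x hx => by
    obtain ⟨n, hn⟩ := he x hx
    exact ⟨n, by rw [← map_smul, hn, map_zero]⟩)

instance (s : List B) : (torsFunctor s).Additive where

/-- The inclusion of the elements with more torsion. -/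
def torsIncl (x : B) (s : List B) : torsFunctor (x :: s) ⟶ torsFunctor s where
  app M := ModuleCat.ofHom (Submodule.inclusion fun e he y hy => he y (List.mem_cons_of_mem _ hy) :
    torsSub (x :: s) M →ₗ[B] torsSub s M)

/-- Torsion elements can be divided by `y` up to multiplication by a power of `y`. -/
def TorsDiv (s : List B) (y : B) (M : Type*) [AddCommGroup M] [Module B M] : Prop :=
  ∀ e ∈ torsSub s M, ∃ e' ∈ torsSub s M, ∃ m : ℕ, y ^ (m + 1) • e' = y ^ m • e

lemma TorsDiv.pow {s : List B} {y : B} {M : Type*} [AddCommGroup M] [Module B M]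
    (h : TorsDiv s y M) (k : ℕ) (e : M) (he : e ∈ torsSub s M) :
    ∃ e' ∈ torsSub s M, ∃ m : ℕ, y ^ (m + k) • e' = y ^ m • e := by
  induction k with
  | zero => exact ⟨e, he, 0, rfl⟩
  | succ k ih =>
    obtain ⟨e1, he1, m, hm⟩ := ih
    obtain ⟨e2, he2, l, hl⟩ := h e1 he1
    refine ⟨e2, he2, l + m, ?_⟩
    rw [show l + m + (k + 1) = (m + k) + (l + 1) by omega, pow_add, mul_smul, hl, smul_comm, hm,
      ← mul_smul, ← pow_add]

/-- Everything except surjectivity onto the localization is formal. A fraction `e / x ^ n` is the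
image of any torsion element `e'` with `x ^ (m + n) • e' = x ^ m • e`, and the division property
supplies one. -/
lemma torsIncl_shortExact (x : B) (s : List B) (M : ModuleCat.{u} B) (h : TorsDiv s x M) :
    ∃ w, (ShortComplex.mk ((torsIncl x s).app M) ((toLoc x).app ((torsFunctor s).obj M)) w).ShortExact := by
  have hk : ∀ e : torsSub s M, LocalizedModule.mkLinearMap (.powers x) (torsSub s M) e = 0 ↔
      ∃ n : ℕ, x ^ n • e.1 = 0 := fun e => by
    rw [IsLocalizedModule.eq_zero_iff (.powers x)]
    constructor
    · rintro ⟨⟨_, n, rfl⟩, h⟩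
      exact ⟨n, congrArg Subtype.val h⟩
    · rintro ⟨n, h⟩
      exact ⟨⟨_, n, rfl⟩, Subtype.ext h⟩
  refine ⟨ModuleCat.hom_ext (LinearMap.ext fun e => (hk _).2 (e.2 x List.mem_cons_self)), ?_⟩
  refine ShortComplex.ShortExact.mk' ?_ ?_ ?_
  · rw [ShortComplex.ShortExact.moduleCat_exact_iff_function_exact]
    intro (e : torsSub s M)
    constructor
    · intro he
      refine ⟨(⟨e.1, fun y hy => ?_⟩ : torsSub (x :: s) M), rfl⟩
      rcases List.mem_cons.1 hy with rfl | hy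
      · exact (hk e).1 he
      · exact e.2 y hy
    · rintro ⟨e', rfl⟩
      exact (hk _).2 (e'.2 x List.mem_cons_self)
  · exact (ModuleCat.mono_iff_injective _).2 fun e e' h => Subtype.ext (congrArg (fun t : torsSub s M => t.1) h)
  · refine (ModuleCat.epi_iff_surjective _).2 fun z => ?_
    obtain ⟨⟨e, ⟨_, n, rfl⟩⟩, hz⟩ := IsLocalizedModule.surj (.powers x)
      (LocalizedModule.mkLinearMap (.powers x) (torsSub s M)) z
    obtain ⟨e', he', m, hm⟩ := h.pow n e.1 e.2
    refine ⟨(⟨e', he'⟩ : torsSub s M), ?_⟩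
    apply IsLocalizedModule.smul_injective (LocalizedModule.mkLinearMap (.powers x) (torsSub s M))
      (⟨_, m + n, rfl⟩ : Submonoid.powers x)
    have h1 : x ^ (m + n) • (⟨e', he'⟩ : torsSub s M) = x ^ m • e := Subtype.ext hm
    have h2 := congrArg (LocalizedModule.mkLinearMap (.powers x) (torsSub s M)) h1
    rw [map_smul, map_smul, ← hz] at h2
    refine h2.trans ?_
    change x ^ m • x ^ n • z = x ^ (m + n) • z
    rw [← mul_smul, pow_add]

/-- The torsion conditions are imposed one element at a time. Each is a kernel of a map to a
localization and so costs one `ker` step, whence the summand `s.length`. -/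
lemma FlatBuilt.tors {c : ℕ} {L : CochainComplex (ModuleCat.{u} B) ℤ} (hL : FlatBuilt c L) (s : List B)
    (h : ∀ t : List B, ∀ x, (x :: t) <:+ s → ∀ n, TorsDiv t x (L.X n)) :
    FlatBuilt (c + s.length) (((torsFunctor s).mapHomologicalComplex _).obj L) := by
  induction s with
  | nil =>
    refine hL.of_iso (HomologicalComplex.Hom.isoOfComponents (fun n =>
      (LinearEquiv.ofTop (torsSub [] (L.X n)) (eq_top_iff.2 fun e _ x hx =>
        absurd hx List.not_mem_nil)).toModuleIso) fun n m _ => rfl)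
  | cons x s ih =>
    have ih' := ih fun t y ht n => h t y (ht.trans (List.suffix_cons x s)) n
    choose w hw using fun n => torsIncl_shortExact x s (L.X n) (h s x List.suffix_rfl n)
    let S : ShortComplex (CochainComplex (ModuleCat.{u} B) ℤ) :=
      { X₁ := ((torsFunctor (x :: s)).mapHomologicalComplex _).obj L
        X₂ := ((torsFunctor s).mapHomologicalComplex _).obj L
        X₃ := ((locFunctor x).mapHomologicalComplex _).obj
          (((torsFunctor s).mapHomologicalComplex _).obj L)
        f := (NatTrans.mapHomologicalComplex (torsIncl x s) _).app L
        g :=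
          { f := fun n => (toLoc x).app _
            comm' := fun n m _ =>
              ((toLoc x).naturality ((((torsFunctor s).mapHomologicalComplex _).obj L).d n m)).symm }
        zero := by
          ext n : 1
          exact w n }
    exact .ker _ S (HomologicalComplex.shortExact_of_degreewise_shortExact _ hw) ih'.succ (ih'.loc x)

end localization

end HomFlip

namespace HomFlip

/-! ### Finite flat dimension of local cohomology and Čech complexes -/

section totComplex

variable {Y : Scheme.{u}} {A : GradedRingSheaf Y} {U V W : Y.Opens}

namespace Tot

variable {M N : GrMod A}

open Classical in
lemma mem_of_comp {hV : V ≤ U} (S : AddSubmonoid (Tot M hV)) (x : Tot M hV)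
    (h : ∀ k, of M hV k (comp M hV k x) ∈ S) : x ∈ S := by
  have h1 : x = ∑ k ∈ DFinsupp.support (show DirectSum ℤ fun k => (Γ(M.obj k, V) : Type u) from x),
      of M hV k (comp M hV k x) :=
    (DirectSum.sum_support_of (show DirectSum ℤ fun k => (Γ(M.obj k, V) : Type u) from x)).symm
  rw [h1]
  exact S.sum_mem fun k _ => h k

lemma exists_map_eq (f : M ⟶ N) (hV : V ≤ U) (x : Tot N hV)
    (h : ∀ k, ∃ t, sec (f.app k) V t = comp N hV k x) : ∃ t, map f hV t = x := by
  refine mem_of_comp (LinearMap.range (map f hV)).toAddSubmonoid x fun k => ?_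
  obtain ⟨t, ht⟩ := h k
  exact ⟨of M hV k t, by rw [map_of, ht]⟩

lemma map_injective (f : M ⟶ N) (hV : V ≤ U) (h : ∀ k, Function.Injective (sec (f.app k) V)) :
    Function.Injective (map f hV) := fun x y hxy => ext fun k => h k (by
  rw [← comp_map f hV, hxy, comp_map])

lemma comp_pow_smul {hV : V ≤ U} {d : ℤ} (a : Γ(A.gr d, U)) (n : ℕ) (k : ℤ) (x : Tot M hV)
    (h : A.incl U d a ^ n • x = 0) : A.incl U d a ^ n • of M hV k (comp M hV k x) = 0 := by
  obtain ⟨b, hb⟩ := A.exists_incl_pow U a n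
  have h1 : A.incl U _ b • x = 0 := by rw [← hb, h]
  rw [hb, incl_smul_of M hV rfl, ← comp_incl_smul M hV rfl, h1, map_zero, map_zero]

/-- The sections of the structure sheaf form the ring of sections. -/
noncomputable def selfAdd (A : GradedRingSheaf Y) (U : Y.Opens) :
    Tot A.self (le_refl U) ≃+ A.ring U := AddEquiv.refl (DirectSum ℤ (A.piece U))

lemma selfAdd_smul (d : ℤ) (a : Γ(A.gr d, U)) (x : Tot A.self (le_refl U)) :
    selfAdd A U (A.incl U d a • x) = A.incl U d a * selfAdd A U x := by
  induction x using induction with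
  | h0 => rw [smul_zero, map_zero, mul_zero]
  | hof k x =>
    rw [incl_smul_of A.self (le_refl U) rfl a x, res_self]
    exact (A.incl_mul U rfl a x).symm
  | hadd x y hx hy => rw [smul_add, map_add, hx, hy, map_add, mul_add]

/-- The sections of the structure sheaf form the ring of sections, as a module. -/
noncomputable def selfEquiv (A : GradedRingSheaf Y) (U : Y.Opens) :
    Tot A.self (le_refl U) ≃ₗ[A.ring U] A.ring U where
  __ := mkLinear (X := Tot A.self (le_refl U)) (selfAdd A U).toAddMonoidHom
    fun d a x => selfAdd_smul d a x
  invFun := (selfAdd A U).symm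
  left_inv := (selfAdd A U).symm_apply_apply
  right_inv := (selfAdd A U).apply_symm_apply

lemma flat_self (hU : IsAffineOpen U) (hA : ∀ i, QCoh (A.gr i)) (f : Γ(Y, U)) :
    Module.Flat (A.ring U) (Tot A.self (Y.basicOpen_le f)) := by
  have := isLocalizedModule_resTo (M := A.self) hU hA f
  have : Module.Flat (A.ring U) (Tot A.self (le_refl U)) :=
    Module.Flat.of_linearEquiv (selfEquiv A U)
  exact flat_of_isLocalizedModule (.powers (A.scal U f))
    (resTo A.self (le_refl U) (Y.basicOpen_le f) (Y.basicOpen_le f))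

end Tot

/-- The complex of sections of a complex of graded modules. -/
noncomputable abbrev totComplex (hV : V ≤ U) (K : CochainComplex (GrMod A) ℤ) :
    CochainComplex (ModuleCat.{u} (A.ring U)) ℤ :=
  ((Tot.functor A hV).mapHomologicalComplex _).obj K

lemma totComplex_acyclic (hV : V ≤ U) (hVa : IsAffineOpen V) (K : CochainComplex (GrMod A) ℤ)
    (hK : ∀ i, ((weightComplex A i).obj K).Acyclic) (hq : ∀ n i, QCoh ((K.X n).obj i)) :
    (totComplex hV K).Acyclic := by
  rw [moduleCat_acyclic_iff]
  intro n (x : Tot (K.X n) hV) hx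
  refine Tot.exists_map_eq (K.d (n - 1) n) hV x fun k => ?_
  refine exists_sec_of_acyclic ((weightComplex A k).obj K) (hK k) hVa n (hq _ _ _ hVa)
    (hq _ _ _ hVa) (Tot.comp _ hV k x) ?_
  exact (Tot.comp_map (K.d n (n + 1)) hV k x).symm.trans
    ((congrArg (Tot.comp _ hV k) hx).trans (map_zero _))

attribute [local instance] HasDerivedCategory.standard

open CochainComplex Pretriangulated

/-- The cone of `𝒜 → J` has acyclic sections over `D(f)`, and `J` is the kernel of the surjection
from this cone onto `𝒜[1]`. The latter is a flat module in degree `-1`, of index `1`; the `ker` step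
raises the index to `2`. -/
lemma flatBuilt_totComplex_J (hA : A.IsNoetherianOver) (J : InjRes A) (hU : IsAffineOpen U)
    (f : Γ(Y, U)) : FlatBuilt 2 (totComplex (Y.basicOpen_le f) J.J) := by
  let F := Tot.functor A (Y.basicOpen_le f)
  have hac : ∀ i, ((weightComplex A i).obj (mappingCone J.ι)).Acyclic := fun i =>
    (isZero_DWeight_iff i _).1 ((Triangle.isZero₃_iff_isIso₁ _
      ((DWeight A i).map_distinguished _ (Q_mappingCone_triangle_distinguished A J.ι))).2
      ((isIso_DWeight_Q_map_iff A i J.ι).2 (J.quasiIso i)))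
  have h1 : (totComplex (Y.basicOpen_le f) (mappingCone J.ι)).Acyclic :=
    totComplex_acyclic _ (hU.basicOpen f) _ hac fun n i =>
      qcoh_mappingCone _ _ _ (qcoh_single hA.qcoh) fun n i => J.qcoh n i
  have h2 : (mappingCone ((F.mapHomologicalComplex _).map J.ι)).Acyclic := fun n =>
    (h1 n).of_iso (mappingCone.mapHomologicalComplexIso J.ι F)
  refine .ker 1 (mappingCone.triangleRotateShortComplex ((F.mapHomologicalComplex _).map J.ι))
    (HomologicalComplex.shortExact_of_degreewise_shortExact _ fun n =>
      (mappingCone.triangleRotateShortComplexSplitting _ n).shortExact) (.acyclic _ _ h2) ?_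
  refine .flat _ _ (-1) (by simp) (fun p hp => ?_) ?_
  · exact F.map_isZero (HomologicalComplex.isZero_single_obj_X (ComplexShape.up ℤ) 0 A.self _
      (fun h : p + 1 = 0 => hp (by omega)))
  · have := Tot.flat_self hU hA.qcoh f
    let e : Tot (((CochainComplex.singleFunctor (GrMod A) 0).obj A.self).X 0) (Y.basicOpen_le f)
        ≃ₗ[A.ring U] Tot A.self (Y.basicOpen_le f) :=
      (F.mapIso (HomologicalComplex.singleObjXSelf (ComplexShape.up ℤ) 0 A.self)).toLinearEquiv
    exact Module.Flat.of_linearEquiv e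

open Classical in
-- As all the elements are homogeneous, the torsion condition holds for each weight component of `e`
-- and the division can be made weight by weight. The map `T` only replaces the action of `𝒜(U)` by
-- that of `𝒜(W)`, for which `TorsionLift` is formulated.
lemma Tot.torsionLift {M : GrMod A} (hM : TorsionLift M) (hW : W ≤ U) (hWa : IsAffineOpen W)
    (t : List (A.ring U)) (ht : ∀ x ∈ t, ∃ d, ∃ a : Γ(A.gr d, U), x = A.incl U d a) {c : ℤ}
    (y : Γ(A.gr c, U)) : TorsDiv t (A.incl U c y) (Tot M hW) := by
  let T := Tot.resSemi M hW (le_refl W) le_rfl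
  have hc : ∀ k x, Tot.comp M (le_refl W) k (T x) = Tot.comp M hW k x := fun k x =>
    (Tot.comp_mapAdd _ k x).trans (res_self _ _)
  have hTi : Function.Injective T := fun x x' h => Tot.ext fun k => by rw [← hc, h, hc]
  have hT : ∀ {d : ℤ} (a : Γ(A.gr d, U)) (n : ℕ) (x : Tot M hW), T (A.incl U d a ^ n • x) =
      A.incl W d (res _ hW a) ^ n • T x := fun a n x => by
    refine (Tot.resSemi_smul M hW le_rfl le_rfl hW _ x).trans ?_
    rw [map_pow, A.resRing_incl]
  have hTof : ∀ k x, T (Tot.of M hW k x) = Tot.of M le_rfl k x := fun k x => by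
    refine (Tot.resSemi_of M hW le_rfl le_rfl k x).trans ?_
    rw [res_self]
  choose d a hda using fun j : Fin t.length => ht t[j] (List.getElem_mem _)
  intro e he
  let S : AddSubmonoid (Tot M hW) :=
    { carrier := {e | ∃ e' ∈ torsSub t (Tot M hW), ∃ m : ℕ,
        A.incl U c y ^ (m + 1) • e' = A.incl U c y ^ m • e}
      zero_mem' := ⟨0, Submodule.zero_mem _, 0, by simp⟩
      add_mem' := by
        rintro e₁ e₂ ⟨e₁', h₁, m₁, hm₁⟩ ⟨e₂', h₂, m₂, hm₂⟩
        refine ⟨e₁' + e₂', Submodule.add_mem _ h₁ h₂, m₁ + m₂, ?_⟩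
        have h1 : A.incl U c y ^ (m₁ + m₂ + 1) • e₁' = A.incl U c y ^ (m₁ + m₂) • e₁ := by
          rw [show m₁ + m₂ + 1 = m₂ + (m₁ + 1) by omega, pow_add, mul_smul, hm₁, smul_smul,
            ← pow_add, add_comm m₂]
        have h2 : A.incl U c y ^ (m₁ + m₂ + 1) • e₂' = A.incl U c y ^ (m₁ + m₂) • e₂ := by
          rw [add_assoc, pow_add, mul_smul, hm₂, smul_smul, ← pow_add]
        rw [smul_add, smul_add, h1, h2] }
  refine Tot.mem_of_comp S e fun k => ?_
  obtain ⟨e', m, h1, h2⟩ := hM W hWa t.length d (fun j => res _ hW (a j)) c k (k - c) (by omega)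
    (res _ hW y) (Tot.comp M hW k e) fun j => by
      obtain ⟨n, hn⟩ := he t[j] (List.getElem_mem _)
      rw [hda] at hn
      refine ⟨n, ?_⟩
      rw [← hTof, ← hT, Tot.comp_pow_smul (a j) n k e hn, map_zero]
  refine ⟨Tot.of M hW _ e', fun x hx => ?_, m, hTi ?_⟩
  · obtain ⟨j, hj, rfl⟩ := List.getElem_of_mem hx
    obtain ⟨n, hn⟩ := h1 ⟨j, hj⟩
    refine ⟨n, hTi ?_⟩
    have h3 := hda ⟨j, hj⟩
    refine (congrArg (fun z => T (z ^ n • Tot.of M hW _ e')) h3).trans ?_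
    rw [hT, hTof, hn, map_zero]
  · rw [hT, hT, hTof, hTof, h2]

/-- Torsion sections over an affine open. -/
noncomputable def totTorsionEquiv (hA : ∀ i, QCoh (A.gr i)) (hU : IsAffineOpen U)
    {P : ℤ → Prop} (G : A.Gens P U) (hW : W ≤ U) (hWa : IsAffineOpen W) (M : GrMod A) :
    Tot ((GrMod.Gam A P).obj M) hW ≃ₗ[A.ring U] torsSub (List.ofFn G.x) (Tot M hW) :=
  (LinearEquiv.ofInjective (Tot.map ((GrMod.gamIncl A P).app M) hW)
    (Tot.map_injective _ hW fun k x y h => Subtype.ext h)).trans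
    (LinearEquiv.ofEq _ _ (by
      ext x
      constructor
      · rintro ⟨z, rfl⟩
        refine Tot.mem_of_comp ((torsSub (List.ofFn G.x) (Tot M hW)).toAddSubmonoid.comap
          (Tot.map ((GrMod.gamIncl A P).app M) hW).toAddMonoidHom) z fun k => ?_
        intro g hg
        obtain ⟨j, rfl⟩ := (List.mem_ofFn' _ _).1 hg
        obtain ⟨n, hn⟩ := (mem_torsion_iff M hA hU G hW hWa k _).1 (Tot.comp _ hW k z).2 j
        refine ⟨n, Eq.trans ?_ hn⟩
        exact congrArg (G.x j ^ n • ·) (Tot.map_of _ hW k _)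
      · intro hx
        refine Tot.exists_map_eq _ hW x fun k => ?_
        refine ⟨⟨Tot.comp M hW k x, (mem_torsion_iff M hA hU G hW hWa k _).2 fun j => ?_⟩, rfl⟩
        obtain ⟨n, hn⟩ := hx (G.x j) ((List.mem_ofFn' _ _).2 ⟨j, rfl⟩)
        exact ⟨n, Tot.comp_pow_smul _ n k x hn⟩))

/-- The generators of the ideal are chosen once over `U` and detect torsion over every basic open.
The bound depends only on their number, hence is uniform in `f`. -/
lemma flatBuilt_totComplex_RΓ [IsNoetherian Y] [Y.IsSeparated] (hA : A.IsNoetherianOver)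
    (J : InjRes A) (hU : IsAffineOpen U) (P : ℤ → Prop) :
    ∃ c, ∀ f : Γ(Y, U), FlatBuilt c (totComplex (Y.basicOpen_le f) (J.RΓ P)) := by
  have := hA.noetherian ⟨U, hU⟩
  obtain ⟨G⟩ := A.exists_gens P U
  have hs : ∀ x ∈ List.ofFn G.x, ∃ d, ∃ a : Γ(A.gr d, U), x = A.incl U d a := fun x hx => by
    obtain ⟨j, rfl⟩ := (List.mem_ofFn' _ _).1 hx
    exact ⟨_, _, rfl⟩
  refine ⟨2 + (List.ofFn G.x).length, fun f => ?_⟩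
  have h := (flatBuilt_totComplex_J hA J hU f).tors (List.ofFn G.x) fun t x ht n => by
    obtain ⟨c, y, rfl⟩ := hs x (ht.subset List.mem_cons_self)
    exact Tot.torsionLift (J.torsionLift hA n) _ (hU.basicOpen f) t
      (fun x hx => hs x (ht.subset (List.mem_cons_of_mem _ hx))) y
  refine h.of_iso (HomologicalComplex.Hom.isoOfComponents (fun n =>
    (totTorsionEquiv hA.qcoh hU G (Y.basicOpen_le f) (hU.basicOpen f) (J.J.X n)).toModuleIso)
    fun n m _ => ?_)
  refine ModuleCat.hom_ext (LinearMap.ext fun x => Subtype.ext ?_)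
  have h1 := congrArg (fun g => (g : (J.RΓ P).X n ⟶ J.J.X m)) ((GrMod.gamIncl A P).naturality (J.J.d n m))
  exact (ConcreteCategory.congr_hom (((Tot.functor A (Y.basicOpen_le f)).map_comp _ _).symm.trans
    ((congrArg (Tot.functor A (Y.basicOpen_le f)).map h1).trans
      ((Tot.functor A (Y.basicOpen_le f)).map_comp _ _))) x).symm

lemma flatBuilt_totComplex_shift {c : ℕ} {hV : V ≤ U} {K : CochainComplex (GrMod A) ℤ}
    (h : FlatBuilt c (totComplex hV K)) : FlatBuilt (c + 1) (totComplex hV (K⟦(1 : ℤ)⟧)) :=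
  h.shift.of_iso ((((Tot.functor A hV).mapHomologicalComplex
    (ComplexShape.up ℤ)).commShiftIso (1 : ℤ)).app K)

lemma flatBuilt_totComplex_mappingCone {c : ℕ} {hV : V ≤ U} {K L : CochainComplex (GrMod A) ℤ} (f : K ⟶ L)
    (hK : FlatBuilt c (totComplex hV K)) (hL : FlatBuilt c (totComplex hV L)) :
    FlatBuilt (c + 1) (totComplex hV (mappingCone f)) := by
  let F := Tot.functor A hV
  refine (FlatBuilt.ext _ (mappingCone.triangleRotateShortComplex ((F.mapHomologicalComplex _).map f))
    (HomologicalComplex.shortExact_of_degreewise_shortExact _ fun n =>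
      (mappingCone.triangleRotateShortComplexSplitting _ n).shortExact) hL.succ hK.shift).of_iso
    (mappingCone.mapHomologicalComplexIso f F)

end totComplex

end HomFlip

namespace HomFlip

open CochainComplex HomComplex Pretriangulated

/-! ### Test complexes and locally finite injective dimension -/

section test

variable {Y : Scheme.{u}} {A : GradedRingSheaf Y} {U V W : Y.Opens}

/-- A complex of free modules with finite homogeneous bases. -/
structure GradedFree (A : GradedRingSheaf Y) (U : Y.Opens)
    (Q : CochainComplex (ModuleCat.{u} (A.ring U)) ℤ) where
  rk : ℤ → ℕ
  basis (p : ℤ) : Module.Basis (Fin (rk p)) (A.ring U) (Q.X p)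
  deg (p : ℤ) : Fin (rk p) → ℤ
  homog (p q : ℤ) (t : Fin (rk p)) (v : Fin (rk q)) :
    ∃ a : Γ(A.gr (deg p t - deg q v), U), (basis q).repr (Q.d p q (basis p t)) v = A.incl U _ a

/-- A free graded complex concentrated in degrees `n - s, …, n` whose cohomology is concentrated
in the two extreme degrees. -/
structure GradedFree.IsTest {Q : CochainComplex (ModuleCat.{u} (A.ring U)) ℤ}
    (F : GradedFree A U Q) (n s : ℤ) : Prop where
  rk_eq_zero (p : ℤ) (hp : p < n - s ∨ n < p) : F.rk p = 0
  exactAt (p : ℤ) (hp : n - s < p) (hp' : p < n) : Q.ExactAt p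

lemma GradedFree.isZero {Q : CochainComplex (ModuleCat.{u} (A.ring U)) ℤ}
    (F : GradedFree A U Q) {p : ℤ} (hp : F.rk p = 0) : IsZero (Q.X p) := by
  rw [ModuleCat.isZero_iff_subsingleton]
  have : IsEmpty (Fin (F.rk p)) := by rw [hp]; infer_instance
  exact (F.basis p).repr.toEquiv.subsingleton

lemma exists_common_open {y : Y} {n : ℕ} (P : Fin n → Y.Opens → Prop)
    (mono : ∀ t V V', V' ≤ V → P t V → P t V') (hy : y ∈ V)
    (h : ∀ t, ∃ V' ≤ V, y ∈ V' ∧ P t V') : ∃ V' ≤ V, y ∈ V' ∧ ∀ t, P t V' := by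
  induction n with
  | zero => exact ⟨V, le_rfl, hy, fun t => t.elim0⟩
  | succ n ih =>
    obtain ⟨V₁, h1, hy1, hP1⟩ := ih (fun t => P t.succ) (fun t => mono _) fun t => h _
    obtain ⟨V₂, h2, hy2, hP2⟩ := h 0
    exact ⟨V₁ ⊓ V₂, inf_le_left.trans h1, ⟨hy1, hy2⟩, Fin.cases (mono _ _ _ inf_le_right hP2)
      fun t => mono _ _ _ inf_le_left (hP1 t)⟩

lemma Tot.exists_locally (K : CochainComplex (GrMod A) ℤ)
    (hK : ∀ i, ((weightComplex A i).obj K).Acyclic) (hV : V ≤ U) {y : Y} (hy : y ∈ V) (q : ℤ)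
    (x : Tot (K.X q) hV) (hx : Tot.map (K.d q (q + 1)) hV x = 0) :
    ∃ V', ∃ h : V' ≤ V, y ∈ V' ∧ ∃ t : Tot (K.X (q - 1)) (h.trans hV),
      Tot.map (K.d (q - 1) q) (h.trans hV) t = Tot.resTo _ hV h (h.trans hV) x := by
  let S : AddSubmonoid (Tot (K.X q) hV) :=
    { carrier := {x | ∃ V', ∃ h : V' ≤ V, y ∈ V' ∧ ∃ t : Tot (K.X (q - 1)) (h.trans hV),
        Tot.map (K.d (q - 1) q) (h.trans hV) t = Tot.resTo _ hV h (h.trans hV) x}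
      zero_mem' := ⟨V, le_rfl, hy, 0, by simp⟩
      add_mem' := by
        rintro x x' ⟨V₁, h₁, hy₁, t₁, ht₁⟩ ⟨V₂, h₂, hy₂, t₂, ht₂⟩
        have l1 : V₁ ⊓ V₂ ≤ V₁ := inf_le_left
        have l2 : V₁ ⊓ V₂ ≤ V₂ := inf_le_right
        refine ⟨V₁ ⊓ V₂, l1.trans h₁, ⟨hy₁, hy₂⟩,
          Tot.resTo _ _ l1 ((l1.trans h₁).trans hV) t₁ + Tot.resTo _ _ l2 ((l1.trans h₁).trans hV) t₂, ?_⟩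
        rw [map_add, map_add, ← Tot.resTo_map, ← Tot.resTo_map, ht₁, ht₂, Tot.resTo_resTo,
          Tot.resTo_resTo] }
  refine Tot.mem_of_comp S x fun k => ?_
  obtain ⟨V', h, hyV, t, ht⟩ := (acyclic_iff_locally _).1 (hK k) q V (Tot.comp _ hV k x)
    ((Tot.comp_map (K.d q (q + 1)) hV k x).symm.trans
      ((congrArg (Tot.comp _ hV k) hx).trans (map_zero _))) y hy
  change Γ((K.X (q - 1)).obj k, V') at t
  refine ⟨V', h, hyV, Tot.of (K.X (q - 1)) (h.trans hV) k t, ?_⟩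
  refine (Tot.map_of _ _ _ _).trans (Eq.trans ?_ (Tot.resTo_of (K.X q) hV h (h.trans hV) k _).symm)
  exact congrArg (Tot.of (K.X q) (h.trans hV) k) ht

/-- Restriction of complexes of sections. -/
noncomputable def totRes (hV : V ≤ U) (h : W ≤ V) (K : CochainComplex (GrMod A) ℤ) :
    totComplex hV K ⟶ totComplex (h.trans hV) K :=
  (NatTrans.mapHomologicalComplex (Tot.resTrans A hV h (h.trans hV)) _).app K

lemma totRes_totRes {W' : Y.Opens} (hV : V ≤ U) (h : W ≤ V) (h' : W' ≤ W)
    (K : CochainComplex (GrMod A) ℤ) :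
    totRes hV h K ≫ totRes (h.trans hV) h' K = totRes hV (h'.trans h) K := by
  ext p x
  exact Tot.resTo_resTo _ hV h _ h' _ x

/-- Acyclicity as a complex of sheaves provides a primitive of each basis image near `y`; finitely
many basis elements have a common neighbourhood. -/
lemma GradedFree.exists_lift {Q : CochainComplex (ModuleCat.{u} (A.ring U)) ℤ}
    (F : GradedFree A U Q) (K : CochainComplex (GrMod A) ℤ)
    (hK : ∀ i, ((weightComplex A i).obj K).Acyclic) (hV : V ≤ U) {y : Y} (hy : y ∈ V) (p q : ℤ)
    (r : Q.X p ⟶ (totComplex hV K).X q) (hr : r ≫ (totComplex hV K).d q (q + 1) = 0) :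
    ∃ V', ∃ h : V' ≤ V, y ∈ V' ∧ ∃ g : Q.X p ⟶ (totComplex (h.trans hV) K).X (q - 1),
      g ≫ (totComplex (h.trans hV) K).d (q - 1) q = r ≫ (totRes hV h K).f q := by
  let r' : Q.X p →ₗ[A.ring U] Tot (K.X q) hV := r.hom
  obtain ⟨V', h, hyV, hg⟩ := exists_common_open (V := V) (y := y) (n := F.rk p)
    (fun t V' => ∃ h : V' ≤ V, ∃ z : Tot (K.X (q - 1)) (h.trans hV),
      Tot.map (K.d (q - 1) q) (h.trans hV) z =
        Tot.resTo _ hV h (h.trans hV) (r' (F.basis p t)))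
    (fun t V₁ V₂ h12 ⟨h, z, hz⟩ => ⟨h12.trans h, Tot.resTo _ _ h12 _ z, by
      rw [← Tot.resTo_map, hz, Tot.resTo_resTo]⟩) hy fun t => by
      obtain ⟨V', h, hy, hz⟩ := Tot.exists_locally K hK hV hy q (r' (F.basis p t))
        (congrArg (fun g => ModuleCat.Hom.hom g (F.basis p t)) hr)
      exact ⟨V', h, hy, h, hz⟩
  choose h' z hz using hg
  let g : Q.X p →ₗ[A.ring U] Tot (K.X (q - 1)) (h.trans hV) := 
    (F.basis p).constr (M' := Tot (K.X (q - 1)) (h.trans hV)) ℕ z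
  refine ⟨V', h, hyV, ModuleCat.ofHom g, ?_⟩
  refine ModuleCat.hom_ext ((F.basis p).ext fun t => ?_)
  refine Eq.trans ?_ (hz t)
  exact congrArg (Tot.map (K.d (q - 1) q) (h.trans hV)) 
    ((F.basis p).constr_basis (M' := Tot (K.X (q - 1)) (h.trans hV)) ℕ z t)

/-- The homotopy is built by descending induction from the top degree `m`, shrinking the
neighbourhood at each step; finitely many degrees suffice. Quasi-coherence of `K` is not assumed, so
a homotopy exists only after restriction. -/
lemma GradedFree.exists_nullHomotopy {Q : CochainComplex (ModuleCat.{u} (A.ring U)) ℤ}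
    (F : GradedFree A U Q) (l m : ℤ) (hF : ∀ p, p < l ∨ m < p → F.rk p = 0)
    (K : CochainComplex (GrMod A) ℤ)
    (hK : ∀ i, ((weightComplex A i).obj K).Acyclic) (hV : V ≤ U) {y : Y} (hy : y ∈ V)
    (f : Q ⟶ totComplex hV K) :
    ∃ V', ∃ h : V' ≤ V, y ∈ V' ∧ Nonempty (Homotopy (f ≫ totRes hV h K) 0) := by
  have key : ∀ k : ℕ, ∃ V', ∃ h : V' ≤ V, y ∈ V' ∧
      ∃ z : Cochain Q (totComplex (h.trans hV) K) (-1), ∀ p, m - k < p →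
        (Cochain.ofHom (f ≫ totRes hV h K) - δ (-1) 0 z).v p p (add_zero p) = 0 := by
    intro k
    induction k with
    | zero =>
      exact ⟨V, le_rfl, hy, 0, fun p hp => (F.isZero (hF p (Or.inr (by simpa using hp)))).eq_of_src _ _⟩
    | succ k ih =>
      obtain ⟨V₁, h₁, hy₁, z, hz⟩ := ih
      let c := Cochain.ofHom (f ≫ totRes hV h₁ K) - δ (-1) 0 z
      let p := m - k
      have hc : δ 0 1 c = 0 := by
        rw [δ_sub, δ_δ, δ_ofHom, sub_zero]
      have hr : c.v p p (add_zero p) ≫ (totComplex (h₁.trans hV) K).d p (p + 1) = 0 := by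
        have h2 := δ_v 0 1 rfl c p (p + 1) rfl p (p + 1) (by omega) rfl
        rw [hc, hz (p + 1) (by omega), comp_zero, smul_zero, add_zero] at h2
        exact h2.symm
      obtain ⟨V₂, h₂, hy₂, g, hg⟩ := F.exists_lift K hK (h₁.trans hV) hy₁ p p _ hr
      let ρ := totRes (h₁.trans hV) h₂ K
      -- In degree `p` the remaining error is a cocycle, because the errors in higher degrees are
      -- already zero. The local lift `g` of this cocycle, placed in degree `p` alone, removes it
      -- without disturbing the higher degrees.
      refine ⟨V₂, h₂.trans h₁, hy₂, z.comp (Cochain.ofHom ρ) (add_zero _) + Cochain.single g (-1),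
        fun p' hp' => ?_⟩
      have e1 : Cochain.ofHom (f ≫ totRes hV (h₂.trans h₁) K) -
          δ (-1) 0 (z.comp (Cochain.ofHom ρ) (add_zero _) + Cochain.single g (-1)) =
          c.comp (Cochain.ofHom ρ) (add_zero _) - δ (-1) 0 (Cochain.single g (-1)) := by
        rw [δ_add, δ_comp_ofHom, Cochain.sub_comp, ← Cochain.ofHom_comp, Category.assoc,
          totRes_totRes]
        abel
      rw [e1, Cochain.sub_v, Cochain.comp_zero_cochain_v, Cochain.ofHom_v,
        δ_v (-1) 0 rfl _ p' p' (add_zero p') (p' - 1) (p' + 1) (by omega) (by omega)]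
      by_cases hpp : p' = p
      · subst hpp
        rw [Cochain.single_v, Cochain.single_v_eq_zero _ _ _ _ _ (by omega), comp_zero, smul_zero,
          add_zero, hg, sub_self]
      · rw [Cochain.single_v_eq_zero _ _ _ _ _ hpp, Cochain.single_v_eq_zero _ _ _ _ _ (by omega),
          zero_comp, comp_zero, smul_zero, add_zero, sub_zero]
        have : c.v p' p' (add_zero p') = 0 := hz p' (by push_cast at hp'; omega)
        rw [this, zero_comp]
  obtain ⟨V', h, hyV, z, hz⟩ := key (m - l + 1).toNat
  refine ⟨V', h, hyV, ⟨(Cochain.equivHomotopy _ _).symm ⟨z, ?_⟩⟩⟩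
  rw [Cochain.ofHom_zero, add_zero, ← sub_eq_zero]
  refine Cochain.ext₀ _ _ fun p => ?_
  by_cases hp : p < l
  · exact (F.isZero (hF p (Or.inl hp))).eq_of_src _ _
  · exact hz p (by omega)

/-- The functor of sections on the homotopy category. -/
noncomputable abbrev KTot (hV : V ≤ U) :
    KGr A ⥤ HomotopyCategory (ModuleCat.{u} (A.ring U)) (ComplexShape.up ℤ) :=
  (Tot.functor A hV).mapHomotopyCategory _

/-- Restriction of sections on the homotopy category. -/
noncomputable def KTot.res (hV : V ≤ U) (h : W ≤ V) :
    KTot (A := A) hV ⟶ KTot (h.trans hV) :=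
  NatTrans.mapHomotopyCategory (Tot.resTrans A hV h (h.trans hV)) _

/-- Morphisms from test complexes in high degree vanish locally. -/
def IsLocallyFinInj (A : GradedRingSheaf Y) (U : Y.Opens) (K : KGr A) : Prop :=
  ∃ n₀ : ℤ, ∀ n s, n₀ ≤ n → n + n₀ ≤ s → ∀ (Q : CochainComplex (ModuleCat.{u} (A.ring U)) ℤ)
    (F : GradedFree A U Q), F.IsTest n s → ∀ (V : Y.Opens) (hV : V ≤ U),
      ∀ y ∈ V, ∀ f : (HomotopyCategory.quotient _ _).obj Q ⟶ (KTot hV).obj K,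
        ∃ V', ∃ h : V' ≤ V, y ∈ V' ∧ f ≫ (KTot.res hV h).app K = 0

lemma KTot.res_res {W' : Y.Opens} (hV : V ≤ U) (h : W ≤ V) (h' : W' ≤ W) (K : KGr A) :
    (KTot.res hV h).app K ≫ (KTot.res (h.trans hV) h').app K = (KTot.res hV (h'.trans h)).app K := by
  have h1 : Tot.resTrans A hV h (h.trans hV) ≫ Tot.resTrans A (h.trans hV) h' (h'.trans (h.trans hV)) =
      Tot.resTrans A hV (h'.trans h) ((h'.trans h).trans hV) := by
    ext M x
    exact Tot.resTo_resTo _ hV h _ h' _ x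
  exact (congrArg (fun t => NatTrans.app t K) (NatTrans.mapHomotopyCategory_comp (ComplexShape.up ℤ)
    (Tot.resTrans A hV h (h.trans hV)) (Tot.resTrans A (h.trans hV) h' _))).symm.trans
    (congrArg (fun t => (NatTrans.mapHomotopyCategory t (ComplexShape.up ℤ)).app K) h1)

/-- One restriction kills the composite with the map to the third object, so the restricted morphism
factors through the first object; a second restriction kills that factor. -/
lemma IsLocallyFinInj.triangle (T : Triangle (KGr A)) (hT : T ∈ distTriang _)
    (h₁ : IsLocallyFinInj A U T.obj₁) (h₃ : IsLocallyFinInj A U T.obj₃) :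
    IsLocallyFinInj A U T.obj₂ := by
  obtain ⟨n, hn⟩ := h₁
  obtain ⟨m, hm⟩ := h₃
  refine ⟨max n m, fun k s hk hs Q F hF V hV y hy f => ?_⟩
  have := le_max_left n m
  have := le_max_right n m
  obtain ⟨V₁, h₁, hy₁, e₁⟩ := hm k s (by omega) (by omega) Q F hF V hV y hy (f ≫ (KTot hV).map T.mor₂)
  have hT' := (KTot (A := A) (h₁.trans hV)).map_distinguished T hT
  obtain ⟨g, hg⟩ := Triangle.coyoneda_exact₂ _ hT' (f ≫ (KTot.res hV h₁).app T.obj₂) (by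
    have := (KTot.res hV h₁).naturality T.mor₂
    rw [Category.assoc] at e₁
    exact (Category.assoc _ _ _).trans ((congrArg (f ≫ ·) this.symm).trans e₁))
  obtain ⟨V₂, h₂, hy₂, e₂⟩ := hn k s (by omega) (by omega) Q F hF V₁ (h₁.trans hV) y hy₁ g
  refine ⟨V₂, h₂.trans h₁, hy₂, ?_⟩
  rw [← KTot.res_res hV h₁ h₂, ← Category.assoc]
  refine (congrArg (· ≫ (KTot.res (h₁.trans hV) h₂).app T.obj₂) hg).trans ?_
  refine (Category.assoc _ _ _).trans ((congrArg (g ≫ ·) ((KTot.res (h₁.trans hV) h₂).naturality T.mor₁)).trans ?_)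
  exact (Category.assoc _ _ _).symm.trans
    ((congrArg (· ≫ (KTot (h₂.trans (h₁.trans hV))).map T.mor₁) e₂).trans zero_comp)

/-- It is for this statement, which makes the condition invariant under quasi-isomorphism, that
vanishing is demanded only locally. -/
lemma IsLocallyFinInj.of_acyclic (K : KGr A) (hK : acyclicGr A K) : IsLocallyFinInj A U K := by
  refine ⟨0, fun n s _ _ Q F hF V hV y hy f => ?_⟩
  obtain ⟨K, rfl⟩ : ∃ K', (KGr.q A).obj K' = K := ⟨K.as, rfl⟩
  obtain ⟨f, rfl⟩ := (HomotopyCategory.quotient _ _).map_surjective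
    (X := Q) (Y := totComplex hV K) f
  obtain ⟨V', h, hy', ⟨H⟩⟩ := F.exists_nullHomotopy (n - s) n hF.rk_eq_zero K
    (fun i => (acyclicIn_q_iff A i K).1 (hK i)) hV hy f
  refine ⟨V', h, hy', ?_⟩
  have e := HomotopyCategory.eq_of_homotopy _ _ H
  rw [Functor.map_comp, Functor.map_zero] at e
  exact e

lemma acyclicGr_of_isZero (K : KGr A) (h : IsZero ((Qh A).obj K)) : acyclicGr A K := by
  obtain ⟨K, rfl⟩ : ∃ K', (KGr.q A).obj K' = K := ⟨K.as, rfl⟩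
  let := HasDerivedCategory.standard Y.Modules
  intro i
  rw [acyclicIn_q_iff, ← isZero_DWeight_iff]
  exact (DWeight A i).map_isZero (h.of_iso ((qCompQhIso A).symm.app K))

lemma IsLocallyFinInj.of_iso_target {K L : KGr A} (f : K ⟶ L) (hf : IsIso ((Qh A).map f))
    (h : IsLocallyFinInj A U K) : IsLocallyFinInj A U L := by
  obtain ⟨Z, g, k, hT⟩ := distinguished_cocone_triangle f
  have hZ := acyclicGr_of_isZero Z ((Triangle.isZero₃_iff_isIso₁ _
    ((Qh A).map_distinguished _ hT)).2 hf)
  exact IsLocallyFinInj.triangle _ hT h (.of_acyclic Z hZ)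

lemma IsLocallyFinInj.of_iso_source {K L : KGr A} (f : K ⟶ L) (hf : IsIso ((Qh A).map f))
    (h : IsLocallyFinInj A U L) : IsLocallyFinInj A U K := by
  obtain ⟨Z, g, k, hT⟩ := distinguished_cocone_triangle₁ f
  have hZ := acyclicGr_of_isZero Z ((Triangle.isZero₁_iff_isIso₂ _
    ((Qh A).map_distinguished _ hT)).2 hf)
  exact IsLocallyFinInj.triangle _ hT (.of_acyclic Z hZ) h

/-- An isomorphism in the derived category is a fraction whose numerator and denominator both become
invertible. -/
lemma IsLocallyFinInj.of_iso {K L : KGr A} (e : (Qh A).obj K ≅ (Qh A).obj L)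
    (h : IsLocallyFinInj A U K) : IsLocallyFinInj A U L := by
  obtain ⟨φ, hφ⟩ := Localization.exists_leftFraction (Qh A) (acyclicGr A).trW e.hom
  have h1 : IsIso ((Qh A).map φ.s) := Localization.inverts (Qh A) (acyclicGr A).trW _ φ.hs
  have h2 : (Qh A).map φ.f = e.hom ≫ (Qh A).map φ.s := by
    rw [hφ, MorphismProperty.LeftFraction.map_comp_map_s]
  have h3 : IsIso ((Qh A).map φ.f) := by rw [h2]; infer_instance
  exact (h.of_iso_target φ.f h3).of_iso_source φ.s h1

end test

end HomFlip

namespace HomFlip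

open CochainComplex HomComplex Pretriangulated

attribute [local instance] HasDerivedCategory.standard

/-! ### Vanishing of morphisms from test complexes -/

section truncation

variable {B : Type u} [CommRing B]

lemma isZero_homology_Q_iff (Q : CochainComplex (ModuleCat.{u} B) ℤ) (p : ℤ) :
    IsZero ((DerivedCategory.homologyFunctor _ p).obj (DerivedCategory.Q.obj Q)) ↔ Q.ExactAt p :=
  (((DerivedCategory.homologyFunctorFactors _ p).app Q).isZero_iff).trans
    (HomologicalComplex.exactAt_iff_isZero_homology _ _).symm

/-- Morphisms from a complex with cohomology in two degrees only to an object of finite injective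
dimension. -/
lemma FinInj.eq_zero_of_exactAt {X : DerivedCategory (ModuleCat.{u} B)} {n₀ : ℤ} (h₀ : 0 < n₀)
    (hX : FinInj n₀ X) {n s : ℤ} (hn : n₀ ≤ n) (hs : n + n₀ ≤ s)
    (Q : CochainComplex (ModuleCat.{u} B) ℤ) (hQ : ∀ p, n - s < p → p ≠ n → Q.ExactAt p)
    (f : DerivedCategory.Q.obj Q ⟶ X) : f = 0 := by
  -- Truncation at `n - s ≤ -n₀`. The lower part `X₁` has no maps to `X` by the second clause of
  -- `FinInj`. The upper part `X₃` has cohomology only in degree `n ≥ n₀`, so it is `Z[-n]` for a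
  -- module `Z`, and the first clause applies.
  obtain ⟨X₁, X₃, hX₁, hX₃, a, b, c, hT⟩ :=
    DerivedCategory.TStructure.t.exists_triangle (DerivedCategory.Q.obj Q) (n - s) (n - s + 1) rfl
  have i1 : X₁.IsLE (n - s) := ⟨hX₁⟩
  have i3 : X₃.IsGE (n - s + 1) := ⟨hX₃⟩
  have hz : ∀ p, p ≠ n → IsZero ((DerivedCategory.homologyFunctor _ p).obj X₃) := by
    intro p hp
    by_cases hps : p < n - s + 1
    · exact DerivedCategory.isZero_of_isGE X₃ (n - s + 1) p hps
    · refine (DerivedCategory.HomologySequence.exact₃ _ hT p (p + 1) rfl).isZero_of_both_zeros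
        (IsZero.eq_of_src ?_ _ _) (IsZero.eq_of_tgt ?_ _ _)
      · exact (isZero_homology_Q_iff Q p).2 (hQ p (by omega) hp)
      · exact DerivedCategory.isZero_of_isLE X₁ (n - s) (p + 1) (by omega)
  have j1 : X₃.IsGE n := (DerivedCategory.isGE_iff _ _).2 fun p hp => hz p (by omega)
  have j2 : X₃.IsLE n := (DerivedCategory.isLE_iff _ _).2 fun p hp => hz p (by omega)
  obtain ⟨Z, ⟨e⟩⟩ := DerivedCategory.exists_iso_singleFunctor_obj_of_isGE_of_isLE X₃ n
  let e' : (CategoryTheory.shiftFunctor _ (-n)).obj ((DerivedCategory.singleFunctor _ 0).obj Z) ≅ X₃ :=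
    ((DerivedCategory.singleFunctors (ModuleCat.{u} B)).shiftIso (-n) n 0 (by omega)).app Z ≪≫ e.symm
  obtain ⟨g, rfl⟩ := Triangle.yoneda_exact₂ _ hT f (hX.2 X₁
    (DerivedCategory.TStructure.t.isLE_of_le X₁ (n - s) (-n₀) (by omega)) _)
  change X₃ ⟶ X at g
  have hg : g = 0 := by
    rw [← cancel_epi e'.hom, comp_zero]
    exact hX.1 n (by omega) Z _
  exact (congrArg (b ≫ ·) hg).trans comp_zero

variable {Y : Scheme.{u}} {A : GradedRingSheaf Y} {U V W : Y.Opens}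

/-- A test complex is a bounded above complex of projectives, hence K-projective: its maps in the
derived category are homotopy classes of chain maps. -/
lemma GradedFree.exists_homotopy_of_finInj {I : CochainComplex (ModuleCat.{u} (A.ring U)) ℤ}
    {n₀ : ℤ} (h₀ : 0 < n₀) (hI : FinInj n₀ (DerivedCategory.Q.obj I)) {n s : ℤ} (hn : n₀ ≤ n)
    (hs : n + n₀ ≤ s) {Q : CochainComplex (ModuleCat.{u} (A.ring U)) ℤ} (F : GradedFree A U Q)
    (hF : F.IsTest n s) (f : Q ⟶ I) : Nonempty (Homotopy f 0) := by
  have i1 : Q.IsStrictlyLE n := (isStrictlyLE_iff _ _).2 fun p hp =>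
    F.isZero (hF.rk_eq_zero p (Or.inr hp))
  have i2 : ∀ p, Projective (Q.X p) := fun p => by
    have := Module.Projective.of_basis (F.basis p)
    exact IsProjective.iff_projective _ |>.1 this
  have i3 := isKProjective_of_projective Q n
  have h0 := hI.eq_zero_of_exactAt h₀ hn hs Q (fun p hp hpn => by
    by_cases hp' : n < p
    · exact HomologicalComplex.ExactAt.of_isZero (F.isZero (hF.rk_eq_zero p (Or.inr hp')))
    · exact hF.exactAt p hp (by omega)) (DerivedCategory.Q.map f)
  refine ⟨HomotopyCategory.homotopyOfEq _ _ ((IsKProjective.Qh_map_bijective Q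
    ((HomotopyCategory.quotient _ _).obj I)).1 ?_)⟩
  rw [Functor.map_zero, Functor.map_zero]
  exact h0

end truncation

/-! ### Projecting null-homotopies onto weights -/

section projection

variable {Y : Scheme.{u}} {A : GradedRingSheaf Y} {U V W : Y.Opens}

/-- If the complex of sections of a complex of graded modules embeds in a complex that has weight
projections, then a morphism from a finite graded free complex is null-homotopic if it becomes so
in the larger complex. -/
lemma GradedFree.homotopy_of_projection {Q : CochainComplex (ModuleCat.{u} (A.ring U)) ℤ}
    (F : GradedFree A U Q) (l m : ℤ) (hF : ∀ p, p < l ∨ m < p → F.rk p = 0)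
    (K : CochainComplex (GrMod A) ℤ) (hW : W ≤ U) (I : CochainComplex (ModuleCat.{u} (A.ring U)) ℤ)
    (j : totComplex hW K ⟶ I) (π : ∀ p w : ℤ, I.X p →+ Γ((K.X p).obj w, W))
    (hπj : ∀ p w (x : Tot (K.X p) hW), π p w (j.f p x) = Tot.comp _ hW w x)
    (hπa : ∀ p d w k (h : d + w = k) (a : Γ(A.gr d, U)) (x : I.X p),
      π p k (A.incl U d a • x) = (K.X p).act h W (res _ hW a) (π p w x))
    (hπd : ∀ p q w (x : I.X p), π q w (I.d p q x) = sec ((K.d p q).app w) W (π p w x))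
    (f : Q ⟶ totComplex hW K) (H : Homotopy (f ≫ j) 0) : Nonempty (Homotopy f 0) := by
  classical
  let f' : ∀ p, Q.X p →ₗ[A.ring U] Tot (K.X p) hW := fun p => (f.f p).hom
  have hfin : ∀ (p : ℤ) (t : Fin (F.rk p)), {w | Tot.comp _ hW (w + F.deg p t) (f' p (F.basis p t)) ≠ 0}.Finite := by
    intro p t
    refine Set.Finite.preimage (f := fun w => w + F.deg p t)
      (s := {w | Tot.comp _ hW w (f' p (F.basis p t)) ≠ 0}) (fun a _ b _ h => by simpa using h) ?_
    exact DFinsupp.finite_support (show DirectSum ℤ fun k => (Γ((K.X p).obj k, W) : Type u) from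
      f' p (F.basis p t))
  -- A finite set of offsets: the image of a basis element of weight `k` has components only in
  -- weights `w + k` with `w ∈ D`. Finiteness keeps the sums below inside the direct sum of weights.
  obtain ⟨D, hD⟩ : ∃ D : Finset ℤ, ∀ p t w, w ∉ D →
      Tot.comp _ hW (w + F.deg p t) (f' p (F.basis p t)) = 0 := by
    have h1 := Set.Finite.biUnion (Set.finite_Icc l m) fun p _ => Set.finite_iUnion (hfin p)
    refine ⟨h1.toFinset, fun p t w hw => ?_⟩
    by_contra h
    refine hw ((Set.Finite.mem_toFinset _).2 ?_)
    have hp : p ∈ Set.Icc l m := by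
      by_contra hp
      have := hF p (by simp only [Set.mem_Icc, not_and_or, not_le] at hp; exact hp)
      exact absurd t.2 (by omega)
    exact Set.mem_biUnion hp (Set.mem_iUnion.2 ⟨t, h⟩)
  -- The operator `P p k` retains the weights in `D + k`. It is only additive, but it commutes with
  -- a homogeneous element of weight `d` once `k` is replaced by `d + k`, and it fixes the image
  -- under `f` of a basis element of weight `k`.
  let P : ∀ p k, I.X p →+ Tot (K.X p) hW := fun p k =>
    ∑ w ∈ D, (Tot.of (K.X p) hW (w + k)).comp (π p (w + k))
  have hP : ∀ p k x, P p k x = ∑ w ∈ D, Tot.of (K.X p) hW (w + k) (π p (w + k) x) := fun p k x =>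
    AddMonoidHom.finsetSum_apply _ _ _
  have hPa : ∀ p d k k' (h : d + k = k') (a : Γ(A.gr d, U)) x,
      P p k' (A.incl U d a • x) = A.incl U d a • P p k x := by
    intro p d k k' h a x
    rw [hP, hP, Finset.smul_sum]
    refine Finset.sum_congr rfl fun w _ => ?_
    have h2 : d + (w + k) = w + k' := by omega
    rw [Tot.incl_smul_of _ _ h2, hπa p d _ _ h2]
  have hPd : ∀ p q k (x : I.X p), P q k (I.d p q x) = Tot.map (K.d p q) hW (P p k x) := by
    intro p q k x
    rw [hP, hP, map_sum]
    refine Finset.sum_congr rfl fun w _ => ?_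
    rw [Tot.map_of, hπd]
  have hPf : ∀ p t, P p (F.deg p t) (j.f p (f' p (F.basis p t))) = f' p (F.basis p t) := by
    intro p t
    rw [hP]
    refine Tot.ext fun k => ?_
    rw [map_sum, Finset.sum_eq_single (k - F.deg p t)]
    · have e : k - F.deg p t + F.deg p t = k := by omega
      rw [hπj, e, Tot.comp_of_same]
    · intro w _ hw
      exact Tot.comp_of_ne _ _ (by omega) _
    · intro hw
      rw [hπj, hD p t _ hw, map_zero, map_zero]
  let z := Cochain.ofHomotopy H
  have hz : Cochain.ofHom (f ≫ j) = δ (-1) 0 z :=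
    (Cochain.equivHomotopy _ _ H).2.trans
      ((congrArg (δ (-1) 0 z + ·) (Cochain.ofHom_zero _ _)).trans (add_zero _))
  -- The new homotopy applies `P` to the old one on basis elements, with `k` the weight of the basis
  -- element, and is extended linearly. Because the differential of `Q` has homogeneous entries, the
  -- formula remains valid on the differentials of basis elements (`hgd`).
  let g : ∀ p q, p + -1 = q → (Q.X p →ₗ[A.ring U] Tot (K.X q) hW) := fun p q hpq =>
    (F.basis p).constr (M' := Tot (K.X q) hW) ℕ fun t => P q (F.deg p t) (z.v p q hpq (F.basis p t))
  have hg : ∀ p q hpq t, g p q hpq (F.basis p t) = P q (F.deg p t) (z.v p q hpq (F.basis p t)) :=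
    fun p q hpq t => (F.basis p).constr_basis (M' := Tot (K.X q) hW) ℕ _ t
  have hgd : ∀ p p' q hpq t, g p' q hpq (Q.d p p' (F.basis p t)) =
      P q (F.deg p t) (z.v p' q hpq (Q.d p p' (F.basis p t))) := by
    intro p p' q hpq t
    rw [← (F.basis p').sum_repr (Q.d p p' (F.basis p t)), map_sum, map_sum, map_sum]
    refine Finset.sum_congr rfl fun v _ => ?_
    obtain ⟨a, ha⟩ := F.homog p p' t v
    rw [ha, map_smul, map_smul, hg]
    exact (hPa q _ _ _ (by omega) a _).symm
  refine ⟨(Cochain.equivHomotopy _ _).symm ⟨Cochain.mk fun p q hpq => ModuleCat.ofHom (g p q hpq), ?_⟩⟩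
  rw [Cochain.ofHom_zero, add_zero]
  refine Cochain.ext₀ _ _ fun p => ?_
  rw [Cochain.ofHom_v, δ_v (-1) 0 rfl _ p p (add_zero p) (p - 1) (p + 1) (by omega) (by omega),
    Int.negOnePow_zero, one_smul]
  refine ModuleCat.hom_ext ((F.basis p).ext fun t => ?_)
  have h1 := congrArg (fun c : Cochain Q I 0 => c.v p p (add_zero p) (F.basis p t)) hz
  have h2 := δ_v (-1) 0 rfl z p p (add_zero p) (p - 1) (p + 1) (by omega) (by omega)
  have h3 : j.f p (f' p (F.basis p t)) = I.d (p - 1) p (z.v p (p - 1) (by omega) (F.basis p t)) +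
      z.v (p + 1) p (by omega) (Q.d p (p + 1) (F.basis p t)) := by
    refine Eq.trans ?_ (h1.trans ((congrArg (fun c : Q.X p ⟶ I.X p => c (F.basis p t)) h2).trans ?_))
    · rfl
    · rw [Int.negOnePow_zero, one_smul]
      rfl
  have h4 : f' p (F.basis p t) = Tot.map (K.d (p - 1) p) hW (g p (p - 1) (by omega) (F.basis p t)) +
      g (p + 1) p (by omega) (Q.d p (p + 1) (F.basis p t)) := by
    rw [hg, hgd, ← hPd, ← map_add, ← h3, hPf]
  exact h4

end projection

end HomFlip

namespace HomFlip

open CochainComplex HomComplex Pretriangulated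

/-! ### Coextension along ring homomorphisms -/

section coext

variable {R S B : Type u} [CommRing R] [CommRing S] [CommRing B]

/-- Base change along the flat `σ` keeps `i` injective. The `S`-linear extension of `g` to the base
change of `X` therefore extends further to that of `Z`, since `N` is injective, and is then
restricted to the elements `1 ⊗ z`. -/
lemma exists_extension_of_flat (σ : R →+* S) (hσ : σ.Flat) (ρ : R →+* B) {N X Z : Type u} [AddCommGroup N]
    [Module S N] [Module.Injective S N] [AddCommGroup X] [Module B X] [AddCommGroup Z] [Module B Z]
    (i : X →ₗ[B] Z) (hi : Function.Injective i) (g : X →+ N) (hg : ∀ r x, g (ρ r • x) = σ r • g x) :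
    ∃ g' : Z →+ N, (∀ r x, g' (ρ r • x) = σ r • g' x) ∧ ∀ x, g' (i x) = g x := by
  algebraize [σ]
  let := Module.compHom N σ
  let := Module.compHom X ρ
  let := Module.compHom Z ρ
  have : IsScalarTower R S N := ⟨fun r s x => mul_smul (σ r) s x⟩
  let gl : X →ₗ[R] N := { g with map_smul' := hg }
  let il : X →ₗ[R] Z := { i.toAddMonoidHom with map_smul' := fun r x => i.map_smul (ρ r) x }
  obtain ⟨h, hh⟩ := Module.Injective.out (R := S) (il.baseChange S)
    (Module.Flat.lTensor_preserves_injective_linearMap (M := S) il hi) (gl.liftBaseChange S)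
  refine ⟨((h.restrictScalars R).comp (TensorProduct.mk R S Z 1)).toAddMonoidHom, fun r x => ?_,
    fun x => ?_⟩
  · exact ((h.restrictScalars R).comp (TensorProduct.mk R S Z 1)).map_smul r x
  · refine (hh ((1 : S) ⊗ₜ x)).trans ?_
    rw [LinearMap.liftBaseChange_tmul, one_smul]
    rfl

/-- The group of maps that are linear along two ring homomorphisms. -/
def coextSub (ρ : R →+* B) (σ : R →+* S) (N : Type u) [AddCommGroup N] [Module S N] :
    AddSubgroup (B →+ N) where
  carrier := {g | ∀ r b, g (ρ r * b) = σ r • g b}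
  zero_mem' := fun r b => (smul_zero _).symm
  add_mem' := fun {g g'} h h' r b => by
    rw [AddMonoidHom.add_apply, AddMonoidHom.add_apply, h, h', smul_add]
  neg_mem' := fun {g} h r b => by
    rw [AddMonoidHom.neg_apply, AddMonoidHom.neg_apply, h, smul_neg]

/-- The module of maps that are linear along two ring homomorphisms. -/
def Coext (ρ : R →+* B) (σ : R →+* S) (N : Type u) [AddCommGroup N] [Module S N] : Type u :=
  coextSub ρ σ N

namespace Coext

variable {ρ : R →+* B} {σ : R →+* S} {N N' X : Type u} [AddCommGroup N] [Module S N]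
  [AddCommGroup N'] [Module S N'] [AddCommGroup X] [Module B X]

noncomputable instance : AddCommGroup (Coext ρ σ N) :=
  inferInstanceAs (AddCommGroup (coextSub ρ σ N))

/-- The underlying additive map. -/
noncomputable def val : Coext ρ σ N →+ B →+ N := (coextSub ρ σ N).subtype

lemma val_mul (g : Coext ρ σ N) (r : R) (b : B) : val g (ρ r * b) = σ r • val g b := g.2 r b

lemma ext {g g' : Coext ρ σ N} (h : ∀ b, val g b = val g' b) : g = g' :=
  Subtype.ext (AddMonoidHom.ext h)

noncomputable instance : SMul B (Coext ρ σ N) :=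
  ⟨fun b g => ⟨(val g).comp (AddMonoidHom.mulRight b), fun r x => by
    change val g (ρ r * x * b) = σ r • val g (x * b)
    rw [mul_assoc, val_mul]⟩⟩

lemma val_smul (b : B) (g : Coext ρ σ N) (x : B) : val (b • g) x = val g (x * b) := rfl

noncomputable instance : Module B (Coext ρ σ N) where
  one_smul g := ext fun x => by rw [val_smul, mul_one]
  mul_smul b b' g := ext fun x => by rw [val_smul, val_smul, val_smul, mul_comm b b', mul_assoc, mul_comm b' b, mul_comm b b']
  smul_zero b := rfl
  smul_add b g g' := rfl
  add_smul b b' g := ext fun x => by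
    rw [val_smul, mul_add, map_add, map_add, AddMonoidHom.add_apply, val_smul, val_smul]
  zero_smul g := ext fun x => by rw [val_smul, mul_zero, map_zero, map_zero]; rfl

/-- Maps to the coextension. -/
noncomputable def lift (ψ : X →+ N) (hψ : ∀ r x, ψ (ρ r • x) = σ r • ψ x) : X →ₗ[B] Coext ρ σ N where
  toFun x := ⟨{ toFun := fun b => ψ (b • x)
                map_zero' := by rw [zero_smul, map_zero]
                map_add' := fun b b' => by rw [add_smul, map_add] }, fun r b => by
      change ψ ((ρ r * b) • x) = σ r • ψ (b • x)
      rw [mul_smul, hψ]⟩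
  map_add' x x' := ext fun b => (congrArg ψ (smul_add b x x')).trans (map_add _ _ _)
  map_smul' b x := ext fun b' => congrArg ψ (smul_smul b' b x)

lemma val_lift (ψ : X →+ N) (hψ : ∀ r x, ψ (ρ r • x) = σ r • ψ x) (x : X) (b : B) :
    val (lift ψ hψ x) b = ψ (b • x) := rfl

/-- Functoriality of the coextension. -/
noncomputable def map (φ : N →ₗ[S] N') : Coext ρ σ N →ₗ[B] Coext ρ σ N' where
  toFun g := ⟨φ.toAddMonoidHom.comp (val g), fun r b =>
    (congrArg φ (val_mul g r b)).trans (φ.map_smul _ _)⟩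
  map_add' g g' := ext fun b => map_add φ _ _
  map_smul' b g := rfl

lemma val_map (φ : N →ₗ[S] N') (g : Coext ρ σ N) (b : B) : val (map φ g) b = φ (val g b) := rfl

/-- Evaluation at `1` identifies `B`-linear maps to the coextension with additive maps to `N` that
are linear along `ρ` and `σ`; such maps extend along injections because `σ` is flat. -/
lemma injective (hσ : σ.Flat) [Module.Injective S N] : Module.Injective B (Coext ρ σ N) := by
  refine ⟨fun X Z _ _ _ _ i hi g => ?_⟩
  have h1 : ∀ x b, val (g x) b = val (g (b • x)) 1 := fun x b => by
    rw [map_smul, val_smul, one_mul]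
  obtain ⟨ψ, hψ, h⟩ := exists_extension_of_flat σ hσ ρ i hi
    (((AddMonoidHom.eval (1 : B)).comp val).comp g.toAddMonoidHom : X →+ N) fun r x => by
      change val (g (ρ r • x)) 1 = σ r • val (g x) 1
      rw [← h1, ← val_mul, mul_one]
  refine ⟨lift ψ hψ, fun x => ext fun b => ?_⟩
  rw [val_lift, ← map_smul, h, h1]
  rfl

end Coext

end coext

/-! ### Sections of the dual inside the full complex of homomorphisms -/

section dualEmbedding

variable {Y : Scheme.{u}} {A : GradedRingSheaf Y} {U W : Y.Opens} (ω : CochainComplex Y.Modules ℤ)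

/-- The sections of the dualizing complex, coextended to the ring `𝒜(U)`. -/
noncomputable def coextComplex (A : GradedRingSheaf Y) (hW : W ≤ U) :
    CochainComplex (ModuleCat.{u} (A.ring U)) ℤ where
  X q := ModuleCat.of _ (Coext (A.scal U) (resO Y hW) Γ(ω.X q, W))
  d p q := ModuleCat.ofHom (Coext.map (sec (ω.d p q) W))
  shape p q h := ModuleCat.hom_ext (LinearMap.ext fun g => Coext.ext fun b => by
    refine (Coext.val_map _ _ _).trans ?_
    rw [ω.shape p q h]
    rfl)
  d_comp_d' p q r _ _ := ModuleCat.hom_ext (LinearMap.ext fun g => Coext.ext fun b =>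
    sec_d_d ω p q r W _)

variable (hW : W ≤ U) (K : CochainComplex (GrMod A) ℤ)

/-- The evaluation pairing between the dual and the complex. -/
noncomputable def dualPair {n : ℤ} (t : Triplet n) :
    Tot (dualX ω K n) hW →+ Tot (K.X t.p) hW →+ Γ(ω.X t.q, W) :=
  DirectSum.toAddMonoid fun w =>
    { toFun := fun φ : DualSec ω K n w W =>
        (φ.app t W le_rfl).toAddMonoidHom.comp (Tot.comp (K.X t.p) hW (-w))
      map_zero' := rfl
      map_add' := fun φ ψ => rfl }

lemma dualPair_of {n : ℤ} (t : Triplet n) (w : ℤ) (φ : DualSec ω K n w W) (x : Tot (K.X t.p) hW) :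
    dualPair ω hW K t (Tot.of (dualX ω K n) hW w φ) x =
      φ.app t W le_rfl (Tot.comp (K.X t.p) hW (-w) x) :=
  congrArg (fun g : Tot (K.X t.p) hW →+ Γ(ω.X t.q, W) => g x) (DirectSum.toAddMonoid_of _ _ _)

lemma dualPair_smul {n : ℤ} (t : Triplet n) (b : A.ring U) (φ : Tot (dualX ω K n) hW)
    (x : Tot (K.X t.p) hW) : dualPair ω hW K t (b • φ) x = dualPair ω hW K t φ (b • x) := by
  induction b using GradedRingSheaf.ring_induction with
  | h0 => rw [zero_smul, zero_smul, map_zero, map_zero, AddMonoidHom.zero_apply]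
  | hof d a =>
    induction φ using Tot.induction with
    | h0 => rw [smul_zero, map_zero, AddMonoidHom.zero_apply, AddMonoidHom.zero_apply]
    | hof w φ =>
      change DualSec ω K n w W at φ
      have h : d + -(d + w) = -w := by omega
      refine (congrArg (fun z => dualPair ω hW K t z x)
        (Tot.incl_smul_of (dualX ω K n) hW rfl a φ)).trans ?_
      refine (dualPair_of ω hW K t (d + w) _ x).trans
        (Eq.trans ?_ (dualPair_of ω hW K t w φ _).symm)
      rw [Tot.comp_incl_smul (K.X t.p) hW h]
      refine (dualSmul_app ω K n rfl W (res _ hW a) φ t W le_rfl _).trans ?_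
      rw [res_self]
    | hadd φ ψ h h' =>
      rw [smul_add, map_add, map_add, AddMonoidHom.add_apply, AddMonoidHom.add_apply, h, h']
  | hadd b b' h h' => rw [add_smul, add_smul, map_add, map_add, AddMonoidHom.add_apply, h, h']

lemma dualPair_scal_smul {n : ℤ} (t : Triplet n) (r : Γ(Y, U)) (φ : Tot (dualX ω K n) hW)
    (x : Tot (K.X t.p) hW) :
    dualPair ω hW K t φ (A.scal U r • x) = resO Y hW r • dualPair ω hW K t φ x := by
  induction φ using Tot.induction with
  | h0 => rw [map_zero, AddMonoidHom.zero_apply, AddMonoidHom.zero_apply, smul_zero]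
  | hof w φ =>
    refine (dualPair_of ω hW K t w φ _).trans
      (Eq.trans ?_ (congrArg (resO Y hW r • ·) (dualPair_of ω hW K t w φ x)).symm)
    rw [Tot.comp_scal_smul]
    exact map_smul _ _ _
  | hadd φ ψ h h' =>
    rw [map_add, AddMonoidHom.add_apply, AddMonoidHom.add_apply, h, h', smul_add]

/-- The components of the embedding of the sections of the dual in the complex of homomorphisms. -/
noncomputable def dualEmbHom {n : ℤ} (t : Triplet n) (φ : Tot (dualX ω K n) hW) :
    Tot (K.X t.p) hW →ₗ[A.ring U] Coext (A.scal U) (resO Y hW) Γ(ω.X t.q, W) :=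
  Coext.lift (dualPair ω hW K t φ) fun r x => dualPair_scal_smul ω hW K t r φ x

lemma val_dualEmbHom {n : ℤ} (t : Triplet n) (φ : Tot (dualX ω K n) hW) (x : Tot (K.X t.p) hW)
    (b : A.ring U) : Coext.val (dualEmbHom ω hW K t φ x) b = dualPair ω hW K t φ (b • x) := rfl

lemma dualEmbHom_add {n : ℤ} (t : Triplet n) (φ ψ : Tot (dualX ω K n) hW) :
    dualEmbHom ω hW K t (φ + ψ) = dualEmbHom ω hW K t φ + dualEmbHom ω hW K t ψ :=
  LinearMap.ext fun x => Coext.ext fun b => by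
    rw [val_dualEmbHom, map_add, AddMonoidHom.add_apply]
    rfl

lemma dualEmbHom_smul {n : ℤ} (t : Triplet n) (c : A.ring U) (φ : Tot (dualX ω K n) hW) :
    dualEmbHom ω hW K t (c • φ) = c • dualEmbHom ω hW K t φ :=
  LinearMap.ext fun x => Coext.ext fun b => by
    rw [val_dualEmbHom, dualPair_smul, LinearMap.smul_apply, Coext.val_smul, val_dualEmbHom,
      smul_smul, mul_comm]

/-- The embedding of the sections of the dual in the complex of homomorphisms. -/
noncomputable def dualEmb (n : ℤ) : Tot (dualX ω K n) hW →ₗ[A.ring U]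
    Cochain (totComplex hW K) (coextComplex ω A hW) n where
  toFun φ := Cochain.mk fun p q hpq => ModuleCat.ofHom (dualEmbHom ω hW K ⟨p, q, hpq⟩ φ)
  map_add' φ ψ := Cochain.ext _ _ fun p q hpq => ModuleCat.hom_ext (dualEmbHom_add ω hW K _ φ ψ)
  map_smul' c φ := Cochain.ext _ _ fun p q hpq => ModuleCat.hom_ext (dualEmbHom_smul ω hW K _ c φ)

end dualEmbedding

end HomFlip

namespace HomFlip

open CochainComplex HomComplex Pretriangulated

attribute [local instance] HasDerivedCategory.standard

/-! ### Differentials and weight projections -/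

section dualEmbedding

variable {Y : Scheme.{u}} {A : GradedRingSheaf Y} {U W : Y.Opens} (ω : CochainComplex Y.Modules ℤ)
  (hW : W ≤ U) (K : CochainComplex (GrMod A) ℤ)

/-- The differential of the dual on sections. -/
noncomputable def dualDTot (n m : ℤ) : Tot (dualX ω K n) hW →+ Tot (dualX ω K m) hW :=
  (Tot.map ((dual ω K).d n m) hW).toAddMonoidHom

lemma dualDTot_of {n m : ℤ} (h : n + 1 = m) (w : ℤ) (φ : DualSec ω K n w W) :
    dualDTot ω hW K n m (Tot.of (dualX ω K n) hW w φ) =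
      Tot.of (dualX ω K m) hW w (dualDSec ω K n m h w W φ) :=
  (Tot.map_of ((dual ω K).d n m) hW w φ).trans
    (congrArg (Tot.of (dualX ω K m) hW w) (dual_d_sec ω K n m h w W φ))

lemma dualPair_d {n m : ℤ} (h : n + 1 = m) (t : Triplet m) (φ : Tot (dualX ω K n) hW)
    (x : Tot (K.X t.p) hW) :
    dualPair ω hW K t (dualDTot ω hW K n m φ) x =
      sec (ω.d (t.q - 1) t.q) W
        (dualPair ω hW K ⟨t.p, t.q - 1, by have := t.hpq; omega⟩ φ x) +
      (m.negOnePow : ℤ) • dualPair ω hW K ⟨t.p + 1, t.q, by have := t.hpq; omega⟩ φ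
        (Tot.map (K.d t.p (t.p + 1)) hW x) := by
  induction φ using Tot.induction with
  | h0 => simp only [map_zero, AddMonoidHom.zero_apply, smul_zero, add_zero]
  | hof w φ =>
    change DualSec ω K n w W at φ
    refine (congrArg (fun ψ => dualPair ω hW K t ψ x) (dualDTot_of ω hW K h w φ)).trans ?_
    refine (dualPair_of ω hW K t w _ x).trans ?_
    rw [dualDSec_apply]
    have := t.hpq
    refine Eq.symm (congrArg₂ (· + ·) (congrArg (sec (ω.d (t.q - 1) t.q) W)
      (dualPair_of ω hW K ⟨t.p, t.q - 1, by omega⟩ w φ x)) (congrArg ((m.negOnePow : ℤ) • ·)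
      ((dualPair_of ω hW K ⟨t.p + 1, t.q, by omega⟩ w φ _).trans ?_)))
    exact congrArg (φ.app _ W le_rfl) (Tot.comp_map (K.d t.p (t.p + 1)) hW (-w) x)
  | hadd φ ψ hφ hψ =>
    simp only [map_add, AddMonoidHom.add_apply, smul_add]
    rw [hφ, hψ]
    abel

lemma val_δ {n m : ℤ} (h : n + 1 = m) (z : Cochain (totComplex hW K) (coextComplex ω A hW) n)
    (t : Triplet m) (x : Tot (K.X t.p) hW) (b : A.ring U) :
    Coext.val ((δ n m z).v t.p t.q t.hpq x : Coext (A.scal U) (resO Y hW) Γ(ω.X t.q, W)) b =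
      sec (ω.d (t.q - 1) t.q) W (Coext.val (z.v t.p (t.q - 1) (by have := t.hpq; omega) x :
        Coext (A.scal U) (resO Y hW) Γ(ω.X (t.q - 1), W)) b) +
      (m.negOnePow : ℤ) • Coext.val (z.v (t.p + 1) t.q (by have := t.hpq; omega)
        (Tot.map (K.d t.p (t.p + 1)) hW x) : Coext (A.scal U) (resO Y hW) Γ(ω.X t.q, W)) b := by
  have h1 := congrArg (fun g : (totComplex hW K).X t.p ⟶ (coextComplex ω A hW).X t.q =>
    Coext.val (g x : Coext (A.scal U) (resO Y hW) Γ(ω.X t.q, W)) b)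
    (δ_v n m h z t.p t.q t.hpq (t.q - 1) (t.p + 1) (by omega) rfl)
  refine h1.trans ?_
  rfl

/-- The embedding of the sections of the dual in the complex of homomorphisms. -/
noncomputable def dualEmbComplex : totComplex hW (dual ω K) ⟶
    innerHom (totComplex hW K) (coextComplex ω A hW) where
  f n := ModuleCat.ofHom (dualEmb ω hW K n)
  comm' n m h := ModuleCat.hom_ext (LinearMap.ext fun φ => Cochain.ext _ _ fun p q hpq =>
    ModuleCat.hom_ext (LinearMap.ext fun x => Coext.ext fun b =>
      (val_δ ω hW K h (dualEmb ω hW K n φ) ⟨p, q, hpq⟩ x b).trans (by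
        refine Eq.symm ((dualPair_d ω hW K h ⟨p, q, hpq⟩ φ (b • x)).trans ?_)
        refine congrArg₂ (· + ·) rfl (congrArg ((m.negOnePow : ℤ) • ·) ?_)
        exact congrArg (dualPair ω hW K ⟨p + 1, q, _⟩ φ) (map_smul _ b x))))

variable {ω K} (hq : ∀ n i, QCoh ((K.X n).obj i)) (hWa : IsAffineOpen W)
  (hres : ∀ t : Γ(Y, W), ∃ r s : Γ(Y, U), IsUnit (resO Y hW r) ∧ resO Y hW s = resO Y hW r * t)

/-- The map on sections of weight `-w` obtained from a cochain. -/
noncomputable def cochainSec {n : ℤ} (w : ℤ)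
    (z : Cochain (totComplex hW K) (coextComplex ω A hW) n) (t : Triplet n) :
    Γ((K.X t.p).obj (-w), W) →+ Γ(ω.X t.q, W) where
  toFun x := Coext.val (z.v t.p t.q t.hpq (Tot.of (K.X t.p) hW (-w) x) :
    Coext (A.scal U) (resO Y hW) Γ(ω.X t.q, W)) 1
  map_zero' := by
    rw [map_zero]
    exact congrArg (fun g : Coext (A.scal U) (resO Y hW) Γ(ω.X t.q, W) => Coext.val g 1)
      (map_zero (z.v t.p t.q t.hpq).hom)
  map_add' x y := by
    rw [map_add]
    exact congrArg (fun g : Coext (A.scal U) (resO Y hW) Γ(ω.X t.q, W) => Coext.val g 1)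
      (map_add (z.v t.p t.q t.hpq).hom _ _)

lemma cochainSec_apply {n : ℤ} (w : ℤ) (z : Cochain (totComplex hW K) (coextComplex ω A hW) n)
    (t : Triplet n) (x : Γ((K.X t.p).obj (-w), W)) :
    cochainSec hW w z t x = Coext.val (z.v t.p t.q t.hpq (Tot.of (K.X t.p) hW (-w) x) :
      Coext (A.scal U) (resO Y hW) Γ(ω.X t.q, W)) 1 := rfl

lemma val_cochain_smul {n : ℤ} (z : Cochain (totComplex hW K) (coextComplex ω A hW) n)
    (t : Triplet n) (b : A.ring U) (x : Tot (K.X t.p) hW) :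
    Coext.val (z.v t.p t.q t.hpq (b • x) : Coext (A.scal U) (resO Y hW) Γ(ω.X t.q, W)) 1 =
      Coext.val (z.v t.p t.q t.hpq x : Coext (A.scal U) (resO Y hW) Γ(ω.X t.q, W)) b := by
  refine (congrArg (fun g : Coext (A.scal U) (resO Y hW) Γ(ω.X t.q, W) => Coext.val g 1)
      (map_smul (z.v t.p t.q t.hpq).hom b x)).trans ?_
  refine (Coext.val_smul b _ 1).trans ?_
  rw [one_mul]
  rfl

lemma cochainSec_resO_smul {n : ℤ} (w : ℤ) (z : Cochain (totComplex hW K) (coextComplex ω A hW) n)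
    (t : Triplet n) (r : Γ(Y, U)) (x : Γ((K.X t.p).obj (-w), W)) :
    cochainSec hW w z t (resO Y hW r • x) = resO Y hW r • cochainSec hW w z t x := by
  rw [cochainSec_apply, cochainSec_apply, ← Tot.scal_smul_of]
  refine (val_cochain_smul hW z t _ _).trans ?_
  have := Coext.val_mul (z.v t.p t.q t.hpq (Tot.of (K.X t.p) hW (-w) x) :
    Coext (A.scal U) (resO Y hW) Γ(ω.X t.q, W)) r 1
  rwa [mul_one] at this

/-- Linearity over functions on `U` is built into the coextension. By `hres` each function on `W` is
a quotient of functions coming from `U`, with denominator invertible on `W`. -/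
lemma cochainSec_smul
    (hres : ∀ t : Γ(Y, W), ∃ r s : Γ(Y, U), IsUnit (resO Y hW r) ∧ resO Y hW s = resO Y hW r * t)
    {n : ℤ} (w : ℤ) (z : Cochain (totComplex hW K) (coextComplex ω A hW) n)
    (t : Triplet n) (c : Γ(Y, W)) (x : Γ((K.X t.p).obj (-w), W)) :
    cochainSec hW w z t (c • x) = c • cochainSec hW w z t x := by
  obtain ⟨r, s, hr, hs⟩ := hres c
  refine (IsUnit.smul_left_cancel hr).1 ?_
  rw [← cochainSec_resO_smul, ← mul_smul, ← mul_smul, ← hs, cochainSec_resO_smul]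

/-- The section of the dual defined by a cochain. -/
noncomputable def cochainHomSec {n : ℤ} (w : ℤ)
    (z : Cochain (totComplex hW K) (coextComplex ω A hW) n) : DualSec ω K n w W :=
  homSecExtend hWa (fun t : Triplet n => hq t.p (-w) W hWa) fun t =>
    { cochainSec hW w z t with map_smul' := cochainSec_smul hW hres w z t }

lemma cochainHomSec_app {n : ℤ} (w : ℤ) (z : Cochain (totComplex hW K) (coextComplex ω A hW) n)
    (t : Triplet n) (x : Γ((K.X t.p).obj (-w), W)) :
    (cochainHomSec hW hq hWa hres w z).app t W le_rfl x = cochainSec hW w z t x :=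
  homSecExtend_app hWa (fun t : Triplet n => hq t.p (-w) W hWa) _ t x

/-- The weight components of a cochain. -/
noncomputable def dualProj (n w : ℤ) :
    Cochain (totComplex hW K) (coextComplex ω A hW) n →+ DualSec ω K n w W :=
  AddMonoidHom.mk' (cochainHomSec hW hq hWa hres w) fun z z' =>
    homSec_ext_affine hWa (fun t : Triplet _ => hq t.p (-w) W hWa) fun t x => by
      rw [HomSec.add_app, LinearMap.add_apply, cochainHomSec_app, cochainHomSec_app,
        cochainHomSec_app]
      rfl

lemma dualProj_app (n w : ℤ) (z : Cochain (totComplex hW K) (coextComplex ω A hW) n)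
    (t : Triplet n) (x : Γ((K.X t.p).obj (-w), W)) :
    (dualProj hW hq hWa hres n w z).app t W le_rfl x = cochainSec hW w z t x :=
  cochainHomSec_app hW hq hWa hres w z t x

lemma dualProj_dualEmb (n w : ℤ) (φ : Tot (dualX ω K n) hW) :
    dualProj hW hq hWa hres n w (dualEmb ω hW K n φ) = Tot.comp (dualX ω K n) hW w φ := by
  induction φ using Tot.induction with
  | h0 =>
    rw [map_zero, map_zero, map_zero]
    rfl
  | hof w' φ =>
    change DualSec ω K n w' W at φ
    refine homSec_ext_affine hWa (fun t : Triplet _ => hq t.p (-w) W hWa) fun t x => ?_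
    refine (dualProj_app hW hq hWa hres n w _ t x).trans ?_
    refine (dualPair_of ω hW K t w' φ _).trans ?_
    rw [one_smul]
    by_cases h : w' = w
    · subst h
      rw [Tot.comp_of_same]
      exact (congrArg (fun ψ : DualSec ω K n w' W => ψ.app t W le_rfl x)
        (Tot.comp_of_same (dualX ω K n) hW w' φ)).symm
    · rw [Tot.comp_of_ne _ _ (by omega), map_zero]
      exact (congrArg (fun ψ : DualSec ω K n w W => ψ.app t W le_rfl x)
        (Tot.comp_of_ne (dualX ω K n) hW h φ)).symm
  | hadd φ ψ h h' =>
    rw [map_add, map_add, h, h', map_add]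
    rfl

lemma dualProj_incl_smul (n d w k : ℤ) (h : d + w = k) (a : Γ(A.gr d, U))
    (z : Cochain (totComplex hW K) (coextComplex ω A hW) n) :
    dualProj hW hq hWa hres n k (A.incl U d a • z) =
      (dualX ω K n).act h W (res _ hW a) (dualProj hW hq hWa hres n w z) := by
  refine homSec_ext_affine hWa (fun t : Triplet _ => hq t.p (-k) W hWa) fun t x => ?_
  refine (dualProj_app hW hq hWa hres n k _ t x).trans ?_
  refine Eq.trans ?_ (dualSmul_app ω K n h W (res _ hW a) _ t W le_rfl x).symm
  rw [res_self, dualProj_app, cochainSec_apply, cochainSec_apply,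
    ← Tot.incl_smul_of (K.X t.p) hW (show d + -k = -w by omega)]
  refine Eq.trans ?_ (val_cochain_smul hW z t _ _).symm
  refine (Coext.val_smul (A.incl U d a) _ 1).trans ?_
  rw [one_mul]
  rfl

/-- Together with `dualProj_dualEmb` and `dualProj_incl_smul` this is what
`GradedFree.homotopy_of_projection` asks of weight projections. -/
lemma dualProj_d (p q w : ℤ) (z : Cochain (totComplex hW K) (coextComplex ω A hW) p) :
    dualProj hW hq hWa hres q w (δ p q z) =
      sec (((dual ω K).d p q).app w) W (dualProj hW hq hWa hres p w z) := by
  by_cases h : p + 1 = q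
  · refine homSec_ext_affine hWa (fun t : Triplet _ => hq t.p (-w) W hWa) fun t x => ?_
    refine (dualProj_app hW hq hWa hres q w _ t x).trans ?_
    refine Eq.trans ?_ (congrArg (fun ψ : DualSec ω K q w W => ψ.app t W le_rfl x)
      (dual_d_sec ω K p q h w W _)).symm
    rw [dualDSec_apply, dualProj_app, dualProj_app]
    refine (val_δ ω hW K h z t _ 1).trans ?_
    rw [Tot.map_of]
    rfl
  · rw [δ_shape p q h, map_zero, (dual ω K).shape p q h]
    rfl

end dualEmbedding

/-! ### Duals have locally finite injective dimension -/

section dualLocal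

variable {Y : Scheme.{u}} {A : GradedRingSheaf Y} {U W : Y.Opens} {ω : CochainComplex Y.Modules ℤ}

lemma flat_resO (hU : IsAffineOpen U) (f : Γ(Y, U)) : (resO Y (Y.basicOpen_le f)).Flat := by
  have := hU.isLocalization_basicOpen f
  exact IsLocalization.flat (R := Γ(Y, U)) Γ(Y, Y.basicOpen f) (.powers f)

lemma injective_coextComplex (hω : IsDualizingComplex ω) (hU : IsAffineOpen U) (f : Γ(Y, U)) (q : ℤ) :
    Injective ((coextComplex ω A (Y.basicOpen_le f)).X q) := by
  have := hω.injective ⟨_, hU.basicOpen f⟩ q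
  have := Coext.injective (ρ := A.scal U) (N := Γ(ω.X q, Y.basicOpen f)) (flat_resO hU f)
  exact Module.injective_object_of_injective_module _
    (Coext (A.scal U) (resO Y (Y.basicOpen_le f)) Γ(ω.X q, Y.basicOpen f))

lemma isZero_coextComplex (hW : W ≤ U) (q : ℤ) (h : IsZero (ω.X q)) :
    IsZero ((coextComplex ω A hW).X q) := by
  have h1 : ∀ x : Γ(ω.X q, W), x = 0 := fun x => by
    have := congrArg (fun g => sec g W x) (h.eq_of_src (𝟙 _) 0)
    exact this
  rw [ModuleCat.isZero_iff_subsingleton]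
  exact ⟨fun (g g' : Coext (A.scal U) (resO Y hW) Γ(ω.X q, W)) =>
    Coext.ext fun b => (h1 _).trans (h1 _).symm⟩

/-- Near a given point, over a basic open `W` of `U`, the sections of the dual embed in the
homomorphisms from `K(W)` to the coextension of `ω(W)`. This target has finite injective dimension:
`K(W)` is built from flat modules, and the coextension is a bounded complex of injective
`𝒜(U)`-modules. Hence a map from a test complex is null-homotopic there, and weight projections
bring the homotopy back to the dual. The bound depends only on `c` and on the amplitude of `ω`, not
on `W`. -/
lemma isLocallyFinInj_dual (hω : IsDualizingComplex ω) (hU : IsAffineOpen U)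
    (K : CochainComplex (GrMod A) ℤ) (hq : ∀ n i, QCoh ((K.X n).obj i)) {c : ℕ}
    (hK : ∀ f : Γ(Y, U), FlatBuilt c (totComplex (Y.basicOpen_le f) K)) :
    IsLocallyFinInj A U ((KGr.q A).obj (dual ω K)) := by
  obtain ⟨l, m, hb⟩ := hω.bounded
  refine ⟨|l| + |m| + 1 + c, fun n s hn hs Q F hF V hV y hy f => ?_⟩
  obtain ⟨f, rfl⟩ := (HomotopyCategory.quotient _ _).map_surjective
    (X := Q) (Y := totComplex hV (dual ω K)) f
  obtain ⟨g, hg, hyg⟩ := exists_basicOpen hU hy (hV hy)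
  have hW := Y.basicOpen_le g
  have hWa := hU.basicOpen g
  have hres : ∀ t : Γ(Y, Y.basicOpen g), ∃ r s : Γ(Y, U), IsUnit (resO Y hW r) ∧
      resO Y hW s = resO Y hW r * t := fun t => by
    obtain ⟨k, s, hs⟩ := exists_resO_eq hU g t
    refine ⟨g ^ k, s, ?_, hs⟩
    rw [map_pow]
    exact (isUnit_resO g le_rfl).pow k
  have hI := (hK g).finInj (coextComplex ω A hW) (injective_coextComplex hω hU g) l m
    fun p hp => isZero_coextComplex hW p (hb p hp)
  have := abs_nonneg l
  have := abs_nonneg m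
  obtain ⟨H⟩ := F.exists_homotopy_of_finInj (by omega) hI hn hs hF
    ((f ≫ totRes hV hg (dual ω K)) ≫ dualEmbComplex ω hW K)
  obtain ⟨H'⟩ := F.homotopy_of_projection (n - s) n hF.rk_eq_zero (dual ω K) hW _
    (dualEmbComplex ω hW K) (dualProj hW hq hWa hres)
    (fun p w x => dualProj_dualEmb hW hq hWa hres p w x)
    (fun p d w k h a x => dualProj_incl_smul hW hq hWa hres p d w k h a x)
    (fun p q w x => dualProj_d hW hq hWa hres p q w x) (f ≫ totRes hV hg (dual ω K)) H
  refine ⟨_, hg, hyg, ?_⟩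
  have e := HomotopyCategory.eq_of_homotopy _ _ H'
  rw [Functor.map_comp, Functor.map_zero] at e
  exact e

end dualLocal

end HomFlip

namespace HomFlip

open CochainComplex HomComplex Pretriangulated

attribute [local instance] HasDerivedCategory.standard

/-! ### Locally finite injective dimension of the structure sheaf -/

section flipFlop

variable {Y : Scheme.{u}} {A : GradedRingSheaf Y} {U : Y.Opens} {ω : CochainComplex Y.Modules ℤ}

lemma IsLocallyFinInj.of_Q_iso {K L : CochainComplex (GrMod A) ℤ}
    (e : (DGr.Q A).obj K ≅ (DGr.Q A).obj L) (h : IsLocallyFinInj A U ((KGr.q A).obj K)) :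
    IsLocallyFinInj A U ((KGr.q A).obj L) :=
  h.of_iso ((qCompQhIso A).app K ≪≫ e ≪≫ ((qCompQhIso A).app L).symm)

lemma IsLocallyFinInj.of_mappingCone {K L : CochainComplex (GrMod A) ℤ} (f : K ⟶ L)
    (h₁ : IsLocallyFinInj A U ((KGr.q A).obj K))
    (h₃ : IsLocallyFinInj A U ((KGr.q A).obj (mappingCone f))) :
    IsLocallyFinInj A U ((KGr.q A).obj L) :=
  IsLocallyFinInj.triangle _ (HomotopyCategory.mappingCone_triangleh_distinguished f) h₁ h₃

/-- The local finiteness of the injective dimension of the structure sheaf. -/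
lemma isLocallyFinInj_self [IsNoetherian Y] [Y.IsSeparated] (hω : IsDualizingComplex ω)
    (hA : A.IsNoetherianOver) {J : InjRes A} (H : HomologicalFlipFlop ω J)
    (Ψ : ((DGr.Q A).obj ((twistComplex A H.a).obj J.RΓplus))⟦(1 : ℤ)⟧ ≅
        (DGr.Q A).obj (dual ω J.RΓminus)) (hU : IsAffineOpen U) :
    IsLocallyFinInj A U ((KGr.q A).obj ((twistComplex A H.a).obj
      ((CochainComplex.singleFunctor (GrMod A) 0).obj A.self))) := by
  have hΦ := H.isIso_Φplus
  -- `Č⁺(a)` is isomorphic to the dual `𝔻(Č⁺)` through `Φ⁺`, and the Čech complex has finite flat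
  -- dimension as the cone of a map between two complexes that do.
  have hC : IsLocallyFinInj A U ((KGr.q A).obj (dual ω J.CechPlus)) := by
    obtain ⟨c, hc⟩ := flatBuilt_totComplex_RΓ hA J hU (0 < ·)
    exact isLocallyFinInj_dual hω hU _ (fun n i => qcoh_mappingCone _ n i
      (fun n i => J.qcoh_RΓ hA _ n i) fun n i => J.qcoh n i) fun f =>
        flatBuilt_totComplex_mappingCone (J.ε (0 < ·)) ((hc f).mono (Nat.le_add_right c 2))
          ((flatBuilt_totComplex_J hA J hU f).mono (Nat.le_add_left 2 c))
  have hC' : IsLocallyFinInj A U ((KGr.q A).obj ((twistComplex A H.a).obj J.CechPlus)) :=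
    hC.of_Q_iso (asIso H.Φplus).symm
  have hC'' : IsLocallyFinInj A U ((KGr.q A).obj
      (mappingCone ((twistComplex A H.a).map (J.ε (0 < ·))))) :=
    hC'.of_Q_iso ((DGr.Q A).mapIso (mappingCone.mapHomologicalComplexIso (J.ε (0 < ·)) (GrMod.twist A H.a)))
  have hR : IsLocallyFinInj A U ((KGr.q A).obj (dual ω (J.RΓminus⟦(1 : ℤ)⟧))) := by
    obtain ⟨c, hc⟩ := flatBuilt_totComplex_RΓ hA J hU (· < 0)
    exact isLocallyFinInj_dual hω hU _ (fun n i => J.qcoh_RΓ hA _ (n + 1) i) fun f =>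
      flatBuilt_totComplex_shift (hc f)
  -- Since `RΓ⁺(a)[1] ≅ 𝔻(RΓ⁻) ≅ 𝔻(RΓ⁻[1])[1]`, undoing the shift shows that `RΓ⁺(a)` is the dual of
  -- `RΓ⁻[1]`.
  let e : ((DGr.Q A).obj ((twistComplex A H.a).obj J.RΓplus))⟦(1 : ℤ)⟧ ≅
      ((DGr.Q A).obj (dual ω (J.RΓminus⟦(1 : ℤ)⟧)))⟦(1 : ℤ)⟧ :=
    Ψ ≪≫ (DGr.Q A).mapIso (asIso (dualShift ω J.RΓminus)) ≪≫
      ((DGr.Q A).commShiftIso (1 : ℤ)).app _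
  have hR' : IsLocallyFinInj A U ((KGr.q A).obj ((twistComplex A H.a).obj J.RΓplus)) :=
    hR.of_Q_iso ((CategoryTheory.shiftFunctor (DGr A) (1 : ℤ)).preimageIso e).symm
  have hJ : IsLocallyFinInj A U ((KGr.q A).obj ((twistComplex A H.a).obj J.J)) :=
    hR'.of_mappingCone _ hC''
  have hι : IsIso ((DGr.Q A).map ((twistComplex A H.a).map J.ι)) :=
    Localization.inverts (DGr.Q A) (grQuasiIso A) _ fun i => J.quasiIso (i + H.a)
  exact hJ.of_Q_iso (asIso ((DGr.Q A).map ((twistComplex A H.a).map J.ι))).symm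

end flipFlop

end HomFlip

namespace HomFlip

open Abelian

/-! ### Injective dimension and Ext of cyclic modules -/

section ext

variable {R : Type u} [CommRing R]

/-- Baer's criterion: the obstruction to extending a map `I → M` to `R` lies in `Ext^1(R/I, M)`. -/
lemma injective_of_ext_quotient (M : ModuleCat.{u} R)
    (h : ∀ (I : Ideal R) (e : Ext (ModuleCat.of R (R ⧸ I)) M 1), e = 0) : Injective M := by
  suffices hB : Module.Baer R M by
    have := hB.injective
    exact Module.injective_object_of_injective_module R M
  intro I g
  let S : ShortComplex (ModuleCat.{u} R) :=
    ModuleCat.shortComplexOfCompEqZero I.subtype I.mkQ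
      (LinearMap.exact_subtype_mkQ I).linearMap_comp_eq_zero
  have hS : S.ShortExact := ModuleCat.shortComplex_shortExact S (LinearMap.exact_subtype_mkQ I)
    I.injective_subtype I.mkQ_surjective
  obtain ⟨x, hx⟩ := Ext.contravariant_sequence_exact₁ hS M (Ext.mk₀ (ModuleCat.ofHom g))
    (add_zero 1) (h I _)
  obtain ⟨g', rfl⟩ := Ext.addEquiv₀.symm.surjective x
  refine ⟨g'.hom, fun x hx' => ?_⟩
  have h1 : S.f ≫ g' = ModuleCat.ofHom g := by
    apply Ext.addEquiv₀.symm.injective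
    refine Eq.trans ?_ hx
    exact (Ext.mk₀_comp_mk₀ S.f g').symm
  exact congrArg (fun f : S.X₁ ⟶ M => f.hom (⟨x, hx'⟩ : I)) h1

/-- Baer's criterion for the injective dimension. -/
lemma hasInjectiveDimensionLT_of_ext_quotient (n : ℕ) (M : ModuleCat.{u} R)
    (h : ∀ (I : Ideal R) (e : Ext (ModuleCat.of R (R ⧸ I)) M (n + 1)), e = 0) :
    HasInjectiveDimensionLT M (n + 1) := by
  induction n generalizing M with
  | zero => exact injective_iff_hasInjectiveDimensionLT_one.1 (injective_of_ext_quotient M h)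
  | succ n ih =>
    -- Dimension shifting: with `M` embedded in an injective, the cokernel inherits the vanishing
    -- one degree lower.
    obtain ⟨⟨I, inj, f, _⟩⟩ := EnoughInjectives.presentation M
    let S := ShortComplex.mk f (cokernel.π f) (cokernel.condition f)
    have hS : S.ShortExact := { exact := ShortComplex.exact_cokernel f }
    refine (hS.hasInjectiveDimensionLT_X₃_iff n inj).1 (ih _ fun J e => ?_)
    obtain ⟨x, rfl⟩ := Ext.covariant_sequence_exact₃ _ hS e rfl (h J _)
    have : x = 0 := Ext.eq_zero_of_injective x
    rw [this, Ext.zero_comp]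

/-- The vanishing of the groups `Ext^n(N, M)` for `n ≥ k`. -/
def ExtVanish (M : ModuleCat.{u} R) (k : ℕ) (N : ModuleCat.{u} R) : Prop :=
  ∀ n, k ≤ n → ∀ e : Ext N M n, e = 0

variable {M : ModuleCat.{u} R} {k : ℕ}

lemma ExtVanish.mono {l : ℕ} (hkl : k ≤ l) {N : ModuleCat.{u} R} (h : ExtVanish M k N) :
    ExtVanish M l N := fun n hn => h n (hkl.trans hn)

lemma ExtVanish.ext {S : ShortComplex (ModuleCat.{u} R)} (hS : S.ShortExact)
    (h₁ : ExtVanish M k S.X₁) (h₃ : ExtVanish M k S.X₃) : ExtVanish M k S.X₂ := fun n hn e => by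
  obtain ⟨x, rfl⟩ := Ext.contravariant_sequence_exact₂ hS M e (h₁ n hn _)
  rw [h₃ n hn x, Ext.comp_zero]

lemma ExtVanish.coker {S : ShortComplex (ModuleCat.{u} R)} (hS : S.ShortExact)
    (h₁ : ExtVanish M k S.X₁) (h₂ : ExtVanish M k S.X₂) : ExtVanish M (k + 1) S.X₃ := by
  intro n hn e
  obtain ⟨n, rfl⟩ : ∃ m, n = 1 + m := ⟨n - 1, by omega⟩
  obtain ⟨x, rfl⟩ := Ext.contravariant_sequence_exact₃ hS M e (h₂ _ (by omega) _) rfl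
  rw [h₁ n (by omega) x, Ext.comp_zero]

/-- The exact sequence `0 → R/(I : a) → R/I → R/(I + (a)) → 0`. -/
lemma shortExact_quotient_mul (I J K : Ideal R) (a : R) (hJ : ∀ r, r ∈ J ↔ a * r ∈ I)
    (hK : K = I ⊔ Ideal.span {a}) :
    ∃ (f : ModuleCat.of R (R ⧸ J) ⟶ ModuleCat.of R (R ⧸ I))
      (g : ModuleCat.of R (R ⧸ I) ⟶ ModuleCat.of R (R ⧸ K)) (w : f ≫ g = 0),
      (ShortComplex.mk f g w).ShortExact ∧ ∀ r : R, f.hom (J.mkQ r) = I.mkQ (a * r) := by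
  subst hK
  let f : R ⧸ J →ₗ[R] R ⧸ I := Submodule.mapQ J I (LinearMap.lsmul R R a) fun r hr => (hJ r).1 hr
  let g : R ⧸ I →ₗ[R] R ⧸ (I ⊔ Ideal.span {a}) := Submodule.factor le_sup_left
  have hf : ∀ r, f (J.mkQ r) = I.mkQ (a * r) := fun r => rfl
  have hg : ∀ r, g (I.mkQ r) = Submodule.mkQ _ r := fun r => rfl
  have hex : Function.Exact f g := by
    intro y
    obtain ⟨y, rfl⟩ := I.mkQ_surjective y
    rw [hg]
    constructor
    · intro h
      have h1 : y ∈ I ⊔ Ideal.span {a} := (Submodule.Quotient.mk_eq_zero _).1 h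
      obtain ⟨i, hi, z, hz, rfl⟩ := Submodule.mem_sup.1 h1
      obtain ⟨r, rfl⟩ := Ideal.mem_span_singleton'.1 hz
      refine ⟨J.mkQ r, ?_⟩
      rw [hf, map_add, (Submodule.Quotient.mk_eq_zero I (x := i)).2 hi |> (show I.mkQ i = 0 from ·),
        zero_add, mul_comm]
    · rintro ⟨x, hx⟩
      obtain ⟨x, rfl⟩ := J.mkQ_surjective x
      rw [hf] at hx
      have h1 : a * x - y ∈ I := (Submodule.Quotient.eq I).1 hx
      refine (Submodule.Quotient.mk_eq_zero _).2 ?_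
      have h2 : y = a * x - (a * x - y) := by ring
      rw [h2]
      exact Submodule.sub_mem _ (Ideal.mul_mem_right _ _
        (Submodule.mem_sup_right (Ideal.mem_span_singleton_self a))) (Submodule.mem_sup_left h1)
  have hinj : Function.Injective f := by
    rw [← LinearMap.ker_eq_bot, LinearMap.ker_eq_bot']
    intro x hx
    obtain ⟨x, rfl⟩ := J.mkQ_surjective x
    rw [hf] at hx
    exact (Submodule.Quotient.mk_eq_zero _).2 ((hJ x).2 ((Submodule.Quotient.mk_eq_zero _).1 hx))
  have hsurj : Function.Surjective g := fun y => by
    obtain ⟨y, rfl⟩ := Submodule.mkQ_surjective _ y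
    exact ⟨I.mkQ y, rfl⟩
  exact ⟨ModuleCat.ofHom f, ModuleCat.ofHom g,
    ModuleCat.hom_ext hex.linearMap_comp_eq_zero, ModuleCat.shortComplex_shortExact
      (ModuleCat.shortComplexOfCompEqZero f g hex.linearMap_comp_eq_zero) hex hinj hsurj, hf⟩

lemma ExtVanish.of_quotient_mul {I J K : Ideal R} (a : R) (hJ : ∀ r, r ∈ J ↔ a * r ∈ I)
    (hK : K = I ⊔ Ideal.span {a}) (h₁ : ExtVanish M k (ModuleCat.of R (R ⧸ J)))
    (h₃ : ExtVanish M k (ModuleCat.of R (R ⧸ K))) : ExtVanish M k (ModuleCat.of R (R ⧸ I)) := by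
  obtain ⟨f, g, w, hS, -⟩ := shortExact_quotient_mul I J K a hJ hK
  exact h₁.ext hS h₃

/-- If `N` is annihilated by `a`, then so are the groups `Ext^n(N, M)`. -/
lemma smul_ext_eq_zero {N : ModuleCat.{u} R} (a : R) (h : ∀ x : N, a • x = 0) {n : ℕ}
    (e : Ext N M n) : a • e = 0 := by
  have h1 : a • 𝟙 N = 0 := ModuleCat.hom_ext (LinearMap.ext h)
  rw [← Ext.mk₀_id_comp e, ← Ext.smul_comp, ← Ext.mk₀_smul, h1, Ext.mk₀_zero, Ext.zero_comp]

/-- The kernel `p/J` of `R/J → R/p` is killed by `s`. As `Ext^n(R/J, M)` vanishes, `Ext^n(R/p, M)`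
is a quotient of `Ext^(n-1)(p/J, M)` and so is killed by `s` too. In the long exact sequence of `0 →
R/p → R/p → R/(p + (s)) → 0`, with first map multiplication by `s`, every class of `Ext^n(R/p, M)`
then comes from `Ext^n(R/(p + (s)), M)`, which is zero. -/
lemma ExtVanish.of_annihilated {J p : Ideal R} (hJ : J ≤ p) (s : R)
    (hs : ∀ r ∈ p, s * r ∈ J) (hp : ∀ r, r ∈ p ↔ s * r ∈ p)
    (h : ExtVanish M k (ModuleCat.of R (R ⧸ J)))
    (h' : ExtVanish M (k + 1) (ModuleCat.of R (R ⧸ (p ⊔ Ideal.span {s})))) :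
    ExtVanish M (k + 1) (ModuleCat.of R (R ⧸ p)) := by
  intro n hn e
  let g : R ⧸ J →ₗ[R] R ⧸ p := Submodule.factor hJ
  have hg : ∀ x, g x = 0 → s • x = 0 := fun x hx => by
    obtain ⟨x, rfl⟩ := J.mkQ_surjective x
    have hx' : p.mkQ x = 0 := hx
    rw [← map_smul]
    exact (Submodule.Quotient.mk_eq_zero _).2 (hs x ((Submodule.Quotient.mk_eq_zero _).1 hx'))
  have hgs : Function.Surjective g := fun y => by
    obtain ⟨y, rfl⟩ := p.mkQ_surjective y
    exact ⟨J.mkQ y, rfl⟩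
  have hS := LinearMap.shortExact_shortComplexKer (f := g) hgs
  have he : s • e = 0 := by
    obtain ⟨m, rfl⟩ : ∃ m, n = 1 + m := ⟨n - 1, by omega⟩
    obtain ⟨x, rfl⟩ := Ext.contravariant_sequence_exact₃ hS M e (h _ (by omega) _) rfl
    rw [← Ext.comp_smul, smul_ext_eq_zero s (fun x : LinearMap.ker g => Subtype.ext (hg x.1 x.2)) x, Ext.comp_zero]
  obtain ⟨f, g', w, hT, hf⟩ := shortExact_quotient_mul p p _ s hp rfl
  have hf' : f = s • 𝟙 _ := by
    refine ModuleCat.hom_ext (LinearMap.ext fun x => ?_)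
    obtain ⟨x, rfl⟩ := p.mkQ_surjective x
    exact hf x
  obtain ⟨x, rfl⟩ := Ext.contravariant_sequence_exact₂ hT M e (by
    change (Ext.mk₀ f).comp e _ = 0
    rw [hf', Ext.mk₀_smul, Ext.smul_comp, Ext.mk₀_id_comp, he])
  rw [h' n hn x, Ext.comp_zero]

lemma exists_mul_mem_of_fg {p J N : Ideal R} [p.IsPrime] (hN : N.FG)
    (h : ∀ g ∈ N, ∃ s ∉ p, s * g ∈ J) : ∃ s ∉ p, ∀ g ∈ N, s * g ∈ J := by
  induction N, hN using Submodule.fg_induction with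
  | singleton x =>
    obtain ⟨s, hs, hx⟩ := h x (Submodule.mem_span_singleton_self x)
    refine ⟨s, hs, fun g hg => ?_⟩
    obtain ⟨r, rfl⟩ := Submodule.mem_span_singleton.1 hg
    rw [smul_eq_mul, mul_left_comm]
    exact Ideal.mul_mem_left _ _ hx
  | sup N N' _ _ ih ih' =>
    obtain ⟨s, hs, h1⟩ := ih fun g hg => h g (Submodule.mem_sup_left hg)
    obtain ⟨s', hs', h2⟩ := ih' fun g hg => h g (Submodule.mem_sup_right hg)
    refine ⟨s * s', fun hh => ((‹p.IsPrime›.mem_or_mem hh).elim hs hs'), fun g hg => ?_⟩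
    obtain ⟨x, hx, y, hy, rfl⟩ := Submodule.mem_sup.1 hg
    rw [mul_add]
    refine J.add_mem ?_ ?_
    · rw [mul_right_comm, mul_comm]
      exact Ideal.mul_mem_left _ _ (h1 x hx)
    · rw [mul_assoc]
      exact Ideal.mul_mem_left _ _ (h2 y hy)

/-- If `Ext^n(R/q, M) = 0` for `n ≥ c` and sufficiently many prime ideals `q`, then
`Ext^n(R/I, M) = 0` for `n ≥ c + 2` and all ideals `I`. -/
theorem extVanish_quotient [IsNoetherianRing R] (M : ModuleCat.{u} R) (c : ℕ)
    (H : ∀ p : Ideal R, p.IsPrime → ∃ q ≤ p, q.IsPrime ∧ ExtVanish M c (ModuleCat.of R (R ⧸ q)) ∧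
      (p = q ∨ ∃ f ∈ p, f ∉ q ∧ ∀ g ∈ p, ∃ s ∉ p, s * g ∈ q ⊔ Ideal.span {f})) (I : Ideal R) :
    ExtVanish M (c + 2) (ModuleCat.of R (R ⧸ I)) := by
  -- Noetherian induction: the claim may be assumed for all strictly larger ideals.
  refine IsNoetherian.induction (P := fun I : Ideal R =>
    ExtVanish M (c + 2) (ModuleCat.of R (R ⧸ I))) (fun (p : Ideal R) ih => ?_) I
  by_cases hp : p.IsPrime
  · obtain ⟨q, hqp, hq, hE, rfl | ⟨f, hf, hfq, hg⟩⟩ := H p hp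
    · exact hE.mono (by omega)
    -- `R/(q + (f))` is the cokernel of the injective multiplication by `f` on `R/q`, which costs
    -- one degree. Passing from there to `R/p` costs a second one and uses the induction hypothesis
    -- for `p + (s)`, strictly larger because `s ∉ p`.
    · obtain ⟨s, hs, hsp⟩ := exists_mul_mem_of_fg (IsNoetherian.noetherian p) hg
      refine ExtVanish.of_annihilated (J := q ⊔ Ideal.span {f}) (sup_le hqp
        ((Ideal.span_singleton_le_iff_mem _).2 hf)) s hsp
        (fun r => ⟨fun h => Ideal.mul_mem_left _ _ h, fun h => (hp.mem_or_mem h).resolve_left hs⟩) ?_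
        (ih _ (lt_of_le_of_ne le_sup_left fun h => hs ?_))
      · obtain ⟨f', g', w, hS, -⟩ := shortExact_quotient_mul q q _ f
          (fun r => ⟨fun h => Ideal.mul_mem_left _ _ h, fun h => (hq.mem_or_mem h).resolve_left hfq⟩) rfl
        exact ExtVanish.coker hS hE hE
      · rw [h]
        exact Submodule.mem_sup_right (Ideal.mem_span_singleton_self s)
  · by_cases htop : p = ⊤
    · subst htop
      intro n hn e
      have : IsZero (ModuleCat.of R (R ⧸ (⊤ : Ideal R))) := by
        rw [ModuleCat.isZero_iff_subsingleton]
        exact Ideal.Quotient.subsingleton_iff.2 rfl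
      rw [← Ext.mk₀_id_comp e, this.eq_of_src (𝟙 _) 0, Ext.mk₀_zero, Ext.zero_comp]
    -- For a proper ideal that is not prime, `R/p` is an extension of `R/(p + (a))` by `R/(p : a)`,
    -- and both ideals are strictly larger: the first contains `a`, the second `b`.
    · obtain ⟨a, b, hab, ha, hb⟩ : ∃ a b, a * b ∈ p ∧ a ∉ p ∧ b ∉ p := by
        by_contra hcon
        push Not at hcon
        exact hp ⟨htop, fun {a b} hab => or_iff_not_imp_left.2 fun ha => hcon a b hab ha⟩
      refine ExtVanish.of_quotient_mul (J := Submodule.comap (LinearMap.lsmul R R a) p) a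
        (fun r => Iff.rfl) rfl (ih _ (lt_of_le_of_ne (fun r hr => Ideal.mul_mem_left _ _ hr)
          fun h => hb ?_)) (ih _ (lt_of_le_of_ne le_sup_left fun h => ha ?_))
      · rw [h]
        exact hab
      · rw [h]
        exact Submodule.mem_sup_right (Ideal.mem_span_singleton_self a)

/-- A Noetherian ring is Gorenstein if `Ext^n(R/I, R) = 0` for all ideals and all large `n`. -/
lemma isGorensteinRing_of_extVanish [IsNoetherianRing R] (c : ℕ)
    (h : ∀ I : Ideal R, ExtVanish (ModuleCat.of R R) c (ModuleCat.of R (R ⧸ I))) :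
    IsGorensteinRing R := by
  refine ⟨inferInstance, fun p hp => ⟨c + 1, ?_⟩⟩
  have h1 : HasInjectiveDimensionLE (ModuleCat.of R R) c :=
    hasInjectiveDimensionLT_of_ext_quotient c _ fun I e => h I _ (by omega) e
  have h2 := (ModuleCat.of R R).localizedModule_hasInjectiveDimensionLE c p.primeCompl
  have h3 := ModuleCat.localizedModule_isLocalizedModule (ModuleCat.of R R) p.primeCompl
  let e := IsLocalizedModule.linearEquiv p.primeCompl
    ((ModuleCat.of R R).localizedModuleMkLinearMap p.primeCompl)
    (Algebra.linearMap R (Localization.AtPrime p))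
  exact (ModuleCat.hasInjectiveDimensionLE_iff_of_linearEquiv
    (N := ModuleCat.of (Localization.AtPrime p) (Localization.AtPrime p))
    (e.extendScalarsOfIsLocalization p.primeCompl (Localization.AtPrime p)) c).1 h2

end ext

end HomFlip

namespace HomFlip

/-! ### Prime ideals of graded rings and their homogeneous cores -/

section graded

variable {B : Type u} [CommRing B] (𝒜 : ℤ → AddSubgroup B) [GradedRing 𝒜]

lemma proj_mem (k : ℤ) (x : B) : GradedRing.proj 𝒜 k x ∈ 𝒜 k := (DirectSum.decompose 𝒜 x k).2

lemma proj_mul_left {i k l : ℤ} (h : i + k = l) {a : B} (ha : a ∈ 𝒜 i) (x : B) :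
    GradedRing.proj 𝒜 l (a * x) = a * GradedRing.proj 𝒜 k x := by
  subst h
  exact DirectSum.coe_decompose_mul_add_of_left_mem 𝒜 ha

open Classical in
lemma exists_finset_proj (x : B) : ∃ D : Finset ℤ, (∀ k ∉ D, GradedRing.proj 𝒜 k x = 0) ∧
    ∑ k ∈ D, GradedRing.proj 𝒜 k x = x := by
  refine ⟨(DirectSum.decompose 𝒜 x).support, fun k hk => ?_, DirectSum.sum_support_decompose 𝒜 x⟩
  rw [DFinsupp.notMem_support_iff] at hk
  exact congrArg Subtype.val hk

lemma mem_of_proj_mem {S : Type*} [SetLike S B] [AddSubmonoidClass S B] (q : S) {x : B}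
    (h : ∀ k, GradedRing.proj 𝒜 k x ∈ q) : x ∈ q := by
  obtain ⟨D, -, hD⟩ := exists_finset_proj 𝒜 x
  rw [← hD]
  exact sum_mem fun k _ => h k

/-- A prime ideal of a graded ring is principal up to homogeneous denominators, modulo its
homogeneous core. -/
lemma exists_mul_mem_core {p q : Ideal B} (hp : p.IsPrime) (hqp : q ≤ p)
    (hh : ∀ k, ∀ a ∈ 𝒜 k, a ∈ p → a ∈ q) (hne : p ≠ q) :
    ∃ f ∈ p, f ∉ q ∧ ∀ g ∈ p, ∃ s ∉ p, s * g ∈ q ⊔ Ideal.span {f} := by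
  -- `W g l v` says that, modulo `q`, the element `g` has components only in the `v` weights from
  -- `l` on. The generator `f` is an element of `p` outside `q` for which this width is minimal.
  let W : B → ℤ → ℕ → Prop := fun g l v => ∀ k, k < l ∨ l + v ≤ k → GradedRing.proj 𝒜 k g ∈ q
  have hW0 : ∀ g l, W g l 0 → g ∈ q := fun g l h => mem_of_proj_mem 𝒜 q fun k => h k (by
    push_cast; omega)
  have hWex : ∀ g, ∃ l v, W g l v := fun g => by
    obtain ⟨D, hD, -⟩ := exists_finset_proj 𝒜 g
    obtain ⟨m, hm⟩ := D.finite_toSet.bddAbove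
    obtain ⟨l, hl⟩ := D.finite_toSet.bddBelow
    refine ⟨l, (m - l + 1).toNat, fun k hk => ?_⟩
    rw [hD k]
    · exact q.zero_mem
    · intro hk'
      have := hm hk'
      have := hl hk'
      omega
  have hex : ∃ w, ∃ f ∈ p, f ∉ q ∧ ∃ l, W f l w := by
    obtain ⟨f, hf, hfq⟩ := SetLike.exists_of_lt (lt_of_le_of_ne hqp hne.symm)
    obtain ⟨l, v, h⟩ := hWex f
    exact ⟨v, f, hf, hfq, l, h⟩
  classical
  obtain ⟨f, hf, hfq, l, hl⟩ := Nat.find_spec hex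
  have hmin : ∀ v < Nat.find hex, ∀ g ∈ p, ∀ l, W g l v → g ∈ q := fun v hv g hg l h => by
    by_contra hgq
    exact Nat.find_min hex hv ⟨g, hg, hgq, l, h⟩
  generalize Nat.find hex = w at hl hmin
  obtain ⟨w, rfl⟩ : ∃ w', w = w' + 1 := by
    cases w with
    | zero => exact absurd (hW0 f l hl) hfq
    | succ w => exact ⟨w, rfl⟩
  let a := GradedRing.proj 𝒜 (l + w) f
  have ha : a ∈ 𝒜 (l + w) := proj_mem 𝒜 _ f
  -- If the top component `a` of `f` were in `p`, it would be in `q`, and `f` would have a smaller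
  -- width.
  have hap : a ∉ p := fun h => hfq (hmin w (by omega) f hf l fun k hk => by
    by_cases hkw : k = l + w
    · rw [hkw]
      exact hh _ a ha h
    · exact hl k (by push_cast; omega))
  refine ⟨f, hf, hfq, fun g hg => ?_⟩
  obtain ⟨l', v, hv⟩ := hWex g
  induction v using Nat.strong_induction_on generalizing g l' with
  | _ v ih =>
  by_cases hvw : v < w + 1
  · exact ⟨1, fun h => hp.ne_top ((Ideal.eq_top_iff_one _).2 h), by
      rw [one_mul]
      exact Submodule.mem_sup_left (hmin v hvw g hg l' hv)⟩
  obtain ⟨v, rfl⟩ : ∃ v', v = v' + 1 := ⟨v - 1, by omega⟩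
  let b := GradedRing.proj 𝒜 (l' + v) g
  have hb : b ∈ 𝒜 (l' + v) := proj_mem 𝒜 _ g
  -- Pseudo-division by `f`: in `a * g - b * f` the top components cancel, so the width drops, and
  -- the price is only the denominator `a`, which is not in `p`. The case of width below that of `f`
  -- is minimality.
  obtain ⟨s, hs, hsg⟩ := ih v (by omega) (a * g - b * f)
    (p.sub_mem (p.mul_mem_left _ hg) (p.mul_mem_left _ hf)) (l' + l + w) fun k hk => by
      rw [map_sub, proj_mul_left 𝒜 (show l + w + (k - (l + w)) = k by omega) ha,
        proj_mul_left 𝒜 (show l' + v + (k - (l' + v)) = k by omega) hb]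
      by_cases hkt : k = l' + l + w + v
      · rw [show k - (l + w) = l' + v by omega, show k - (l' + v) = l + w by omega]
        change a * b - b * a ∈ q
        rw [mul_comm, sub_self]
        exact q.zero_mem
      · exact q.sub_mem (q.mul_mem_left _ (hv _ (by push_cast; omega)))
          (q.mul_mem_left _ (hl _ (by push_cast; omega)))
  refine ⟨s * a, fun h => (hp.mem_or_mem h).elim hs hap, ?_⟩
  have h1 : s * a * g = s * (a * g - b * f) + s * b * f := by ring
  rw [h1]
  exact Ideal.add_mem _ hsg (Submodule.mem_sup_right
    (Ideal.mul_mem_left _ _ (Ideal.mem_span_singleton_self f)))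

/-- A prime ideal of a graded ring is principal up to homogeneous denominators, modulo a
homogeneous prime ideal. -/
lemma exists_homogeneous_prime (p : Ideal B) (hp : p.IsPrime) : ∃ q ≤ p, q.IsPrime ∧
    q.IsHomogeneous 𝒜 ∧
      (p = q ∨ ∃ f ∈ p, f ∉ q ∧ ∀ g ∈ p, ∃ s ∉ p, s * g ∈ q ⊔ Ideal.span {f}) := by
  refine ⟨(p.homogeneousCore 𝒜).toIdeal, Ideal.toIdeal_homogeneousCore_le 𝒜 p,
    Ideal.IsPrime.homogeneousCore hp, (p.homogeneousCore 𝒜).isHomogeneous,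
    or_iff_not_imp_left.2 fun hne => ?_⟩
  exact exists_mul_mem_core 𝒜 hp (Ideal.toIdeal_homogeneousCore_le 𝒜 p)
    (fun k a ha hap => Ideal.mem_homogeneousCore_of_homogeneous_of_mem ⟨k, ha⟩ hap) hne

/-! ### Graded free modules and syzygies -/

/-- The homogeneous components of an element of a graded free module. -/
noncomputable def freeProj {r : ℕ} (e : Fin r → ℤ) (k : ℤ) : (Fin r → B) →+ (Fin r → B) where
  toFun x v := GradedRing.proj 𝒜 (k - e v) (x v)
  map_zero' := funext fun v => map_zero _
  map_add' x y := funext fun v => map_add _ _ _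

lemma freeProj_apply {r : ℕ} (e : Fin r → ℤ) (k : ℤ) (x : Fin r → B) (v : Fin r) :
    freeProj 𝒜 e k x v = GradedRing.proj 𝒜 (k - e v) (x v) := rfl

lemma exists_finset_freeProj {r : ℕ} (e : Fin r → ℤ) (x : Fin r → B) :
    ∃ D : Finset ℤ, ∀ D', D ⊆ D' → ∑ k ∈ D', freeProj 𝒜 e k x = x := by
  classical
  choose D hD hDs using fun v => exists_finset_proj 𝒜 (x v)
  refine ⟨Finset.univ.biUnion fun v => (D v).image (· + e v), fun D' hD' => funext fun v => ?_⟩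
  rw [Finset.sum_apply]
  refine Eq.trans ?_ (hDs v)
  refine Eq.trans ?_ (Finset.sum_subset (s₁ := D v) (s₂ := D'.image (· - e v)) (fun k hk => ?_)
    fun k _ hk => hD v k hk).symm
  · rw [Finset.sum_image fun a _ b _ h => by simpa using h]
    rfl
  · refine Finset.mem_image.2 ⟨k + e v, hD' (Finset.mem_biUnion.2 ⟨v, Finset.mem_univ _,
      Finset.mem_image_of_mem _ hk⟩), by omega⟩

lemma freeProj_map {r r' : ℕ} (e : Fin r → ℤ) (e' : Fin r' → ℤ) (g : (Fin r → B) →ₗ[B] (Fin r' → B))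
    (hg : ∀ t v, g (Pi.single t 1) v ∈ 𝒜 (e t - e' v)) (k : ℤ) (x : Fin r → B) :
    freeProj 𝒜 e' k (g x) = g (freeProj 𝒜 e k x) := by
  classical
  have h : ∀ x, g x = ∑ t, x t • g (Pi.single t 1) := fun x => by
    conv_lhs => rw [pi_eq_sum_univ' x]
    rw [map_sum]
    simp only [map_smul]
  refine funext fun v => ?_
  rw [freeProj_apply, h, h, Finset.sum_apply, Finset.sum_apply, map_sum]
  refine Finset.sum_congr rfl fun t _ => ?_
  rw [Pi.smul_apply, Pi.smul_apply, smul_eq_mul, smul_eq_mul, freeProj_apply, mul_comm, 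
    proj_mul_left 𝒜 (show e t - e' v + (k - e t) = k - e' v by omega) (hg t v), mul_comm]

/-- A homogeneous submodule of a graded free module of finite rank. -/
structure HomogSub where
  rk : ℕ
  deg : Fin rk → ℤ
  N : Submodule B (Fin rk → B)
  freeProj_mem (k : ℤ) (x : Fin rk → B) (hx : x ∈ N) : freeProj 𝒜 deg k x ∈ N

namespace HomogSub

variable {𝒜}

/-- The homogeneous components of finitely many generators lie in the submodule and still generate
it. The new basis is indexed by pairs of a generator and a weight from a finite set `D'` that covers
all its components. -/
lemma exists_cover [IsNoetherianRing B] (S : HomogSub 𝒜) : ∃ (r : ℕ) (e : Fin r → ℤ)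
    (g : (Fin r → B) →ₗ[B] (Fin S.rk → B)),
      (∀ t v, g (Pi.single t 1) v ∈ 𝒜 (e t - S.deg v)) ∧ LinearMap.range g = S.N := by
  classical
  obtain ⟨m, x, hx⟩ := Submodule.fg_iff_exists_fin_generating_family.1 (IsNoetherian.noetherian S.N)
  choose D hD using fun j => exists_finset_freeProj 𝒜 S.deg (x j)
  let D' := Finset.univ.biUnion D
  have hD' : ∀ j, ∑ k ∈ D', freeProj 𝒜 S.deg k (x j) = x j := fun j =>
    hD j _ (Finset.subset_biUnion_of_mem D (Finset.mem_univ j))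
  let φ : Fin (Fintype.card (Fin m × D')) ≃ Fin m × D' := (Fintype.equivFin _).symm
  let y : Fin m × D' → (Fin S.rk → B) := fun t => freeProj 𝒜 S.deg t.2 (x t.1)
  refine ⟨_, fun t => (φ t).2, (Pi.basisFun B _).constr B fun t => y (φ t), fun t v => ?_, ?_⟩
  · rw [← Pi.basisFun_apply, Module.Basis.constr_basis]
    exact proj_mem 𝒜 _ _
  · rw [Module.Basis.constr_range]
    refine le_antisymm (Submodule.span_le.2 ?_) ?_
    · rintro _ ⟨t, rfl⟩
      refine S.freeProj_mem _ _ ?_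
      rw [← hx]
      exact Submodule.subset_span ⟨_, rfl⟩
    · rw [← hx, Submodule.span_le]
      rintro _ ⟨j, rfl⟩
      rw [← hD' j, ← Finset.sum_coe_sort]
      exact Submodule.sum_mem _ fun k _ => Submodule.subset_span ⟨φ.symm (j, k),
        congrArg y (φ.apply_symm_apply (j, k))⟩

variable [IsNoetherianRing B] (S : HomogSub 𝒜)

/-- The kernel of a surjection from a graded free module to a homogeneous submodule. -/
noncomputable def next : HomogSub 𝒜 where
  rk := S.exists_cover.choose
  deg := S.exists_cover.choose_spec.choose
  N := LinearMap.ker S.exists_cover.choose_spec.choose_spec.choose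
  freeProj_mem k x hx := by
    rw [LinearMap.mem_ker] at hx ⊢
    rw [← freeProj_map 𝒜 _ S.deg _ S.exists_cover.choose_spec.choose_spec.choose_spec.1, hx,
      map_zero]

/-- The surjection from a graded free module to a homogeneous submodule. -/
noncomputable def cover : (Fin S.next.rk → B) →ₗ[B] (Fin S.rk → B) :=
  S.exists_cover.choose_spec.choose_spec.choose

lemma cover_mem (t : Fin S.next.rk) (v : Fin S.rk) :
    S.cover (Pi.single t 1) v ∈ 𝒜 (S.next.deg t - S.deg v) :=
  S.exists_cover.choose_spec.choose_spec.choose_spec.1 t v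

lemma range_cover : LinearMap.range S.cover = S.N :=
  S.exists_cover.choose_spec.choose_spec.choose_spec.2

lemma ker_cover : LinearMap.ker S.cover = S.next.N := rfl

open Classical in
/-- The differential between the terms of a resolution. -/
noncomputable def diff (S S' : HomogSub 𝒜) : (Fin S.rk → B) →ₗ[B] (Fin S'.rk → B) :=
  -- The terms of a truncated resolution are indexed by integers, so consecutive ones are syzygies
  -- of each other only up to a propositional equality. Making this equality a case of the
  -- definition confines the transport to one place.
  if h : S = S'.next then S'.cover.comp (LinearMap.funLeft B B (Fin.cast (by rw [h]))) else 0

lemma diff_next : S.next.diff S = S.cover := by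
  rw [diff, dif_pos rfl]
  rfl

lemma diff_eq_zero {S S' : HomogSub 𝒜} (h : S ≠ S'.next) : S.diff S' = 0 := dif_neg h

lemma diff_mem (S S' : HomogSub 𝒜) (t : Fin S.rk) (v : Fin S'.rk) :
    S.diff S' (Pi.single t 1) v ∈ 𝒜 (S.deg t - S'.deg v) := by
  by_cases h : S = S'.next
  · subst h
    rw [diff_next]
    exact S'.cover_mem t v
  · rw [diff_eq_zero h]
    exact zero_mem _

lemma diff_diff (S S' S'' : HomogSub 𝒜) (x : Fin S.rk → B) : S'.diff S'' (S.diff S' x) = 0 := by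
  by_cases h : S = S'.next
  · subst h
    by_cases h' : S' = S''.next
    · subst h'
      rw [diff_next, diff_next]
      have : S''.next.cover x ∈ LinearMap.range S''.next.cover := ⟨x, rfl⟩
      rw [range_cover, ← ker_cover] at this
      exact this
    · rw [diff_eq_zero h']
      rfl
  · rw [diff_eq_zero h, LinearMap.zero_apply, map_zero]

/-- The trivial submodule of the zero module. -/
noncomputable def empty (𝒜 : ℤ → AddSubgroup B) [GradedRing 𝒜] : HomogSub 𝒜 where
  rk := 0
  deg := Fin.elim0
  N := ⊥
  freeProj_mem k x hx := funext fun t => t.elim0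

/-- The terms of the resolution. -/
noncomputable def iter : ℕ → HomogSub 𝒜
  | 0 => S
  | n + 1 => (iter n).next

open Classical in
/-- The terms of a truncated resolution. -/
noncomputable def term (n s p : ℤ) : HomogSub 𝒜 :=
  if n - s ≤ p ∧ p ≤ n then S.iter (n - p).toNat else empty 𝒜

lemma term_eq {n s p : ℤ} (i : ℕ) (hi : n - p = i) (hs : i ≤ s) : S.term n s p = S.iter i := by
  rw [term, if_pos (by omega)]
  congr 1
  omega

lemma term_rk {n s p : ℤ} (h : p < n - s ∨ n < p) : (S.term n s p).rk = 0 := by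
  rw [term, if_neg (by omega)]
  rfl

/-- A truncated free resolution. -/
noncomputable def complex (n s : ℤ) : CochainComplex (ModuleCat.{u} B) ℤ where
  X p := ModuleCat.of B (Fin (S.term n s p).rk → B)
  d p q := if p + 1 = q then ModuleCat.ofHom ((S.term n s p).diff (S.term n s q)) else 0
  shape p q h := if_neg h
  d_comp_d' p q k h h' := by
    have h1 : p + 1 = q := h
    have h2 : q + 1 = k := h'
    rw [if_pos h1, if_pos h2]
    exact ModuleCat.hom_ext (LinearMap.ext fun x => diff_diff _ _ _ x)

lemma complex_d {n s p q : ℤ} (h : p + 1 = q) :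
    (S.complex n s).d p q = ModuleCat.ofHom ((S.term n s p).diff (S.term n s q)) := if_pos h

lemma diff_exact {S S' S'' : HomogSub 𝒜} (h : S = S'.next) (h' : S' = S''.next)
    (x : Fin S'.rk → B) (hx : S'.diff S'' x = 0) : ∃ y, S.diff S' y = x := by
  subst h h'
  rw [diff_next] at hx
  rw [diff_next]
  change x ∈ LinearMap.range _
  rw [range_cover]
  exact hx

lemma complex_exactAt {n s p : ℤ} (h : n - s < p) (h' : p < n) : (S.complex n s).ExactAt p := by
  rw [HomologicalComplex.exactAt_iff' _ (p - 1) p (p + 1) (by simp) (by simp),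
    ShortComplex.moduleCat_exact_iff]
  intro x hx
  change (S.complex n s).d p (p + 1) x = 0 at hx
  change ∃ y, (S.complex n s).d (p - 1) p y = x
  rw [complex_d S rfl] at hx
  rw [complex_d S (by omega)]
  obtain ⟨i, hi⟩ : ∃ i : ℕ, n - p = i + 1 := ⟨(n - p - 1).toNat, by omega⟩
  refine diff_exact ?_ ?_ x hx
  · rw [S.term_eq (i + 2) (by push_cast; omega) (by push_cast; omega),
      S.term_eq (i + 1) (by push_cast; omega) (by push_cast; omega)]
    rfl
  · rw [S.term_eq (i + 1) (by push_cast; omega) (by push_cast; omega),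
      S.term_eq i (by omega) (by omega)]
    rfl

end HomogSub

end graded

end HomFlip

namespace HomFlip

open CochainComplex HomComplex

/-! ### The ring of sections as a graded ring -/

section grading

variable {Y : Scheme.{u}} (A : GradedRingSheaf Y) (U : Y.Opens)

/-- The grading of the ring of sections. -/
noncomputable def grading (d : ℤ) : AddSubgroup (A.ring U) := (A.incl U d).range

lemma ring_hom_ext {X : Type*} [AddCommMonoid X] {f g : A.ring U →+ X}
    (h : ∀ d a, f (A.incl U d a) = g (A.incl U d a)) : f = g :=
  DirectSum.addHom_ext (β := A.piece U) h

/-- The homogeneous components of a section. -/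
noncomputable def decomposeHom : A.ring U →+ DirectSum ℤ fun d => grading A U d :=
  DirectSum.map (α := A.piece U) fun d => (A.incl U d).rangeRestrict

lemma decomposeHom_incl (d : ℤ) (a : Γ(A.gr d, U)) : decomposeHom A U (A.incl U d a) =
    DirectSum.of (fun d => grading A U d) d ⟨A.incl U d a, a, rfl⟩ :=
  DirectSum.map_of (α := A.piece U) _ _ _

noncomputable instance : GradedRing (grading A U) where
  one_mem := ⟨A.one U, rfl⟩
  mul_mem := by
    rintro i j _ _ ⟨a, rfl⟩ ⟨b, rfl⟩
    exact ⟨A.mul rfl U a b, (A.incl_mul U rfl a b).symm⟩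
  __ := DirectSum.Decomposition.ofAddHom (grading A U) (decomposeHom A U)
    (ring_hom_ext A U fun d a => (congrArg (DirectSum.coeAddMonoidHom (grading A U))
      (decomposeHom_incl A U d a)).trans (DirectSum.coeAddMonoidHom_of _ _ _))
    (DirectSum.addHom_ext fun d ⟨_, a, h⟩ => by
      subst h
      exact (congrArg (decomposeHom A U) (DirectSum.coeAddMonoidHom_of (grading A U) _ _)).trans
        (decomposeHom_incl A U d a))

variable {A U}

/-- The truncated resolution of a homogeneous submodule is a graded free complex. -/
noncomputable def HomogSub.gradedFree [IsNoetherianRing (A.ring U)] (S : HomogSub (grading A U))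
    (n s : ℤ) : GradedFree A U (S.complex n s) where
  rk p := (S.term n s p).rk
  basis p := Pi.basisFun (A.ring U) _
  deg p := (S.term n s p).deg
  homog p q t v := by
    by_cases h : p + 1 = q
    · obtain ⟨a, ha⟩ := (S.term n s p).diff_mem (S.term n s q) t v
      refine ⟨a, Eq.trans ?_ ha.symm⟩
      rw [← Pi.basisFun_apply]
      exact congrArg (fun g : (S.complex n s).X p ⟶ (S.complex n s).X q =>
        (show Fin (S.term n s q).rk → A.ring U from g (Pi.basisFun (A.ring U) _ t)) v)
        (complex_d S h)
    · refine ⟨0, Eq.trans ?_ (map_zero (A.incl U _)).symm⟩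
      exact congrArg (fun g : (S.complex n s).X p ⟶ (S.complex n s).X q =>
        (show Fin (S.term n s q).rk → A.ring U from g (Pi.basisFun (A.ring U) _ t)) v)
        ((S.complex n s).shape p q h)

lemma HomogSub.isTest [IsNoetherianRing (A.ring U)] (S : HomogSub (grading A U))
    (n s : ℤ) : (S.gradedFree n s).IsTest n s where
  rk_eq_zero p hp := S.term_rk hp
  exactAt p hp hp' := S.complex_exactAt hp hp'

end grading

/-! ### From local to global extensions -/

section extension

variable {Y : Scheme.{u}} {A : GradedRingSheaf Y} {U : Y.Opens}

/-- The functions `r` for which `r • ξ` extends along `d` form an ideal. Over `D(f)` the module of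
sections of `N` is a localization, so a local extension lifts to `U` after multiplication by a power
of `f` because `X₁` is finitely presented, and it satisfies the required identity after a further
power because `X₀` is finitely generated. -/
lemma exists_extension_of_locally (hU : IsAffineOpen U) {N : GrMod A} (hN : ∀ k, QCoh (N.obj k))
    {X₀ X₁ : Type u} [AddCommGroup X₀] [AddCommGroup X₁] [Module (A.ring U) X₀]
    [Module (A.ring U) X₁] [Module.Finite (A.ring U) X₀] [Module.FinitePresentation (A.ring U) X₁]
    (d : X₀ →ₗ[A.ring U] X₁) (ξ : X₀ →ₗ[A.ring U] Tot N (le_refl U))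
    (h : ∀ y ∈ U, ∃ V, ∃ hV : V ≤ U, y ∈ V ∧ ∃ η : X₁ →ₗ[A.ring U] Tot N hV,
      ∀ x, η (d x) = Tot.resTo N (le_refl U) hV hV (ξ x)) :
    ∃ η : X₁ →ₗ[A.ring U] Tot N (le_refl U), ∀ x, η (d x) = ξ x := by
  let I : Ideal Γ(Y, U) :=
    { carrier := {r | ∃ η : X₁ →ₗ[A.ring U] Tot N (le_refl U), ∀ x, η (d x) = A.scal U r • ξ x}
      zero_mem' := ⟨0, fun x => by rw [map_zero, zero_smul]; rfl⟩
      add_mem' := fun {a b} ⟨η, hη⟩ ⟨η', hη'⟩ => ⟨η + η', fun x => by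
        rw [LinearMap.add_apply, hη, hη', map_add, add_smul]⟩
      smul_mem' := fun c r ⟨η, hη⟩ => ⟨A.scal U c • η, fun x => by
        rw [LinearMap.smul_apply, hη, smul_eq_mul, map_mul, mul_smul]⟩ }
  suffices hI : I = ⊤ by
    obtain ⟨η, hη⟩ : (1 : Γ(Y, U)) ∈ I := by rw [hI]; trivial
    exact ⟨η, fun x => by rw [hη, map_one, one_smul]⟩
  refine ideal_eq_top_of_locally hU I fun y hy => ?_
  obtain ⟨V, hV, hyV, η, hη⟩ := h y hy
  obtain ⟨f, hf, hyf⟩ := exists_basicOpen hU hyV hy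
  let ρ := Tot.resTo N (le_refl U) (Y.basicOpen_le f) (Y.basicOpen_le f)
  have hloc : IsLocalizedModule (.powers (A.scal U f)) ρ := Tot.isLocalizedModule_resTo hU hN f
  obtain ⟨η', ⟨_, k, rfl⟩, hη'⟩ := Module.FinitePresentation.exists_lift_of_isLocalizedModule
    (.powers (A.scal U f)) ρ ((Tot.resTo N hV hf (Y.basicOpen_le f)).comp η)
  obtain ⟨⟨_, m, rfl⟩, hm⟩ := Module.Finite.exists_smul_of_comp_eq_of_isLocalizedModule
    (.powers (A.scal U f)) ρ (η'.comp d) (A.scal U f ^ k • ξ) (LinearMap.ext fun x => by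
      refine (LinearMap.congr_fun hη' (d x)).trans ?_
      change A.scal U f ^ k • Tot.resTo N hV hf _ (η (d x)) = ρ (A.scal U f ^ k • ξ x)
      rw [hη, Tot.resTo_resTo, map_smul])
  refine ⟨f * (f ^ m * f ^ k), ⟨A.scal U f • A.scal U f ^ m • η', fun x => ?_⟩, ?_⟩
  · rw [map_mul, map_mul, mul_smul, mul_smul, map_pow, map_pow]
    exact congrArg (A.scal U f • ·) (LinearMap.congr_fun hm x)
  · rw [← pow_add, ← pow_succ', Y.basicOpen_pow]
    · exact hyf
    · omega

/-- Since `K` has zero differentials, a map from `Q.X 0` that kills boundaries is a chain map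
concentrated in degree `0`, and a null-homotopy of it is nothing but an extension along `Q.X 0 ⟶ Q.X
1`. These extensions, available locally, are then globalized over `U`. -/
lemma IsLocallyFinInj.exists_extension (hU : IsAffineOpen U) {K : CochainComplex (GrMod A) ℤ}
    (hK : ∀ k, QCoh ((K.X 0).obj k)) (hd : ∀ p q, K.d p q = 0)
    (h : IsLocallyFinInj A U ((KGr.q A).obj K)) : ∃ n₀ : ℤ, ∀ n s, n₀ ≤ n → n + n₀ ≤ s →
      ∀ (Q : CochainComplex (ModuleCat.{u} (A.ring U)) ℤ) (F : GradedFree A U Q), F.IsTest n s →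
        ∀ ξ : Q.X 0 →ₗ[A.ring U] Tot (K.X 0) (le_refl U), (∀ x, ξ (Q.d (-1) 0 x) = 0) →
          ∃ η : Q.X 1 →ₗ[A.ring U] Tot (K.X 0) (le_refl U), ∀ x, η (Q.d 0 1 x) = ξ x := by
  obtain ⟨n₀, h₀⟩ := h
  refine ⟨n₀, fun n s hn hs Q F hF ξ hξ => ?_⟩
  have hT : ∀ {V : Y.Opens} (hV : V ≤ U) p q, (totComplex hV K).d p q = 0 := fun hV p q =>
    (congrArg (Tot.functor A hV).map (hd p q)).trans (Functor.map_zero _ _ _)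
  let g : Q.X 0 ⟶ (totComplex (le_refl U) K).X 0 := ModuleCat.ofHom ξ
  have hg : Q.d (-1) 0 ≫ g = 0 := ModuleCat.hom_ext (LinearMap.ext hξ)
  obtain ⟨f, hf⟩ : ∃ f : Q ⟶ totComplex (le_refl U) K, f.f 0 = g := by
    refine ⟨Cocycle.homOf (Cocycle.mk (Cochain.single g 0) 1 rfl ?_), ?_⟩
    · ext p q hpq
      rw [δ_v 0 1 rfl _ p q hpq p q (by omega) (by omega), hT, comp_zero, zero_add, Cochain.zero_v]
      by_cases hq : q = 0
      · subst hq
        obtain rfl : p = -1 := by omega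
        rw [Cochain.single_v, hg, smul_zero]
      · rw [Cochain.single_v_eq_zero _ _ _ _ _ hq, comp_zero, smul_zero]
    · exact Cochain.single_v g 0 (add_zero 0)
  have i0 := Module.Finite.of_basis (F.basis 0)
  have i1 := Module.Finite.of_basis (F.basis 1)
  have i2 := Module.Projective.of_basis (F.basis 1)
  have i3 : Module.FinitePresentation (A.ring U) (Q.X 1) :=
    Module.finitePresentation_of_projective (A.ring U) (Q.X 1)
  refine exists_extension_of_locally hU hK (Q.d 0 1).hom ξ fun y hy => ?_
  obtain ⟨V, hV, hyV, e⟩ := h₀ n s hn hs Q F hF U le_rfl y hy ((HomotopyCategory.quotient _ _).map f)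
  have e' : (HomotopyCategory.quotient _ _).map (f ≫ totRes (le_refl U) hV K) =
      (HomotopyCategory.quotient _ _).map 0 := by
    rw [Functor.map_comp, Functor.map_zero]
    exact e
  have H := HomotopyCategory.homotopyOfEq _ _ e'
  refine ⟨V, hV, hyV, (H.hom 1 0).hom, fun x => ?_⟩
  have h1 := H.comm 0
  rw [dNext_eq _ (show (ComplexShape.up ℤ).Rel 0 1 by rfl),
    prevD_eq _ (show (ComplexShape.up ℤ).Rel (-1) 0 by simp), hT, comp_zero, add_zero,
    HomologicalComplex.zero_f, add_zero, HomologicalComplex.comp_f, hf] at h1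
  exact (congrArg (fun g => ModuleCat.Hom.hom g x) h1).symm

end extension

end HomFlip

namespace HomFlip

open Abelian

/-! ### Ext of homogeneous quotients through syzygies -/

section resolution

variable {B : Type u} [CommRing B] {T : ModuleCat.{u} B}

lemma ext_eq_zero_of_iso {N N' : ModuleCat.{u} B} (i : N ≅ N') {n : ℕ}
    (h : ∀ e : Ext N T n, e = 0) (e : Ext N' T n) : e = 0 := by
  rw [← Ext.mk₀_id_comp e, ← i.inv_hom_id, ← Ext.mk₀_comp_mk₀_assoc,
    h ((Ext.mk₀ i.hom).comp e (zero_add n)), Ext.comp_zero]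

variable {F : Type u} [AddCommGroup F] [Module B F] (N : Submodule B F)

lemma ext_quotient_succ [Module.Projective B F] {n : ℕ}
    (h : ∀ e : Ext (ModuleCat.of B N) T n, e = 0)
    (e : Ext (ModuleCat.of B (F ⧸ N)) T (n + 1)) : e = 0 := by
  let S : ShortComplex (ModuleCat.{u} B) := ModuleCat.shortComplexOfCompEqZero N.subtype N.mkQ
    (LinearMap.exact_subtype_mkQ N).linearMap_comp_eq_zero
  have hS : S.ShortExact := ModuleCat.shortComplex_shortExact S (LinearMap.exact_subtype_mkQ N)
    N.injective_subtype N.mkQ_surjective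
  have : Projective S.X₂ := (IsProjective.iff_projective F).1 inferInstance
  obtain ⟨x, rfl⟩ := Ext.contravariant_sequence_exact₃ hS T e (Ext.eq_zero_of_projective _)
    (add_comm 1 n)
  rw [h x, Ext.comp_zero]

lemma ext_quotient_one [Module.Projective B F] 
    (h : ∀ f : N →ₗ[B] T, ∃ g : F →ₗ[B] T, ∀ x : N, g x = f x)
    (e : Ext (ModuleCat.of B (F ⧸ N)) T 1) : e = 0 := by
  let S : ShortComplex (ModuleCat.{u} B) := ModuleCat.shortComplexOfCompEqZero N.subtype N.mkQ
    (LinearMap.exact_subtype_mkQ N).linearMap_comp_eq_zero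
  have hS : S.ShortExact := ModuleCat.shortComplex_shortExact S (LinearMap.exact_subtype_mkQ N)
    N.injective_subtype N.mkQ_surjective
  have : Projective S.X₂ := (IsProjective.iff_projective F).1 inferInstance
  obtain ⟨x, rfl⟩ := Ext.contravariant_sequence_exact₃ hS T e (Ext.eq_zero_of_projective _)
    (add_zero 1)
  obtain ⟨f, rfl⟩ := Ext.addEquiv₀.symm.surjective x
  obtain ⟨g, hg⟩ := h f.hom
  have h1 : f = S.f ≫ ModuleCat.ofHom g := ModuleCat.hom_ext (LinearMap.ext fun x => (hg x).symm)
  rw [h1]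
  refine (congrArg (fun x => hS.extClass.comp x (add_zero 1))
    (Ext.mk₀_comp_mk₀ S.f (ModuleCat.ofHom g)).symm).trans ?_
  exact hS.extClass_comp_assoc _

namespace HomogSub

variable {𝒜 : ℤ → AddSubgroup B} [GradedRing 𝒜] [IsNoetherianRing B] (S : HomogSub 𝒜)

/-- The cokernel of the inclusion of a homogeneous submodule. -/
noncomputable abbrev coker (S : HomogSub 𝒜) : ModuleCat.{u} B :=
  ModuleCat.of B ((Fin S.rk → B) ⧸ S.N)

/-- A homogeneous submodule is the next syzygy module. -/
noncomputable def nextIso : S.next.coker ≅ ModuleCat.of B S.N :=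
  (S.cover.quotKerEquivRange.trans (LinearEquiv.ofEq _ _ S.range_cover)).toModuleIso

/-- Dimension shifting reduces to `Ext^1` of the cokernel of the syzygy number `m + n`. Its classes
vanish when maps from the syzygy module extend to the free module containing it; composed with the
cover, such a map is a `ξ` that kills the kernel of the cover. -/
lemma ext_coker_eq_zero (c : ℕ)
    (h : ∀ m, c ≤ m → ∀ ξ : (Fin (S.iter m).next.rk → B) →ₗ[B] T,
      (∀ x, (S.iter m).cover x = 0 → ξ x = 0) →
        ∃ η : (Fin (S.iter m).rk → B) →ₗ[B] T, ∀ x, η ((S.iter m).cover x) = ξ x)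
    (n m : ℕ) (hm : c ≤ m + n) (e : Ext (S.iter m).coker T (n + 1)) : e = 0 := by
  induction n generalizing m with
  | zero =>
    refine ext_quotient_one _ (fun f => ?_) e
    let p : (Fin (S.iter m).next.rk → B) →ₗ[B] (S.iter m).N := (S.iter m).cover.codRestrict _
      fun x => by rw [← range_cover]; exact ⟨x, rfl⟩
    obtain ⟨η, hη⟩ := h m hm (f.comp p) fun x hx => by
      have : p x = 0 := Subtype.ext hx
      rw [LinearMap.comp_apply, this, map_zero]
    refine ⟨η, fun ⟨x, hx⟩ => ?_⟩
    obtain ⟨y, rfl⟩ : x ∈ LinearMap.range (S.iter m).cover := by rwa [range_cover]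
    exact hη y
  | succ n ih =>
    exact ext_quotient_succ _ (ext_eq_zero_of_iso (S.iter m).nextIso
      (ih (m + 1) (by omega))) e

/-- The terms of a truncated resolution enter as variables, so the equalities identifying them with
syzygies can be substituted and `diff` replaced by `cover`. -/
lemma exists_extension_of_diff {M : Type*} [AddCommGroup M] [Module B M] {S₀ S₁ S₂ : HomogSub 𝒜}
    (h₁ : S₁ = S₀.next) (h₂ : S₂ = S₁.next)
    (H : ∀ ξ : (Fin S₁.rk → B) →ₗ[B] M, (∀ x, ξ (S₂.diff S₁ x) = 0) →
      ∃ η : (Fin S₀.rk → B) →ₗ[B] M, ∀ x, η (S₁.diff S₀ x) = ξ x)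
    (ξ : (Fin S₀.next.rk → B) →ₗ[B] M) (hξ : ∀ x, S₀.cover x = 0 → ξ x = 0) :
    ∃ η : (Fin S₀.rk → B) →ₗ[B] M, ∀ x, η (S₀.cover x) = ξ x := by
  subst h₁ h₂
  rw [diff_next, diff_next] at H
  refine H ξ fun x => hξ _ ?_
  have : S₀.next.cover x ∈ LinearMap.range S₀.next.cover := ⟨x, rfl⟩
  rwa [range_cover, ← ker_cover] at this

lemma extVanish_coker (c : ℕ)
    (h : ∀ m, c ≤ m → ∀ ξ : (Fin (S.iter m).next.rk → B) →ₗ[B] T,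
      (∀ x, (S.iter m).cover x = 0 → ξ x = 0) →
        ∃ η : (Fin (S.iter m).rk → B) →ₗ[B] T, ∀ x, η ((S.iter m).cover x) = ξ x) :
    ExtVanish T (c + 1) S.coker := fun n hn e => by
  obtain ⟨n, rfl⟩ : ∃ k, n = k + 1 := ⟨n - 1, by omega⟩
  exact S.ext_coker_eq_zero c h n 0 (by omega) e

/-- A homogeneous ideal as a submodule of the free module of rank one. -/
noncomputable def ofIdeal (q : Ideal B) (hq : q.IsHomogeneous 𝒜) : HomogSub 𝒜 where
  rk := 1
  deg _ := 0
  N := Submodule.comap (LinearMap.proj (R := B) (φ := fun _ : Fin 1 => B) 0) q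
  freeProj_mem k x hx := by
    change GradedRing.proj 𝒜 (k - 0) (x 0) ∈ q
    exact hq _ hx

/-- The cokernel of the inclusion of a homogeneous ideal. -/
noncomputable def ofIdealIso (q : Ideal B) (hq : q.IsHomogeneous 𝒜) :
    (ofIdeal q hq).coker ≅ ModuleCat.of B (B ⧸ q) :=
  (Submodule.Quotient.equiv (ofIdeal q hq).N q (LinearEquiv.funUnique (Fin 1) B B) (by
    ext x
    refine ⟨fun ⟨y, hy, h⟩ => h ▸ hy, fun hx => ⟨fun _ => x, hx, rfl⟩⟩)).toModuleIso

end HomogSub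

end resolution

/-! ### Sections of a twist -/

section twist

variable {Y : Scheme.{u}} {A : GradedRingSheaf Y} {U : Y.Opens}

/-- The sections of a twist. -/
noncomputable def twistAdd (M : GrMod A) (a : ℤ) :
    Tot M (le_refl U) ≃+ Tot ((GrMod.twist A a).obj M) (le_refl U) :=
  DirectSum.equivCongrLeft (β := fun k => (Γ(M.obj k, U) : Type u)) (Equiv.subRight a)

lemma comp_twistAdd (M : GrMod A) (a k : ℤ) (x : Tot M (le_refl U)) :
    Tot.comp ((GrMod.twist A a).obj M) (le_refl U) k (twistAdd M a x) =
      Tot.comp M (le_refl U) (k + a) x :=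
  DirectSum.equivCongrLeft_apply (β := fun k => (Γ(M.obj k, U) : Type u)) (Equiv.subRight a) x k

/-- The sections of a twist, as a module. -/
noncomputable def twistEquiv (M : GrMod A) (a : ℤ) :
    Tot M (le_refl U) ≃ₗ[A.ring U] Tot ((GrMod.twist A a).obj M) (le_refl U) where
  __ := Tot.mkLinear (twistAdd M a).toAddMonoidHom fun d b x => Tot.ext fun k => by
    have h : d + (k - d) = k := by omega
    refine (comp_twistAdd M a k _).trans ?_
    refine Eq.trans ?_ (Tot.comp_incl_smul ((GrMod.twist A a).obj M) (le_refl U) h b _).symm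
    refine Eq.trans ?_ (congrArg _ (comp_twistAdd M a (k - d) x).symm)
    exact Tot.comp_incl_smul M (le_refl U) (by omega) b x
  invFun := (twistAdd M a).symm
  left_inv := (twistAdd M a).symm_apply_apply
  right_inv := (twistAdd M a).apply_symm_apply

end twist

/-! ### The Gorenstein property -/

section gorenstein

variable {Y : Scheme.{u}} {A : GradedRingSheaf Y} {U : Y.Opens}

/-- The linear equivalence between the sections of a graded module isomorphic to a twist of the
structure sheaf and the ring of sections. -/
noncomputable def totTwistEquiv (a : ℤ) {N : GrMod A} (e : N ≅ (GrMod.twist A a).obj A.self) :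
    Tot N (le_refl U) ≃ₗ[A.ring U] A.ring U :=
  (((Tot.functor A (le_refl U)).mapIso e).toLinearEquiv : Tot N (le_refl U) ≃ₗ[A.ring U]
    Tot ((GrMod.twist A a).obj A.self) (le_refl U)).trans
    ((twistEquiv A.self a).symm.trans (Tot.selfEquiv A U))

lemma exists_extension_ring (hU : IsAffineOpen U) [IsNoetherianRing (A.ring U)]
    (hA : ∀ i, QCoh (A.gr i)) (a : ℤ)
    (h : IsLocallyFinInj A U ((KGr.q A).obj ((twistComplex A a).obj
      ((CochainComplex.singleFunctor (GrMod A) 0).obj A.self)))) :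
    ∃ c : ℕ, ∀ (S : HomogSub (grading A U)) (m : ℕ), c ≤ m →
      ∀ ξ : (Fin (S.iter m).next.rk → A.ring U) →ₗ[A.ring U] A.ring U,
        (∀ x, (S.iter m).cover x = 0 → ξ x = 0) →
          ∃ η : (Fin (S.iter m).rk → A.ring U) →ₗ[A.ring U] A.ring U,
            ∀ x, η ((S.iter m).cover x) = ξ x := by
  let K := (twistComplex A a).obj ((CochainComplex.singleFunctor (GrMod A) 0).obj A.self)
  let e : K.X 0 ≅ (GrMod.twist A a).obj A.self :=
    (GrMod.twist A a).mapIso (HomologicalComplex.singleObjXSelf _ 0 A.self)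
  let E := totTwistEquiv (U := U) a e
  obtain ⟨n₀, h₀⟩ := h.exists_extension hU (K := K) (fun k => qcoh_single hA 0 (k + a))
    fun p q => (GrMod.twist A a).map_zero _ _
  refine ⟨n₀.toNat, fun S m hm ξ hξ => ?_⟩
  -- With top degree `m + 1`, the terms in degrees `1`, `0`, `-1` are the syzygies of index `m`, `m
  -- + 1`, `m + 2`, so the extension problem sits in degree `0`. The length `s` is large enough for
  -- index `m + 2` to occur and for `n + n₀ ≤ s`.
  let n : ℤ := m + 1
  let s : ℤ := m + 2 + n₀.toNat
  have t₁ : S.term n s 1 = S.iter m := S.term_eq m (by omega) (by omega)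
  have t₀ : S.term n s 0 = (S.term n s 1).next := by
    rw [t₁]
    exact S.term_eq (m + 1) (by omega) (by omega)
  have t₂ : S.term n s (-1) = (S.term n s 0).next := by
    rw [t₀, t₁]
    exact S.term_eq (m + 2) (by push_cast; omega) (by push_cast; omega)
  have key := HomogSub.exists_extension_of_diff t₀ t₂ fun ζ hζ => by
    let ζ' : (S.complex n s).X 0 →ₗ[A.ring U] Tot (K.X 0) (le_refl U) := E.symm.toLinearMap.comp ζ
    obtain ⟨η, hη⟩ := h₀ n s (by omega) (by omega) _ (S.gradedFree n s) (S.isTest n s) ζ'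
      fun x => by
        refine Eq.trans ?_ (map_zero E.symm)
        refine congrArg E.symm (Eq.trans ?_ (hζ x))
        exact congrArg (fun g : (S.complex n s).X (-1) ⟶ (S.complex n s).X 0 => ζ (g x))
          (S.complex_d (show (-1 : ℤ) + 1 = 0 by omega))
    refine ⟨E.toLinearMap.comp η, fun x => ?_⟩
    refine Eq.trans ?_ (E.apply_symm_apply (ζ x))
    refine congrArg E (Eq.trans ?_ (hη x))
    exact congrArg (fun g : (S.complex n s).X 0 ⟶ (S.complex n s).X 1 => η (g x))
      (S.complex_d (show (0 : ℤ) + 1 = 1 by omega)).symm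
  rw [t₁] at key
  exact key ξ hξ

/-- The constant `c` is the same for all homogeneous submodules, so `Ext^n(𝒜(U)/q, 𝒜(U))` vanishes
for `n ≥ c + 1` uniformly in the homogeneous primes `q`. Each prime is compared with its homogeneous
core, and two more degrees are lost in reaching arbitrary ideals. -/
theorem isGorensteinRing_of_isLocallyFinInj (hU : IsAffineOpen U) [IsNoetherianRing (A.ring U)]
    (hA : ∀ i, QCoh (A.gr i)) (a : ℤ)
    (h : IsLocallyFinInj A U ((KGr.q A).obj ((twistComplex A a).obj
      ((CochainComplex.singleFunctor (GrMod A) 0).obj A.self)))) : IsGorensteinRing (A.ring U) := by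
  obtain ⟨c, hc⟩ := exists_extension_ring hU hA a h
  refine isGorensteinRing_of_extVanish (c + 1 + 2) fun I => extVanish_quotient _ (c + 1)
    (fun p hp => ?_) I
  obtain ⟨q, hqp, hq, hqh, H⟩ := exists_homogeneous_prime (grading A U) p hp
  refine ⟨q, hqp, hq, fun n hn => ?_, H⟩
  exact ext_eq_zero_of_iso (HomogSub.ofIdealIso q hqh)
    (HomogSub.extVanish_coker _ c (fun m hm => hc _ m hm) n hn)

end gorenstein

end HomFlip

theorem theorem1p4 (Y : Scheme.{u}) [IsNoetherian Y] [Y.IsSeparated]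
    (ω : CochainComplex Y.Modules ℤ) (hω : HomFlip.IsDualizingComplex ω)
    (A : HomFlip.GradedRingSheaf Y) (hA : A.IsNoetherianOver) (J : HomFlip.InjRes A)
    (H : HomFlip.HomologicalFlipFlop ω J) (hv : H.CanonicalVanishing) :
    ∃ Ψ : (HomFlip.DGr.Q A).obj (((HomFlip.twistComplex A H.a).obj J.RΓplus)⟦(1 : ℤ)⟧) ⟶
        (HomFlip.DGr.Q A).obj (HomFlip.dual ω J.RΓminus),
      (∀ i : ℤ, ¬ (-H.a < i ∧ i < 0) → HomFlip.IsQuasiIsoInWeight Ψ i) ∧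
      ((H.a = 0 ∨ H.a = 1) →
        IsIso Ψ ∧ ∀ U : Y.affineOpens, HomFlip.IsGorensteinRing (A.ring U.1)) := by
  obtain ⟨Ψ, hΨ⟩ := HomFlip.exists_comparison hω hA H hv
  -- The comparison map was built on the shift in the derived category; the commutation isomorphism
  -- moves it to the image of the shifted complex.
  refine ⟨((HomFlip.DGr.Q A).commShiftIso (1 : ℤ)).hom.app _ ≫ Ψ, fun i hi => ?_, fun ha => ?_⟩
  · have := hΨ i hi
    refine HomFlip.isQuasiIsoInWeight_of_isIso A _ i ?_
    rw [Functor.map_comp]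
    infer_instance
  -- For `a = 0` or `a = 1` no integer lies strictly between `-a` and `0`, so `Ψ` is invertible in
  -- every weight.
  · have h : IsIso Ψ := HomFlip.isIso_of_isIso_DWeight A Ψ fun i => hΨ i (by omega)
    exact ⟨inferInstance, fun U => by
      have := hA.noetherian U
      exact HomFlip.isGorensteinRing_of_isLocallyFinInj U.2 hA.qcoh H.a
        (HomFlip.isLocallyFinInj_self hω hA H (asIso Ψ) U.2)⟩
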